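/- Let $K$ be a field with separable closure $K^s$, let $G=\mathrm{Gal}(K^s/K)$ (with its Krull topology), and let $\ell$ be a prime number invertible in $K$. Let $X$ be a connected Noetherian scheme over $K$ with a $K$-rational point $x$. Put $\bar X=X\times_K K^s$, with projection $p:\bar X\to X$, and let $\bar x:\mathrm{Spec}\,K^s\to\mathrm{Spec}\,K\xrightarrow{x}X$ be the geometric point attached to $x$, which we also regard as a point of $\bar X$. Let $s:G\to\pi_1(X,\bar x)$ be the homomorphism induced by $x$; by conjugation through $s$, the group $G$ acts on $\pi_1(\bar X,\bar x)\subseteq\pi_1(X,\bar x)$. Let $\pi_1(\bar X,\bar x)_G$ be the group of coinvariants, that is, the quotient of $\pi_1(\bar X,\bar x)$ by the closed normal subgroup generated by the commutators and the elements $(\gamma\cdot g)g^{-1}$ with $\gamma\in G$. *Local systems.* A smooth $\ell$-adic sheaf with coefficients in a finite extension $E/\mathbb{Q}_\ell$ inside $\overline{\mathbb{Q}}_\ell$ is a projective system $\mathcal F=(\mathcal F_n)_{n\ge 0}$ of locally constant étale sheaves with finite stalks, $\mathcal F_n$ being a sheaf of $\mathcal O_E/\pi_E^{n+1}$-modules,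 such that $\mathcal F_{n+1}\otimes\mathcal O_E/\pi_E^{n+1}\cong\mathcal F_n$. The category of $\overline{\mathbb{Q}}_\ell$-local systems is obtained from these by tensoring the groups of morphisms with $E$ and passing to the direct limit over $E$. The stalk of $\mathcal F\otimes\overline{\mathbb{Q}}_\ell$ at $\bar x$ is $\overline{\mathbb{Q}}_\ell\otimes_{\mathcal O_E}\varprojlim_n(\mathcal F_n)_{\bar x}$. All $\overline{\mathbb{Q}}_\ell$-local systems below have rank one; such a system is equivalent to a continuous character $\rho$ of the fundamental group if the fundamental group acts on the stalk through $\rho$. *Galois actions.* Let $\gamma\in G$ act on $\bar X$ by $\mathrm{id}\times\mathrm{Spec}(\gamma^{-1})$. A compatible action of $G$ on a sheaf, a projective system or a $\overline{\mathbb{Q}}_\ell$-local system $\mathcal F$ on $\bar X$ is a family of isomorphisms $\mu(\gamma):\gamma_*\mathcal F\to\mathcal F$ with $\mu(\gamma\delta)=\mu(\gamma)\circ\gamma_*(\mu(\delta))$. An action on a projective system is continuous if for all $n$ and all quasi-compact étale $U\to X$ the induced action of $G$ on the discrete group $\mathcal F_n(U\times_X\bar X)$ is continuous; an action on a $\overline{\mathbb{Q}}_\ell$-local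 system is continuous if it comes from a continuous action on a smooth $\ell$-adic sheaf giving rise to the local system. For every $\mathcal F$ on $X$, the inverse image $p^*\mathcal F$ has a natural compatible action, namely the inverses of the morphisms $p^*\mathcal F\to\gamma_*p^*\mathcal F$ adjoint to $\mathcal F\to p_*p^*\mathcal F=p_*\gamma_*p^*\mathcal F$. 1. Let $\mathcal F$ be a smooth $\ell$-adic sheaf on $X$ whose $\overline{\mathbb{Q}}_\ell$-local system is equivalent to a continuous character $\rho:\pi_1(X,\bar x)\to\overline{\mathbb{Q}}_\ell^\times$. Then the natural compatible action of $G$ on $p^*\mathcal F$ is continuous and is equal to the action induced by the character $\rho\circ s$: for every $\gamma\in G$, the isomorphism $\mu(\gamma):\gamma_*p^*\mathcal F\to p^*\mathcal F$, composed on stalks with the canonical identification $(\gamma_*p^*\mathcal F)_{\bar x}\cong(p^*\mathcal F)_{\bar x}$ coming from the rational point, is multiplication by $\rho(s(\gamma))$ on the $\overline{\mathbb{Q}}_\ell$-stalk at $\bar x$; and every morphism $\gamma_*p^*\mathcal F\to p^*\mathcal F$ of $\ell$-adic systems with this property agrees with $\mu(\gamma)$ after tensoring with $\overline{\mathbb{Q}}_\ell$.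 2. The functor sending $\mathcal F$ to $p^*\mathcal F$ with its natural action is an equivalence from the category of rank-one $\overline{\mathbb{Q}}_\ell$-local systems on $X$ to the category of rank-one $\overline{\mathbb{Q}}_\ell$-local systems on $\bar X$ which are equivalent to continuous characters factoring through $\pi_1(\bar X,\bar x)_G$ and are equipped with a compatible continuous action of $G$ (the morphisms being those which commute with the actions). -/

import Mathlib

open CategoryTheory Limits AlgebraicGeometry Opposite TensorProduct

universe w v u v' u' v'' u''

noncomputable section

namespace LadicSheaf

section Coefficients

variable {ℓ : ℕ} [Fact ℓ.Prime]

/-- The valuation ring `𝒪_E` of a subfield `E` of `ℚ̄_ℓ`. -/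
def valRing (E : IntermediateField ℚ_[ℓ] (PadicAlgCl ℓ)) : Subring (PadicAlgCl ℓ) where
  carrier := {a | a ∈ E ∧ ‖a‖ ≤ 1}
  mul_mem' := fun {a b} ha hb => ⟨E.mul_mem ha.1 hb.1, by
    rw [norm_mul]; exact mul_le_one₀ ha.2 (norm_nonneg _) hb.2⟩
  one_mem' := ⟨E.one_mem, by simp⟩
  add_mem' := fun {a b} ha hb => ⟨E.add_mem ha.1 hb.1,
    (IsUltrametricDist.norm_add_le_max a b).trans (max_le ha.2 hb.2)⟩
  zero_mem' := ⟨E.zero_mem, by simp⟩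
  neg_mem' := fun {a} ha => ⟨E.neg_mem ha.1, by simpa using ha.2⟩

/-- The maximal ideal `𝔪_E = (π_E)` of `𝒪_E`. -/
def maxIdeal (E : IntermediateField ℚ_[ℓ] (PadicAlgCl ℓ)) : Ideal (valRing E) where
  carrier := {a | ‖(a : PadicAlgCl ℓ)‖ < 1}
  add_mem' := fun {a b} ha hb =>
    (IsUltrametricDist.norm_add_le_max (a : PadicAlgCl ℓ) b).trans_lt (max_lt ha hb)
  zero_mem' := by simp
  smul_mem' := fun c a ha => by
    have hc : ‖(c : PadicAlgCl ℓ)‖ ≤ 1 := c.2.2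
    have ha' : ‖(a : PadicAlgCl ℓ)‖ < 1 := ha
    simp only [Set.mem_ofPred_eq, smul_eq_mul, Subring.coe_mul, norm_mul]
    exact (mul_le_of_le_one_left (norm_nonneg _) hc).trans_lt ha'

/-- The inclusion `𝒪_E ⊆ 𝒪_L` for `E ⊆ L`. -/
def valRingIncl {E L : IntermediateField ℚ_[ℓ] (PadicAlgCl ℓ)} (h : E ≤ L) :
    valRing E →+* valRing L :=
  Subring.inclusion fun _ ha => ⟨h ha.1, ha.2⟩

end Coefficients

section Systems

variable (ℓ : ℕ) [Fact ℓ.Prime]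

/-- Let `A` carry an action of `R` and `B` an action of `S`, let `ι : R →+* S` and let `I` be an
ideal of `S`.  An `R`-linear morphism `f : A ⟶ B` *exhibits `B` as `A ⊗_R S/I`* if every `R`-linear
morphism from `A` to an object with an action of `S` killed by `I` factors uniquely through an
`S`-linear morphism from `B`. -/
def IsExtensionOfScalars {𝒜 : Type u} [Category.{v} 𝒜] [Preadditive 𝒜] {R S : Type}
    [CommRing R] [CommRing S] (ι : R →+* S) (I : Ideal S) {A B : 𝒜}
    (α : R →+* End A) (β : S →+* End B) (f : A ⟶ B) : Prop :=
  ∀ (H : 𝒜) (θ : S →+* End H), (∀ a ∈ I, θ a = 0) →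
    ∀ φ : A ⟶ H, (∀ a : R, (α a : A ⟶ A) ≫ φ = φ ≫ (θ (ι a) : H ⟶ H)) →
      ∃! ψ : B ⟶ H, (∀ a : S, (β a : B ⟶ B) ≫ ψ = ψ ≫ (θ a : H ⟶ H)) ∧ f ≫ ψ = φ

/-- A projective system `⋯ ⟶ F₂ ⟶ F₁ ⟶ F₀` of objects of `𝒜` with an action of the valuation ring
`𝒪_E` of some finite extension `E/ℚ_ℓ` inside `ℚ̄_ℓ`, such that `π_E ^ (n + 1)` kills `F_n`. -/
structure PiSystem (𝒜 : Type u) [Category.{v} 𝒜] [Preadditive 𝒜] where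
  /-- the coefficient field -/
  E : IntermediateField ℚ_[ℓ] (PadicAlgCl ℓ)
  finite : FiniteDimensional ℚ_[ℓ] E
  /-- the components -/
  obj : ℕ → 𝒜
  /-- the transition morphisms -/
  tr : ∀ n, obj (n + 1) ⟶ obj n
  /-- the `𝒪_E`-module structure of the components -/
  act : ∀ n, valRing E →+* End (obj n)
  tr_act : ∀ n (a : valRing E),
    (act (n + 1) a : obj (n + 1) ⟶ obj (n + 1)) ≫ tr n = tr n ≫ (act n a : obj n ⟶ obj n)
  act_eq_zero : ∀ n, ∀ a ∈ maxIdeal E ^ (n + 1), act n a = 0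

namespace PiSystem

variable {ℓ}
variable {𝒜 : Type u} [Category.{v} 𝒜] [Preadditive 𝒜]

/-- A morphism `(E, F) ⟶ (L, G)` of systems exists only for `E ⊆ L`; it is then a compatible family
of `𝒪_E`-linear morphisms `F_n ⟶ G_n`. -/
@[ext]
structure Hom (F G : PiSystem ℓ 𝒜) where
  field_le : F.E ≤ G.E
  app : ∀ n, F.obj n ⟶ G.obj n
  app_tr : ∀ n, app (n + 1) ≫ G.tr n = F.tr n ≫ app n
  act_app : ∀ n (a : valRing F.E),
    (F.act n a : F.obj n ⟶ F.obj n) ≫ app n =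
      app n ≫ (G.act n (valRingIncl field_le a) : G.obj n ⟶ G.obj n)

instance : Category (PiSystem ℓ 𝒜) where
  Hom := Hom
  id F := ⟨le_rfl, fun _ => 𝟙 _, by simp, fun n a => by
    rw [Category.comp_id, Category.id_comp]; rfl⟩
  comp {F G H} f g := ⟨f.field_le.trans g.field_le, fun n => f.app n ≫ g.app n,
    fun n => by rw [Category.assoc, g.app_tr, ← Category.assoc, f.app_tr, Category.assoc],
    fun n a => by
      rw [← Category.assoc, f.act_app, Category.assoc, g.act_app, Category.assoc]; rfl⟩
  id_comp f := Hom.ext (by funext n; exact Category.id_comp _)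
  comp_id f := Hom.ext (by funext n; exact Category.comp_id _)
  assoc f g h := Hom.ext (by funext n; exact Category.assoc _ _ _)

@[ext]
lemma hom_ext {F G : PiSystem ℓ 𝒜} {f g : F ⟶ G} (h : ∀ n, f.app n = g.app n) : f = g :=
  Hom.ext (funext h)

@[simp] lemma id_app (F : PiSystem ℓ 𝒜) (n : ℕ) : Hom.app (𝟙 F) n = 𝟙 (F.obj n) := rfl

@[simp] lemma comp_app {F G H : PiSystem ℓ 𝒜} (f : F ⟶ G) (g : G ⟶ H) (n : ℕ) :
    (f ≫ g).app n = f.app n ≫ g.app n := rfl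

/-- Multiplication by `ℓ` on a system. -/
def mulEll (F : PiSystem ℓ 𝒜) : F ⟶ F where
  field_le := le_rfl
  app n := ℓ • 𝟙 (F.obj n)
  app_tr n := by simp
  act_app n a := by
    rw [Preadditive.comp_nsmul, Preadditive.nsmul_comp, Category.comp_id, Category.id_comp]; rfl

/-- `f : (E, F) ⟶ (L, G)` identifies `G` with the extension of scalars of `F` from `E` to `L`,
that is, `G_n = F_n ⊗_{𝒪_E} 𝒪_L/π_L^(n+1)` for all `n`. -/
def IsBaseChange {F G : PiSystem ℓ 𝒜} (f : F ⟶ G) : Prop :=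
  ∀ n, IsExtensionOfScalars (valRingIncl f.field_le) (maxIdeal G.E ^ (n + 1)) (F.act n) (G.act n)
    (f.app n)

/-- The morphisms which become isomorphisms with `ℚ̄_ℓ`-coefficients. -/
inductive W : MorphismProperty (PiSystem ℓ 𝒜)
  | baseChange {F G : PiSystem ℓ 𝒜} (f : F ⟶ G) (hf : IsBaseChange f) : W f
  | mulEll (F : PiSystem ℓ 𝒜) : W F.mulEll

/-- A system is *adic* if `F_{n+1} ⟶ F_n` induces `F_{n+1} ⊗ 𝒪_E/π_E^(n+1) ≅ F_n` for all `n`. -/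
def IsAdic (F : PiSystem ℓ 𝒜) : Prop :=
  ∀ n, IsExtensionOfScalars (RingHom.id (valRing F.E)) (maxIdeal F.E ^ (n + 1)) (F.act (n + 1))
    (F.act n) (F.tr n)

section Functoriality

variable {ℬ : Type u'} [Category.{v'} ℬ] [Preadditive ℬ]
variable {𝒞 : Type u''} [Category.{v''} 𝒞] [Preadditive 𝒞]

/-- The ring homomorphism `End A →+* End (T A)` of an additive functor. -/
def mapEndRingHom (T : 𝒜 ⥤ ℬ) [T.Additive] (A : 𝒜) : End A →+* End (T.obj A) where
  __ := T.mapEnd A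
  map_zero' := T.map_zero _ _
  map_add' _ _ := T.map_add

/-- Componentwise application of an additive functor. -/
@[simps]
def map (T : 𝒜 ⥤ ℬ) [T.Additive] : PiSystem ℓ 𝒜 ⥤ PiSystem ℓ ℬ where
  obj F :=
    { E := F.E
      finite := F.finite
      obj := fun n => T.obj (F.obj n)
      tr := fun n => T.map (F.tr n)
      act := fun n => (mapEndRingHom T (F.obj n)).comp (F.act n)
      tr_act := fun n a => by
        change T.map _ ≫ T.map _ = T.map _ ≫ T.map _
        rw [← T.map_comp, F.tr_act, T.map_comp]
      act_eq_zero := fun n a ha => by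
        change T.map (F.act n a) = 0
        rw [F.act_eq_zero n a ha]; exact T.map_zero _ _ }
  map {F G} f :=
    { field_le := f.field_le
      app := fun n => T.map (f.app n)
      app_tr := fun n => by rw [← T.map_comp, f.app_tr, T.map_comp]
      act_app := fun n a => by
        change T.map _ ≫ T.map _ = T.map _ ≫ T.map _
        rw [← T.map_comp, f.act_app, T.map_comp] }
  map_id F := hom_ext fun n => T.map_id _
  map_comp f g := hom_ext fun n => T.map_comp _ _

/-- An isomorphism `T ⋙ T' ≅ T''` of additive functors, applied componentwise. -/
@[simps!]
def mapComp {T : 𝒜 ⥤ ℬ} [T.Additive] {T' : ℬ ⥤ 𝒞} [T'.Additive] {T'' : 𝒜 ⥤ 𝒞} [T''.Additive]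
    (e : T ⋙ T' ≅ T'') :
    (map T : PiSystem ℓ 𝒜 ⥤ _) ⋙ map T' ≅ map T'' :=
  NatIso.ofComponents (fun F =>
    { hom :=
        { field_le := le_rfl
          app := fun n => e.hom.app (F.obj n)
          app_tr := fun n => (e.hom.naturality (F.tr n)).symm
          act_app := fun n a => e.hom.naturality (F.act n a) }
      inv :=
        { field_le := le_rfl
          app := fun n => e.inv.app (F.obj n)
          app_tr := fun n => (e.inv.naturality (F.tr n)).symm
          act_app := fun n a => e.inv.naturality (F.act n a) }
      hom_inv_id := hom_ext fun _ => e.hom_inv_id_app _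
      inv_hom_id := hom_ext fun _ => e.inv_hom_id_app _ })
    (fun f => hom_ext fun n => e.hom.naturality (f.app n))

lemma isExtensionOfScalars_map {R S : Type} [CommRing R] [CommRing S] {ι : R →+* S} {I : Ideal S}
    {A B : 𝒜} {α : R →+* End A} {β : S →+* End B} {f : A ⟶ B}
    (hf : IsExtensionOfScalars ι I α β f) (T : 𝒜 ⥤ ℬ) [T.Additive] [T.IsLeftAdjoint] :
    IsExtensionOfScalars ι I ((mapEndRingHom T A).comp α) ((mapEndRingHom T B).comp β)
      (T.map f) := by
  intro H θ hθ φ hφ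
  let adj := Adjunction.ofIsLeftAdjoint T
  let U := T.rightAdjoint
  have : U.Additive := adj.right_adjoint_additive
  have key (C : 𝒜) (a : S) (χ : T.obj C ⟶ H) :
      adj.homEquiv C H (χ ≫ (θ a : H ⟶ H)) = adj.homEquiv C H χ ≫ U.map (θ a) :=
    adj.homEquiv_naturality_right _ _
  have key' (C : 𝒜) (c : C ⟶ C) (χ : T.obj C ⟶ H) :
      adj.homEquiv C H (T.map c ≫ χ) = c ≫ adj.homEquiv C H χ :=
    adj.homEquiv_naturality_left _ _
  obtain ⟨ψ, ⟨h₁, h₂⟩, h₃⟩ := hf (U.obj H) ((mapEndRingHom U H).comp θ)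
    (fun a ha => by
      change U.map (θ a) = 0
      rw [hθ a ha]; exact U.map_zero _ _) (adj.homEquiv A H φ)
    (fun a => by
      change _ = _ ≫ U.map (θ (ι a))
      rw [← key, ← key']
      exact congrArg _ (hφ a))
  refine ⟨(adj.homEquiv B H).symm ψ, ⟨fun a => ?_, ?_⟩, fun ψ' hψ' => ?_⟩
  · apply (adj.homEquiv B H).injective
    rw [key]
    change adj.homEquiv B H (T.map _ ≫ _) = _
    rw [key', Equiv.apply_symm_apply]
    exact h₁ a
  · apply (adj.homEquiv A H).injective
    rw [adj.homEquiv_naturality_left, Equiv.apply_symm_apply, h₂]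
  · rw [Equiv.eq_symm_apply]
    refine h₃ _ ⟨fun a => ?_, ?_⟩
    · change _ = _ ≫ U.map (θ a)
      rw [← key, ← key']
      exact congrArg _ (hψ'.1 a)
    · rw [← adj.homEquiv_naturality_left, hψ'.2]

lemma map_W (T : 𝒜 ⥤ ℬ) [T.Additive] [T.IsLeftAdjoint] {F G : PiSystem ℓ 𝒜} (f : F ⟶ G)
    (hf : W f) : W ((map T).map f) := by
  induction hf with
  | baseChange f hf => exact W.baseChange _ fun n => isExtensionOfScalars_map (hf n) T
  | mulEll F =>
    have : (map T).map F.mulEll = ((map T).obj F).mulEll := hom_ext fun n => by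
      change T.map (ℓ • 𝟙 _) = ℓ • 𝟙 _
      rw [T.map_nsmul, T.map_id]; rfl
    rw [this]
    exact W.mulEll _

end Functoriality

end PiSystem

/-- The category of systems with `ℚ̄_ℓ`-coefficients.  Inverting the extensions of scalars amounts
to passing to the filtered colimit of the categories of `𝒪_E`-linear systems along the functors
`- ⊗_{𝒪_E} 𝒪_L` for `E ⊆ L`; inverting `ℓ` amounts to replacing each `𝒪_E`-module of
morphisms by its tensor product with `E`.  (Between adic systems, the Artin-Rees morphisms are the
morphisms of systems, since every `F_{n+r} ⟶ G_n` factors through `F_n`.) -/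
abbrev QlSystem (𝒜 : Type u) [Category.{v} 𝒜] [Preadditive 𝒜] :=
  (PiSystem.W : MorphismProperty (PiSystem ℓ 𝒜)).Localization

namespace QlSystem

variable {𝒜 : Type u} [Category.{v} 𝒜] [Preadditive 𝒜]
variable {ℬ : Type u'} [Category.{v'} ℬ] [Preadditive ℬ]
variable {𝒞 : Type u''} [Category.{v''} 𝒞] [Preadditive 𝒞]

variable (𝒜) in
/-- The functor `F ↦ F ⊗ ℚ̄_ℓ`. -/
abbrev Q : PiSystem ℓ 𝒜 ⥤ QlSystem ℓ 𝒜 := MorphismProperty.Q _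

lemma isInvertedBy (T : 𝒜 ⥤ ℬ) [T.Additive] [T.IsLeftAdjoint] :
    (PiSystem.W : MorphismProperty (PiSystem ℓ 𝒜)).IsInvertedBy (PiSystem.map T ⋙ Q ℓ ℬ) :=
  fun _ _ f hf => MorphismProperty.Q_inverts _ _ (PiSystem.map_W T f hf)

/-- The functor on systems with `ℚ̄_ℓ`-coefficients induced by an additive left adjoint. -/
def map (T : 𝒜 ⥤ ℬ) [T.Additive] [T.IsLeftAdjoint] : QlSystem ℓ 𝒜 ⥤ QlSystem ℓ ℬ :=
  Localization.Construction.lift (PiSystem.map T ⋙ Q ℓ ℬ) (isInvertedBy ℓ T)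

/-- `T(F ⊗ ℚ̄_ℓ) = T(F) ⊗ ℚ̄_ℓ`. -/
def fac (T : 𝒜 ⥤ ℬ) [T.Additive] [T.IsLeftAdjoint] :
    Q ℓ 𝒜 ⋙ map ℓ T ≅ PiSystem.map T ⋙ Q ℓ ℬ :=
  eqToIso (Localization.Construction.fac _ _)

instance (T : 𝒜 ⥤ ℬ) [T.Additive] [T.IsLeftAdjoint] :
    Localization.Lifting (Q ℓ 𝒜) PiSystem.W (PiSystem.map T ⋙ Q ℓ ℬ) (map ℓ T) :=
  ⟨fac ℓ T⟩

/-- An isomorphism `T ⋙ T' ≅ T''`, with `ℚ̄_ℓ`-coefficients. -/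
def mapComp {T : 𝒜 ⥤ ℬ} [T.Additive] [T.IsLeftAdjoint] {T' : ℬ ⥤ 𝒞} [T'.Additive]
    [T'.IsLeftAdjoint] {T'' : 𝒜 ⥤ 𝒞} [T''.Additive] [T''.IsLeftAdjoint] (e : T ⋙ T' ≅ T'') :
    map ℓ T ⋙ map ℓ T' ≅ map ℓ T'' :=
  Localization.liftNatIso (Q ℓ 𝒜) PiSystem.W ((PiSystem.map T ⋙ Q ℓ ℬ) ⋙ map ℓ T')
    (PiSystem.map T'' ⋙ Q ℓ 𝒞) _ _
    (Functor.associator _ _ _ ≪≫ Functor.isoWhiskerLeft (PiSystem.map T) (fac ℓ T') ≪≫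
      (Functor.associator _ _ _).symm ≪≫ Functor.isoWhiskerRight (PiSystem.mapComp e) (Q ℓ 𝒞))

lemma mapComp_app {T : 𝒜 ⥤ ℬ} [T.Additive] [T.IsLeftAdjoint] {T' : ℬ ⥤ 𝒞} [T'.Additive]
    [T'.IsLeftAdjoint] {T'' : 𝒜 ⥤ 𝒞} [T''.Additive] [T''.IsLeftAdjoint] (e : T ⋙ T' ≅ T'')
    (F : PiSystem ℓ 𝒜) :
    (mapComp ℓ e).hom.app ((Q ℓ 𝒜).obj F) =
      (map ℓ T').map ((fac ℓ T).hom.app F) ≫ (fac ℓ T').hom.app ((PiSystem.map T).obj F) ≫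
        (Q ℓ 𝒞).map ((PiSystem.mapComp e).hom.app F) ≫ (fac ℓ T'').inv.app F := by
  simp [mapComp, Localization.Lifting.iso]

end QlSystem

end Systems

section EtaleSite

variable {X Y Z : Scheme.{u}}

/-- The total space of an étale `X`-scheme. -/
def tot (U : X.Etale) : Scheme.{u} := ((Scheme.Etale.forget X).obj U).left

/-- The structure morphism of an étale `X`-scheme. -/
def str (U : X.Etale) : tot U ⟶ X := ((Scheme.Etale.forget X).obj U).hom

instance (U : X.Etale) : Etale (str U) := U.prop

/-- The morphism of schemes underlying a morphism of étale `X`-schemes. -/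
def totMap {U V : X.Etale} (f : U ⟶ V) : tot U ⟶ tot V := ((Scheme.Etale.forget X).map f).left

@[simp] lemma totMap_id (U : X.Etale) : totMap (𝟙 U) = 𝟙 (tot U) := rfl

@[simp] lemma totMap_comp {U V W : X.Etale} (f : U ⟶ V) (g : V ⟶ W) :
    totMap (f ≫ g) = totMap f ≫ totMap g := rfl

@[simp] lemma totMap_str {U V : X.Etale} (f : U ⟶ V) : totMap f ≫ str V = str U :=
  Over.w ((Scheme.Etale.forget X).map f)

@[simp] lemma totMap_str_assoc {U V : X.Etale} (f : U ⟶ V) {T : Scheme.{u}} (g : X ⟶ T) :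
    totMap f ≫ str V ≫ g = str U ≫ g := by
  rw [← Category.assoc, totMap_str]

lemma et_hom_ext {U V : X.Etale} {f g : U ⟶ V} (h : totMap f = totMap g) : f = g :=
  (Scheme.Etale.forget X).map_injective (Over.OverMorphism.ext h)

/-- A morphism of étale `X`-schemes. -/
def etHomMk {U V : X.Etale} (f : tot U ⟶ tot V) (w : f ≫ str V = str U) : U ⟶ V :=
  (Scheme.Etale.forgetFullyFaithful X).preimage (Over.homMk f w)

@[simp] lemma totMap_etHomMk {U V : X.Etale} (f : tot U ⟶ tot V) (w : f ≫ str V = str U) :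
    totMap (etHomMk f w) = f := rfl

/-- The étale `Y`-scheme `U ×_X Y`. -/
def bcObj (f : Y ⟶ X) (U : X.Etale) : Y.Etale := Scheme.Etale.mk (pullback.snd (str U) f)

/-- The projection `U ×_X Y ⟶ U`. -/
def bcObjFst (f : Y ⟶ X) (U : X.Etale) : tot (bcObj f U) ⟶ tot U := pullback.fst (str U) f

lemma bcObj_isPullback (f : Y ⟶ X) (U : X.Etale) :
    IsPullback (bcObjFst f U) (str (bcObj f U)) (str U) f :=
  IsPullback.of_hasPullback _ _

/-- Base change `U ↦ U ×_X Y` of étale schemes. -/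
def etBaseChange (f : Y ⟶ X) : X.Etale ⥤ Y.Etale where
  obj U := bcObj f U
  map {U V} g := etHomMk ((bcObj_isPullback f V).lift (bcObjFst f U ≫ totMap g)
    (str (bcObj f U)) (by simp [(bcObj_isPullback f U).w])) (by simp)
  map_id U := et_hom_ext ((bcObj_isPullback f U).hom_ext (by simp) (by simp))
  map_comp {U V W} g h := et_hom_ext ((bcObj_isPullback f W).hom_ext (by simp)
    (by simp))

/-- The projection `U ×_X Y ⟶ U`. -/
def bcFst (f : Y ⟶ X) (U : X.Etale) : tot ((etBaseChange f).obj U) ⟶ tot U :=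
  bcObjFst f U

lemma bc_isPullback (f : Y ⟶ X) (U : X.Etale) :
    IsPullback (bcFst f U) (str ((etBaseChange f).obj U)) (str U) f :=
  bcObj_isPullback f U

lemma bc_w (f : Y ⟶ X) (U : X.Etale) :
    bcFst f U ≫ str U = str ((etBaseChange f).obj U) ≫ f :=
  (bc_isPullback f U).w

@[simp] lemma etBaseChange_map_fst (f : Y ⟶ X) {U V : X.Etale} (g : U ⟶ V) :
    totMap ((etBaseChange f).map g) ≫ bcFst f V = bcFst f U ≫ totMap g :=
  IsPullback.lift_fst _ _ _ _

/-- Morphisms into `U ×_X Y`. -/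
def bcLift (f : Y ⟶ X) (U : X.Etale) (V : Y.Etale) (a : tot V ⟶ tot U)
    (w : a ≫ str U = str V ≫ f) : V ⟶ (etBaseChange f).obj U :=
  etHomMk ((bc_isPullback f U).lift a (str V) w) (by simp)

@[simp] lemma bcLift_fst (f : Y ⟶ X) (U : X.Etale) (V : Y.Etale) (a : tot V ⟶ tot U)
    (w : a ≫ str U = str V ≫ f) : totMap (bcLift f U V a w) ≫ bcFst f U = a := by
  simp [bcLift]

lemma bc_hom_ext (f : Y ⟶ X) {U : X.Etale} {V : Y.Etale} {a b : V ⟶ (etBaseChange f).obj U}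
    (h : totMap a ≫ bcFst f U = totMap b ≫ bcFst f U) : a = b :=
  et_hom_ext ((bc_isPullback f U).hom_ext h (by simp))

lemma bc_w_assoc (f : Y ⟶ X) (U : X.Etale) {T : Scheme.{u}} (a : X ⟶ T) :
    bcFst f U ≫ str U ≫ a = str ((etBaseChange f).obj U) ≫ f ≫ a := by
  rw [← Category.assoc, bc_w, Category.assoc]

lemma bc_tot_hom_ext (f : Y ⟶ X) {U : X.Etale} {T : Scheme.{u}}
    {a b : T ⟶ tot ((etBaseChange f).obj U)} (h₁ : a ≫ bcFst f U = b ≫ bcFst f U)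
    (h₂ : a ≫ str ((etBaseChange f).obj U) = b ≫ str ((etBaseChange f).obj U)) : a = b :=
  (bc_isPullback f U).hom_ext h₁ h₂

@[simp] lemma etBaseChange_map_fst_assoc (f : Y ⟶ X) {U V : X.Etale} (g : U ⟶ V) {T : Scheme.{u}}
    (a : tot V ⟶ T) : totMap ((etBaseChange f).map g) ≫ bcFst f V ≫ a =
      bcFst f U ≫ totMap g ≫ a := by
  rw [← Category.assoc, etBaseChange_map_fst, Category.assoc]

@[simp] lemma bcLift_fst_assoc (f : Y ⟶ X) (U : X.Etale) (V : Y.Etale) (a : tot V ⟶ tot U)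
    (w : a ≫ str U = str V ≫ f) {T : Scheme.{u}} (b : tot U ⟶ T) :
    totMap (bcLift f U V a w) ≫ bcFst f U ≫ b = a ≫ b := by
  rw [← Category.assoc, bcLift_fst]

lemma coverPreserving_etBaseChange (f : Y ⟶ X) :
    CoverPreserving X.smallEtaleTopology Y.smallEtaleTopology (etBaseChange f) where
  cover_preserve {U S} hS := by
    obtain ⟨ι, T, g, rfl⟩ := S.exists_eq_ofArrows
    rw [Scheme.ofArrows_mem_smallEtaleTopology_iff] at hS
    have : Sieve.ofArrows _ (fun i => (etBaseChange f).map (g i)) ∈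
        Y.smallEtaleTopology ((etBaseChange f).obj U) := by
      rw [Scheme.ofArrows_mem_smallEtaleTopology_iff, Set.eq_univ_iff_forall]
      intro z
      have hz : bcFst f U z ∈ ⋃ i, Set.range (totMap (g i)) := by
        change _ ∈ ⋃ i, Set.range (g i).left
        rw [hS]; trivial
      obtain ⟨i, y, hy⟩ := Set.mem_iUnion.1 hz
      have hp : IsPullback (bcFst f (T i)) (totMap ((etBaseChange f).map (g i))) (totMap (g i))
          (bcFst f U) := by
        refine IsPullback.of_bot ?_ (etBaseChange_map_fst f (g i)).symm (bc_isPullback f U)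
        simpa using bc_isPullback f (T i)
      obtain ⟨t, ht, -⟩ := Scheme.exists_preimage_of_isPullback hp.flip z y hy.symm
      exact Set.mem_iUnion.2 ⟨i, t, ht⟩
    refine Y.smallEtaleTopology.superset_covering ?_ this
    rw [Sieve.ofArrows, Sieve.generate_le_iff]
    rintro _ _ ⟨i⟩
    exact ⟨T i, g i, 𝟙 _, Sieve.ofArrows_mk _ _ i, (Category.id_comp _).symm⟩

instance (f : Y ⟶ X) : PreservesFiniteLimits (etBaseChange f) := by
  have : PreservesFiniteLimits (etBaseChange f ⋙ Scheme.Etale.forget Y) := by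
    let e : Scheme.Etale.forget X ⋙ Over.pullback f ≅ etBaseChange f ⋙ Scheme.Etale.forget Y :=
      NatIso.ofComponents (fun U => Iso.refl _) (by
        intro U V g
        refine (Category.comp_id _).trans (Eq.trans ?_ (Category.id_comp _).symm)
        refine Over.OverMorphism.ext ((bc_isPullback f V).hom_ext ?_ ?_)
        · refine Eq.trans ?_ (etBaseChange_map_fst f g).symm
          exact pullback.lift_fst _ _ _
        · refine Eq.trans ?_ (totMap_str ((etBaseChange f).map g)).symm
          exact pullback.lift_snd _ _ _)
    have : PreservesFiniteLimits (Over.pullback f) := inferInstance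
    exact preservesFiniteLimits_of_natIso e
  exact preservesFiniteLimits_of_reflects_of_preserves _ (Scheme.Etale.forget Y)

instance (f : Y ⟶ X) : RepresentablyFlat (etBaseChange f) :=
  flat_of_preservesFiniteLimits _

instance (f : Y ⟶ X) :
    (etBaseChange f).IsContinuous X.smallEtaleTopology Y.smallEtaleTopology :=
  (Functor.isContinuous_iff_coverPreserving ..).2 (coverPreserving_etBaseChange f)

/-- `U ×_X Z = (U ×_X Y) ×_Y Z`. -/
def etBaseChangeComp (f : Z ⟶ Y) (g : Y ⟶ X) (h : Z ⟶ X) (e : h = f ≫ g) :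
    etBaseChange g ⋙ etBaseChange f ≅ etBaseChange h :=
  NatIso.ofComponents (fun U =>
    { hom := bcLift h U ((etBaseChange f).obj ((etBaseChange g).obj U))
        (bcFst f ((etBaseChange g).obj U) ≫ bcFst g U) (by
        rw [Category.assoc, bc_w, ← Category.assoc, bc_w, Category.assoc, e])
      inv := bcLift f ((etBaseChange g).obj U) ((etBaseChange h).obj U)
        ((bc_isPullback g U).lift (bcFst h U) (str ((etBaseChange h).obj U) ≫ f)
        (by rw [bc_w, e, Category.assoc])) (by simp)
      hom_inv_id := bc_hom_ext _ ((bc_isPullback g U).hom_ext (by simp) (by simp [bc_w]))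
      inv_hom_id := bc_hom_ext _ (by simp) })
    (fun {U V} a => bc_hom_ext _ (by simp))

@[simp] lemma etBaseChangeComp_inv_fst (f : Z ⟶ Y) (g : Y ⟶ X) (h : Z ⟶ X) (e : h = f ≫ g)
    (U : X.Etale) : totMap ((etBaseChangeComp f g h e).inv.app U) ≫
      bcFst f ((etBaseChange g).obj U) ≫ bcFst g U = bcFst h U := by
  refine (bcLift_fst_assoc f ((etBaseChange g).obj U) ((etBaseChange h).obj U) _ _ _).trans ?_
  exact IsPullback.lift_fst _ _ _ _

/-- `U ×_X X = U`. -/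
def etBaseChangeId (f : X ⟶ X) (hf : f = 𝟙 X) : etBaseChange f ≅ 𝟭 _ :=
  NatIso.ofComponents (fun U =>
    { hom := etHomMk (V := U) (bcFst _ _) (by simp [bc_w, hf])
      inv := bcLift f U U (𝟙 _) (by simp [hf])
      hom_inv_id := bc_hom_ext _ (by simp)
      inv_hom_id := et_hom_ext (by simp) })
    (fun {U V} a => et_hom_ext (by simp))

/-- Sheaves of abelian groups on the small étale site of `X`. -/
abbrev EtAb (X : Scheme.{u}) := Sheaf X.smallEtaleTopology AddCommGrpCat.{u}

/-- The direct image `f_*`. -/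
abbrev push (f : Y ⟶ X) : EtAb Y ⥤ EtAb X :=
  (etBaseChange f).sheafPushforwardContinuous _ _ _

instance (f : Y ⟶ X) : (push f).IsRightAdjoint := by
  let i := Scheme.AffineEtale.Spec X
  let J := Scheme.AffineEtale.topology X
  have : (i ⋙ etBaseChange f).IsContinuous J Y.smallEtaleTopology :=
    Functor.isContinuous_comp _ _ J X.smallEtaleTopology Y.smallEtaleTopology
  have h (Z : Y.Etaleᵒᵖ) :
      EssentiallySmall.{u} (CostructuredArrow (i ⋙ etBaseChange f).op Z) := inferInstance
  have hK (F : (Scheme.AffineEtale X)ᵒᵖ ⥤ AddCommGrpCat.{u}) :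
      (i ⋙ etBaseChange f).op.HasLeftKanExtension F := by
    have (Z : Y.Etaleᵒᵖ) : HasColimitsOfShape (CostructuredArrow (i ⋙ etBaseChange f).op Z)
        AddCommGrpCat.{u} := hasColimitsOfShape_of_essentiallySmall.{u} _ _
    infer_instance
  let T : EtAb X ⥤ Sheaf J AddCommGrpCat.{u} := i.sheafPushforwardContinuous _ J X.smallEtaleTopology
  have : T.IsEquivalence := inferInstanceAs (i.sheafPushforwardContinuous _ J X.smallEtaleTopology).IsEquivalence
  let G := (i ⋙ etBaseChange f).sheafPushforwardContinuous AddCommGrpCat.{u} J Y.smallEtaleTopology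
  have : G.IsRightAdjoint := inferInstance
  let e : G ⋙ T.inv ≅ push f :=
    Functor.isoWhiskerRight (Functor.sheafPushforwardContinuousComp' (Iso.refl (i ⋙ etBaseChange f))
        AddCommGrpCat.{u} J X.smallEtaleTopology Y.smallEtaleTopology).symm T.inv ≪≫
      Functor.associator _ _ _ ≪≫ Functor.isoWhiskerLeft (push f) T.asEquivalence.unitIso.symm ≪≫
      Functor.rightUnitor _
  exact Functor.isRightAdjoint_of_iso e

instance (f : Y ⟶ X) : (push f).Additive where

/-- The inverse image `f^*`, left adjoint to `f_*`. -/
abbrev pull (f : Y ⟶ X) : EtAb X ⥤ EtAb Y :=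
  (etBaseChange f).sheafPullback _ _ _

/-- The adjunction between inverse and direct image. -/
abbrev pullPushAdj (f : Y ⟶ X) : pull f ⊣ push f :=
  (etBaseChange f).sheafAdjunctionContinuous _ _ _

instance (f : Y ⟶ X) : (pull f).IsLeftAdjoint := (pullPushAdj f).isLeftAdjoint

instance (f : Y ⟶ X) : (pull f).Additive := (pullPushAdj f).left_adjoint_additive

/-- `g_* ∘ f_* = (g ∘ f)_*`. -/
def pushComp (f : Z ⟶ Y) (g : Y ⟶ X) (h : Z ⟶ X) (e : h = f ≫ g) : push f ⋙ push g ≅ push h :=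
  Functor.sheafPushforwardContinuousComp' (etBaseChangeComp f g h e) _ _ _ _

lemma pushComp_hom_app (f : Z ⟶ Y) (g : Y ⟶ X) (h : Z ⟶ X) (e : h = f ≫ g) (A : EtAb Z)
    (U : X.Etale) : ((pushComp f g h e).hom.app A).hom.app (op U) =
      A.obj.map ((etBaseChangeComp f g h e).inv.app U).op := by
  rfl

/-- The direct image under the identity is the identity. -/
def pushId (f : X ⟶ X) (hf : f = 𝟙 X) : push f ≅ 𝟭 (EtAb X) :=
  Functor.sheafPushforwardContinuousId' (etBaseChangeId f hf) _ _

lemma pushId_inv_app (f : X ⟶ X) (hf : f = 𝟙 X) (A : EtAb X)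
    (U : X.Etale) : ((pushId f hf).inv.app A).hom.app (op U) =
      A.obj.map ((etBaseChangeId f hf).hom.app U).op := by
  rfl

instance (f : Y ⟶ X) [IsIso f] : (push f).IsEquivalence :=
  (CategoryTheory.Equivalence.mk (push f) (push (inv f))
    ((pushComp f (inv f) (𝟙 _) (by simp)) ≪≫ pushId _ rfl).symm
    ((pushComp (inv f) f (𝟙 _) (by simp)) ≪≫ pushId _ rfl)).isEquivalence_functor

end EtaleSite

section Equivariance

/-- An action (up to isomorphism) of a group `G` on a category: endofunctors `T g` together with
identifications of `T g ∘ T h` with `T (g * h)`. -/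
structure CatAction (G : Type w) [Group G] (𝒞 : Type u) [Category.{v} 𝒞] where
  /-- the functor attached to a group element -/
  T : G → 𝒞 ⥤ 𝒞
  /-- compatibility with multiplication -/
  comp : ∀ g h, T h ⋙ T g ≅ T (g * h)

variable {G : Type w} [Group G] {𝒞 : Type u} [Category.{v} 𝒞]

/-- An object `F` with isomorphisms `μ g : T g F ≅ F` such that
`μ (g * h) = μ g ∘ T g (μ h)`, i.e. an object with a compatible action of `G`. -/
structure Equivariant (A : CatAction G 𝒞) where
  /-- the underlying object -/
  obj : 𝒞
  /-- the action -/
  act : ∀ g, (A.T g).obj obj ≅ obj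
  act_mul : ∀ g h, (A.comp g h).hom.app obj ≫ (act (g * h)).hom =
    (A.T g).map (act h).hom ≫ (act g).hom

namespace Equivariant

variable {A : CatAction G 𝒞}

/-- Morphisms compatible with the actions. -/
@[ext]
structure Hom (F F' : Equivariant A) where
  /-- the underlying morphism -/
  hom : F.obj ⟶ F'.obj
  comm : ∀ g, (F.act g).hom ≫ hom = (A.T g).map hom ≫ (F'.act g).hom

instance : Category (Equivariant A) where
  Hom := Hom
  id F := ⟨𝟙 _, by simp⟩
  comp f g := ⟨f.hom ≫ g.hom, fun γ => by
    rw [← Category.assoc, f.comm, Category.assoc, g.comm, Functor.map_comp, Category.assoc]⟩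
  id_comp f := Hom.ext (Category.id_comp _)
  comp_id f := Hom.ext (Category.comp_id _)
  assoc f g h := Hom.ext (Category.assoc _ _ _)

end Equivariant

section NatAction

variable {𝒜 : Type u'} [Category.{v'} 𝒜] (A : CatAction G 𝒞) {L : 𝒜 ⥤ 𝒞} {R : 𝒞 ⥤ 𝒜}
  (adj : L ⊣ R) (c : ∀ g, A.T g ⋙ R ≅ R)

lemma adj_hom_ext {F : 𝒜} {B : 𝒞} {a b : L.obj F ⟶ B}
    (h : adj.unit.app F ≫ R.map a = adj.unit.app F ≫ R.map b) : a = b :=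
  (adj.homEquiv F B).injective (by simpa [adj.homEquiv_unit] using h)

/-- The morphism `L F ⟶ T g (L F)` which is adjoint to `F ⟶ R (L F) ≅ R (T g (L F))`. -/
def coact (g : G) (F : 𝒜) : L.obj F ⟶ (A.T g).obj (L.obj F) :=
  (adj.homEquiv F ((A.T g).obj (L.obj F))).symm (adj.unit.app F ≫ (c g).inv.app (L.obj F))

@[simp] lemma unit_coact (g : G) (F : 𝒜) :
    adj.unit.app F ≫ R.map (coact A adj c g F) = adj.unit.app F ≫ (c g).inv.app (L.obj F) := by
  exact (adj.homEquiv_unit _ _ _).symm.trans (Equiv.apply_symm_apply _ _)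

@[simp] lemma unit_coact_assoc (g : G) (F : 𝒜) {B : 𝒜}
    (b : R.obj ((A.T g).obj (L.obj F)) ⟶ B) :
    adj.unit.app F ≫ R.map (coact A adj c g F) ≫ b =
      adj.unit.app F ≫ (c g).inv.app (L.obj F) ≫ b := by
  rw [← Category.assoc, unit_coact, Category.assoc]

lemma coact_naturality (g : G) {F F' : 𝒜} (f : F ⟶ F') :
    L.map f ≫ coact A adj c g F' = coact A adj c g F ≫ (A.T g).map (L.map f) := by
  apply adj_hom_ext adj
  have h := (c g).inv.naturality (L.map f)
  simp only [Functor.comp_map] at h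
  rw [Functor.map_comp, Functor.map_comp, unit_coact_assoc, ← h]
  simp [-NatTrans.naturality, -NatTrans.naturality_assoc]

lemma coact_mul (hc : ∀ g h B, R.map ((A.comp g h).hom.app B) ≫ (c (g * h)).hom.app B =
      (c g).hom.app ((A.T h).obj B) ≫ (c h).hom.app B) (g h : G) (F : 𝒜) :
    coact A adj c (g * h) F = coact A adj c g F ≫
      (A.T g).map (coact A adj c h F) ≫ (A.comp g h).hom.app (L.obj F) := by
  apply adj_hom_ext adj
  have h₁ := (c g).inv.naturality (coact A adj c h F)
  simp only [Functor.comp_map] at h₁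
  rw [Functor.map_comp, Functor.map_comp, unit_coact, unit_coact_assoc, ← Category.assoc ((c g).inv.app _), ← h₁,
    Category.assoc, unit_coact_assoc]
  congr 1
  rw [← cancel_mono ((c (g * h)).hom.app (L.obj F))]
  simp [hc]

lemma isIso_coact (hc : ∀ g h B, R.map ((A.comp g h).hom.app B) ≫ (c (g * h)).hom.app B =
      (c g).hom.app ((A.T h).obj B) ≫ (c h).hom.app B)
    (e : 𝟭 𝒞 ≅ A.T 1) (he : ∀ B, R.map (e.hom.app B) ≫ (c 1).hom.app B = 𝟙 _)
    [∀ g, (A.T g).ReflectsIsomorphisms] (g : G) (F : 𝒜) : IsIso (coact A adj c g F) := by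
  have h₁ : coact A adj c 1 F = e.hom.app (L.obj F) := by
    apply adj_hom_ext adj
    rw [unit_coact]
    congr 1
    rw [← cancel_mono ((c 1).hom.app (L.obj F)), he]
    simp
  have : IsIso (coact A adj c 1 F) := by rw [h₁]; infer_instance
  have key (g : G) : ∃ b, coact A adj c g F ≫ (A.T g).map (coact A adj c g⁻¹ F) ≫ b = 𝟙 _ ∧ IsIso b := by
    have h₂ := coact_mul A adj c hc g g⁻¹ F
    have : ∃ a, IsIso a ∧ coact A adj c (g * g⁻¹) F ≫ a = 𝟙 _ := by
      rw [mul_inv_cancel]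
      exact ⟨inv _, inferInstance, IsIso.hom_inv_id _⟩
    obtain ⟨a, ha, ha'⟩ := this
    refine ⟨(A.comp g g⁻¹).hom.app (L.obj F) ≫ a, ?_, inferInstance⟩
    rw [← ha', h₂]
    simp only [Category.assoc]
  have hs (g : G) : IsSplitMono (coact A adj c g F) := by
    obtain ⟨b, hb, -⟩ := key g
    exact ⟨⟨_, hb⟩⟩
  have hi (g : G) : IsIso (coact A adj c g⁻¹ F) := by
    obtain ⟨b, hb, hb'⟩ := key g
    have h₃ : IsSplitMono ((A.T g).map (coact A adj c g⁻¹ F)) := inferInstance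
    have h₄ : IsSplitEpi ((A.T g).map (coact A adj c g⁻¹ F) ≫ b) := ⟨⟨_, hb⟩⟩
    have h₅ : IsIso ((A.T g).map (coact A adj c g⁻¹ F) ≫ b) := isIso_of_mono_of_isSplitEpi _
    have h₆ : IsIso ((A.T g).map (coact A adj c g⁻¹ F)) := IsIso.of_isIso_comp_right _ b
    exact isIso_of_reflects_iso _ (A.T g)
  have h := hi g⁻¹
  rwa [inv_inv] at h

/-- The isomorphism of functors `T g ∘ L ≅ L` inverse to `coact`. -/
def natAct (hc : ∀ g h B, R.map ((A.comp g h).hom.app B) ≫ (c (g * h)).hom.app B =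
      (c g).hom.app ((A.T h).obj B) ≫ (c h).hom.app B)
    (e : 𝟭 𝒞 ≅ A.T 1) (he : ∀ B, R.map (e.hom.app B) ≫ (c 1).hom.app B = 𝟙 _)
    [∀ g, (A.T g).ReflectsIsomorphisms] (g : G) : L ⋙ A.T g ≅ L :=
  NatIso.ofComponents
    (fun F =>
      have := isIso_coact A adj c hc e he g F
      (asIso (coact A adj c g F)).symm)
    (fun {F F'} f => by
      have := isIso_coact A adj c hc e he g F
      have := isIso_coact A adj c hc e he g F'
      change (A.T g).map (L.map f) ≫ inv _ = inv _ ≫ L.map f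
      rw [IsIso.comp_inv_eq, Category.assoc, coact_naturality, IsIso.inv_hom_id_assoc])

lemma natAct_mul (hc : ∀ g h B, R.map ((A.comp g h).hom.app B) ≫ (c (g * h)).hom.app B =
      (c g).hom.app ((A.T h).obj B) ≫ (c h).hom.app B)
    (e : 𝟭 𝒞 ≅ A.T 1) (he : ∀ B, R.map (e.hom.app B) ≫ (c 1).hom.app B = 𝟙 _)
    [∀ g, (A.T g).ReflectsIsomorphisms] (g h : G) (F : 𝒜) :
    (A.comp g h).hom.app (L.obj F) ≫ (natAct A adj c hc e he (g * h)).hom.app F =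
      (A.T g).map ((natAct A adj c hc e he h).hom.app F) ≫
        (natAct A adj c hc e he g).hom.app F := by
  have := isIso_coact A adj c hc e he g F
  have := isIso_coact A adj c hc e he h F
  have := isIso_coact A adj c hc e he (g * h) F
  change _ ≫ inv _ = (A.T g).map (inv _) ≫ inv _
  rw [IsIso.comp_inv_eq, coact_mul A adj c hc g h F, Category.assoc, IsIso.inv_hom_id_assoc,
    ← Functor.map_comp_assoc, IsIso.inv_hom_id, CategoryTheory.Functor.map_id, Category.id_comp]

end NatAction

end Equivariance

section EquivariantSystems

variable {G : Type w} [Group G]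

/-- The functor `F ↦ (L F, N)` to equivariant objects. -/
@[simps]
def Equivariant.ofNat {𝒜 : Type u'} [Category.{v'} 𝒜] {𝒞 : Type u} [Category.{v} 𝒞]
    (A : CatAction G 𝒞) (L : 𝒜 ⥤ 𝒞) (N : ∀ g, L ⋙ A.T g ≅ L)
    (hN : ∀ g h F, (A.comp g h).hom.app (L.obj F) ≫ (N (g * h)).hom.app F =
      (A.T g).map ((N h).hom.app F) ≫ (N g).hom.app F) : 𝒜 ⥤ Equivariant A where
  obj F := ⟨L.obj F, fun g => (N g).app F, fun g h => hN g h F⟩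
  map f := ⟨L.map f, fun g => ((N g).hom.naturality f).symm⟩
  map_id F := Equivariant.Hom.ext (L.map_id F)
  map_comp f g := Equivariant.Hom.ext (L.map_comp f g)

variable (ℓ : ℕ) [Fact ℓ.Prime]
variable {𝒞 : Type u} [Category.{v} 𝒞] [Preadditive 𝒞]

/-- The induced componentwise action on systems. -/
@[simps]
def CatAction.pi (A : CatAction G 𝒞) [∀ g, (A.T g).Additive] : CatAction G (PiSystem ℓ 𝒞) where
  T g := PiSystem.map (A.T g)
  comp g h := PiSystem.mapComp (A.comp g h)

/-- The induced action on systems with `ℚ̄_ℓ`-coefficients. -/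
@[simps]
def CatAction.ql (A : CatAction G 𝒞) [∀ g, (A.T g).Additive] [∀ g, (A.T g).IsLeftAdjoint] :
    CatAction G (QlSystem ℓ 𝒞) where
  T g := QlSystem.map ℓ (A.T g)
  comp g h := QlSystem.mapComp ℓ (A.comp g h)

variable {𝒜 : Type u'} [Category.{v'} 𝒜] [Preadditive 𝒜]

lemma QlSystem.mapComp_mul (A : CatAction G 𝒞) [∀ g, (A.T g).Additive]
    [∀ g, (A.T g).IsLeftAdjoint] (L : 𝒜 ⥤ 𝒞) [L.Additive] [L.IsLeftAdjoint]
    (N : ∀ g, L ⋙ A.T g ≅ L)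
    (hN : ∀ g h F, (A.comp g h).hom.app (L.obj F) ≫ (N (g * h)).hom.app F =
      (A.T g).map ((N h).hom.app F) ≫ (N g).hom.app F) (g h : G) (𝓕 : QlSystem ℓ 𝒜) :
    ((A.ql ℓ).comp g h).hom.app ((QlSystem.map ℓ L).obj 𝓕) ≫
        (QlSystem.mapComp ℓ (N (g * h))).hom.app 𝓕 =
      ((A.ql ℓ).T g).map ((QlSystem.mapComp ℓ (N h)).hom.app 𝓕) ≫
        (QlSystem.mapComp ℓ (N g)).hom.app 𝓕 := by
  obtain ⟨F, rfl⟩ := (Localization.Construction.objEquiv _).surjective 𝓕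
  change (mapComp ℓ (A.comp g h)).hom.app ((map ℓ L).obj ((Q ℓ 𝒜).obj F)) ≫
        (QlSystem.mapComp ℓ (N (g * h))).hom.app ((Q ℓ 𝒜).obj F) =
      (map ℓ (A.T g)).map ((QlSystem.mapComp ℓ (N h)).hom.app ((Q ℓ 𝒜).obj F)) ≫
        (QlSystem.mapComp ℓ (N g)).hom.app ((Q ℓ 𝒜).obj F)
  have h₁ := (mapComp ℓ (A.comp g h)).hom.naturality ((fac ℓ L).hom.app F)
  have h₂ := (fac ℓ (A.T g)).hom.naturality ((PiSystem.mapComp (N h)).hom.app F)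
  have h₃ : (PiSystem.mapComp (A.comp g h)).hom.app ((PiSystem.map L).obj F) ≫
      (PiSystem.mapComp (N (g * h))).hom.app F =
    (PiSystem.map (A.T g)).map ((PiSystem.mapComp (N h)).hom.app F) ≫
      (PiSystem.mapComp (N g)).hom.app F := PiSystem.hom_ext fun n => hN g h (F.obj n)
  have h₁' : (mapComp ℓ (A.comp g h)).hom.app ((map ℓ L).obj ((Q ℓ 𝒜).obj F)) ≫
      (map ℓ (A.T (g * h))).map ((fac ℓ L).hom.app F) =
    (map ℓ (A.T g)).map ((map ℓ (A.T h)).map ((fac ℓ L).hom.app F)) ≫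
      (mapComp ℓ (A.comp g h)).hom.app ((Q ℓ 𝒞).obj ((PiSystem.map L).obj F)) := h₁.symm
  have h₂' : (map ℓ (A.T g)).map ((Q ℓ 𝒞).map ((PiSystem.mapComp (N h)).hom.app F)) ≫
      (fac ℓ (A.T g)).hom.app ((PiSystem.map L).obj F) =
    (fac ℓ (A.T g)).hom.app ((PiSystem.map (A.T h)).obj ((PiSystem.map L).obj F)) ≫
      (Q ℓ 𝒞).map ((PiSystem.map (A.T g)).map ((PiSystem.mapComp (N h)).hom.app F)) := h₂
  have h₄ := congrArg (Q ℓ 𝒞).map h₃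
  rw [Functor.map_comp, Functor.map_comp] at h₄
  rw [mapComp_app, mapComp_app, mapComp_app, reassoc_of% h₁', mapComp_app]
  simp only [Functor.map_comp, Category.assoc]
  have h₅ : (fac ℓ (A.T (g * h))).inv.app ((PiSystem.map L).obj F) ≫
      (fac ℓ (A.T (g * h))).hom.app ((PiSystem.map L).obj F) = 𝟙 _ := Iso.inv_hom_id_app _ _
  have h₆ : (map ℓ (A.T g)).map ((fac ℓ L).inv.app F) ≫
      (map ℓ (A.T g)).map ((fac ℓ L).hom.app F) = 𝟙 _ := by
    rw [← Functor.map_comp, Iso.inv_hom_id_app]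
    exact CategoryTheory.Functor.map_id _ _
  rw [reassoc_of% h₅, reassoc_of% h₆, reassoc_of% h₂', reassoc_of% h₄]

end EquivariantSystems

section LocalSystems

variable {ℓ : ℕ} [Fact ℓ.Prime] {X : Scheme.{u}}

/-- Locally constant sheaves with finite stalks: étale locally isomorphic to the constant sheaf
attached to a finite abelian group. -/
def IsFiniteLocallyConstant (A : EtAb X) : Prop :=
  ∀ x : X, ∃ U : X.Etale, x ∈ Set.range (str U) ∧
    ∃ M : AddCommGrpCat.{u}, Finite M ∧
      Nonempty ((pull (str U)).obj A ≅
        (constantSheaf (tot U).smallEtaleTopology AddCommGrpCat.{u}).obj M)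

/-- Smooth `ℓ`-adic sheaves: adic systems of locally constant sheaves with finite stalks. -/
def IsSmoothSystem (F : PiSystem ℓ (EtAb X)) : Prop :=
  F.IsAdic ∧ ∀ n, IsFiniteLocallyConstant (F.obj n)

variable {Ω : Type u} [Field Ω] [IsSepClosed Ω] (x : Spec (.of Ω) ⟶ X)

/-- The stalk functor at a geometric point. -/
abbrev stalk : EtAb X ⥤ AddCommGrpCat.{u} := (Scheme.pointSmallEtale x).sheafFiber

instance : (stalk x).Additive := Functor.additive_of_preserves_binary_products _

/-- The liftings of the geometric point `x` to an étale `X`-scheme `U`. -/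
abbrev Lift (U : X.Etale) : Type u := (Scheme.pointSmallEtale x).fiber.obj U

/-- A lifting of the geometric point `x` to `U`. -/
def Lift.mk {U : X.Etale} (u : Spec (.of Ω) ⟶ tot U) (w : u ≫ str U = x) : Lift x U :=
  Over.homMk u w

/-- The geometric point of `U` underlying a lifting. -/
def Lift.pt {U : X.Etale} (u : Lift x U) : Spec (.of Ω) ⟶ tot U :=
  (show Over.mk x ⟶ (Scheme.Etale.forget X).obj U from u).left

/-- The germ of a section over an étale neighbourhood. -/
def germ (A : EtAb X) (U : X.Etale) (u : Lift x U) (s : A.obj.obj (op U)) : (stalk x).obj A :=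
  ((Scheme.pointSmallEtale x).toPresheafFiber U u A.obj).hom s

lemma germ_stalk_map {A B : EtAb X} (φ : A ⟶ B) (U : X.Etale) (u : Lift x U)
    (s : A.obj.obj (op U)) :
    ((stalk x).map φ).hom (germ x A U u s) = germ x B U u ((φ.hom.app (op U)).hom s) :=
  congrArg (fun t => t.hom s)
    ((Scheme.pointSmallEtale x).toPresheafFiber_naturality φ.hom U u)

lemma stalk_comp_apply {A B C : EtAb X} (φ : A ⟶ B) (ψ : B ⟶ C) (t : (stalk x).obj A) :
    ((stalk x).map (φ ≫ ψ)).hom t = ((stalk x).map ψ).hom (((stalk x).map φ).hom t) :=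
  congrArg (fun χ => χ.hom t) ((stalk x).map_comp φ ψ)

/-- The stalk `T = lim_n (F_n)_x` of a system. -/
def Stalk (F : PiSystem ℓ (EtAb X)) : Type u :=
  {t : ∀ n, (stalk x).obj (F.obj n) // ∀ n, ((stalk x).map (F.tr n)).hom (t (n + 1)) = t n}

namespace Stalk

variable {x} {F F' : PiSystem ℓ (EtAb X)}

/-- The components of an element of `T`. -/
def val (t : Stalk x F) (n : ℕ) : (stalk x).obj (F.obj n) := t.1 n

@[ext] lemma ext {t t' : Stalk x F} (h : ∀ n, t.val n = t'.val n) : t = t' :=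
  Subtype.ext (funext h)

lemma tr_val (t : Stalk x F) (n : ℕ) :
    ((stalk x).map (F.tr n)).hom (t.val (n + 1)) = t.val n := t.2 n

instance : AddCommGroup (Stalk x F) :=
  inferInstanceAs (AddCommGroup (AddSubgroup.mk (G := ∀ n, (stalk x).obj (F.obj n))
    ⟨⟨{t | ∀ n, ((stalk x).map (F.tr n)).hom (t (n + 1)) = t n},
      fun {a b} ha hb n => by simp [ha n, hb n]⟩, fun n => by simp⟩
      (fun {a} ha n => by simp [ha n])))

@[simp] lemma add_val (t t' : Stalk x F) (n : ℕ) : (t + t').val n = t.val n + t'.val n := rfl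

instance : Module (valRing F.E) (Stalk x F) where
  smul a t := ⟨fun n => ((stalk x).map (F.act n a)).hom (t.val n), fun n => by
    beta_reduce
    rw [← t.tr_val n, ← stalk_comp_apply, ← stalk_comp_apply, F.tr_act]⟩
  one_smul t := ext fun n => by
    change ((stalk x).map (F.act n 1)).hom (t.val n) = t.val n
    rw [map_one]
    exact congrArg (fun φ => φ.hom (t.val n)) ((stalk x).map_id (F.obj n))
  mul_smul a b t := ext fun n => by
    change ((stalk x).map (F.act n (a * b))).hom (t.val n) =
      ((stalk x).map (F.act n a)).hom (((stalk x).map (F.act n b)).hom (t.val n))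
    rw [map_mul, ← stalk_comp_apply]
    rfl
  smul_zero a := ext fun n => map_zero ((stalk x).map (F.act n a)).hom
  smul_add a t t' := ext fun n => map_add ((stalk x).map (F.act n a)).hom _ _
  add_smul a b t := ext fun n => by
    change ((stalk x).map (F.act n (a + b))).hom (t.val n) =
      ((stalk x).map (F.act n a)).hom (t.val n) + ((stalk x).map (F.act n b)).hom (t.val n)
    rw [map_add, Functor.map_add]
    rfl
  zero_smul t := ext fun n => by
    change ((stalk x).map (F.act n 0)).hom (t.val n) = 0
    rw [map_zero, Functor.map_zero]
    rfl

/-- Functoriality of `T` in the system. -/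
def map (f : F ⟶ F') (t : Stalk x F) : Stalk x F' :=
  ⟨fun n => ((stalk x).map (f.app n)).hom (t.val n), fun n => by
    beta_reduce
    rw [← t.tr_val n, ← stalk_comp_apply, ← stalk_comp_apply, f.app_tr]⟩

end Stalk

/-- The stalk `ℚ̄_ℓ ⊗ T` of the sheaf with `ℚ̄_ℓ`-coefficients given by a system. -/
abbrev QlStalk (F : PiSystem ℓ (EtAb X)) := TensorProduct (valRing F.E) (PadicAlgCl ℓ) (Stalk x F)

/-- Systems whose stalk at `x` has rank `1`. -/
def IsRankOne (F : PiSystem ℓ (EtAb X)) : Prop := Module.finrank (PadicAlgCl ℓ) (QlStalk x F) = 1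

end LocalSystems

section FundamentalGroup

variable {X Y Z : Scheme.{u}} {Ω : Type u} [Field Ω] [IsSepClosed Ω]

namespace Lift

variable (x : Spec (.of Ω) ⟶ X)

@[ext] lemma ext {U : X.Etale} {u v : Lift x U} (h : pt x u = pt x v) : u = v :=
  Over.OverMorphism.ext h

@[simp] lemma pt_mk {U : X.Etale} (u : Spec (.of Ω) ⟶ tot U) (w : u ≫ str U = x) :
    pt x (mk x u w) = u := rfl

@[simp] lemma pt_str {U : X.Etale} (u : Lift x U) : pt x u ≫ str U = x :=
  Over.w (show Over.mk x ⟶ (Scheme.Etale.forget X).obj U from u)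

/-- The image of a lifting under a morphism of étale `X`-schemes. -/
def map {U V : X.Etale} (f : U ⟶ V) (u : Lift x U) : Lift x V :=
  mk x (pt x u ≫ totMap f) (by simp)

@[simp] lemma pt_map {U V : X.Etale} (f : U ⟶ V) (u : Lift x U) :
    pt x (map x f u) = pt x u ≫ totMap f := rfl

end Lift

/-- The category of finite étale `X`-schemes. -/
abbrev FEt (X : Scheme.{u}) := ObjectProperty.FullSubcategory (fun U : X.Etale => IsFinite (str U))

/-- Base change of finite étale schemes. -/
def fetBaseChange (f : Y ⟶ X) : FEt X ⥤ FEt Y :=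
  ObjectProperty.lift _ (ObjectProperty.ι _ ⋙ etBaseChange f) fun U =>
    MorphismProperty.of_isPullback (bc_isPullback f U.obj) U.property

variable (x : Spec (.of Ω) ⟶ X)

/-- The automorphisms of the fibre functor `U ↦ {liftings of x to U}` on finite étale
`X`-schemes, as a group of families of permutations. -/
def pi1Subgroup : Subgroup (∀ U : FEt X, Equiv.Perm (Lift x U.obj)) where
  carrier := {g | ∀ {U V : FEt X} (f : U ⟶ V) (u : Lift x U.obj),
    g V (Lift.map x f.hom u) = Lift.map x f.hom (g U u)}
  one_mem' := fun _ _ => rfl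
  mul_mem' := fun {a b} ha hb U V f u => by
    change a V (b V _) = Lift.map x f.hom (a U (b U u))
    rw [hb f u, ha f (b U u)]
  inv_mem' := fun {a} ha U V f u => by
    change (a V).symm _ = Lift.map x f.hom ((a U).symm u)
    rw [Equiv.symm_apply_eq, ha f, Equiv.apply_symm_apply]

/-- The étale fundamental group `π₁(X, x)`. -/
def Pi1 : Type _ := pi1Subgroup x

namespace Pi1

instance : Group (Pi1 x) := inferInstanceAs (Group (pi1Subgroup x))

instance (U : FEt X) : MulAction (Pi1 x) (Lift x U.obj) where
  smul g u := g.1 U u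
  one_smul _ := rfl
  mul_smul _ _ _ := rfl

variable {x}

lemma smul_map (g : Pi1 x) {U V : FEt X} (f : U ⟶ V) (u : Lift x U.obj) :
    g • Lift.map x f.hom u = Lift.map x f.hom (g • u) := g.2 f u

@[ext] lemma ext {g h : Pi1 x} (H : ∀ (U : FEt X) (u : Lift x U.obj), g • u = h • u) : g = h :=
  Subtype.ext (funext fun U => Equiv.ext (H U))

/-- An element of the fundamental group from an action on the fibres. -/
def mk' (a b : ∀ U : FEt X, Lift x U.obj → Lift x U.obj) (hab : ∀ U u, a U (b U u) = u)
    (hba : ∀ U u, b U (a U u) = u)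
    (ha : ∀ {U V : FEt X} (f : U ⟶ V) (u : Lift x U.obj),
      a V (Lift.map x f.hom u) = Lift.map x f.hom (a U u)) : Pi1 x :=
  ⟨fun U => ⟨a U, b U, hba U, hab U⟩, ha⟩

/-- The coarsest topology for which the action on the (discrete) fibres is continuous. -/
instance : TopologicalSpace (Pi1 x) :=
  TopologicalSpace.induced (fun (g : Pi1 x) (U : FEt X) (u : Lift x U.obj) => g • u)
    (@Pi.topologicalSpace _ _ fun _ => @Pi.topologicalSpace _ _ fun _ => ⊥)

lemma continuous_iff {T : Type*} [TopologicalSpace T] (a : T → Pi1 x) :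
    Continuous a ↔ ∀ (U : FEt X) (u : Lift x U.obj), IsLocallyConstant fun t => a t • u := by
  let _ : ∀ U : FEt X, TopologicalSpace (Lift x U.obj) := fun _ => ⊥
  have _ : ∀ U : FEt X, DiscreteTopology (Lift x U.obj) := fun _ => ⟨rfl⟩
  rw [continuous_induced_rng]
  change Continuous (fun t (U : FEt X) (u : Lift x U.obj) => a t • u) ↔ _
  simp only [continuous_pi_iff, IsLocallyConstant.iff_continuous]

lemma isLocallyConstant_smul (U : FEt X) (u : Lift x U.obj) :
    IsLocallyConstant fun g : Pi1 x => g • u :=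
  (continuous_iff id).1 continuous_id U u

instance : IsTopologicalGroup (Pi1 x) where
  continuous_mul := by
    rw [continuous_iff]
    intro U u
    rw [IsLocallyConstant.iff_eventually_eq]
    rintro ⟨g, h⟩
    have h₁ := ((IsLocallyConstant.iff_eventually_eq _).1 (isLocallyConstant_smul U u) h)
    have h₂ := ((IsLocallyConstant.iff_eventually_eq _).1 (isLocallyConstant_smul U (h • u)) g)
    filter_upwards [(h₂.prod_nhds h₁)] with ⟨g', h'⟩ ⟨e₂, e₁⟩
    change (g' * h') • u = (g * h) • u
    rw [mul_smul, mul_smul, e₁, e₂]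
  continuous_inv := by
    rw [continuous_iff]
    intro U u
    rw [IsLocallyConstant.iff_eventually_eq]
    intro g
    filter_upwards [(IsLocallyConstant.iff_eventually_eq _).1
      (isLocallyConstant_smul U (g⁻¹ • u)) g] with g' e
    rw [inv_smul_eq_iff, e, smul_inv_smul]

end Pi1

variable {x}

/-- The liftings of `y` to `U ×_X Y` are the liftings of its image `x` to `U`. -/
def liftEquiv (f : Y ⟶ X) (y : Spec (.of Ω) ⟶ Y) (e : y ≫ f = x) (U : X.Etale) :
    Lift y ((etBaseChange f).obj U) ≃ Lift x U where
  toFun u := Lift.mk x (Lift.pt y u ≫ bcFst f U) (by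
    rw [Category.assoc, bc_w, ← Category.assoc, Lift.pt_str, e])
  invFun u := Lift.mk y ((bc_isPullback f U).lift (Lift.pt x u) y (by rw [Lift.pt_str, e])) (by simp)
  left_inv u := Lift.ext _ ((bc_isPullback f U).hom_ext (by simp) (by simp))
  right_inv u := Lift.ext _ (by simp)

lemma liftEquiv_map (f : Y ⟶ X) (y : Spec (.of Ω) ⟶ Y) (e : y ≫ f = x) {U V : X.Etale}
    (a : U ⟶ V) (u : Lift y ((etBaseChange f).obj U)) :
    liftEquiv f y e V (Lift.map y ((etBaseChange f).map a) u) =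
      Lift.map x a (liftEquiv f y e U u) :=
  Lift.ext _ (by simp [liftEquiv])

/-- `liftEquiv` for finite étale schemes. -/
def fetLiftEquiv (f : Y ⟶ X) (y : Spec (.of Ω) ⟶ Y) (e : y ≫ f = x) (U : FEt X) :
    Lift y ((fetBaseChange f).obj U).obj ≃ Lift x U.obj :=
  liftEquiv f y e U.obj

lemma fetLiftEquiv_map (f : Y ⟶ X) (y : Spec (.of Ω) ⟶ Y) (e : y ≫ f = x) {U V : FEt X}
    (a : U ⟶ V) (u : Lift y ((fetBaseChange f).obj U).obj) :
    fetLiftEquiv f y e V (Lift.map y ((fetBaseChange f).map a).hom u) =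
      Lift.map x a.hom (fetLiftEquiv f y e U u) :=
  liftEquiv_map f y e a.hom u

lemma fetLiftEquiv_symm_map (f : Y ⟶ X) (y : Spec (.of Ω) ⟶ Y) (e : y ≫ f = x) {U V : FEt X}
    (a : U ⟶ V) (u : Lift x U.obj) :
    (fetLiftEquiv f y e V).symm (Lift.map x a.hom u) =
      Lift.map y ((fetBaseChange f).map a).hom ((fetLiftEquiv f y e U).symm u) := by
  rw [Equiv.symm_apply_eq, fetLiftEquiv_map, Equiv.apply_symm_apply]

/-- The homomorphism `π₁(Y, y) ⟶ π₁(X, x)` induced by a morphism `f : Y ⟶ X` with `f(y) = x`. -/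
def pi1Map (f : Y ⟶ X) (y : Spec (.of Ω) ⟶ Y) (e : y ≫ f = x) : Pi1 y →* Pi1 x where
  toFun g := Pi1.mk'
    (fun U u => fetLiftEquiv f y e U (g • (fetLiftEquiv f y e U).symm u))
    (fun U u => fetLiftEquiv f y e U (g⁻¹ • (fetLiftEquiv f y e U).symm u))
    (fun U u => by simp) (fun U u => by simp)
    (fun {U V} a u => by rw [fetLiftEquiv_symm_map, Pi1.smul_map, fetLiftEquiv_map])
  map_one' := Pi1.ext fun U u => by
    change fetLiftEquiv f y e U ((1 : Pi1 y) • (fetLiftEquiv f y e U).symm u) = u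
    simp
  map_mul' g h := Pi1.ext fun U u => by
    change fetLiftEquiv f y e U ((g * h) • (fetLiftEquiv f y e U).symm u) =
      fetLiftEquiv f y e U (g • (fetLiftEquiv f y e U).symm
        (fetLiftEquiv f y e U (h • (fetLiftEquiv f y e U).symm u)))
    rw [Equiv.symm_apply_apply, mul_smul]

/-- The `ℚ̄_ℓ`-sheaf given by a system `F` is equivalent to the character `ρ` of `π₁(X, x)`: it has
rank one, and `π₁(X, x)`, acting on the stalk through its action on the fibres of finite étale
coverings, acts through `ρ`. -/
def IsEquivalentTo {ℓ : ℕ} [Fact ℓ.Prime] (F : PiSystem ℓ (EtAb X))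
    (ρ : Pi1 x →* (PadicAlgCl ℓ)ˣ) : Prop :=
  IsRankOne x F ∧ ∀ (g : Pi1 x) (t t' : Stalk x F),
    (∀ n, ∃ (Y : FEt X) (s : (F.obj n).obj.obj (op Y.obj)) (u : Lift x Y.obj),
      germ x (F.obj n) Y.obj u s = t.val n ∧ germ x (F.obj n) Y.obj (g • u) s = t'.val n) →
    (1 : PadicAlgCl ℓ) ⊗ₜ[valRing F.E] t' = (ρ g : PadicAlgCl ℓ) ⊗ₜ[valRing F.E] t

end FundamentalGroup

section GaloisAction

variable {K : Type u} (Ks : Type u) [Field K] [Field Ks] [Algebra K Ks]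

variable (K) in
/-- `Spec K^s ⟶ Spec K`. -/
abbrev specSep : Spec (.of Ks) ⟶ Spec (.of K) := Spec.map (CommRingCat.ofHom (algebraMap K Ks))

variable {Ks} in
/-- The left action of `γ ∈ Gal(K^s/K)` on `Spec K^s` by transport of structure, that is
`Spec(γ⁻¹)`. -/
def galSpec (γ : Ks ≃ₐ[K] Ks) : Spec (.of Ks) ⟶ Spec (.of Ks) :=
  Spec.map (CommRingCat.ofHom ((γ⁻¹ : Ks ≃ₐ[K] Ks) : Ks →+* Ks))

lemma galSpec_specSep (γ : Ks ≃ₐ[K] Ks) : galSpec γ ≫ specSep K Ks = specSep K Ks := by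
  rw [galSpec, ← Spec.map_comp, ← CommRingCat.ofHom_comp]
  congr 2
  ext a
  exact (γ⁻¹ : Ks ≃ₐ[K] Ks).commutes a

lemma galSpec_one : galSpec (1 : Ks ≃ₐ[K] Ks) = 𝟙 _ := by
  rw [galSpec, ← Spec.map_id]
  rfl

lemma galSpec_mul (γ δ : Ks ≃ₐ[K] Ks) : galSpec (γ * δ) = galSpec δ ≫ galSpec γ := by
  rw [galSpec, galSpec, galSpec, ← Spec.map_comp, ← CommRingCat.ofHom_comp]
  congr 2

variable {X : Scheme.{u}} (f : X ⟶ Spec (.of K))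

/-- The base change `X̄ = X ×_K K^s`. -/
def sepBaseChange : Scheme.{u} := pullback f (specSep K Ks)

/-- The projection `X̄ ⟶ X`. -/
def sepProj : sepBaseChange Ks f ⟶ X := pullback.fst _ _

/-- The projection `X̄ ⟶ Spec K^s`. -/
def sepStr : sepBaseChange Ks f ⟶ Spec (.of Ks) := pullback.snd _ _

lemma sep_isPullback : IsPullback (sepProj Ks f) (sepStr Ks f) f (specSep K Ks) :=
  IsPullback.of_hasPullback _ _

variable {Ks}

/-- The action of `γ ∈ Gal(K^s/K)` on `X̄` by transport of structure: `id × Spec(γ⁻¹)`. -/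
def galX (γ : Ks ≃ₐ[K] Ks) : sepBaseChange Ks f ⟶ sepBaseChange Ks f :=
  (sep_isPullback Ks f).lift (sepProj Ks f) (sepStr Ks f ≫ galSpec γ) (by
    rw [(sep_isPullback Ks f).w, Category.assoc, galSpec_specSep])

@[simp] lemma galX_proj (γ : Ks ≃ₐ[K] Ks) : galX f γ ≫ sepProj Ks f = sepProj Ks f :=
  IsPullback.lift_fst _ _ _ _

@[simp] lemma galX_str (γ : Ks ≃ₐ[K] Ks) : galX f γ ≫ sepStr Ks f = sepStr Ks f ≫ galSpec γ :=
  IsPullback.lift_snd _ _ _ _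

lemma galX_one : galX f (1 : Ks ≃ₐ[K] Ks) = 𝟙 _ :=
  (sep_isPullback Ks f).hom_ext (by simp) (by simp [galSpec_one])

lemma galX_mul (γ δ : Ks ≃ₐ[K] Ks) : galX f (γ * δ) = galX f δ ≫ galX f γ :=
  (sep_isPullback Ks f).hom_ext (by simp) (by
    rw [galX_str, galSpec_mul, Category.assoc, galX_str, ← Category.assoc, ← Category.assoc,
      galX_str])

instance (γ : Ks ≃ₐ[K] Ks) : IsIso (galX f γ) :=
  ⟨galX f γ⁻¹, by rw [← galX_mul, inv_mul_cancel, galX_one],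
    by rw [← galX_mul, mul_inv_cancel, galX_one]⟩

/-- The action of `Gal(K^s/K)` on sheaves on `X̄` by direct images. -/
@[simps]
def galAction : CatAction (Ks ≃ₐ[K] Ks) (EtAb (sepBaseChange Ks f)) where
  T γ := push (galX f γ)
  comp γ δ := pushComp (galX f δ) (galX f γ) (galX f (γ * δ)) (galX_mul f γ δ)

instance (γ : Ks ≃ₐ[K] Ks) : ((galAction f).T γ).Additive :=
  inferInstanceAs (push (galX f γ)).Additive

instance (γ : Ks ≃ₐ[K] Ks) : ((galAction f).T γ).IsEquivalence :=
  inferInstanceAs (push (galX f γ)).IsEquivalence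

/-- `p_* ∘ γ_* = p_*` for the projection `p : X̄ ⟶ X`. -/
def projIso (γ : Ks ≃ₐ[K] Ks) : (galAction f).T γ ⋙ push (sepProj Ks f) ≅ push (sepProj Ks f) :=
  pushComp (galX f γ) (sepProj Ks f) (sepProj Ks f) (galX_proj f γ).symm

lemma projIso_mul (γ δ : Ks ≃ₐ[K] Ks) (B : EtAb (sepBaseChange Ks f)) :
    (push (sepProj Ks f)).map (((galAction f).comp γ δ).hom.app B) ≫
        (projIso f (γ * δ)).hom.app B =
      (projIso f γ).hom.app (((galAction f).T δ).obj B) ≫ (projIso f δ).hom.app B := by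
  refine ObjectProperty.hom_ext _ (NatTrans.ext (funext fun U => ?_))
  induction U with | op U => ?_
  change B.obj.map ((etBaseChangeComp (galX f δ) (galX f γ) _ (galX_mul f γ δ)).inv.app
        ((etBaseChange (sepProj Ks f)).obj U)).op ≫
      B.obj.map ((etBaseChangeComp (galX f (γ * δ)) _ _ (galX_proj f (γ * δ)).symm).inv.app U).op =
    B.obj.map ((etBaseChange (galX f δ)).map
        ((etBaseChangeComp (galX f γ) _ _ (galX_proj f γ).symm).inv.app U)).op ≫
      B.obj.map ((etBaseChangeComp (galX f δ) _ _ (galX_proj f δ).symm).inv.app U).op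
  rw [← Functor.map_comp, ← Functor.map_comp, ← op_comp, ← op_comp]
  congr 2
  refine bc_hom_ext _ (bc_tot_hom_ext _ ?_ ?_)
  · refine bc_tot_hom_ext _ ?_ ?_
    · simp
    · simp [bc_w, bc_w_assoc, galX_mul]
  · simp [bc_w]

lemma projIso_one (B : EtAb (sepBaseChange Ks f)) :
    (push (sepProj Ks f)).map ((pushId (galX f (1 : Ks ≃ₐ[K] Ks)) (galX_one f)).inv.app B) ≫
      (projIso f 1).hom.app B = 𝟙 _ := by
  refine ObjectProperty.hom_ext _ (NatTrans.ext (funext fun U => ?_))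
  induction U with | op U => ?_
  change B.obj.map ((etBaseChangeId _ (galX_one f)).hom.app
        ((etBaseChange (sepProj Ks f)).obj U)).op ≫
      B.obj.map ((etBaseChangeComp (galX f 1) _ _ (galX_proj f (1 : Ks ≃ₐ[K] Ks)).symm).inv.app U).op = 𝟙 _
  rw [← Functor.map_comp, ← op_comp]
  refine Eq.trans ?_ (B.obj.map_id _)
  congr 2
  refine bc_hom_ext _ ?_
  simp [etBaseChangeId]

/-- The natural action on the inverse image: the isomorphisms `γ_* p^* F ≅ p^* F` inverse to the
morphisms `p^* F ⟶ γ_* p^* F` adjoint to `F ⟶ p_* p^* F = p_* γ_* p^* F`. -/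
def baseChangeAct (γ : Ks ≃ₐ[K] Ks) : pull (sepProj Ks f) ⋙ (galAction f).T γ ≅ pull (sepProj Ks f) :=
  natAct (galAction f) (pullPushAdj (sepProj Ks f)) (projIso f) (projIso_mul f)
    (pushId (galX f (1 : Ks ≃ₐ[K] Ks)) (galX_one f)).symm (projIso_one f) γ

lemma baseChangeAct_mul (γ δ : Ks ≃ₐ[K] Ks) (F : EtAb X) :
    ((galAction f).comp γ δ).hom.app ((pull (sepProj Ks f)).obj F) ≫
        (baseChangeAct f (γ * δ)).hom.app F =
      ((galAction f).T γ).map ((baseChangeAct f δ).hom.app F) ≫ (baseChangeAct f γ).hom.app F :=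
  natAct_mul (galAction f) (pullPushAdj (sepProj Ks f)) (projIso f) (projIso_mul f)
    (pushId (galX f (1 : Ks ≃ₐ[K] Ks)) (galX_one f)).symm (projIso_one f) γ δ F

end GaloisAction

section PushStalk

variable {X Y : Scheme.{u}} {Ω : Type u} [Field Ω] [IsSepClosed Ω]

/-- If `f(y) = x ∘ τ` for an endomorphism `τ` of `Spec Ω`, then a lifting `w` of `x` to `W` yields
the lifting of `y` to `W ×_X Y` with components `w ∘ τ` and `y`. -/
def Lift.twist (f : Y ⟶ X) (y : Spec (.of Ω) ⟶ Y) (x : Spec (.of Ω) ⟶ X)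
    (τ : Spec (.of Ω) ⟶ Spec (.of Ω)) (e : y ≫ f = τ ≫ x) {W : X.Etale} (w : Lift x W) :
    Lift y ((etBaseChange f).obj W) :=
  Lift.mk y ((bc_isPullback f W).lift (τ ≫ Lift.pt x w) y (by rw [Category.assoc, Lift.pt_str, e]))
    (by simp)

lemma Lift.twist_map (f : Y ⟶ X) (y : Spec (.of Ω) ⟶ Y) (x : Spec (.of Ω) ⟶ X)
    (τ : Spec (.of Ω) ⟶ Spec (.of Ω)) (e : y ≫ f = τ ≫ x) {W W' : X.Etale} (a : W ⟶ W')
    (w : Lift x W) : Lift.map y ((etBaseChange f).map a) (Lift.twist f y x τ e w) =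
      Lift.twist f y x τ e (Lift.map x a w) :=
  Lift.ext _ (bc_tot_hom_ext _ (by simp [Lift.twist]) (by simp [Lift.twist]))

/-- The map `(f_* A)_x ⟶ A_y` sending the germ of a section `s ∈ (f_* A)(W) = A(W ×_X Y)` at a
lifting `w` of `x` to the germ of `s` at `w ∘ τ`. -/
def pushStalk (f : Y ⟶ X) (y : Spec (.of Ω) ⟶ Y) (x : Spec (.of Ω) ⟶ X)
    (τ : Spec (.of Ω) ⟶ Spec (.of Ω)) (e : y ≫ f = τ ≫ x) (A : EtAb Y) :
    (stalk x).obj ((push f).obj A) ⟶ (stalk y).obj A :=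
  (Scheme.pointSmallEtale x).presheafFiberDesc (P := ((push f).obj A).obj)
    (fun W w => (Scheme.pointSmallEtale y).toPresheafFiber ((etBaseChange f).obj W)
      (Lift.twist f y x τ e w) A.obj)
    (fun W W' a w => by
      refine ((Scheme.pointSmallEtale y).toPresheafFiber_w ((etBaseChange f).map a)
        (Lift.twist f y x τ e w) A.obj).trans ?_
      exact congrArg (fun v => (Scheme.pointSmallEtale y).toPresheafFiber
        ((etBaseChange f).obj W') v A.obj) (Lift.twist_map f y x τ e a w))

lemma pushStalk_germ (f : Y ⟶ X) (y : Spec (.of Ω) ⟶ Y) (x : Spec (.of Ω) ⟶ X)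
    (τ : Spec (.of Ω) ⟶ Spec (.of Ω)) (e : y ≫ f = τ ≫ x) (A : EtAb Y) (W : X.Etale)
    (w : Lift x W) (s : A.obj.obj (op ((etBaseChange f).obj W))) :
    (pushStalk f y x τ e A).hom (germ x ((push f).obj A) W w s) =
      germ y A ((etBaseChange f).obj W) (Lift.twist f y x τ e w) s := by
  have h : (Scheme.pointSmallEtale x).toPresheafFiber W w ((push f).obj A).obj ≫
        pushStalk f y x τ e A =
      (Scheme.pointSmallEtale y).toPresheafFiber ((etBaseChange f).obj W)
        (Lift.twist f y x τ e w) A.obj :=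
    (Scheme.pointSmallEtale x).toPresheafFiber_presheafFiberDesc _ _ W w
  exact congrArg (fun φ : A.obj.obj (op ((etBaseChange f).obj W)) ⟶ (stalk y).obj A => φ.hom s) h

end PushStalk

section Galois

variable {K Ks : Type u} [Field K] [Field Ks] [Algebra K Ks] [IsSepClosed Ks]
variable {X : Scheme.{u}} (f : X ⟶ Spec (.of K)) (x : Spec (.of K) ⟶ X)

variable (Ks) in
/-- The geometric point attached to the rational point `x`. -/
abbrev geomPt : Spec (.of Ks) ⟶ X := specSep K Ks ≫ x

variable (Ks) in
/-- The geometric point of `X̄` over it. -/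
def geomPtBar (hx : x ≫ f = 𝟙 _) : Spec (.of Ks) ⟶ sepBaseChange Ks f :=
  (sep_isPullback Ks f).lift (geomPt Ks x) (𝟙 _) (by rw [Category.assoc, hx]; simp)

lemma geomPtBar_proj (hx : x ≫ f = 𝟙 _) : geomPtBar Ks f x hx ≫ sepProj Ks f = geomPt Ks x :=
  IsPullback.lift_fst _ _ _ _

lemma geomPtBar_galX (hx : x ≫ f = 𝟙 _) (γ : Ks ≃ₐ[K] Ks) :
    geomPtBar Ks f x hx ≫ galX f γ = galSpec γ ≫ geomPtBar Ks f x hx := by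
  refine (sep_isPullback Ks f).hom_ext ?_ ?_
  · rw [Category.assoc, galX_proj, Category.assoc, geomPtBar_proj, geomPt, ← Category.assoc,
      galSpec_specSep]
  · rw [Category.assoc, galX_str, geomPtBar, IsPullback.lift_snd_assoc, Category.assoc,
      IsPullback.lift_snd, Category.id_comp, Category.comp_id]

variable (K Ks) in
/-- The homomorphism `Gal(K^s/K) ⟶ π₁(Spec K, Spec K^s)`: an automorphism `γ` sends a lifting
`Spec K^s ⟶ U` to its composition with `Spec γ`. -/
def galToPi1 : (Ks ≃ₐ[K] Ks) →* Pi1 (specSep K Ks) where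
  toFun γ := Pi1.mk'
    (fun U u => Lift.mk _ (galSpec γ⁻¹ ≫ Lift.pt _ u) (by rw [Category.assoc, Lift.pt_str, galSpec_specSep]))
    (fun U u => Lift.mk _ (galSpec γ ≫ Lift.pt _ u) (by rw [Category.assoc, Lift.pt_str, galSpec_specSep]))
    (fun U u => Lift.ext _ (by
      rw [Lift.pt_mk, Lift.pt_mk, ← Category.assoc, ← galSpec_mul, mul_inv_cancel, galSpec_one,
        Category.id_comp]))
    (fun U u => Lift.ext _ (by
      rw [Lift.pt_mk, Lift.pt_mk, ← Category.assoc, ← galSpec_mul, inv_mul_cancel, galSpec_one,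
        Category.id_comp]))
    (fun {U V} a u => Lift.ext _ (by simp))
  map_one' := Pi1.ext fun U u => Lift.ext _ (by
    change galSpec 1⁻¹ ≫ Lift.pt _ u = Lift.pt _ u
    rw [inv_one, galSpec_one, Category.id_comp])
  map_mul' γ δ := Pi1.ext fun U u => Lift.ext _ (by
    change galSpec (γ * δ)⁻¹ ≫ Lift.pt _ u = galSpec γ⁻¹ ≫ galSpec δ⁻¹ ≫ Lift.pt _ u
    rw [mul_inv_rev, galSpec_mul, Category.assoc])

variable (Ks) in
/-- The homomorphism `Gal(K^s/K) ⟶ π₁(X, x̄)` induced by the rational point. -/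
def galSection : (Ks ≃ₐ[K] Ks) →* Pi1 (geomPt Ks x) :=
  (pi1Map x (specSep K Ks) rfl).comp (galToPi1 K Ks)

variable (Ks) in
/-- The closed normal subgroup of `π₁(X̄, x̄)` generated by the commutators and by the elements
`(γ • g) * g⁻¹`, where `γ ∈ Gal(K^s/K)` acts on `π₁(X̄, x̄) ⊆ π₁(X, x̄)` by conjugation with the
image of `γ` in `π₁(X, x̄)`. -/
def coinvSubgroup (hx : x ≫ f = 𝟙 _) : Subgroup (Pi1 (geomPtBar Ks f x hx)) :=
  (Subgroup.normalClosure ({a | ∃ g h, a = g * h * g⁻¹ * h⁻¹} ∪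
    {a | ∃ (γ : Ks ≃ₐ[K] Ks) (g h : Pi1 (geomPtBar Ks f x hx)),
      pi1Map (sepProj Ks f) _ (geomPtBar_proj f x hx) h =
        galSection Ks x γ * pi1Map (sepProj Ks f) _ (geomPtBar_proj f x hx) g *
          (galSection Ks x γ)⁻¹ ∧ a = h * g⁻¹})).topologicalClosure

instance (hx : x ≫ f = 𝟙 _) : (coinvSubgroup Ks f x hx).Normal :=
  Subgroup.is_normal_topologicalClosure _

variable (Ks) in
/-- The (abelian) group `π₁(X̄, x̄)_Gal` of Galois coinvariants. -/
abbrev Coinvariants (hx : x ≫ f = 𝟙 _) := Pi1 (geomPtBar Ks f x hx) ⧸ coinvSubgroup Ks f x hx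

variable (ℓ : ℕ) [Fact ℓ.Prime]

instance (γ : Ks ≃ₐ[K] Ks) : ((galAction f).T γ).IsLeftAdjoint := inferInstance

variable (Ks) in
/-- The functor sending a system `F` on `X` to `p^* F` with its natural Galois action. -/
def naturalAction : PiSystem ℓ (EtAb X) ⥤ Equivariant ((galAction (Ks := Ks) f).pi ℓ) :=
  Equivariant.ofNat _ (PiSystem.map (pull (sepProj Ks f)))
    (fun γ => PiSystem.mapComp (baseChangeAct f γ))
    (fun γ δ F => PiSystem.hom_ext fun n => baseChangeAct_mul f γ δ (F.obj n))

variable (Ks) in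
/-- The same with `ℚ̄_ℓ`-coefficients. -/
def naturalActionQl : QlSystem ℓ (EtAb X) ⥤ Equivariant ((galAction (Ks := Ks) f).ql ℓ) :=
  Equivariant.ofNat _ (QlSystem.map ℓ (pull (sepProj Ks f)))
    (fun γ => QlSystem.mapComp ℓ (baseChangeAct f γ))
    (QlSystem.mapComp_mul ℓ (galAction f) (pull (sepProj Ks f)) (baseChangeAct f)
      (baseChangeAct_mul f))

variable {ℓ}

/-- A Galois action on a system on `X̄` is continuous if for all quasi-compact étale `X`-schemes `U`
the resulting action of `Gal(K^s/K)` on the sections over `Ū = U ×_X X̄`,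
`F_n(Ū) = (γ_* F_n)(Ū) ⟶ F_n(Ū)`, is continuous for the discrete topology on `F_n(Ū)`. -/
def IsContinuousAction (F : Equivariant ((galAction (Ks := Ks) f).pi ℓ)) : Prop :=
  ∀ (n : ℕ) (U : X.Etale), CompactSpace (tot U) →
    ∀ s : ((push (sepProj Ks f)).obj (F.obj.obj n)).obj.obj (op U),
      IsLocallyConstant fun γ : Ks ≃ₐ[K] Ks =>
        (((projIso f γ).inv.app (F.obj.obj n) ≫
          (push (sepProj Ks f)).map ((F.act γ).hom.app n)).hom.app (op U)).hom s

/-- A Galois action on a sheaf on `X̄` with `ℚ̄_ℓ`-coefficients is continuous if it comes from a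
continuous action on a smooth `ℓ`-adic sheaf giving rise to it. -/
def IsContinuousActionQl (𝓕 : Equivariant ((galAction (Ks := Ks) f).ql ℓ)) : Prop :=
  ∃ F : Equivariant ((galAction (Ks := Ks) f).pi ℓ), IsSmoothSystem F.obj ∧ IsContinuousAction f F ∧
    ∃ e : (QlSystem.Q ℓ _).obj F.obj ≅ 𝓕.obj, ∀ γ,
      (QlSystem.fac ℓ ((galAction f).T γ)).hom.app F.obj ≫
          (QlSystem.Q ℓ _).map (F.act γ).hom ≫ e.hom =
        (((galAction f).ql ℓ).T γ).map e.hom ≫ (𝓕.act γ).hom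

/-- The morphism `a : γ_* F ⟶ F`, composed on stalks with the identification of `(γ_* F)_x̄` with
`F_x̄`, is multiplication by `c` on `ℚ̄_ℓ ⊗ T`. -/
def ActsOnStalkBy (hx : x ≫ f = 𝟙 _) {F : PiSystem ℓ (EtAb (sepBaseChange Ks f))}
    (γ : Ks ≃ₐ[K] Ks) (a : (PiSystem.map ((galAction f).T γ)).obj F ⟶ F) (c : PadicAlgCl ℓ) : Prop :=
  ∀ (t : Stalk (geomPtBar Ks f x hx) ((PiSystem.map ((galAction f).T γ)).obj F))
    (t' : Stalk (geomPtBar Ks f x hx) F),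
    (∀ n, (pushStalk (galX f γ) _ _ _ (geomPtBar_galX f x hx γ) (F.obj n)).hom (t.val n) = t'.val n) →
      (1 : PadicAlgCl ℓ) ⊗ₜ[valRing F.E] t.map a = c ⊗ₜ[valRing F.E] t'

end Galois

/-- The `ℚ̄_ℓ`-local systems of rank one. -/
def rankOneLocalSystem {X : Scheme.{u}} (ℓ : ℕ) [Fact ℓ.Prime] {Ω : Type u} [Field Ω] [IsSepClosed Ω]
    (x : Spec (.of Ω) ⟶ X) : ObjectProperty (QlSystem ℓ (EtAb X)) :=
  fun 𝓕 => ∃ F : PiSystem ℓ (EtAb X), IsSmoothSystem F ∧ IsRankOne x F ∧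
    Nonempty ((QlSystem.Q ℓ _).obj F ≅ 𝓕)

/-- The `ℚ̄_ℓ`-local system `𝓕` is equivalent to the character `ρ`. -/
def IsQlEquivalentTo {X : Scheme.{u}} {ℓ : ℕ} [Fact ℓ.Prime] {Ω : Type u} [Field Ω] [IsSepClosed Ω]
    {x : Spec (.of Ω) ⟶ X} (𝓕 : QlSystem ℓ (EtAb X)) (ρ : Pi1 x →* (PadicAlgCl ℓ)ˣ) : Prop :=
  ∃ F : PiSystem ℓ (EtAb X), IsSmoothSystem F ∧ IsEquivalentTo F ρ ∧ Nonempty ((QlSystem.Q ℓ _).obj F ≅ 𝓕)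

/-- The `ℚ̄_ℓ`-local systems on `X̄` which are equivalent to a continuous character factoring through
`π₁(X̄, x̄)_Gal`, equipped with a compatible continuous Galois action. -/
def coinvLocalSystem {K Ks : Type u} [Field K] [Field Ks] [Algebra K Ks] [IsSepClosed Ks]
    {X : Scheme.{u}} (f : X ⟶ Spec (.of K)) (x : Spec (.of K) ⟶ X) (hx : x ≫ f = 𝟙 _)
    (ℓ : ℕ) [Fact ℓ.Prime] : ObjectProperty (Equivariant ((galAction (Ks := Ks) f).ql ℓ)) :=
  fun 𝓕 => IsContinuousActionQl f 𝓕 ∧ ∃ χ : Coinvariants Ks f x hx →* (PadicAlgCl ℓ)ˣ,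
    Continuous χ ∧ IsQlEquivalentTo 𝓕.obj (χ.comp (QuotientGroup.mk' _))

end LadicSheaf

end

open LadicSheaf

/-!
The argument rests on three facts about a connected Noetherian scheme and one descent theorem.

*Local systems as fractions.* Passing to `ℚ̄_ℓ`-coefficients inverts the extensions of scalars
between rings of integers and the multiplications by `ℓ`. These admit a calculus of left fractions,
so a morphism of local systems is a morphism of systems divided by a composite of such maps. On a
connected base, two morphisms to a given smooth system which agree after passing to
`ℚ̄_ℓ`-coefficients agree after multiplication by one power of `ℓ`, independent of the morphisms
(`IsSmoothSystem.exists_bound`), and they are compared on the `ℚ̄_ℓ`-stalk at a single geometric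
point (`Q_map_eq_of_actsOnStalkBy`).

*Locally constant sheaves as coverings.* A locally constant sheaf with finite stalks is represented
by a finite étale scheme (`IsLC.exists_representing`, by descent of split étale algebras), so the
fundamental group acts on its stalks, and continuously on the stalk of a smooth system; in rank one
this gives the character (`exists_character`).

*The natural action at the rational point.* The action of `γ` on the stalk of `p^*F` at the
geometric point above the rational point `x` is the monodromy of `s(γ)` (`stalkPull_baseChangeAct`).
By comparison on the stalk, this identifies the natural action with the one induced by `ρ ∘ s`. Since `ℚ̄_ℓ^×` is
abelian, the conjugates of an element of `π₁(X)` have equal values under `ρ`, so the restriction of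
`ρ` to `π₁(X̄)` kills the closed subgroup defining the coinvariants (`exists_coinvariants_factor`).

*Galois descent.* An étale sheaf on `X̄` with a compatible continuous action of `G` is the inverse
image of the sheaf of invariants on `X`. Étale schemes over `X̄` are locally defined over finite
subextensions of `K^s`, and continuity makes every section fixed by an open subgroup, so that the
counit of the adjunction is an isomorphism (`isIso_descendCounit`). Local constancy descends
(`IsLC.of_pull_sepProj`), and so do equivariant morphisms (`exists_map_pull_eq`).

For systems, descent has to be combined with fractions. Faithfulness (`QlSystem.map_pull_injective`)
is a statement on stalks. For fullness (`exists_naturalActionQl_map_eq`), the denominator of an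
equivariant morphism may be taken from `X` (`exists_dominating`); the numerator then commutes with
the action only up to torsion, and one power of `ℓ` kills that torsion for all `γ` at once, so that
a multiple of the numerator descends. For essential surjectivity (`exists_naturalActionQl_iso`), a
smooth system with continuous action that gives rise to the local system is descended level by
level, and its descent is again smooth of rank one.
-/

noncomputable section

namespace LadicSheaf

/-! ### Sections and germs of étale sheaves -/

section Sections

variable {X : Scheme.{u}}

/-- The sections of `A` over `U`. -/
abbrev Sec (A : EtAb X) (U : X.Etale) : Type u := A.obj.obj (op U)

/-- Restriction of sections. -/
def res (A : EtAb X) {V U : X.Etale} (a : V ⟶ U) : Sec A U →+ Sec A V := (A.obj.map a.op).hom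

/-- The action of a morphism of sheaves on sections. -/
def mor {A B : EtAb X} (φ : A ⟶ B) (U : X.Etale) : Sec A U →+ Sec B U := (φ.hom.app (op U)).hom

variable {A B C : EtAb X}

lemma res_id {U : X.Etale} (s : Sec A U) : res A (𝟙 U) s = s :=
  congrArg (fun φ => φ.hom s) (A.obj.map_id (op U))

lemma res_res {U V W : X.Etale} (b : W ⟶ V) (a : V ⟶ U) (s : Sec A U) :
    res A b (res A a s) = res A (b ≫ a) s :=
  (congrArg (fun φ => φ.hom s) (A.obj.map_comp a.op b.op)).symm

lemma mor_res (φ : A ⟶ B) {U V : X.Etale} (a : V ⟶ U) (s : Sec A U) :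
    mor φ V (res A a s) = res B a (mor φ U s) :=
  congrArg (fun φ => φ.hom s) (φ.hom.naturality a.op)

@[simp] lemma mor_id {U : X.Etale} (s : Sec A U) : mor (𝟙 A) U s = s := rfl

@[simp] lemma mor_comp (φ : A ⟶ B) (ψ : B ⟶ C) {U : X.Etale} (s : Sec A U) :
    mor (φ ≫ ψ) U s = mor ψ U (mor φ U s) := rfl

lemma mor_hom_ext {φ ψ : A ⟶ B} (h : ∀ U s, mor φ U s = mor ψ U s) : φ = ψ := by
  refine ObjectProperty.hom_ext _ (NatTrans.ext (funext fun U => ?_))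
  induction U with | op U => ?_
  ext s
  exact h U s

lemma mor_add (φ ψ : A ⟶ B) {U : X.Etale} (s : Sec A U) :
    mor (φ + ψ) U s = mor φ U s + mor ψ U s := rfl

@[simp] lemma mor_zero {U : X.Etale} (s : Sec A U) : mor (0 : A ⟶ B) U s = 0 := rfl

lemma mem_topology_iff {U : X.Etale} (S : Sieve U) : S ∈ X.smallEtaleTopology U ↔
    ∀ u : tot U, ∃ (V : X.Etale) (a : V ⟶ U), S a ∧ u ∈ Set.range (totMap a) := by
  obtain ⟨ι, T, g, rfl⟩ := S.exists_eq_ofArrows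
  rw [Scheme.ofArrows_mem_smallEtaleTopology_iff, Set.eq_univ_iff_forall]
  refine forall_congr' fun u => ⟨fun h => ?_, fun ⟨V, a, ha, v, hv⟩ => ?_⟩
  · obtain ⟨i, hi⟩ := Set.mem_iUnion.1 h
    exact ⟨T i, g i, Sieve.ofArrows_mk _ _ i, hi⟩
  · obtain ⟨W, b, c, ⟨i⟩, rfl⟩ := ha
    exact Set.mem_iUnion.2 ⟨i, totMap b v, by rw [← hv]; rfl⟩

lemma isSheaf_forget (A : EtAb X) :
    Presieve.IsSheaf X.smallEtaleTopology (A.obj ⋙ forget AddCommGrpCat.{u}) :=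
  (isSheaf_iff_isSheaf_of_type _ _).1
    (GrothendieckTopology.HasSheafCompose.isSheaf (F := forget AddCommGrpCat.{u}) A.obj A.property)

/-- Two sections which agree locally are equal. -/
lemma sec_ext {U : X.Etale} {s t : Sec A U}
    (h : ∀ u : tot U, ∃ (V : X.Etale) (a : V ⟶ U), u ∈ Set.range (totMap a) ∧
      res A a s = res A a t) : s = t := by
  let S : Sieve U :=
    { arrows := fun V a => res A a s = res A a t
      downward_closed := fun {V W a} ha b => by rw [← res_res, ha, res_res] }
  have hS : S ∈ X.smallEtaleTopology U := (mem_topology_iff S).2 fun u => by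
    obtain ⟨V, a, h₁, h₂⟩ := h u
    exact ⟨V, a, h₂, h₁⟩
  exact ((isSheaf_forget A) S hS).isSeparatedFor.ext fun V a ha => ha

/-- Sections can be defined by a local characterization. -/
lemma sec_glue {U : X.Etale} (P : ∀ (V : X.Etale), (V ⟶ U) → Sec A V → Prop)
    (hres : ∀ {V W : X.Etale} (a : V ⟶ U) (b : W ⟶ V) s, P V a s → P W (b ≫ a) (res A b s))
    (huniq : ∀ (V : X.Etale) (a : V ⟶ U) s t, P V a s → P V a t → s = t)
    (hex : ∀ u : tot U, ∃ (V : X.Etale) (a : V ⟶ U), u ∈ Set.range (totMap a) ∧ ∃ s, P V a s) :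
    ∃ s : Sec A U, ∀ (V : X.Etale) (a : V ⟶ U) t, P V a t → res A a s = t := by
  let S : Sieve U :=
    { arrows := fun V a => ∃ s, P V a s
      downward_closed := fun {V W a} ⟨s, ha⟩ b => ⟨_, hres a b s ha⟩ }
  have hS : S ∈ X.smallEtaleTopology U := (mem_topology_iff S).2 fun u => by
    obtain ⟨V, a, h₁, h₂⟩ := hex u
    exact ⟨V, a, h₂, h₁⟩
  let y : Presieve.FamilyOfElements (A.obj ⋙ forget AddCommGrpCat.{u}) S.arrows :=
    fun V a ha => ha.choose
  have hy (V : X.Etale) (a : V ⟶ U) (ha : S a) : P V a (y a ha) := ha.choose_spec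
  have hc : y.SieveCompatible := fun {V W a} b ha =>
    huniq _ _ _ _ (hy _ _ _) (hres a b _ (hy V a ha))
  obtain ⟨s, hs, -⟩ := isSheaf_forget A S hS y
    ((Presieve.compatible_iff_sieveCompatible y).2 hc)
  exact ⟨s, fun V a t ht => (hs a ⟨t, ht⟩).trans (huniq _ _ _ _ (hy _ _ _) ht)⟩

/-- A morphism of sheaves is an isomorphism if it is injective on sections and locally surjective. -/
lemma isIso_of_mor (φ : A ⟶ B)
    (hinj : ∀ (U : X.Etale) (s : Sec A U), mor φ U s = 0 → s = 0)
    (hsurj : ∀ (U : X.Etale) (t : Sec B U) (u : tot U), ∃ (V : X.Etale) (a : V ⟶ U),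
      u ∈ Set.range (totMap a) ∧ ∃ s, mor φ V s = res B a t) : IsIso φ := by
  have hb (U : X.Etale) : Function.Bijective (mor φ U) := by
    have hi : Function.Injective (mor φ U) := (injective_iff_map_eq_zero _).2 (hinj U)
    refine ⟨hi, fun t => ?_⟩
    obtain ⟨s, hs⟩ := sec_glue (A := A) (U := U) (fun V a s => mor φ V s = res B a t)
      (fun a b s h => by rw [mor_res, h, res_res])
      (fun V a s s' h h' => (injective_iff_map_eq_zero (mor φ V)).2 (hinj V) (h.trans h'.symm))
      (hsurj U t)
    refine ⟨s, sec_ext fun u => ?_⟩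
    obtain ⟨V, a, hu, s', hs'⟩ := hsurj U t u
    exact ⟨V, a, hu, by rw [← mor_res, hs V a s' hs', hs']⟩
  have (U : X.Etaleᵒᵖ) : IsIso (φ.hom.app U) := by
    rw [ConcreteCategory.isIso_iff_bijective]
    exact hb U.unop
  have : IsIso φ.hom := NatIso.isIso_of_isIso_app _
  exact (isIso_iff_of_reflects_iso φ (sheafToPresheaf _ _)).1 this

lemma mor_bijective (φ : A ⟶ B) [IsIso φ] (U : X.Etale) : Function.Bijective (mor φ U) := by
  refine Function.bijective_iff_has_inverse.2 ⟨mor (inv φ) U, fun s => ?_, fun s => ?_⟩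
  · rw [← mor_comp, IsIso.hom_inv_id, mor_id]
  · rw [← mor_comp, IsIso.inv_hom_id, mor_id]

end Sections

section Germs

variable {X : Scheme.{u}} {Ω : Type u} [Field Ω] [IsSepClosed Ω] (x : Spec (.of Ω) ⟶ X)
variable {A B : EtAb X}

lemma germ_add {U : X.Etale} (u : Lift x U) (s t : Sec A U) :
    germ x A U u (s + t) = germ x A U u s + germ x A U u t := map_add _ _ _

lemma germ_sub {U : X.Etale} (u : Lift x U) (s t : Sec A U) :
    germ x A U u (s - t) = germ x A U u s - germ x A U u t := map_sub _ _ _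

lemma germ_zero {U : X.Etale} (u : Lift x U) : germ x A U u 0 = 0 := map_zero _

lemma germ_res {U V : X.Etale} (a : V ⟶ U) (v : Lift x V) (s : Sec A U) :
    germ x A V v (res A a s) = germ x A U (Lift.map x a v) s :=
  congrArg (fun φ => φ.hom s) ((Scheme.pointSmallEtale x).toPresheafFiber_w a v A.obj)

lemma germ_mor (φ : A ⟶ B) (U : X.Etale) (u : Lift x U) (s : Sec A U) :
    ((stalk x).map φ).hom (germ x A U u s) = germ x B U u (mor φ U s) :=
  germ_stalk_map x φ U u s

lemma exists_germ (t : (stalk x).obj A) : ∃ (U : X.Etale) (u : Lift x U) (s : Sec A U),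
    germ x A U u s = t :=
  (Scheme.pointSmallEtale x).toPresheafFiber_jointly_surjective t

lemma germ_eq_iff {U : X.Etale} (u : Lift x U) (s t : Sec A U) :
    germ x A U u s = germ x A U u t ↔
      ∃ (V : X.Etale) (a : V ⟶ U) (v : Lift x V), Lift.map x a v = u ∧
        res A a s = res A a t :=
  (Scheme.pointSmallEtale x).toPresheafFiber_eq_iff' U u s t

/-- A lifting refines to a common étale neighbourhood. -/
lemma exists_common_nbhd {U V : X.Etale} (u : Lift x U) (v : Lift x V) :
    ∃ (W : X.Etale) (w : Lift x W) (a : W ⟶ U) (b : W ⟶ V),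
      Lift.map x a w = u ∧ Lift.map x b w = v := by
  have := (Scheme.pointSmallEtale x).isCofiltered
  let α := (Scheme.pointSmallEtale x).fiber.elementsMk U u
  let β := (Scheme.pointSmallEtale x).fiber.elementsMk V v
  obtain ⟨p, a, b, -⟩ := IsCofilteredOrEmpty.cone_objs α β
  exact ⟨p.1, p.2, a.1, b.1, a.2, b.2⟩

lemma germ_eq_germ_iff {U U' : X.Etale} (u : Lift x U) (u' : Lift x U') (s : Sec A U)
    (s' : Sec A U') : germ x A U u s = germ x A U' u' s' ↔
      ∃ (V : X.Etale) (a : V ⟶ U) (a' : V ⟶ U') (v : Lift x V), Lift.map x a v = u ∧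
        Lift.map x a' v = u' ∧ res A a s = res A a' s' := by
  refine ⟨fun h => ?_, ?_⟩
  · obtain ⟨W, w, a, b, rfl, rfl⟩ := exists_common_nbhd x u u'
    rw [← germ_res, ← germ_res, germ_eq_iff] at h
    obtain ⟨V, c, v, rfl, h⟩ := h
    refine ⟨V, c ≫ a, c ≫ b, v, Lift.ext _ (by simp), Lift.ext _ (by simp), ?_⟩
    rw [← res_res, h, res_res]
  · rintro ⟨V, a, a', v, rfl, rfl, h⟩
    rw [← germ_res, ← germ_res, h]

lemma exists_geomPoint_aux (T : Scheme.{u}) (p : T) {R : CommRingCat.{u}}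
    (φ : T.residueField p ⟶ R) (z : Spec R) :
    (Spec.map φ ≫ T.fromSpecResidueField p) z = p := by
  rw [Scheme.Hom.comp_apply, Scheme.fromSpecResidueField_apply]

/-- Every point of an étale `X`-scheme underlies a lifting of a geometric point of `X`. -/
lemma exists_geomPoint {U : X.Etale} (p : tot U) : ∃ (Ω : Type u) (_ : Field Ω)
    (_ : IsSepClosed Ω) (x : Spec (.of Ω) ⟶ X) (u : Lift x U), Lift.pt x u default = p := by
  let k := (tot U).residueField p
  let Ω := SeparableClosure k
  let y : Spec (.of Ω) ⟶ tot U :=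
    Spec.map (CommRingCat.ofHom (algebraMap k Ω)) ≫ (tot U).fromSpecResidueField p
  refine ⟨Ω, inferInstance, inferInstance, y ≫ str U, Lift.mk _ y rfl, ?_⟩
  exact exists_geomPoint_aux _ p _ _

/-- A geometric point lifts through every point in its support. -/
lemma exists_lift_map {U V : X.Etale} (a : V ⟶ U) (u : Lift x U) {q : tot V}
    (h : totMap a q = Lift.pt x u default) : ∃ v : Lift x V, Lift.map x a v = u ∧
      Lift.pt x v default = q := by
  have : Etale (totMap a ≫ str U) := by rw [totMap_str]; infer_instance
  have : Etale (totMap a) := Etale.of_comp _ (str U)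
  obtain ⟨l, h₁, h₂⟩ := Scheme.exists_fac_of_etale_of_isSepClosed (totMap a) (Lift.pt x u) q h
  exact ⟨Lift.mk x l (by rw [← totMap_str a, ← Category.assoc, h₁, Lift.pt_str]),
    Lift.ext _ h₁, h₂⟩

lemma exists_lift {U : X.Etale} {q : tot U} (h : str U q = x default) :
    ∃ u : Lift x U, Lift.pt x u default = q := by
  obtain ⟨l, h₁, h₂⟩ := Scheme.exists_fac_of_etale_of_isSepClosed (str U) x q h
  exact ⟨Lift.mk x l h₁, h₂⟩

/-- A section is determined by its germs. -/
lemma sec_ext_germ {U : X.Etale} {s t : Sec A U}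
    (h : ∀ (Ω : Type u) (_ : Field Ω) (_ : IsSepClosed Ω) (x : Spec (.of Ω) ⟶ X) (u : Lift x U),
      germ x A U u s = germ x A U u t) : s = t := by
  refine sec_ext fun p => ?_
  obtain ⟨Ω, _, _, x, u, rfl⟩ := exists_geomPoint p
  obtain ⟨V, a, v, rfl, e⟩ := (germ_eq_iff x u s t).1 (h Ω _ _ x u)
  exact ⟨V, a, ⟨_, rfl⟩, e⟩

end Germs

/-! ### Stalks and sections of inverse images -/

section PullStalk

variable {X Y : Scheme.{u}} (f : Y ⟶ X)

/-- The pull-back of sections `A(U) ⟶ (f^* A)(U ×_X Y)`. -/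
def pb (A : EtAb X) (U : X.Etale) :
    Sec A U →+ Sec ((pull f).obj A) ((etBaseChange f).obj U) :=
  mor ((pullPushAdj f).unit.app A) U

variable {A B : EtAb X}

lemma pb_res {U V : X.Etale} (a : V ⟶ U) (s : Sec A U) :
    pb f A V (res A a s) = res _ ((etBaseChange f).map a) (pb f A U s) :=
  mor_res _ a s

lemma pb_mor (φ : A ⟶ B) (U : X.Etale) (s : Sec A U) :
    pb f B U (mor φ U s) = mor ((pull f).map φ) _ (pb f A U s) := by
  have h := (pullPushAdj f).unit.naturality φ
  exact congrArg (fun ψ => mor ψ U s) h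

lemma pb_homEquiv {C : EtAb Y} (φ : A ⟶ (push f).obj C) (U : X.Etale) (s : Sec A U) :
    mor (((pullPushAdj f).homEquiv A C).symm φ) ((etBaseChange f).obj U) (pb f A U s) =
      mor φ U s := by
  have h : (pullPushAdj f).unit.app A ≫
      (push f).map (((pullPushAdj f).homEquiv A C).symm φ) = φ :=
    ((pullPushAdj f).homEquiv_unit _ _ _).symm.trans (Equiv.apply_symm_apply _ _)
  exact congrArg (fun ψ => mor ψ U s) h

lemma pull_hom_ext {C : EtAb Y} {φ ψ : (pull f).obj A ⟶ C}
    (h : ∀ U s, mor φ _ (pb f A U s) = mor ψ _ (pb f A U s)) : φ = ψ :=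
  adj_hom_ext (pullPushAdj f) (mor_hom_ext h)

variable {Ω : Type u} [Field Ω] [IsSepClosed Ω] (y : Spec (.of Ω) ⟶ Y) {x : Spec (.of Ω) ⟶ X}
  (e : y ≫ f = x)

lemma skyscraper_desc {C : EtAb Y} {M : AddCommGrpCat.{u}}
    (g : C ⟶ (Scheme.pointSmallEtale y).skyscraperSheaf M) :
    ∃ ψ : (stalk y).obj C ⟶ M, ∀ (V : Y.Etale) (v : Lift y V) (s : Sec C V),
      ψ.hom (germ y C V v s) = (Pi.π (fun _ : Lift y V => M) v).hom (mor g V s) := by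
  refine ⟨(Scheme.pointSmallEtale y).skyscraperPresheafHomEquiv.symm g.hom, fun V v s => ?_⟩
  exact congrArg (fun φ => φ.hom s)
    ((Scheme.pointSmallEtale y).toPresheafFiber_skyscraperPresheafHomEquiv_symm g.hom V v)

/-- The morphism to a direct image of a skyscraper sheaf which is given by a homomorphism on the
stalk at the image point. -/
def toPushSky {M : AddCommGrpCat.{u}} (φ : (stalk x).obj A ⟶ M) :
    A ⟶ (push f).obj ((Scheme.pointSmallEtale y).skyscraperSheaf M) :=
  ⟨{  app := fun U => Pi.lift (f := fun _ : Lift y ((etBaseChange f).obj U.unop) => M) fun v =>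
        (Scheme.pointSmallEtale x).toPresheafFiber U.unop (liftEquiv f y e U.unop v) A.obj ≫ φ
      naturality := fun U V a => by
        refine Pi.hom_ext _ _ fun v => ?_
        refine (Category.assoc _ _ _).trans ((congrArg (A.obj.map a ≫ ·) (Pi.lift_π _ v)).trans ?_)
        have h := (Scheme.pointSmallEtale x).toPresheafFiber_w a.unop
          (liftEquiv f y e V.unop v) A.obj
        refine (Category.assoc _ _ _).symm.trans ((congrArg (· ≫ φ) h).trans ?_)
        symm
        refine (Category.assoc _ _ _).trans ?_
        have h' : ((push f).obj ((Scheme.pointSmallEtale y).skyscraperSheaf M)).obj.map a ≫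
            Pi.π (fun _ : Lift y ((etBaseChange f).obj V.unop) => M) v =
            Pi.π (fun _ : Lift y ((etBaseChange f).obj U.unop) => M)
              (Lift.map y ((etBaseChange f).map a.unop) v) := by
          exact Pi.lift_π _ _
        refine (congrArg _ h').trans ((Pi.lift_π _ _).trans ?_)
        rw [liftEquiv_map]
        rfl }⟩

/-- The stalk of `f^* A` at `y` receives no more than the stalk of `A` at the image of `y`. -/
lemma exists_stalk_pull_desc {M : AddCommGrpCat.{u}} (φ : (stalk x).obj A ⟶ M) :
    ∃ ψ : (stalk y).obj ((pull f).obj A) ⟶ M, ∀ (U : X.Etale)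
      (v : Lift y ((etBaseChange f).obj U)) (s : Sec A U),
      ψ.hom (germ y _ _ v (pb f A U s)) = φ.hom (germ x A U (liftEquiv f y e U v) s) := by
  obtain ⟨ψ, hψ⟩ := skyscraper_desc y
    (((pullPushAdj f).homEquiv A _).symm (toPushSky f y e φ))
  refine ⟨ψ, fun U v s => ?_⟩
  rw [hψ, pb_homEquiv]
  have h : (toPushSky f y e φ).hom.app (op U) ≫
      Pi.π (fun _ : Lift y ((etBaseChange f).obj U) => M) v =
      (Scheme.pointSmallEtale x).toPresheafFiber U (liftEquiv f y e U v) A.obj ≫ φ :=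
    Pi.lift_π _ _
  exact congrArg (fun χ => χ.hom s) h

/-- Homomorphisms from a stalk of `f^* A` are determined by the germs of pull-backs of sections. -/
lemma stalk_pull_hom_ext {M : AddCommGrpCat.{u}}
    {ψ ψ' : (stalk y).obj ((pull f).obj A) ⟶ M}
    (h : ∀ (U : X.Etale) (v : Lift y ((etBaseChange f).obj U)) (s : Sec A U),
      ψ.hom (germ y _ _ v (pb f A U s)) = ψ'.hom (germ y _ _ v (pb f A U s))) : ψ = ψ' := by
  apply (Scheme.pointSmallEtale y).skyscraperPresheafHomEquiv.injective
  have key : (⟨(Scheme.pointSmallEtale y).skyscraperPresheafHomEquiv ψ⟩ :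
      (pull f).obj A ⟶ (Scheme.pointSmallEtale y).skyscraperSheaf M) =
      ⟨(Scheme.pointSmallEtale y).skyscraperPresheafHomEquiv ψ'⟩ := by
    apply adj_hom_ext (pullPushAdj f)
    refine ObjectProperty.hom_ext _ (NatTrans.ext (funext fun U => ?_))
    induction U with | op U => ?_
    refine Pi.hom_ext _ _ fun v => ?_
    ext s
    have h₁ := fun ψ : (stalk y).obj ((pull f).obj A) ⟶ M =>
      congrArg (fun χ => χ.hom (pb f A U s))
      ((Scheme.pointSmallEtale y).skyscraperPresheafHomEquiv_app_π ψ ((etBaseChange f).obj U) v)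
    exact (h₁ ψ).trans ((h U v s).trans (h₁ ψ').symm)
  exact congrArg (fun φ => φ.hom) key

/-- Every germ of `f^* A` is the germ of the pull-back of a section of `A`. -/
lemma exists_germ_pb (t : (stalk y).obj ((pull f).obj A)) : ∃ (U : X.Etale)
    (v : Lift y ((etBaseChange f).obj U)) (s : Sec A U), germ y _ _ v (pb f A U s) = t := by
  let S : AddSubgroup ((stalk y).obj ((pull f).obj A)) :=
    { carrier := {t | ∃ (U : X.Etale) (v : Lift y ((etBaseChange f).obj U)) (s : Sec A U),
        germ y _ _ v (pb f A U s) = t}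
      add_mem' := by
        rintro _ _ ⟨U, v, s, rfl⟩ ⟨U', v', s', rfl⟩
        obtain ⟨W, w, a, b, h, h'⟩ := exists_common_nbhd _ (liftEquiv f y rfl U v)
          (liftEquiv f y rfl U' v')
        refine ⟨W, (liftEquiv f y rfl W).symm w, res A a s + res A b s', ?_⟩
        rw [map_add, germ_add, pb_res, pb_res, germ_res, germ_res]
        congr 2
        · rw [← Equiv.apply_eq_iff_eq (liftEquiv f y rfl U), liftEquiv_map, Equiv.apply_symm_apply, h]
        · rw [← Equiv.apply_eq_iff_eq (liftEquiv f y rfl U'), liftEquiv_map, Equiv.apply_symm_apply, h']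
      zero_mem' := by
        obtain ⟨U, u, -⟩ := exists_germ (y ≫ f) (0 : (stalk _).obj A)
        exact ⟨U, (liftEquiv f y rfl U).symm u, 0, by rw [map_zero, germ_zero]⟩
      neg_mem' := by
        rintro _ ⟨U, v, s, rfl⟩
        exact ⟨U, v, -s, by rw [map_neg]; exact map_neg _ _⟩ }
  have h : (AddCommGrpCat.ofHom (QuotientAddGroup.mk' S) :
      (stalk y).obj ((pull f).obj A) ⟶ AddCommGrpCat.of (_ ⧸ S)) = 0 := by
    refine stalk_pull_hom_ext f y fun U v s => ?_
    exact (QuotientAddGroup.eq_zero_iff _).2 ⟨U, v, s, rfl⟩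
  exact (QuotientAddGroup.eq_zero_iff t).1 (congrArg (fun φ => φ.hom t) h)

/-- Sections of `A` whose pull-backs have the same germ have the same germ. -/
lemma germ_eq_of_germ_pb_eq {U U' : X.Etale} {v : Lift y ((etBaseChange f).obj U)}
    {v' : Lift y ((etBaseChange f).obj U')} {s : Sec A U} {s' : Sec A U'}
    (h : germ y _ _ v (pb f A U s) = germ y _ _ v' (pb f A U' s')) :
    germ x A U (liftEquiv f y e U v) s = germ x A U' (liftEquiv f y e U' v') s' := by
  obtain ⟨ψ, hψ⟩ := exists_stalk_pull_desc f y e (𝟙 ((stalk x).obj A))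
  exact (hψ _ _ _).symm.trans ((congrArg _ h).trans (hψ _ _ _))

lemma germ_pb_eq_of_germ_eq {U U' : X.Etale} {v : Lift y ((etBaseChange f).obj U)}
    {v' : Lift y ((etBaseChange f).obj U')} {s : Sec A U} {s' : Sec A U'}
    (h : germ x A U (liftEquiv f y e U v) s = germ x A U' (liftEquiv f y e U' v') s') :
    germ y _ _ v (pb f A U s) = germ y _ _ v' (pb f A U' s') := by
  obtain ⟨V, a, a', w, h₁, h₂, h₃⟩ := (germ_eq_germ_iff x _ _ _ _).1 h
  have e₁ : v = Lift.map y ((etBaseChange f).map a) ((liftEquiv f y e V).symm w) := by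
    rw [← Equiv.apply_eq_iff_eq (liftEquiv f y e U), liftEquiv_map, Equiv.apply_symm_apply, h₁]
  have e₂ : v' = Lift.map y ((etBaseChange f).map a') ((liftEquiv f y e V).symm w) := by
    rw [← Equiv.apply_eq_iff_eq (liftEquiv f y e U'), liftEquiv_map, Equiv.apply_symm_apply, h₂]
  rw [e₁, e₂, ← germ_res, ← germ_res, ← pb_res, ← pb_res, h₃]

end PullStalk

section PullSections

variable {X Y : Scheme.{u}} (f : Y ⟶ X) {A B : EtAb X}

/-- Locally, every section of `f^* A` is the restriction of the pull-back of a section of `A`. -/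
lemma exists_res_eq_res_pb {V : Y.Etale} (t : Sec ((pull f).obj A) V) (v : tot V) :
    ∃ (W : Y.Etale) (a : W ⟶ V) (U : X.Etale) (b : W ⟶ (etBaseChange f).obj U) (s : Sec A U),
      v ∈ Set.range (totMap a) ∧ res _ a t = res _ b (pb f A U s) := by
  obtain ⟨Ω, _, _, y, v, rfl⟩ := exists_geomPoint v
  obtain ⟨U, v', s, h⟩ := exists_germ_pb f y (germ y _ V v t)
  obtain ⟨W, b, a, w, -, rfl, e⟩ := (germ_eq_germ_iff y _ _ _ _).1 h
  exact ⟨W, a, U, b, s, ⟨_, rfl⟩, e.symm⟩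

/-- If the pull-back of a section vanishes near a point of the base change, then the section
vanishes near the image. -/
lemma exists_res_eq_zero_of_pb {U : X.Etale} {s : Sec A U} {W : Y.Etale}
    {b : W ⟶ (etBaseChange f).obj U} (h : res _ b (pb f A U s) = 0) (w : tot W) :
    ∃ (V : X.Etale) (a : V ⟶ U), bcFst f U (totMap b w) ∈ Set.range (totMap a) ∧
      res A a s = 0 := by
  obtain ⟨Ω, _, _, y, w, rfl⟩ := exists_geomPoint w
  have h₁ : germ y _ _ (Lift.map y b w) (pb f A U s) = germ y _ _ (Lift.map y b w) (pb f A U 0) := by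
    rw [← germ_res, h, map_zero, germ_zero, germ_zero]
  obtain ⟨V, a, v, hv, h₂⟩ := (germ_eq_iff _ _ _ _).1 (germ_eq_of_germ_pb_eq f y rfl h₁)
  refine ⟨V, a, ⟨Lift.pt _ v default, ?_⟩, by rw [h₂, map_zero]⟩
  have h₃ := congrArg (fun u => Lift.pt _ u default) hv
  exact h₃

/-- Inverse image along a surjective morphism detects equality of sections. -/
lemma pb_injective [Surjective f] {U : X.Etale} {s : Sec A U} (h : pb f A U s = 0) : s = 0 := by
  refine sec_ext fun u => ?_
  have : Surjective (bcFst f U) := MorphismProperty.of_isPullback (bc_isPullback f U).flip ‹_›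
  obtain ⟨v, rfl⟩ := (bcFst f U).surjective u
  obtain ⟨V, a, hv, h'⟩ := exists_res_eq_zero_of_pb f (b := 𝟙 _) (by rw [h, map_zero]) v
  exact ⟨V, a, hv, by rw [h', map_zero]⟩

lemma pull_map_injective [Surjective f] {φ ψ : A ⟶ B} (h : (pull f).map φ = (pull f).map ψ) :
    φ = ψ := by
  refine mor_hom_ext fun U s => ?_
  rw [← sub_eq_zero]
  apply pb_injective f
  rw [map_sub, pb_mor, pb_mor, h, sub_self]

/-- Inverse image along a surjective morphism reflects isomorphisms. -/
lemma isIso_of_isIso_pull_map [Surjective f] (φ : A ⟶ B) [IsIso ((pull f).map φ)] : IsIso φ := by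
  refine isIso_of_mor φ (fun U s h => ?_) fun U t u => ?_
  · apply pb_injective f
    apply (mor_bijective ((pull f).map φ) _).1
    rw [← pb_mor, h, map_zero, map_zero]
  · have : Surjective (bcFst f U) := MorphismProperty.of_isPullback (bc_isPullback f U).flip ‹_›
    obtain ⟨v, rfl⟩ := (bcFst f U).surjective u
    obtain ⟨s, hs⟩ := (mor_bijective ((pull f).map φ) _).2 (pb f B U t)
    obtain ⟨W, a, U', b, s', ⟨w, rfl⟩, h⟩ := exists_res_eq_res_pb f s v
    have h₁ : res _ b (pb f B U' (mor φ U' s')) = res _ a (pb f B U t) := by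
      rw [pb_mor, ← mor_res, ← h, mor_res, hs]
    obtain ⟨Ω, _, _, y, w, rfl⟩ := exists_geomPoint w
    have h₂ : germ y _ _ (Lift.map y b w) (pb f B U' (mor φ U' s')) =
        germ y _ _ (Lift.map y a w) (pb f B U t) := by
      rw [← germ_res, h₁, germ_res]
    obtain ⟨V, c, c', v, hv, hv', h₃⟩ :=
      (germ_eq_germ_iff _ _ _ _ _).1 (germ_eq_of_germ_pb_eq f y rfl h₂)
    refine ⟨V, c', ⟨Lift.pt _ v default, ?_⟩, res A c s', by rw [mor_res, h₃]⟩
    exact congrArg (fun u => Lift.pt _ u default) hv'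

end PullSections

section PullStalkEquiv

variable {X Y : Scheme.{u}} (f : Y ⟶ X) {Ω : Type u} [Field Ω] [IsSepClosed Ω]
  (y : Spec (.of Ω) ⟶ Y) {x : Spec (.of Ω) ⟶ X} (e : y ≫ f = x) (A : EtAb X)

/-- The stalk of `f^* A` at `y` is the stalk of `A` at `f(y)`. -/
lemma exists_stalkPull : ∃ ψ : (stalk y).obj ((pull f).obj A) ≃+ (stalk x).obj A,
    ∀ (U : X.Etale) (v : Lift y ((etBaseChange f).obj U)) (s : Sec A U),
      ψ (germ y _ _ v (pb f A U s)) = germ x A U (liftEquiv f y e U v) s := by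
  obtain ⟨ψ, hψ⟩ := exists_stalk_pull_desc f y e (𝟙 ((stalk x).obj A))
  refine ⟨AddEquiv.ofBijective ψ.hom ⟨?_, fun t => ?_⟩, hψ⟩
  · intro t t' h
    obtain ⟨U, v, s, rfl⟩ := exists_germ_pb f y t
    obtain ⟨U', v', s', rfl⟩ := exists_germ_pb f y t'
    exact germ_pb_eq_of_germ_eq f y e ((hψ _ _ _).symm.trans (h.trans (hψ _ _ _)))
  · obtain ⟨U, u, s, rfl⟩ := exists_germ x t
    refine ⟨germ y _ _ ((liftEquiv f y e U).symm u) (pb f A U s), (hψ _ _ _).trans ?_⟩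
    rw [Equiv.apply_symm_apply]
    rfl

/-- The identification of the stalk of `f^* A` at `y` with the stalk of `A` at the image of `y`. -/
def stalkPull : (stalk y).obj ((pull f).obj A) ≃+ (stalk x).obj A :=
  (exists_stalkPull f y e A).choose

lemma stalkPull_germ {U : X.Etale} (v : Lift y ((etBaseChange f).obj U)) (s : Sec A U) :
    stalkPull f y e A (germ y _ _ v (pb f A U s)) = germ x A U (liftEquiv f y e U v) s :=
  (exists_stalkPull f y e A).choose_spec U v s

variable {A} in
lemma stalkPull_map {B : EtAb X} (φ : A ⟶ B) (t : (stalk y).obj ((pull f).obj A)) :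
    stalkPull f y e B (((stalk y).map ((pull f).map φ)).hom t) =
      ((stalk x).map φ).hom (stalkPull f y e A t) := by
  obtain ⟨U, v, s, rfl⟩ := exists_germ_pb f y t
  rw [germ_mor, ← pb_mor, stalkPull_germ, stalkPull_germ, germ_mor]

end PullStalkEquiv

lemma isIso_of_stalk {X : Scheme.{u}} {A B : EtAb X} (φ : A ⟶ B)
    (h : ∀ (Ω : Type u) (_ : Field Ω) (_ : IsSepClosed Ω) (x : Spec (.of Ω) ⟶ X),
      Function.Bijective ((stalk x).map φ).hom) : IsIso φ := by
  refine isIso_of_mor φ (fun U s hs => sec_ext_germ fun Ω _ _ x u => ?_) fun U t p => ?_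
  · apply (h Ω _ _ x).1
    rw [germ_mor, germ_mor, hs, map_zero]
  · obtain ⟨Ω, _, _, x, u, rfl⟩ := exists_geomPoint p
    obtain ⟨s', hs'⟩ := (h Ω _ _ x).2 (germ x B U u t)
    obtain ⟨U', u', s, rfl⟩ := exists_germ x s'
    rw [germ_mor, germ_eq_germ_iff] at hs'
    obtain ⟨V, a, b, v, -, rfl, e⟩ := hs'
    exact ⟨V, b, ⟨_, rfl⟩, res A a s, by rw [mor_res, e]⟩

lemma stalk_map_bijective {X : Scheme.{u}} {A B : EtAb X} (φ : A ⟶ B) [IsIso φ]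
    {Ω : Type u} [Field Ω] [IsSepClosed Ω] (x : Spec (.of Ω) ⟶ X) :
    Function.Bijective ((stalk x).map φ).hom :=
  (ConcreteCategory.isIso_iff_bijective ((stalk x).map φ)).1 inferInstance

/-! ### Locally constant sheaves with finite stalks -/

section Triv

variable {X Y : Scheme.{u}} {A B : EtAb X} {M N : Type u} [AddCommGroup M] [AddCommGroup N]

/-- A homomorphism `φ` from `M` to the sections of `A` over `U` *trivializes* `A` over `U` if it
identifies `M` with all stalks of `A` at the geometric points of `U`, that is, if it identifies the
constant sheaf `M` with the restriction of `A` to `U`. -/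
def IsTriv (A : EtAb X) (U : X.Etale) (φ : M →+ Sec A U) : Prop :=
  ∀ (Ω : Type u) (_ : Field Ω) (_ : IsSepClosed Ω) (x : Spec (.of Ω) ⟶ X) (u : Lift x U),
    Function.Bijective fun m => germ x A U u (φ m)

namespace IsTriv

variable {U V : X.Etale} {φ : M →+ Sec A U}

lemma restrict (h : IsTriv A U φ) (a : V ⟶ U) : IsTriv A V ((res A a).comp φ) :=
  fun Ω _ _ x v => by
    convert! h Ω _ _ x (Lift.map x a v) using 2 with m
    exact germ_res x a v _

lemma map_iso (h : IsTriv A U φ) (θ : A ⟶ B) [IsIso θ] : IsTriv B U ((mor θ U).comp φ) :=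
  fun Ω _ _ x u => by
    convert! (stalk_map_bijective θ x).comp (h Ω _ _ x u) using 2 with m
    exact (germ_mor x θ U u _).symm

lemma pullback (h : IsTriv A U φ) (f : Y ⟶ X) :
    IsTriv ((pull f).obj A) ((etBaseChange f).obj U) ((pb f A U).comp φ) := fun Ω _ _ y v => by
  have := (h Ω _ _ (y ≫ f) (liftEquiv f y rfl U v))
  rw [← (stalkPull f y rfl A).bijective.of_comp_iff'] at *
  convert! this using 2 with m
  exact stalkPull_germ f y rfl A v (φ m)

lemma eq_zero_of_germ (h : IsTriv A U φ) {Ω : Type u} [Field Ω] [IsSepClosed Ω]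
    {x : Spec (.of Ω) ⟶ X} (u : Lift x U) {m : M} (hm : germ x A U u (φ m) = 0) : m = 0 :=
  (h Ω _ _ x u).1 (by simp only [hm, map_zero, germ_zero])

lemma exists_germ_eq (h : IsTriv A U φ) {Ω : Type u} [Field Ω] [IsSepClosed Ω]
    {x : Spec (.of Ω) ⟶ X} (u : Lift x U) (t : (stalk x).obj A) :
    ∃ m, germ x A U u (φ m) = t := (h Ω _ _ x u).2 t

/-- Triviality can be checked locally. -/
lemma of_local (hinj : ∀ (V : X.Etale) (a : V ⟶ U) (m : M), Nonempty (tot V) →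
      res A a (φ m) = 0 → m = 0)
    (hsurj : ∀ (V : X.Etale) (a : V ⟶ U) (s : Sec A V) (v : tot V),
      ∃ (W : X.Etale) (b : W ⟶ V) (m : M), v ∈ Set.range (totMap b) ∧
        res A b s = res A (b ≫ a) (φ m)) : IsTriv A U φ := by
  intro Ω _ _ x u
  constructor
  · rw [show (fun m => germ x A U u (φ m)) = ⇑((AddMonoidHom.mk' (germ x A U u)
      (germ_add x u)).comp φ) from rfl, injective_iff_map_eq_zero]
    intro m hm
    change germ x A U u (φ m) = 0 at hm
    rw [← germ_zero x u, germ_eq_iff] at hm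
    obtain ⟨V, a, v, -, e⟩ := hm
    exact hinj V a m ⟨Lift.pt x v default⟩ (by rw [e, map_zero])
  · intro t
    obtain ⟨V, v, s, rfl⟩ := exists_germ x t
    obtain ⟨W, w, a, b, rfl, rfl⟩ := exists_common_nbhd x u v
    obtain ⟨W', c, m, ⟨q, hq⟩, h⟩ := hsurj W a (res A b s) (Lift.pt x w default)
    obtain ⟨w', rfl, -⟩ := exists_lift_map x c w hq
    refine ⟨m, ?_⟩
    dsimp only
    rw [← germ_res x b, ← germ_res x c (w') (res A b s), h, germ_res]
    congr 1

end IsTriv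

/-- Étale-locally trivial with finite stalks. -/
def IsLC (A : EtAb X) : Prop :=
  ∀ p : X, ∃ U : X.Etale, p ∈ Set.range (str U) ∧
    ∃ (M : Type u) (_ : AddCommGroup M) (_ : Finite M) (φ : M →+ Sec A U), IsTriv A U φ

lemma IsLC.map_iso (h : IsLC A) (e : A ≅ B) : IsLC B := fun p => by
  obtain ⟨U, hU, M, _, hM, φ, hφ⟩ := h p
  exact ⟨U, hU, M, _, hM, _, hφ.map_iso e.hom⟩

lemma IsLC.pull (h : IsLC A) (f : Y ⟶ X) : IsLC ((pull f).obj A) := fun q => by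
  obtain ⟨U, ⟨p, hp⟩, M, _, hM, φ, hφ⟩ := h (f q)
  obtain ⟨r, -, hr⟩ := Scheme.exists_preimage_of_isPullback (bc_isPullback f U) p q hp
  exact ⟨_, ⟨r, hr⟩, M, _, hM, _, hφ.pullback f⟩

end Triv

section ConstantSheaf

variable {X : Scheme.{u}}

variable (X) in
/-- The final object of the small étale site. -/
def etTop : X.Etale := Scheme.Etale.mk (𝟙 X)

/-- The morphism to the final object. -/
def toTop (U : X.Etale) : U ⟶ etTop X := etHomMk (V := etTop X) (str U) (Category.comp_id _)

lemma toTop_uniq {U : X.Etale} (a b : U ⟶ etTop X) : a = b := et_hom_ext (by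
  have h (c : U ⟶ etTop X) : totMap c = str U := (Category.comp_id _).symm.trans (totMap_str c)
  rw [h, h])

/-- The sections of a constant sheaf given by its values. -/
def constSec (M : AddCommGrpCat.{u}) (U : X.Etale) :
    M →+ Sec ((constantSheaf X.smallEtaleTopology AddCommGrpCat.{u}).obj M) U :=
  ((toSheafify X.smallEtaleTopology ((Functor.const _).obj M)).app (op U)).hom

lemma res_constSec (M : AddCommGrpCat.{u}) {U V : X.Etale} (a : V ⟶ U) (m : M) :
    res _ a (constSec M U m) = constSec M V m :=
  (congrArg (fun φ => φ.hom m)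
    ((toSheafify X.smallEtaleTopology ((Functor.const _).obj M)).naturality a.op)).symm

lemma isTriv_constSec (M : AddCommGrpCat.{u}) (U : X.Etale) :
    IsTriv _ U (constSec M U) := by
  refine IsTriv.of_local (fun V a m ⟨v⟩ h => ?_) fun V a s v => ?_
  · rw [res_constSec] at h
    have h₁ := Presheaf.equalizerSieve_mem X.smallEtaleTopology
      (toSheafify X.smallEtaleTopology ((Functor.const _).obj M)) (X := op V) m 0
      (h.trans (map_zero _).symm)
    obtain ⟨W, b, hb, -⟩ := (mem_topology_iff _).1 h₁ v
    exact hb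
  · have h₁ := Presheaf.imageSieve_mem X.smallEtaleTopology
      (toSheafify X.smallEtaleTopology ((Functor.const _).obj M)) (U := op V) s
    obtain ⟨W, b, ⟨m, hm⟩, hv⟩ := (mem_topology_iff _).1 h₁ v
    exact ⟨W, b, m, hv, by rw [res_constSec]; exact hm.symm⟩

/-- A sheaf with a trivialization over the final object is constant. -/
lemma nonempty_iso_constantSheaf {A : EtAb X} {M : Type u} [AddCommGroup M]
    {φ : M →+ Sec A (etTop X)} (h : IsTriv A (etTop X) φ) :
    Nonempty (A ≅ (constantSheaf X.smallEtaleTopology AddCommGrpCat.{u}).obj (.of M)) := by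
  let η : (Functor.const X.Etaleᵒᵖ).obj (AddCommGrpCat.of M) ⟶ A.obj :=
    { app := fun U => AddCommGrpCat.ofHom ((res A (toTop U.unop)).comp φ)
      naturality := fun U V a => by
        ext m
        change res A _ _ = res A a.unop (res A _ _)
        rw [res_res, toTop_uniq (a.unop ≫ _) (toTop _)]
        rfl }
  let θ : (constantSheaf X.smallEtaleTopology AddCommGrpCat.{u}).obj (.of M) ⟶ A :=
    ⟨sheafifyLift X.smallEtaleTopology η A.property⟩
  have hθ (U : X.Etale) (m : M) : mor θ U (constSec (.of M) U m) = res A (toTop U) (φ m) :=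
    congrArg (fun χ => (χ.app (op U)).hom m)
      (toSheafify_sheafifyLift X.smallEtaleTopology η A.property)
  have : IsIso θ := by
    refine isIso_of_stalk θ fun Ω _ _ x => ?_
    obtain ⟨U, u, -⟩ := exists_germ x (0 : (stalk x).obj A)
    have h₁ := isTriv_constSec (.of M) U Ω _ _ x u
    have h₂ := (h.restrict (toTop U)) Ω _ _ x u
    rw [← Function.Bijective.of_comp_iff _ h₁]
    convert! h₂ using 2 with m
    exact (germ_mor x θ U u _).trans (by rw [hθ]; rfl)
  exact ⟨(asIso θ).symm⟩

end ConstantSheaf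

section Finite

variable {X : Scheme.{u}} {Ω : Type u} [Field Ω] [IsSepClosed Ω] (x : Spec (.of Ω) ⟶ X)

lemma exists_common_nbhd_of_finite {ι : Type*} [Finite ι] (U : ι → X.Etale)
    (u : ∀ i, Lift x (U i)) : ∃ (W : X.Etale) (w : Lift x W) (a : ∀ i, W ⟶ U i),
      ∀ i, Lift.map x (a i) w = u i := by
  have := Fintype.ofFinite ι
  classical
  obtain ⟨p, hp⟩ := IsCofiltered.inf_objs_exists
    (Finset.univ.image fun i => (Scheme.pointSmallEtale x).fiber.elementsMk (U i) (u i))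
  have h (i : ι) : Nonempty (p ⟶ (Scheme.pointSmallEtale x).fiber.elementsMk (U i) (u i)) :=
    hp (Finset.mem_image_of_mem _ (Finset.mem_univ i))
  exact ⟨p.1, p.2, fun i => (h i).some.1, fun i => (h i).some.2⟩

end Finite

section LCIff

variable {X : Scheme.{u}} {A : EtAb X}

/-- An étale `U`-scheme as an étale `X`-scheme. -/
def etPost (U : X.Etale) (V : (tot U).Etale) : X.Etale := Scheme.Etale.mk (str V ≫ str U)

/-- Morphisms from an étale `U`-scheme to an étale `X`-scheme. -/
def etPostHom {U : X.Etale} {V : (tot U).Etale} {T : X.Etale} (a : tot V ⟶ tot T)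
    (w : a ≫ str T = str V ≫ str U) : etPost U V ⟶ T :=
  etHomMk (U := etPost U V) a w

/-- If the inverse image of `A` on an étale `X`-scheme is constant, with finite values, then so is `A` in an
étale neighbourhood of every point of the image. -/
lemma isLC_of_isTriv_pull (U : X.Etale) {M : Type u} [AddCommGroup M] [Finite M]
    (ψ : M →+ Sec ((pull (str U)).obj A) (etTop (tot U)))
    (hψ : IsTriv _ _ ψ) (p : tot U) : ∃ V : X.Etale, str U p ∈ Set.range (str V) ∧
    ∃ φ : M →+ Sec A V, IsTriv A V φ := by
  let j := str U
  obtain ⟨Ω, _, _, y, t, hp⟩ := exists_geomPoint (U := etTop (tot U)) p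
  have h₁ (m : M) : ∃ (U' : X.Etale) (s : Sec A U') (V : (tot U).Etale)
      (a : V ⟶ (etBaseChange j).obj U') (v : Lift y V),
      res _ a (pb j A U' s) = res _ (toTop V) (ψ m) := by
    obtain ⟨U', v', s, h⟩ := exists_germ_pb j y (germ y _ _ t (ψ m))
    obtain ⟨V, a, b, v, -, -, e⟩ := (germ_eq_germ_iff y _ _ _ _).1 h
    exact ⟨U', s, V, a, v, by rw [e, toTop_uniq b]⟩
  -- As `M` is finite, one neighbourhood `W` of the point serves for all `m`; composed with `tot U ⟶ X`,
  -- it is an étale `X`-scheme over which the sections `ψ m` come from sections of `A`.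
  choose U' s V a v h₂ using h₁
  obtain ⟨W, w, b, hb⟩ := exists_common_nbhd_of_finite y V v
  let c (m : M) : etPost U W ⟶ U' m :=
    etPostHom (totMap (b m) ≫ totMap (a m) ≫ bcFst j (U' m)) (by
      rw [Category.assoc, Category.assoc, bc_w, totMap_str_assoc, totMap_str_assoc])
  let φ (m : M) : Sec A (etPost U W) := res A (c m) (s m)
  have key (Ω : Type u) [Field Ω] [IsSepClosed Ω] (x : Spec (.of Ω) ⟶ X)
      (z : Lift x (etPost U W)) : ∃ (y : Spec (.of Ω) ⟶ tot U) (e : y ≫ j = x)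
      (t : Lift y (etTop (tot U))), ∀ m,
      germ x A (etPost U W) z (φ m) = stalkPull j y e A (germ y _ _ t (ψ m)) := by
    let y : Spec (.of Ω) ⟶ tot U := Lift.pt x z ≫ str W
    have e : y ≫ j = x := (Category.assoc _ _ _).trans (Lift.pt_str x z)
    let z' : Lift y W := Lift.mk y (Lift.pt x z) rfl
    refine ⟨y, e, Lift.map y (toTop W) z', fun m => ?_⟩
    have e₁ : res _ (toTop W) (ψ m) = res _ (b m ≫ a m) (pb j A (U' m) (s m)) := by
      rw [← res_res, h₂, res_res, toTop_uniq (b m ≫ _)]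
    rw [← germ_res y, e₁, germ_res y, stalkPull_germ, germ_res x]
    congr 1
  -- The germs of `φ` are those of `ψ`, so that `φ` inherits additivity and triviality.
  have hadd (m m' : M) : φ (m + m') = φ m + φ m' := sec_ext_germ fun Ω _ _ x z => by
    obtain ⟨y, e, t, h⟩ := key Ω x z
    rw [germ_add, h, h, h, map_add ψ, germ_add, map_add]
  refine ⟨etPost U W, ⟨Lift.pt y w default, ?_⟩,
    AddMonoidHom.mk' φ hadd, fun Ω _ _ x z => ?_⟩
  · change str U (str W (Lift.pt y w default)) = _
    have h₃ : str W (Lift.pt y w default) = y default := congrArg (· default) (Lift.pt_str y w)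
    have h₄ : p = y default := by
      rw [← hp]
      exact congrArg (· default) (Lift.pt_str y t)
    rw [h₃, h₄]
  · obtain ⟨y, e, t, h⟩ := key Ω x z
    convert! (stalkPull j y e A).bijective.comp (hψ Ω _ _ y t) using 2 with m
    exact h m

/-- Locally constant sheaves in terms of trivializations by sections. -/
lemma isFiniteLocallyConstant_iff : IsFiniteLocallyConstant A ↔ IsLC A := by
  refine ⟨fun h p => ?_, fun h p => ?_⟩
  · obtain ⟨U, ⟨q, rfl⟩, M, hM, ⟨e⟩⟩ := h p
    obtain ⟨V, hV, φ, hφ⟩ := isLC_of_isTriv_pull U _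
      ((isTriv_constSec M (etTop (tot U))).map_iso e.inv) q
    exact ⟨V, hV, M, _, hM, φ, hφ⟩
  · obtain ⟨U, hU, M, _, hM, φ, hφ⟩ := h p
    refine ⟨U, hU, .of M, hM, ?_⟩
    exact nonempty_iso_constantSheaf ((hφ.pullback (str U)).restrict
      (bcLift (str U) U (etTop (tot U)) (𝟙 _) rfl))

end LCIff

section Vanishing

variable {X Y : Scheme.{u}} {A B C : EtAb X}

instance {U V : X.Etale} (a : V ⟶ U) : Etale (totMap a) := by
  have : Etale (totMap a ≫ str U) := by rw [totMap_str]; infer_instance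
  exact Etale.of_comp _ (str U)

lemma isOpen_range_totMap {U V : X.Etale} (a : V ⟶ U) : IsOpen (Set.range (totMap a)) :=
  (totMap a).isOpenMap.isOpen_range

lemma isOpen_range_str (U : X.Etale) : IsOpen (Set.range (str U)) :=
  (str U).isOpenMap.isOpen_range

lemma germ_eq_zero_iff {Ω : Type u} [Field Ω] [IsSepClosed Ω] {x : Spec (.of Ω) ⟶ X}
    {U : X.Etale} (u : Lift x U) (s : Sec A U) : germ x A U u s = 0 ↔
      ∃ (V : X.Etale) (a : V ⟶ U), Lift.pt x u default ∈ Set.range (totMap a) ∧ res A a s = 0 := by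
  constructor
  · intro h
    rw [← germ_zero x u, germ_eq_iff] at h
    obtain ⟨V, a, v, rfl, e⟩ := h
    exact ⟨V, a, ⟨_, rfl⟩, by rw [e, map_zero]⟩
  · rintro ⟨V, a, ⟨q, hq⟩, e⟩
    obtain ⟨v, rfl, -⟩ := exists_lift_map x a u hq
    rw [← germ_res, e, germ_zero]

/-- The vanishing locus of a section of a locally constant sheaf is open and closed. -/
lemma exists_isClopen_vanishing (hA : IsLC A) {U : X.Etale} (s : Sec A U) :
    ∃ Z : Set (tot U), IsClopen Z ∧ ∀ (Ω : Type u) (_ : Field Ω) (_ : IsSepClosed Ω)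
      (x : Spec (.of Ω) ⟶ X) (u : Lift x U), Lift.pt x u default ∈ Z ↔ germ x A U u s = 0 := by
  let Z : Set (tot U) := {p | ∃ (V : X.Etale) (a : V ⟶ U), p ∈ Set.range (totMap a) ∧ res A a s = 0}
  refine ⟨Z, ⟨⟨?_⟩, ?_⟩, fun Ω _ _ x u => (germ_eq_zero_iff u s).symm⟩
  · rw [isOpen_iff_mem_nhds]
    intro p hp
    obtain ⟨T, ⟨t, ht⟩, M, _, _, φ, hφ⟩ := hA (str U p)
    obtain ⟨Ω, _, _, x, u, rfl⟩ := exists_geomPoint p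
    obtain ⟨t, -⟩ := exists_lift (U := T) x (q := t) (ht.trans (congrArg (· default) (Lift.pt_str x u)))
    obtain ⟨W, w, a, b, rfl, rfl⟩ := exists_common_nbhd x u t
    obtain ⟨m, hm⟩ := hφ.exists_germ_eq (Lift.map x b w) (germ x A U (Lift.map x a w) s)
    rw [← germ_res, ← germ_res, germ_eq_iff] at hm
    obtain ⟨W', c, w', rfl, e⟩ := hm
    refine Filter.mem_of_superset ((isOpen_range_totMap (c ≫ a)).mem_nhds ⟨Lift.pt x w' default, rfl⟩) ?_
    rintro _ ⟨q, rfl⟩ hq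
    obtain ⟨Ω', _, _, x', w'', rfl⟩ := exists_geomPoint q
    have h₁ : germ x' A U (Lift.map x' (c ≫ a) w'') s = 0 := (germ_eq_zero_iff _ _).2 hq
    have h₂ : m = 0 := by
      refine hφ.eq_zero_of_germ (Lift.map x' (c ≫ b) w'') ?_
      rw [← germ_res, ← res_res, e, res_res, germ_res, h₁]
    refine hp ⟨W', c ≫ a, ⟨_, rfl⟩, ?_⟩
    rw [← res_res, ← e, h₂, map_zero, map_zero, map_zero]
  · rw [isOpen_iff_mem_nhds]
    rintro _ ⟨V, a, ⟨q, rfl⟩, h⟩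
    refine Filter.mem_of_superset ((isOpen_range_totMap a).mem_nhds ⟨q, rfl⟩) ?_
    rintro _ ⟨q', rfl⟩
    exact ⟨V, a, ⟨_, rfl⟩, h⟩

/-- Locally, a morphism of locally constant sheaves is a homomorphism of groups. -/
lemma exists_triv_hom (hA : IsLC A) (hB : IsLC B) (θ : A ⟶ B) (p : X) :
    ∃ U : X.Etale, p ∈ Set.range (str U) ∧
      ∃ (M N : Type u) (_ : AddCommGroup M) (_ : AddCommGroup N) (_ : Finite M) (_ : Finite N)
        (φ : M →+ Sec A U) (ψ : N →+ Sec B U) (ρ : M →+ N), IsTriv A U φ ∧ IsTriv B U ψ ∧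
          ∀ m, mor θ U (φ m) = ψ (ρ m) := by
  obtain ⟨U, ⟨u, hu⟩, M, _, _, φ, hφ⟩ := hA p
  obtain ⟨V, ⟨v, hv⟩, N, _, _, ψ, hψ⟩ := hB p
  obtain ⟨Ω, _, _, x, u, rfl⟩ := exists_geomPoint u
  have hx : str U (Lift.pt x u default) = x default := congrArg (· default) (Lift.pt_str x u)
  obtain ⟨v, -⟩ := exists_lift (U := V) x (q := v) (hv.trans (hu.symm.trans hx))
  obtain ⟨W, w, a, b, rfl, rfl⟩ := exists_common_nbhd x u v
  have h (m : M) : ∃ (n : N) (W' : X.Etale) (c : W' ⟶ W) (w' : Lift x W'), Lift.map x c w' = w ∧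
      res B (c ≫ a) (mor θ U (φ m)) = res B (c ≫ b) (ψ n) := by
    obtain ⟨n, hn⟩ := hψ.exists_germ_eq (Lift.map x b w) (germ x B U (Lift.map x a w) (mor θ U (φ m)))
    rw [← germ_res, ← germ_res, germ_eq_iff] at hn
    obtain ⟨W', c, w', rfl, e⟩ := hn
    exact ⟨n, W', c, w', rfl, by rw [← res_res, ← e, res_res]⟩
  -- The values of `θ` on the finitely many sections `φ m` are compared over one neighbourhood `T`.
  choose ρ W' c w' h₁ h₂ using h
  have := (Scheme.pointSmallEtale x).isCofiltered
  obtain ⟨T, t, d, hd, h₃⟩ : ∃ (T : X.Etale) (t : Lift x T) (d : T ⟶ W), Lift.map x d t = w ∧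
      ∀ m, res B (d ≫ a) (mor θ U (φ m)) = res B (d ≫ b) (ψ (ρ m)) := by
    classical
    have := Fintype.ofFinite M
    suffices H : ∀ S : Finset M, ∃ (T : X.Etale) (t : Lift x T) (d : T ⟶ W), Lift.map x d t = w ∧
      ∀ m ∈ S, res B (d ≫ a) (mor θ U (φ m)) = res B (d ≫ b) (ψ (ρ m)) by
      obtain ⟨T, t, d, hd, h⟩ := H Finset.univ
      exact ⟨T, t, d, hd, fun m => h m (Finset.mem_univ m)⟩
    intro S
    induction S using Finset.induction_on with
    | empty => exact ⟨W, w, 𝟙 _, Lift.ext _ (by simp), by simp⟩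
    | insert m S _ ih =>
      obtain ⟨T, t, d, rfl, h⟩ := ih
      have h₄ : germ x B _ (Lift.map x d t) (res B a (mor θ U (φ m)) - res B b (ψ (ρ m))) = 0 := by
        rw [← h₁ m, ← germ_res, map_sub, res_res, res_res, h₂, sub_self, germ_zero]
      rw [← germ_res, ← germ_zero x t, germ_eq_iff] at h₄
      obtain ⟨T', e, t', rfl, h₅⟩ := h₄
      refine ⟨T', t', e ≫ d, Lift.ext _ (by simp), fun m' hm' => ?_⟩
      obtain rfl | hm' := Finset.mem_insert.1 hm'
      · rw [map_zero, res_res, map_sub, res_res, res_res, sub_eq_zero] at h₅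
        exact h₅
      · rw [Category.assoc, Category.assoc, ← res_res e, h m' hm', res_res]
  have htriv := hψ.restrict (d ≫ b)
  have hρ (m : M) : germ x B T t (mor θ T (res A (d ≫ a) (φ m))) =
      germ x B T t (res B (d ≫ b) (ψ (ρ m))) := by rw [mor_res, h₃]
  refine ⟨T, ⟨Lift.pt x t default, ?_⟩, M, N, _, _, ‹_›, ‹_›, (res A (d ≫ a)).comp φ,
    (res B (d ≫ b)).comp ψ, AddMonoidHom.mk' ρ fun m m' => (htriv Ω _ _ x t).1 ?_,
    hφ.restrict _, htriv, fun m => ?_⟩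
  · exact (congrArg (· default) (Lift.pt_str x t)).trans (hx.symm.trans hu)
  · simp only [AddMonoidHom.comp_apply, map_add, germ_add]
    rw [← hρ, ← hρ, ← hρ, map_add, map_add, map_add, germ_add]
  · exact (mor_res _ _ _).trans (h₃ m)

/-- A morphism between locally constant sheaves on a connected scheme which vanishes at one
geometric point vanishes. -/
lemma eq_zero_of_stalk_map [ConnectedSpace X] (hA : IsLC A) (hB : IsLC B) (θ : A ⟶ B)
    {Ω : Type u} [Field Ω] [IsSepClosed Ω] (x : Spec (.of Ω) ⟶ X)
    (hx : ∀ t, ((stalk x).map θ).hom t = 0) : θ = 0 := by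
  -- The locus `Z` where `θ` vanishes is open by definition, and closed because over a common
  -- trivialization `θ` is a constant homomorphism of groups.
  let Z : Set X := {p | ∃ U : X.Etale, p ∈ Set.range (str U) ∧ ∀ (V : X.Etale) (_ : V ⟶ U) s,
    mor θ V s = 0}
  have key (U : X.Etale) {M N : Type u} [AddCommGroup M] [AddCommGroup N] (φ : M →+ Sec A U)
      (ψ : N →+ Sec B U) (ρ : M →+ N) (hφ : IsTriv A U φ) (hψ : IsTriv B U ψ)
      (h : ∀ m, mor θ U (φ m) = ψ (ρ m)) (Ω : Type u) [Field Ω] [IsSepClosed Ω]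
      (x : Spec (.of Ω) ⟶ X) (u : Lift x U) (hx : ∀ t, ((stalk x).map θ).hom t = 0)
      (V : X.Etale) (a : V ⟶ U) (s : Sec A V) : mor θ V s = 0 := by
    have h₁ (m : M) : ρ m = 0 := hψ.eq_zero_of_germ u (by rw [← h, ← germ_mor, hx])
    refine sec_ext_germ fun Ω _ _ y v => ?_
    obtain ⟨m, hm⟩ := hφ.exists_germ_eq (Lift.map y a v) (germ y A V v s)
    rw [← germ_mor, ← hm, germ_mor, h, h₁, map_zero, germ_zero, germ_zero]
  have hZ : IsClopen Z := by
    refine ⟨⟨?_⟩, ?_⟩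
    · rw [isOpen_iff_mem_nhds]
      intro p hp
      obtain ⟨U, hU, M, N, _, _, -, -, φ, ψ, ρ, hφ, hψ, h⟩ := exists_triv_hom hA hB θ p
      refine Filter.mem_of_superset ((isOpen_range_str U).mem_nhds hU) ?_
      rintro _ ⟨q, rfl⟩ ⟨U', ⟨q', hq'⟩, h'⟩
      obtain ⟨Ω, _, _, x, u, rfl⟩ := exists_geomPoint q
      obtain ⟨u', -⟩ := exists_lift (U := U') x (q := q')
        (hq'.trans (congrArg (· default) (Lift.pt_str x u)))
      refine hp ⟨U, hU, key U φ ψ ρ hφ hψ h Ω x u fun t => ?_⟩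
      obtain ⟨W, w, s, rfl⟩ := exists_germ x t
      obtain ⟨V, v, a, b, rfl, -⟩ := exists_common_nbhd x w u'
      rw [← germ_res, germ_mor, h' V b, germ_zero]
    · rw [isOpen_iff_mem_nhds]
      rintro p ⟨U, hU, h⟩
      refine Filter.mem_of_superset ((isOpen_range_str U).mem_nhds hU) fun q hq => ⟨U, hq, h⟩
  have hne : Z.Nonempty := by
    obtain ⟨U, ⟨q, hq⟩, M, N, _, _, -, -, φ, ψ, ρ, hφ, hψ, h⟩ := exists_triv_hom hA hB θ (x default)
    obtain ⟨u, -⟩ := exists_lift x hq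
    exact ⟨x default, U, ⟨q, hq⟩, key U φ ψ ρ hφ hψ h Ω x u hx⟩
  have huniv := hZ.eq_univ hne
  refine mor_hom_ext fun U s => sec_ext_germ fun Ω _ _ y u => ?_
  obtain ⟨V, ⟨q, hq⟩, h⟩ : y default ∈ Z := huniv ▸ trivial
  obtain ⟨v, -⟩ := exists_lift y hq
  obtain ⟨W, w, a, b, rfl, -⟩ := exists_common_nbhd y u v
  rw [← germ_res, ← mor_res, h W b, mor_zero, germ_zero, germ_zero]

/-- Cokernels of locally constant sheaves are locally constant. -/
lemma IsLC.cokernel (hA : IsLC A) (hB : IsLC B) (θ : A ⟶ B) : IsLC (cokernel θ) := fun p => by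
  obtain ⟨U, hU, M, N, _, _, _, _, φ, ψ, ρ, hφ, hψ, h⟩ := exists_triv_hom hA hB θ p
  let π : B ⟶ Limits.cokernel θ := cokernel.π θ
  have hπ : θ ≫ π = 0 := cokernel.condition θ
  let χ : N ⧸ ρ.range →+ Sec (Limits.cokernel θ) U :=
    QuotientAddGroup.lift _ ((mor π U).comp ψ) fun n ⟨m, hm⟩ => by
      change mor π U (ψ n) = 0
      rw [← hm, ← h, ← mor_comp, hπ, mor_zero]
  refine ⟨U, hU, N ⧸ ρ.range, inferInstance, inferInstance, χ, fun Ω _ _ x u => ⟨?_, fun t => ?_⟩⟩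
  · rw [show (fun m => germ x _ U u (χ m)) = ⇑((AddMonoidHom.mk' (germ x _ U u)
      (germ_add x u)).comp χ) from rfl, injective_iff_map_eq_zero]
    intro n hn
    obtain ⟨n, rfl⟩ := QuotientAddGroup.mk_surjective n
    have hn : germ x _ U u (mor π U (ψ n)) = 0 := hn
    rw [← germ_mor] at hn
    have hex : ((ShortComplex.mk θ π hπ).map (stalk x)).Exact :=
      (ShortComplex.exact_of_g_is_cokernel (ShortComplex.mk θ π hπ)
        (cokernelIsCokernel θ)).map (stalk x)
    rw [ShortComplex.ab_exact_iff] at hex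
    obtain ⟨t, ht⟩ := hex _ hn
    obtain ⟨m, hm⟩ := hφ.exists_germ_eq u t
    refine (QuotientAddGroup.eq_zero_iff _).2 ⟨m, (hψ Ω _ _ x u).1 ?_⟩
    change germ x B U u _ = germ x B U u _
    rw [← h, ← germ_mor, hm]
    exact ht
  · have hepi : Epi ((stalk x).map π) := inferInstance
    obtain ⟨t, rfl⟩ := (AddCommGrpCat.epi_iff_surjective _).1 hepi t
    obtain ⟨n, hn⟩ := hψ.exists_germ_eq u t
    refine ⟨QuotientAddGroup.mk n, ?_⟩
    change germ x _ U u (mor π U (ψ n)) = _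
    rw [← germ_mor, hn]

/-- Finite sums of locally constant sheaves are locally constant. -/
lemma IsLC.directSum (hA : IsLC A) {d : ℕ} (ι : Fin d → (A ⟶ B)) (π : Fin d → (B ⟶ A))
    (hself : ∀ i, ι i ≫ π i = 𝟙 A) (hne : ∀ i j, i ≠ j → ι i ≫ π j = 0)
    (htotal : ∑ i, π i ≫ ι i = 𝟙 B) : IsLC B := fun p => by
  obtain ⟨U, hU, M, _, _, φ, hφ⟩ := hA p
  let χ : (Fin d → M) →+ Sec B U :=
    ∑ i, ((mor (ι i) U).comp φ).comp (Pi.evalAddMonoidHom (fun _ => M) i)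
  have hχ (n : Fin d → M) : χ n = ∑ i, mor (ι i) U (φ (n i)) := by
    simp [χ, AddMonoidHom.finsetSum_apply]
  have hπ (n : Fin d → M) (j : Fin d) : mor (π j) U (χ n) = φ (n j) := by
    rw [hχ, map_sum, Finset.sum_eq_single j]
    · rw [← mor_comp, hself, mor_id]
    · intro i _ hij
      rw [← mor_comp, hne i j hij, mor_zero]
    · simp
  refine ⟨U, hU, Fin d → M, inferInstance, inferInstance, χ, fun Ω _ _ x u => ⟨?_, fun t => ?_⟩⟩
  · intro n n' h
    funext j
    apply (hφ Ω _ _ x u).1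
    change germ x A U u _ = germ x A U u _
    rw [← hπ, ← hπ, ← germ_mor, ← germ_mor]
    exact congrArg _ h
  · choose n hn using fun i => hφ.exists_germ_eq u (((stalk x).map (π i)).hom t)
    refine ⟨n, ?_⟩
    have h₁ : 𝟙 B = ∑ i, π i ≫ ι i := htotal.symm
    have h₂ : t = ((stalk x).map (∑ i, π i ≫ ι i)).hom t := by
      rw [← h₁]
      exact (congrArg (fun χ => χ.hom t) ((stalk x).map_id _)).symm
    obtain ⟨V, v, s, rfl⟩ := exists_germ x t
    obtain ⟨W, w, a, b, rfl, rfl⟩ := exists_common_nbhd x u v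
    rw [h₂, germ_mor]
    have h₃ : mor (∑ i, π i ≫ ι i) V s = ∑ i, mor (ι i) V (mor (π i) V s) := by
      have (S : Finset (Fin d)) : mor (∑ i ∈ S, π i ≫ ι i) V s =
          ∑ i ∈ S, mor (ι i) V (mor (π i) V s) := by
        classical
        induction S using Finset.induction_on with
        | empty => simp
        | insert i S hi ih => rw [Finset.sum_insert hi, Finset.sum_insert hi, mor_add, ih, mor_comp]
      exact this _
    rw [h₃]
    change germ x _ U _ (χ n) = _
    rw [hχ]
    let g {U : X.Etale} (u : Lift x U) : Sec B U →+ _ :=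
      AddMonoidHom.mk' (germ x B U u) (germ_add x u)
    change g _ _ = g _ _
    rw [map_sum, map_sum]
    refine Finset.sum_congr rfl fun i _ => ?_
    change germ x _ U _ _ = germ x _ V _ _
    rw [← germ_mor, hn, germ_mor, germ_mor]

end Vanishing

/-! ### The coefficient rings -/

section Coefficients

variable {ℓ : ℕ} [Fact ℓ.Prime]
variable (E : IntermediateField ℚ_[ℓ] (PadicAlgCl ℓ))

lemma dvd_of_norm_le {a b : valRing E} (hb : b ≠ 0)
    (h : ‖(a : PadicAlgCl ℓ)‖ ≤ ‖(b : PadicAlgCl ℓ)‖) : b ∣ a := by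
  have hb' : (b : PadicAlgCl ℓ) ≠ 0 := fun h => hb (Subtype.ext h)
  refine ⟨⟨a / b, E.div_mem a.2.1 b.2.1, ?_⟩, Subtype.ext ?_⟩
  · rw [norm_div]
    exact div_le_one_of_le₀ h (norm_nonneg _)
  · change (a : PadicAlgCl ℓ) = b * (a / b)
    field_simp

lemma isUnit_of_norm_eq_one {a : valRing E} (h : ‖(a : PadicAlgCl ℓ)‖ = 1) : IsUnit a :=
  isUnit_of_dvd_one (dvd_of_norm_le E (fun h' => by simp [h'] at h) (by simp [h]))

variable [FiniteDimensional ℚ_[ℓ] E]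

lemma isCompact_valRing : IsCompact (valRing E : Set (PadicAlgCl ℓ)) := by
  let S : Submodule ℚ_[ℓ] (PadicAlgCl ℓ) := E.toSubalgebra.toSubmodule
  have : FiniteDimensional ℚ_[ℓ] S := ‹FiniteDimensional ℚ_[ℓ] E›
  have : ProperSpace S := FiniteDimensional.proper ℚ_[ℓ] S
  have h := (isCompact_closedBall (0 : S) 1).image continuous_subtype_val
  convert h using 1
  ext a
  simp only [Set.mem_image, mem_closedBall_zero_iff, Subtype.exists]
  exact ⟨fun ha => ⟨a, ha.1, ha.2, rfl⟩, fun ⟨b, hb, hb', e⟩ => e ▸ ⟨hb, hb'⟩⟩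

lemma norm_ell : ‖(ℓ : PadicAlgCl ℓ)‖ = (ℓ : ℝ)⁻¹ := by
  have := PadicAlgCl.norm_extends ℓ (ℓ : ℚ_[ℓ])
  rw [Padic.norm_p] at this
  rw [← this]
  simp

lemma norm_ell_lt_one : ‖(ℓ : PadicAlgCl ℓ)‖ < 1 := by
  rw [norm_ell]
  exact inv_lt_one_of_one_lt₀ (by exact_mod_cast (Fact.out : ℓ.Prime).one_lt)

lemma ell_ne_zero : (ℓ : PadicAlgCl ℓ) ≠ 0 := by
  exact_mod_cast (Fact.out : ℓ.Prime).ne_zero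

/-- The maximal ideal is principal: an element of maximal norm generates it. -/
lemma exists_uniformizer : ∃ ϖ : valRing E, ϖ ≠ 0 ∧ ‖(ϖ : PadicAlgCl ℓ)‖ < 1 ∧
    ∀ a : valRing E, ‖(a : PadicAlgCl ℓ)‖ < 1 → ‖(a : PadicAlgCl ℓ)‖ ≤ ‖(ϖ : PadicAlgCl ℓ)‖ := by
  have hc : IsCompact ((valRing E : Set (PadicAlgCl ℓ)) ∩ Metric.ball 0 1) :=
    (isCompact_valRing E).inter_right (IsUltrametricDist.isClosed_ball 0 1)
  have hmem : (ℓ : PadicAlgCl ℓ) ∈ ((valRing E : Set (PadicAlgCl ℓ)) ∩ Metric.ball 0 1) :=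
    ⟨natCast_mem (valRing E) ℓ, by simpa using norm_ell_lt_one⟩
  obtain ⟨ϖ, ⟨h₁, h₂⟩, h₃⟩ := hc.exists_isMaxOn ⟨_, hmem⟩ continuous_norm.continuousOn
  refine ⟨⟨ϖ, h₁⟩, fun h => ?_, by simpa using h₂, fun a ha => h₃ ⟨a.2, by simpa using ha⟩⟩
  have h₄ : ϖ = 0 := congrArg Subtype.val h
  have h₅ : ‖(ℓ : PadicAlgCl ℓ)‖ ≤ ‖ϖ‖ := h₃ hmem
  rw [h₄, norm_zero, norm_le_zero_iff] at h₅
  exact ell_ne_zero h₅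

/-- A generator of the maximal ideal. -/
def unif : valRing E := (exists_uniformizer E).choose

lemma unif_ne_zero : unif E ≠ 0 := (exists_uniformizer E).choose_spec.1

lemma norm_unif_lt_one : ‖(unif E : PadicAlgCl ℓ)‖ < 1 := (exists_uniformizer E).choose_spec.2.1

lemma norm_unif_pos : 0 < ‖(unif E : PadicAlgCl ℓ)‖ :=
  norm_pos_iff.2 fun h => unif_ne_zero E (Subtype.ext h)

lemma norm_le_norm_unif {a : valRing E} (h : ‖(a : PadicAlgCl ℓ)‖ < 1) :
    ‖(a : PadicAlgCl ℓ)‖ ≤ ‖(unif E : PadicAlgCl ℓ)‖ :=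
  (exists_uniformizer E).choose_spec.2.2 a h

lemma maxIdeal_eq_span : maxIdeal E = Ideal.span {unif E} := by
  ext a
  rw [Ideal.mem_span_singleton]
  constructor
  · exact fun h => dvd_of_norm_le E (unif_ne_zero E) (norm_le_norm_unif E h)
  · rintro ⟨b, rfl⟩
    exact (maxIdeal E).mul_mem_right b (norm_unif_lt_one E)

lemma mem_maxIdeal_pow_iff (n : ℕ) (a : valRing E) :
    a ∈ maxIdeal E ^ n ↔ ‖(a : PadicAlgCl ℓ)‖ ≤ ‖(unif E : PadicAlgCl ℓ)‖ ^ n := by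
  rw [maxIdeal_eq_span, Ideal.span_singleton_pow, Ideal.mem_span_singleton]
  constructor
  · rintro ⟨b, rfl⟩
    simp only [Subring.coe_mul, SubmonoidClass.coe_pow, norm_mul, norm_pow]
    exact mul_le_of_le_one_right (by positivity) b.2.2
  · exact fun h => dvd_of_norm_le E (pow_ne_zero _ (unif_ne_zero E)) (by simpa using h)

instance : IsDiscreteValuationRing (valRing E) := by
  refine IsDiscreteValuationRing.ofHasUnitMulPowIrreducibleFactorization ⟨unif E, ⟨?_, ?_⟩, ?_⟩
  · rintro ⟨u, hu⟩
    have h₁ := congrArg (fun a : valRing E => ‖(a : PadicAlgCl ℓ)‖) (u.mul_inv)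
    simp only [Subring.coe_mul, norm_mul, Subring.coe_one, norm_one, hu] at h₁
    have h₂ := (u⁻¹ : (valRing E)ˣ).1.2.2
    have h₃ := norm_unif_lt_one E
    nlinarith [norm_nonneg (unif E : PadicAlgCl ℓ)]
  · intro a b hab
    by_contra! h
    have ha : ‖(a : PadicAlgCl ℓ)‖ < 1 :=
      lt_of_le_of_ne a.2.2 fun h' => h.1 (isUnit_of_norm_eq_one E h')
    have hb : ‖(b : PadicAlgCl ℓ)‖ < 1 :=
      lt_of_le_of_ne b.2.2 fun h' => h.2 (isUnit_of_norm_eq_one E h')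
    have h₁ := congrArg (fun a : valRing E => ‖(a : PadicAlgCl ℓ)‖) hab
    simp only [Subring.coe_mul, norm_mul] at h₁
    have h₂ := norm_le_norm_unif E ha
    have h₃ := norm_unif_pos E
    nlinarith [norm_nonneg (b : PadicAlgCl ℓ)]
  · intro a ha
    have ha' : 0 < ‖(a : PadicAlgCl ℓ)‖ := norm_pos_iff.2 fun h => ha (Subtype.ext h)
    obtain ⟨n, h₁, h₂⟩ := exists_nat_pow_near_of_lt_one ha' a.2.2 (norm_unif_pos E)
      (norm_unif_lt_one E)
    obtain ⟨b, hb⟩ := dvd_of_norm_le E (a := a) (b := unif E ^ n)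
      (pow_ne_zero _ (unif_ne_zero E)) (by simpa using h₂)
    refine ⟨n, ?_⟩
    have h₃ : IsUnit b := by
      apply isUnit_of_norm_eq_one
      by_contra h
      have hb' := norm_le_norm_unif E (lt_of_le_of_ne b.2.2 h)
      rw [hb, Subring.coe_mul, SubmonoidClass.coe_pow, norm_mul, norm_pow, pow_succ] at h₁
      exact absurd (h₁.trans_le (mul_le_mul_of_nonneg_left hb' (by positivity))) (lt_irrefl _)
    obtain ⟨u, rfl⟩ := h₃
    exact ⟨u, hb.symm⟩

/-- `𝒪_E` is complete for the topology of its maximal ideal. -/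
instance : IsPrecomplete (maxIdeal E) (valRing E) where
  prec' f hf := by
    have hf' (m n : ℕ) (h : m ≤ n) : ‖(f n - f m : PadicAlgCl ℓ)‖ ≤
        ‖(unif E : PadicAlgCl ℓ)‖ ^ m := by
      have := (hf h).symm
      rw [SModEq.sub_mem, smul_eq_mul, Ideal.mul_top, mem_maxIdeal_pow_iff] at this
      exact this
    obtain ⟨a, ha, φ, hφ, hlim⟩ := (isCompact_valRing E).tendsto_subseq (x := fun n => (f n : PadicAlgCl ℓ))
      fun n => (f n).2
    refine ⟨⟨a, ha⟩, fun n => ?_⟩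
    rw [SModEq.sub_mem, smul_eq_mul, Ideal.mul_top, mem_maxIdeal_pow_iff]
    change ‖(f n - a : PadicAlgCl ℓ)‖ ≤ _
    rw [norm_sub_rev]
    refine le_of_tendsto ((hlim.sub_const (f n : PadicAlgCl ℓ)).norm) ?_
    filter_upwards [Filter.eventually_ge_atTop n] with k hk
    exact hf' n (φ k) (hk.trans (hφ.id_le k))

end Coefficients

section Nakayama

variable {R : Type*} [CommRing R] {I : Ideal R} [IsPrecomplete I R]

instance (r : ℕ) : IsPrecomplete I (Fin r → R) where
  prec' f hf := by
    have key (n : ℕ) (v : Fin r → R) (h : v ∈ (I ^ n • ⊤ : Submodule R (Fin r → R))) (i : Fin r) :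
        v i ∈ (I ^ n • ⊤ : Submodule R R) := by
      have := Submodule.mem_map_of_mem (f := LinearMap.proj (R := R) (φ := fun _ : Fin r => R) i) h
      rw [Submodule.map_smul''] at this
      exact Submodule.smul_mono le_rfl le_top this
    have h (i : Fin r) : ∃ a : R, ∀ n, f n i ≡ a [SMOD (I ^ n • ⊤ : Submodule R R)] := by
      refine IsPrecomplete.prec ‹_› fun {m n} hmn => ?_
      rw [SModEq.sub_mem]
      exact key m (f m - f n) (SModEq.sub_mem.1 (hf hmn)) i
    choose a ha using h
    refine ⟨a, fun n => ?_⟩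
    rw [SModEq.sub_mem]
    have : f n - a = ∑ i, (f n i - a i) • Pi.single (M := fun _ => R) i (1 : R) := by
      funext j
      simp [Finset.sum_apply, Pi.single_apply]
    rw [this]
    refine Submodule.sum_mem _ fun i _ => Submodule.smul_mem_smul ?_ trivial
    have := SModEq.sub_mem.1 (ha i n)
    rwa [smul_eq_mul, Ideal.mul_top] at this

/-- Nakayama's lemma over a complete ring: generators modulo `I` are generators. -/
lemma surjective_of_complete {M : Type*} [AddCommGroup M] [Module R M] [IsHausdorff I M] {r : ℕ}
    (t : Fin r → M) (h : ∀ m : M, ∃ c : Fin r → R, m - ∑ i, c i • t i ∈ (I • ⊤ : Submodule R M)) :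
    Submodule.span R (Set.range t) = ⊤ := by
  have : Function.Surjective (Fintype.linearCombination R t) := by
    apply surjective_of_mkQ_comp_surjective (I := I)
    intro q
    obtain ⟨m, rfl⟩ := Submodule.mkQ_surjective _ q
    obtain ⟨c, hc⟩ := h m
    refine ⟨c, ?_⟩
    rw [LinearMap.comp_apply, eq_comm, ← sub_eq_zero, ← map_sub, Submodule.mkQ_apply,
      Submodule.Quotient.mk_eq_zero]
    exact hc
  rw [← Fintype.range_linearCombination]
  exact LinearMap.range_eq_top.2 this

end Nakayama

section Extension

variable {ℓ : ℕ} [Fact ℓ.Prime]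
variable {E L : IntermediateField ℚ_[ℓ] (PadicAlgCl ℓ)} [FiniteDimensional ℚ_[ℓ] E]
  [FiniteDimensional ℚ_[ℓ] L]

/-- `𝒪_L` is a finite free `𝒪_E`-module. -/
lemma exists_basis_valRing (h : E ≤ L) :
    letI := (valRingIncl h).toAlgebra
    ∃ d : ℕ, Nonempty (Module.Basis (Fin d) (valRing E) (valRing L)) := by
  let := (valRingIncl h).toAlgebra
  have hsmul (a : valRing E) (b : valRing L) :
      ((a • b : valRing L) : PadicAlgCl ℓ) = (a : PadicAlgCl ℓ) * b := rfl
  -- `𝒪_L` is separated for the `π_E`-adic topology and finite modulo `π_E` by compactness, hence finite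
  -- over the complete ring `𝒪_E`; being torsion-free, it is free.
  have hpow (n : ℕ) (b : valRing L) (hb : b ∈ (maxIdeal E ^ n • ⊤ : Submodule (valRing E) (valRing L))) :
      ‖(b : PadicAlgCl ℓ)‖ ≤ ‖(unif E : PadicAlgCl ℓ)‖ ^ n := by
    rw [maxIdeal_eq_span, Ideal.span_singleton_pow, Submodule.ideal_span_singleton_smul] at hb
    obtain ⟨c, -, rfl⟩ := hb
    change ‖((((unif E) ^ n • c : valRing L)) : PadicAlgCl ℓ)‖ ≤ _
    rw [hsmul, norm_mul, SubmonoidClass.coe_pow, norm_pow]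
    exact mul_le_of_le_one_right (by positivity) c.2.2
  have : IsHausdorff (maxIdeal E) (valRing L) := ⟨fun b hb => by
    have h₁ (n : ℕ) : ‖(b : PadicAlgCl ℓ)‖ ≤ ‖(unif E : PadicAlgCl ℓ)‖ ^ n := by
      have := hb n
      rw [SModEq.sub_mem, sub_zero] at this
      exact hpow n b this
    have h₂ : ‖(b : PadicAlgCl ℓ)‖ ≤ 0 := ge_of_tendsto'
      (tendsto_pow_atTop_nhds_zero_of_lt_one (norm_nonneg _) (norm_unif_lt_one E)) h₁
    exact Subtype.ext (norm_le_zero_iff.1 h₂)⟩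
  have hfin : Module.Finite (valRing E) (valRing L) := by
    obtain ⟨T, hT, hcover⟩ := (isCompact_valRing L).elim_nhds_subcover
      (fun b => Metric.closedBall b ‖(unif E : PadicAlgCl ℓ)‖)
      (fun b _ => Metric.closedBall_mem_nhds b (norm_unif_pos E))
    let t (i : Fin T.card) : valRing L := ⟨T.equivFin.symm i, hT _ (T.equivFin.symm i).2⟩
    rw [Module.finite_def, ← surjective_of_complete (I := maxIdeal E) t fun m => ?_]
    · exact Submodule.fg_span (Set.finite_range t)
    · obtain ⟨b, hb, hmb⟩ := Set.mem_iUnion₂.1 (hcover m.2)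
      refine ⟨Pi.single (T.equivFin ⟨b, hb⟩) 1, ?_⟩
      rw [Finset.sum_eq_single (T.equivFin ⟨b, hb⟩) (fun j _ hj => by simp [hj]) (by simp),
        Pi.single_eq_same, one_smul]
      have h₁ : valRingIncl h (unif E) ∣ m - t (T.equivFin ⟨b, hb⟩) := by
        refine dvd_of_norm_le L (fun h' => unif_ne_zero E (Subtype.ext (congrArg (fun c : valRing L => (c : PadicAlgCl ℓ)) h'))) ?_
        simp only [t, Equiv.symm_apply_apply]
        rw [mem_closedBall_iff_norm] at hmb
        exact hmb
      obtain ⟨c, hc⟩ := h₁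
      rw [hc]
      exact Submodule.smul_mem_smul (M := valRing L) (r := unif E) (norm_unif_lt_one E) trivial
  have htf : Module.IsTorsionFree (valRing E) (valRing L) := by
    rw [Module.isTorsionFree_iff_algebraMap_injective]
    exact fun a b hab => Subtype.ext (congrArg (fun c : valRing L => (c : PadicAlgCl ℓ)) hab)
  have : Module.Free (valRing E) (valRing L) := inferInstance
  exact ⟨_, ⟨Module.finBasis _ _⟩⟩

end Extension

/-! ### Extension of scalars and fractions -/

section Fractions

variable {𝒞 : Type u} [Category.{v} 𝒞] {W : MorphismProperty 𝒞}

lemma isInvertedBy_multiplicativeClosure {𝒟 : Type u'} [Category.{v'} 𝒟] {F : 𝒞 ⥤ 𝒟}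
    (hF : W.IsInvertedBy F) : W.multiplicativeClosure.IsInvertedBy F := fun X Y s hs => by
  induction hs with
  | of s hs => exact hF s hs
  | id X => rw [F.map_id]; infer_instance
  | comp_of s t _ ht ih => have := hF t ht; rw [F.map_comp]; infer_instance

instance : W.Q.IsLocalization W.multiplicativeClosure :=
  Functor.IsLocalization.mk' _ _
    { inverts := isInvertedBy_multiplicativeClosure W.Q_inverts
      lift := fun F hF => Localization.Construction.lift F fun _ _ s hs => hF s (.of s hs)
      fac := fun _ _ => Localization.Construction.fac _ _
      uniq := fun _ _ h => Localization.Construction.uniq _ _ h }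
    { inverts := isInvertedBy_multiplicativeClosure W.Q_inverts
      lift := fun F hF => Localization.Construction.lift F fun _ _ s hs => hF s (.of s hs)
      fac := fun _ _ => Localization.Construction.fac _ _
      uniq := fun _ _ h => Localization.Construction.uniq _ _ h }

/-- The Ore conditions can be verified on generators. -/
lemma hasLeftCalculusOfFractions_multiplicativeClosure
    (h₁ : ∀ {X Y Z : 𝒞} (s : X ⟶ Y) (f : X ⟶ Z), W s →
      ∃ (T : 𝒞) (s' : Z ⟶ T) (f' : Y ⟶ T), W.multiplicativeClosure s' ∧ f ≫ s' = s ≫ f')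
    (h₂ : ∀ {X Y Z : 𝒞} (s : X ⟶ Y) (f g : Y ⟶ Z), W s → s ≫ f = s ≫ g →
      ∃ (T : 𝒞) (t : Z ⟶ T), W.multiplicativeClosure t ∧ f ≫ t = g ≫ t) :
    W.multiplicativeClosure.HasLeftCalculusOfFractions where
  exists_leftFraction X Y φ := by
    suffices H : ∀ {X Y : 𝒞} (s : X ⟶ Y), W.multiplicativeClosure s → ∀ (Z : 𝒞) (f : X ⟶ Z),
        ∃ (T : 𝒞) (s' : Z ⟶ T) (f' : Y ⟶ T), W.multiplicativeClosure s' ∧ f ≫ s' = s ≫ f' by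
      obtain ⟨T, s', f', hs', h⟩ := H φ.s φ.hs _ φ.f
      exact ⟨⟨f', s', hs'⟩, h⟩
    intro X Y s hs
    induction hs with
    | of s hs => exact fun Z f => h₁ s f hs
    | id X => exact fun Z f => ⟨Z, 𝟙 Z, f, .id Z, by simp⟩
    | comp_of s t hs ht ih =>
      intro Z f
      obtain ⟨T, s', f', hs', h⟩ := ih Z f
      obtain ⟨T', s'', f'', hs'', h'⟩ := h₁ t f' ht
      refine ⟨T', s' ≫ s'', f'', W.multiplicativeClosure.comp_mem _ _ hs' hs'', ?_⟩
      rw [← Category.assoc, h, Category.assoc, h', Category.assoc]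
  ext X' X Y f g s hs h := by
    suffices H : ∀ {X Y : 𝒞} (s : X ⟶ Y), W.multiplicativeClosure s → ∀ (Z : 𝒞) (f g : Y ⟶ Z),
        s ≫ f = s ≫ g → ∃ (T : 𝒞) (t : Z ⟶ T), W.multiplicativeClosure t ∧ f ≫ t = g ≫ t by
      obtain ⟨T, t, ht, h'⟩ := H s hs _ f g h
      exact ⟨T, t, ht, h'⟩
    intro X Y s hs
    induction hs with
    | of s hs => exact fun Z f g => h₂ s f g hs
    | id X => exact fun Z f g h => ⟨Z, 𝟙 Z, .id Z, by simpa using h⟩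
    | comp_of s t hs ht ih =>
      intro Z f g h
      obtain ⟨T, r, hr, h'⟩ := ih _ (t ≫ f) (t ≫ g) (by simpa using h)
      obtain ⟨T', r', hr', h''⟩ := h₂ t (f ≫ r) (g ≫ r) ht (by simpa using h')
      exact ⟨T', r ≫ r', W.multiplicativeClosure.comp_mem _ _ hr hr', by simpa using h''⟩

end Fractions

section ExtensionOfScalars

variable {𝒜 : Type u} [Category.{v} 𝒜]

lemma IsExtensionOfScalars.hom_ext [Preadditive 𝒜] {R S : Type} [CommRing R] [CommRing S]
    {ι : R →+* S} {I : Ideal S} {A B : 𝒜} {α : R →+* End A} {β : S →+* End B} {f : A ⟶ B}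
    (hf : IsExtensionOfScalars ι I α β f) (hα : ∀ a : R, (α a : A ⟶ A) ≫ f = f ≫ (β (ι a) : B ⟶ B))
    {H : 𝒜} (θ : S →+* End H)
    (hθ : ∀ a ∈ I, θ a = 0) {ψ ψ' : B ⟶ H}
    (hψ : ∀ a : S, (β a : B ⟶ B) ≫ ψ = ψ ≫ (θ a : H ⟶ H))
    (hψ' : ∀ a : S, (β a : B ⟶ B) ≫ ψ' = ψ' ≫ (θ a : H ⟶ H)) (h : f ≫ ψ = f ≫ ψ') : ψ = ψ' :=
  (hf H θ hθ (f ≫ ψ) fun a => by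
    rw [← Category.assoc, hα, Category.assoc, Category.assoc, hψ]).unique ⟨hψ, rfl⟩ ⟨hψ', h.symm⟩

variable [Abelian 𝒜]

/-- The tensor product with a finite free extension of rings, as a finite sum of copies. -/
lemma exists_extension_of_basis {R S : Type} [CommRing R] [CommRing S] [Algebra R S] {d : ℕ}
    (b : Module.Basis (Fin d) R S) {A : 𝒜} (α : R →+* End A) :
    ∃ (P : 𝒜) (β : S →+* End P) (ι : A ⟶ P) (π : Fin d → (P ⟶ A)),
      (∀ a : R, (α a : A ⟶ A) ≫ ι = ι ≫ (β (algebraMap R S a) : P ⟶ P)) ∧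
      IsExtensionOfScalars (algebraMap R S) ⊥ α β ι ∧
      (∀ i, (ι ≫ (β (b i) : P ⟶ P)) ≫ π i = 𝟙 A) ∧
      (∀ i j, i ≠ j → (ι ≫ (β (b i) : P ⟶ P)) ≫ π j = 0) ∧
      ∑ i, π i ≫ (ι ≫ (β (b i) : P ⟶ P)) = 𝟙 P := by
  have : HasFiniteBiproducts 𝒜 := Abelian.hasFiniteBiproducts
  let A' : Fin d → 𝒜 := fun _ => A
  -- `S` acts on the sum of `d` copies of `A` through its regular representation on `R^d`.
  let M : S →ₐ[R] Matrix (Fin d) (Fin d) R := Algebra.leftMulMatrix b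
  let β₀ (s : S) : ⨁ A' ⟶ ⨁ A' := biproduct.matrix fun j i => (α (M s i j) : A ⟶ A)
  have αsum (S : Finset (Fin d)) (c : Fin d → R) : (α (∑ k ∈ S, c k) : A ⟶ A) =
      ∑ k ∈ S, (α (c k) : A ⟶ A) := map_sum α c S
  have αmul (a a' : R) : (α a : A ⟶ A) ≫ α a' = α (a * a') := by rw [mul_comm, map_mul]; rfl
  let β : S →+* End (⨁ A') :=
    { toFun := β₀
      map_one' := by
        refine biproduct.hom_ext' _ _ fun j => biproduct.hom_ext _ _ fun i => ?_
        change (biproduct.ι A' j ≫ β₀ 1) ≫ _ = (biproduct.ι A' j ≫ 𝟙 _) ≫ _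
        simp only [β₀, Category.assoc, biproduct.matrix_π, biproduct.ι_desc, map_one, Category.comp_id]
        by_cases h : i = j
        · subst h
          rw [Matrix.one_apply_eq, map_one, biproduct.ι_π_self]
          rfl
        · rw [Matrix.one_apply_ne h, map_zero, biproduct.ι_π_ne _ (Ne.symm h)]
      map_mul' := fun s t => by
        refine biproduct.hom_ext' _ _ fun j => biproduct.hom_ext _ _ fun i => ?_
        change (biproduct.ι A' j ≫ β₀ (s * t)) ≫ _ = (biproduct.ι A' j ≫ β₀ t ≫ β₀ s) ≫ _
        simp only [β₀, Category.assoc, biproduct.matrix_π, biproduct.ι_desc, map_mul,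
          biproduct.ι_matrix_assoc, biproduct.lift_desc, Matrix.mul_apply, αsum]
        exact Finset.sum_congr rfl fun k _ => rfl
      map_zero' := by
        refine biproduct.hom_ext' _ _ fun j => biproduct.hom_ext _ _ fun i => ?_
        change (biproduct.ι A' j ≫ β₀ 0) ≫ _ = (biproduct.ι A' j ≫ (0 : ⨁ A' ⟶ ⨁ A')) ≫ _
        simp only [β₀, Category.assoc, biproduct.matrix_π, biproduct.ι_desc, map_zero, zero_comp, comp_zero,
          Matrix.zero_apply]
      map_add' := fun s t => by
        refine biproduct.hom_ext' _ _ fun j => biproduct.hom_ext _ _ fun i => ?_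
        change (biproduct.ι A' j ≫ β₀ (s + t)) ≫ _ = (biproduct.ι A' j ≫ (β₀ s + β₀ t)) ≫ _
        simp only [β₀, Category.assoc, biproduct.matrix_π, biproduct.ι_desc, map_add, Preadditive.add_comp,
          Preadditive.comp_add, Matrix.add_apply] }
  -- `vec s` is `a ↦ a ⊗ s`.
  let vec (s : S) : A ⟶ ⨁ A' := biproduct.lift fun i => (α (b.repr s i) : A ⟶ A)
  have vec_β (s t : S) : vec s ≫ β₀ t = vec (t * s) := by
    refine biproduct.hom_ext _ _ fun i => ?_
    simp only [vec, β₀, Category.assoc, biproduct.matrix_π, biproduct.lift_desc, biproduct.lift_π,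
      αmul]
    rw [← αsum]
    congr 1
    rw [← Algebra.leftMulMatrix_mulVec_repr, Matrix.mulVec, dotProduct]
    exact Finset.sum_congr rfl fun k _ => mul_comm _ _
  have vec_basis (j : Fin d) : vec (b j) = biproduct.ι A' j := by
    refine biproduct.hom_ext _ _ fun i => ?_
    simp only [vec, biproduct.lift_π, Module.Basis.repr_self]
    by_cases h : i = j
    · subst h
      rw [Finsupp.single_eq_same, map_one, biproduct.ι_π_self]
      rfl
    · rw [Finsupp.single_eq_of_ne h, map_zero, biproduct.ι_π_ne _ (Ne.symm h)]
  have hβ (s : S) : (β s : ⨁ A' ⟶ ⨁ A') = β₀ s := rfl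
  have hι (j : Fin d) : vec 1 ≫ (β (b j) : ⨁ A' ⟶ ⨁ A') = biproduct.ι A' j := by
    rw [hβ, vec_β, mul_one, vec_basis]
  refine ⟨⨁ A', β, vec 1, biproduct.π A', fun a => ?_, ?_, fun i => ?_, fun i j h => ?_, ?_⟩
  · rw [hβ, vec_β, mul_one]
    refine biproduct.hom_ext _ _ fun i => ?_
    simp only [vec, Category.assoc, biproduct.lift_π, αmul]
    rw [Algebra.algebraMap_eq_smul_one, map_smul]
    rfl
  · intro H θ _ φ hφ
    have θmul (s t : S) : (θ s : H ⟶ H) ≫ θ t = θ (t * s) := by rw [map_mul]; rfl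
    have key (c : Fin d → R) : ∑ i, (α (c i) : A ⟶ A) ≫ φ ≫ (θ (b i) : H ⟶ H) =
        φ ≫ (θ (∑ i, c i • b i) : H ⟶ H) := by
      have : (θ (∑ i, c i • b i) : H ⟶ H) = ∑ i, (θ (c i • b i) : H ⟶ H) := map_sum θ _ _
      rw [this, Preadditive.comp_sum]
      refine Finset.sum_congr rfl fun i _ => ?_
      rw [← Category.assoc, hφ, Category.assoc, θmul, mul_comm, Algebra.smul_def]
    refine ⟨biproduct.desc fun i => φ ≫ (θ (b i) : H ⟶ H), ⟨fun s => ?_, ?_⟩, fun ψ hψ => ?_⟩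
    · refine biproduct.hom_ext' _ _ fun j => ?_
      rw [hβ]
      simp only [β₀, biproduct.ι_matrix_assoc, biproduct.lift_desc, biproduct.ι_desc_assoc]
      rw [key, Category.assoc, θmul]
      congr 2
      rw [← b.sum_repr (s * b j)]
      refine Finset.sum_congr rfl fun i _ => ?_
      rw [Algebra.leftMulMatrix_eq_repr_mul]
    · simp only [vec, biproduct.lift_desc]
      rw [key, b.sum_repr, map_one]
      exact Category.comp_id φ
    · refine biproduct.hom_ext' _ _ fun j => ?_
      rw [biproduct.ι_desc, ← hι, Category.assoc, hψ.1, ← Category.assoc, hψ.2]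
  · rw [hι, biproduct.ι_π_self]
  · rw [hι, biproduct.ι_π_ne _ h]
  · simp_rw [hι]
    exact biproduct.total

lemma IsExtensionOfScalars.trans {R S S' : Type} [CommRing R] [CommRing S] [CommRing S']
    {ι : R →+* S} {κ : S →+* S'} {I : Ideal S} {J : Ideal S'} {A B C : 𝒜} {α : R →+* End A}
    {β : S →+* End B} {γ : S' →+* End C} {f : A ⟶ B} {g : B ⟶ C}
    (hf : IsExtensionOfScalars ι I α β f) (hg : IsExtensionOfScalars κ J β γ g)
    (hIJ : ∀ a ∈ I, κ a ∈ J)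
    (hγ : ∀ a, (β a : B ⟶ B) ≫ g = g ≫ (γ (κ a) : C ⟶ C)) :
    IsExtensionOfScalars (κ.comp ι) J α γ (f ≫ g) := by
  intro H θ hθ φ hφ
  obtain ⟨ψ, ⟨h₁, h₂⟩, h₃⟩ := hf H (θ.comp κ) (fun a ha => hθ _ (hIJ a ha)) φ hφ
  obtain ⟨χ, ⟨h₄, h₅⟩, h₆⟩ := hg H θ hθ ψ h₁
  refine ⟨χ, ⟨h₄, by rw [Category.assoc, h₅, h₂]⟩, fun χ' hχ' => h₆ _ ⟨hχ'.1, h₃ _ ⟨fun a => ?_, ?_⟩⟩⟩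
  · rw [← Category.assoc, hγ, Category.assoc, hχ'.1, Category.assoc]
    rfl
  · rw [← hχ'.2, Category.assoc]

/-- Extensions of scalars are unique. -/
lemma IsExtensionOfScalars.exists_iso {R S : Type} [CommRing R] [CommRing S]
    {ι : R →+* S} {I : Ideal S} {A B B' : 𝒜} {α : R →+* End A} {β : S →+* End B}
    {β' : S →+* End B'} {f : A ⟶ B} {f' : A ⟶ B'}
    (hf : IsExtensionOfScalars ι I α β f) (hf' : IsExtensionOfScalars ι I α β' f')
    (hα : ∀ a : R, (α a : A ⟶ A) ≫ f = f ≫ (β (ι a) : B ⟶ B))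
    (hα' : ∀ a : R, (α a : A ⟶ A) ≫ f' = f' ≫ (β' (ι a) : B' ⟶ B'))
    (hβ : ∀ a ∈ I, β a = 0) (hβ' : ∀ a ∈ I, β' a = 0) :
    ∃ e : B ≅ B', (∀ a : S, (β a : B ⟶ B) ≫ e.hom = e.hom ≫ (β' a : B' ⟶ B')) ∧
      f ≫ e.hom = f' := by
  obtain ⟨ψ, ⟨h₁, h₂⟩, -⟩ := hf B' β' hβ' f' hα'
  obtain ⟨χ, ⟨h₃, h₄⟩, -⟩ := hf' B β hβ f hα
  refine ⟨⟨ψ, χ, ?_, ?_⟩, h₁, h₂⟩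
  · refine hf.hom_ext hα β hβ (fun a => ?_) (fun a => ?_) ?_
    · rw [← Category.assoc, h₁, Category.assoc, h₃, Category.assoc]
    · rw [Category.comp_id, Category.id_comp]
    · rw [← Category.assoc, h₂, h₄, Category.comp_id]
  · refine hf'.hom_ext hα' β' hβ' (fun a => ?_) (fun a => ?_) ?_
    · rw [← Category.assoc, h₃, Category.assoc, h₁, Category.assoc]
    · rw [Category.comp_id, Category.id_comp]
    · rw [← Category.assoc, h₄, h₂, Category.comp_id]

/-- The quotient of an object with an action of a ring by a principal ideal. -/
lemma exists_quotient {S : Type} [CommRing S] (a : S) {P : 𝒜} (β : S →+* End P) :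
    ∃ (γ : S →+* End (cokernel (β a : P ⟶ P))),
      (∀ s, (β s : P ⟶ P) ≫ cokernel.π (β a : P ⟶ P) = cokernel.π (β a : P ⟶ P) ≫ γ s) ∧
      (∀ s ∈ Ideal.span {a}, γ s = 0) ∧
      IsExtensionOfScalars (RingHom.id S) (Ideal.span {a}) β γ (cokernel.π (β a : P ⟶ P)) := by
  let π := cokernel.π (β a : P ⟶ P)
  have βcomm (s t : S) : (β s : P ⟶ P) ≫ β t = (β t : P ⟶ P) ≫ β s := by
    change β t * β s = β s * β t
    rw [← map_mul, mul_comm, map_mul]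
  have hπ : (β a : P ⟶ P) ≫ π = 0 := cokernel.condition _
  let γ₀ (s : S) : cokernel (β a : P ⟶ P) ⟶ cokernel (β a : P ⟶ P) :=
    cokernel.desc _ ((β s : P ⟶ P) ≫ π) (by rw [← Category.assoc, βcomm, Category.assoc, hπ, comp_zero])
  have hγ (s : S) : π ≫ γ₀ s = (β s : P ⟶ P) ≫ π := cokernel.π_desc _ _ _
  let γ : S →+* End (cokernel (β a : P ⟶ P)) :=
    { toFun := γ₀
      map_one' := by
        rw [← cancel_epi π, hγ, map_one]
        exact (Category.id_comp π).trans (Category.comp_id π).symm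
      map_mul' := fun s t => by
        rw [← cancel_epi π, hγ, map_mul]
        change ((β t : P ⟶ P) ≫ (β s : P ⟶ P)) ≫ π = π ≫ γ₀ t ≫ γ₀ s
        rw [← Category.assoc, hγ, Category.assoc, Category.assoc, hγ]
      map_zero' := by
        rw [← cancel_epi π, hγ, map_zero]
        exact zero_comp.trans comp_zero.symm
      map_add' := fun s t => by
        rw [← cancel_epi π, hγ, map_add]
        change ((β s : P ⟶ P) + (β t : P ⟶ P)) ≫ π = π ≫ (γ₀ s + γ₀ t)
        rw [Preadditive.add_comp, Preadditive.comp_add, hγ, hγ] }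
  refine ⟨γ, fun s => (hγ s).symm, fun s hs => ?_, fun H θ hθ ψ hψ => ?_⟩
  · obtain ⟨t, rfl⟩ := Ideal.mem_span_singleton.1 hs
    change γ₀ _ = 0
    rw [← cancel_epi π, hγ, map_mul, comp_zero]
    change ((β t : P ⟶ P) ≫ (β a : P ⟶ P)) ≫ π = 0
    rw [Category.assoc, hπ, comp_zero]
  · have hψ₀ : (β a : P ⟶ P) ≫ ψ = 0 := by
      rw [hψ, RingHom.id_apply, hθ _ (Ideal.mem_span_singleton_self _)]
      exact comp_zero
    refine ⟨cokernel.desc _ ψ hψ₀, ⟨fun s => ?_, cokernel.π_desc _ _ _⟩, fun ψ' hψ' => ?_⟩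
    · change γ₀ s ≫ _ = _
      rw [← cancel_epi π, ← Category.assoc, hγ, Category.assoc, cokernel.π_desc,
        cokernel.π_desc_assoc, hψ]
      rfl
    · rw [← cancel_epi π, cokernel.π_desc, hψ'.2]

variable {ℓ : ℕ} [Fact ℓ.Prime]
variable {E L : IntermediateField ℚ_[ℓ] (PadicAlgCl ℓ)}

lemma maxIdeal_pow_eq_span [FiniteDimensional ℚ_[ℓ] E] (n : ℕ) :
    maxIdeal E ^ n = Ideal.span {unif E ^ n} := by
  rw [maxIdeal_eq_span, Ideal.span_singleton_pow]

variable [FiniteDimensional ℚ_[ℓ] E] [FiniteDimensional ℚ_[ℓ] L]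

/-- The extension of scalars `A ↦ A ⊗ 𝒪_L/π_L^n` exists: it is a quotient of a finite sum `P` of
copies of `A`. -/
lemma exists_baseChange_obj (h : E ≤ L) (n : ℕ) {A : 𝒜} (α : valRing E →+* End A) :
    ∃ (B : 𝒜) (γ : valRing L →+* End B) (f : A ⟶ B) (P : 𝒜) (β : P ⟶ P) (d : ℕ)
      (b : Fin d → valRing L) (ι : Fin d → (A ⟶ P)) (π : Fin d → (P ⟶ A)),
      (∀ a ∈ maxIdeal L ^ n, γ a = 0) ∧
      (∀ a, (α a : A ⟶ A) ≫ f = f ≫ (γ (valRingIncl h a) : B ⟶ B)) ∧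
      IsExtensionOfScalars (valRingIncl h) (maxIdeal L ^ n) α γ f ∧
      (∀ i, ι i ≫ π i = 𝟙 A) ∧ (∀ i j, i ≠ j → ι i ≫ π j = 0) ∧ ∑ i, π i ≫ ι i = 𝟙 P ∧
      Nonempty (B ≅ cokernel β) ∧ Epi (∑ i, π i ≫ f ≫ (γ (b i) : B ⟶ B)) := by
  let := (valRingIncl h).toAlgebra
  obtain ⟨d, ⟨b⟩⟩ := exists_basis_valRing h
  obtain ⟨P, β, ι, π, h₁, h₂, h₃, h₄, h₅⟩ := exists_extension_of_basis b α
  obtain ⟨γ, h₆, h₇, h₈⟩ := exists_quotient (unif L ^ n) β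
  rw [← maxIdeal_pow_eq_span] at h₇ h₈
  refine ⟨_, γ, ι ≫ cokernel.π (β (unif L ^ n) : P ⟶ P), P, β (unif L ^ n), d, b,
    fun i => ι ≫ (β (b i) : P ⟶ P), π, h₇, fun a => ?_, ?_, h₃, h₄, h₅, ⟨Iso.refl _⟩, ?_⟩
  · rw [← Category.assoc, h₁, Category.assoc, h₆, Category.assoc]
    rfl
  · exact h₂.trans h₈ (fun a ha => by rw [Ideal.mem_bot.1 ha, map_zero]; exact zero_mem _) h₆
  · have : ∑ i, π i ≫ (ι ≫ cokernel.π (β (unif L ^ n) : P ⟶ P)) ≫ (γ (b i) : _ ⟶ _) =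
        cokernel.π (β (unif L ^ n) : P ⟶ P) := by
      refine Eq.trans ?_ (Category.id_comp _)
      rw [← h₅, Preadditive.sum_comp]
      refine Finset.sum_congr rfl fun i _ => ?_
      simp only [Category.assoc, h₆]
    rw [this]
    infer_instance

end ExtensionOfScalars

/-! ### The calculus of fractions for systems -/

namespace PiSystem

variable {ℓ : ℕ} [Fact ℓ.Prime] {𝒜 : Type u} [Category.{v} 𝒜]

lemma valRingIncl_mem {E L : IntermediateField ℚ_[ℓ] (PadicAlgCl ℓ)} (h : E ≤ L) {n : ℕ}
    {a : valRing E} (ha : a ∈ maxIdeal E ^ n) : valRingIncl h a ∈ maxIdeal L ^ n := by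
  have h₁ : (maxIdeal E).map (valRingIncl h) ≤ maxIdeal L := by
    rw [Ideal.map_le_iff_le_comap]
    exact fun b hb => hb
  have h₂ := Ideal.mem_map_of_mem (valRingIncl h) ha
  rw [Ideal.map_pow] at h₂
  exact Ideal.pow_right_mono h₁ n h₂

section Preadditive

variable [Preadditive 𝒜] {F G H : PiSystem ℓ 𝒜}

lemma mulEll_comp (f : F ⟶ G) : F.mulEll ≫ f = f ≫ G.mulEll := hom_ext fun n => by
  change (ℓ • 𝟙 _) ≫ f.app n = f.app n ≫ (ℓ • 𝟙 _)
  rw [Preadditive.nsmul_comp, Preadditive.comp_nsmul, Category.id_comp, Category.comp_id]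

lemma comp_mulEll_app (f : F ⟶ G) (n : ℕ) : (f ≫ G.mulEll).app n = ℓ • f.app n := by
  change f.app n ≫ (ℓ • 𝟙 _) = _
  rw [Preadditive.comp_nsmul, Category.comp_id]

lemma IsBaseChange.hom_ext {s : F ⟶ G} (hs : IsBaseChange s) {f g : G ⟶ H} (h : s ≫ f = s ≫ g) :
    f = g := PiSystem.hom_ext fun n =>
  (hs n).hom_ext (s.act_app n) ((H.act n).comp (valRingIncl f.field_le))
    (fun _ ha => H.act_eq_zero n _ (valRingIncl_mem _ ha)) (f.act_app n) (g.act_app n)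
    (congrArg (fun φ => Hom.app φ n) h)

lemma IsBaseChange.exists_desc {s : F ⟶ G} (hs : IsBaseChange s) (f : F ⟶ H) (h : G.E ≤ H.E) :
    ∃ f' : G ⟶ H, s ≫ f' = f := by
  have h₀ (n : ℕ) (a : valRing G.E) (ha : a ∈ maxIdeal G.E ^ (n + 1)) :
      ((H.act n).comp (valRingIncl h)) a = 0 := H.act_eq_zero n _ (valRingIncl_mem _ ha)
  choose ψ hψ _ using fun n => hs n (H.obj n) ((H.act n).comp (valRingIncl h)) (h₀ n)
    (f.app n) (f.act_app n)
  refine ⟨⟨h, ψ, fun n => ?_, fun n => (hψ n).1⟩, PiSystem.hom_ext fun n => (hψ n).2⟩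
  refine (hs (n + 1)).hom_ext (s.act_app (n + 1)) ((H.act n).comp (valRingIncl h))
    (fun a ha => h₀ n a (Ideal.pow_le_pow_right (by lia) ha)) (fun a => ?_) (fun a => ?_) ?_
  · rw [← Category.assoc, (hψ (n + 1)).1, Category.assoc]
    change _ ≫ (H.act (n + 1) _ : H.obj (n + 1) ⟶ H.obj (n + 1)) ≫ _ = _
    rw [H.tr_act, ← Category.assoc]
    rfl
  · rw [← Category.assoc, G.tr_act, Category.assoc, (hψ n).1, Category.assoc]
  · rw [← Category.assoc, (hψ (n + 1)).2, f.app_tr, ← Category.assoc, s.app_tr, Category.assoc,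
      (hψ n).2]

lemma IsBaseChange.isAdic {f : F ⟶ G} (hf : IsBaseChange f) (hF : F.IsAdic) : G.IsAdic := by
  intro n H θ hθ φ hφ
  have hθ' (a : valRing G.E) (ha : a ∈ maxIdeal G.E ^ (n + 1 + 1)) : θ a = 0 :=
    hθ a (Ideal.pow_le_pow_right (by lia) ha)
  have hθ'' (a : valRing F.E) (ha : a ∈ maxIdeal F.E ^ (n + 1)) :
      (θ.comp (valRingIncl f.field_le)) a = 0 := hθ _ (valRingIncl_mem _ ha)
  obtain ⟨ψ₀, ⟨h₁, h₂⟩, h₃⟩ := hF n H (θ.comp (valRingIncl f.field_le)) hθ'' (f.app (n + 1) ≫ φ)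
    (fun a => by rw [← Category.assoc, f.act_app, Category.assoc, hφ, Category.assoc]; rfl)
  obtain ⟨ψ, ⟨h₄, h₅⟩, -⟩ := hf n H θ hθ ψ₀ h₁
  refine ⟨ψ, ⟨h₄, ?_⟩, fun ψ' hψ' => ?_⟩
  · refine (hf (n + 1)).hom_ext (f.act_app (n + 1)) θ hθ' (fun a => ?_) hφ ?_
    · rw [← Category.assoc, G.tr_act, Category.assoc, h₄, Category.assoc]
    · rw [← Category.assoc, f.app_tr, Category.assoc, h₅, h₂]
  · refine (hf n).hom_ext (f.act_app n) θ hθ hψ'.1 h₄ ?_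
    rw [h₅]
    refine h₃ _ ⟨fun a => ?_, ?_⟩
    · rw [← Category.assoc, f.act_app, Category.assoc, hψ'.1, Category.assoc]
      rfl
    · rw [← Category.assoc, ← f.app_tr, Category.assoc, hψ'.2]

/-- The iterated transition morphisms. -/
def trIter (F : PiSystem ℓ 𝒜) (n : ℕ) : ∀ k, F.obj (n + k) ⟶ F.obj n
  | 0 => 𝟙 _
  | k + 1 => F.tr (n + k) ≫ F.trIter n k

lemma app_trIter (f : F ⟶ G) (n k : ℕ) :
    f.app (n + k) ≫ G.trIter n k = F.trIter n k ≫ f.app n := by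
  induction k with
  | zero => exact (Category.comp_id _).trans (Category.id_comp _).symm
  | succ k ih =>
    change f.app (n + k + 1) ≫ G.tr (n + k) ≫ G.trIter n k = (F.tr (n + k) ≫ F.trIter n k) ≫ _
    rw [← Category.assoc, f.app_tr, Category.assoc, ih, Category.assoc]

lemma trIter_act (F : PiSystem ℓ 𝒜) (n k : ℕ) (a : valRing F.E) :
    (F.act (n + k) a : F.obj (n + k) ⟶ F.obj (n + k)) ≫ F.trIter n k =
      F.trIter n k ≫ (F.act n a : F.obj n ⟶ F.obj n) := by
  induction k with
  | zero => exact (Category.comp_id _).trans (Category.id_comp _).symm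
  | succ k ih =>
    change (F.act (n + k + 1) a : F.obj (n + k + 1) ⟶ F.obj (n + k + 1)) ≫
      F.tr (n + k) ≫ F.trIter n k = (F.tr (n + k) ≫ F.trIter n k) ≫ _
    rw [← Category.assoc, F.tr_act, Category.assoc, ih, Category.assoc]

end Preadditive

variable [Abelian 𝒜] {F G H : PiSystem ℓ 𝒜}

/-- Extensions of scalars of systems exist. -/
lemma exists_isBaseChange (F : PiSystem ℓ 𝒜) (L : IntermediateField ℚ_[ℓ] (PadicAlgCl ℓ))
    (hL : FiniteDimensional ℚ_[ℓ] L) (h : F.E ≤ L) :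
    ∃ (G : PiSystem ℓ 𝒜) (f : F ⟶ G), G.E = L ∧ IsBaseChange f := by
  have := F.finite
  choose B γ f P β d b ι π h₁ h₂ h₃ _ _ _ _ _ using fun n =>
    exists_baseChange_obj h (n + 1) (F.act n)
  have h₁' (n : ℕ) (a : valRing L) (ha : a ∈ maxIdeal L ^ (n + 1 + 1)) : γ n a = 0 :=
    h₁ n a (Ideal.pow_le_pow_right (by lia) ha)
  choose tr htr _ using fun n => h₃ (n + 1) (B n) (γ n) (h₁' n) (F.tr n ≫ f n) (fun a => by
    rw [← Category.assoc, F.tr_act, Category.assoc, h₂, Category.assoc])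
  exact ⟨⟨L, hL, B, tr, γ, fun n => (htr n).1, h₁⟩,
    ⟨h, f, fun n => (htr n).2, h₂⟩, rfl, h₃⟩

/-- The components of an extension of scalars are quotients of finite sums of copies of the original ones. -/
lemma IsBaseChange.exists_presentation {f : F ⟶ G} (hf : IsBaseChange f) (n : ℕ) :
    ∃ (P : 𝒜) (β : P ⟶ P) (d : ℕ) (b : Fin d → valRing G.E) (ι : Fin d → (F.obj n ⟶ P))
      (π : Fin d → (P ⟶ F.obj n)),
      (∀ i, ι i ≫ π i = 𝟙 _) ∧ (∀ i j, i ≠ j → ι i ≫ π j = 0) ∧ ∑ i, π i ≫ ι i = 𝟙 P ∧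
      Nonempty (G.obj n ≅ cokernel β) ∧
      Epi (∑ i, π i ≫ f.app n ≫ (G.act n (b i) : G.obj n ⟶ G.obj n)) := by
  have := F.finite
  have := G.finite
  obtain ⟨B, γ, f', P, β, d, b, ι, π, h₁, h₂, h₃, h₄, h₅, h₆, ⟨e⟩, h₇⟩ :=
    exists_baseChange_obj f.field_le (n + 1) (F.act n)
  obtain ⟨e', he', hfe⟩ := h₃.exists_iso (hf n) h₂ (f.act_app n) h₁ (G.act_eq_zero n)
  refine ⟨P, β, d, b, ι, π, h₄, h₅, h₆, ⟨e'.symm ≪≫ e⟩, ?_⟩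
  have : ∑ i, π i ≫ f.app n ≫ (G.act n (b i) : G.obj n ⟶ G.obj n) =
      (∑ i, π i ≫ f' ≫ (γ (b i) : B ⟶ B)) ≫ e'.hom := by
    rw [Preadditive.sum_comp]
    refine Finset.sum_congr rfl fun i _ => ?_
    simp only [← hfe, Category.assoc, he']
  rw [this]
  exact epi_comp _ _

/-- For large `m` the extension of scalars `F_m ⟶ F_m ⊗ 𝒪_L/π_L^(m+1)` has a retraction to `F_n`,
given by a coordinate of `𝒪_L` over `𝒪_E`. -/
lemma IsBaseChange.exists_retraction {f : F ⟶ G} (hf : IsBaseChange f) {d : ℕ}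
    (b : @Module.Basis (Fin d) (valRing F.E) (valRing G.E) _ _
      (valRingIncl f.field_le).toAlgebra.toModule) (n : ℕ) :
    ∃ (k : ℕ) (r : Fin d → (G.obj (n + k) ⟶ F.obj n)),
      (∀ i, f.app (n + k) ≫ (G.act (n + k) (b i) : G.obj (n + k) ⟶ G.obj (n + k)) ≫ r i =
        F.trIter n k) ∧
      ∀ i j, i ≠ j →
        f.app (n + k) ≫ (G.act (n + k) (b i) : G.obj (n + k) ⟶ G.obj (n + k)) ≫ r j = 0 := by
  have := F.finite
  have := G.finite
  let := (valRingIncl f.field_le).toAlgebra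
  obtain ⟨P, β, ι, π, h₁, -, h₃, h₄, h₅⟩ := exists_extension_of_basis b (F.act n)
  -- a power of `π_L` is divisible by `π_E^(n+1)`
  obtain ⟨k, hk⟩ : ∃ k, ∀ a ∈ maxIdeal G.E ^ (n + k + 1),
      algebraMap (valRing F.E) (valRing G.E) (unif F.E ^ (n + 1)) ∣ a := by
    have h₀ : (0 : ℝ) < ‖(unif F.E : PadicAlgCl ℓ)‖ ^ (n + 1) := pow_pos (norm_unif_pos F.E) _
    obtain ⟨k, hk⟩ := exists_pow_lt_of_lt_one h₀ (norm_unif_lt_one G.E)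
    refine ⟨k, fun a ha => dvd_of_norm_le G.E ?_ ?_⟩
    · intro h
      have h' : ((unif F.E ^ (n + 1) : valRing F.E) : PadicAlgCl ℓ) = 0 :=
        congrArg (fun z : valRing G.E => (z : PadicAlgCl ℓ)) h
      exact pow_ne_zero (n + 1) (unif_ne_zero F.E) (Subtype.ext h')
    · rw [mem_maxIdeal_pow_iff] at ha
      refine ha.trans (le_trans ?_ (hk.le.trans (le_of_eq ?_)))
      · exact pow_le_pow_of_le_one (norm_nonneg _) (norm_unif_lt_one G.E).le (by lia)
      · change _ = ‖((unif F.E ^ (n + 1) : valRing F.E) : PadicAlgCl ℓ)‖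
        rw [SubmonoidClass.coe_pow, norm_pow]
  -- The ideal `π_L^(n+k+1)` kills `P = F_n ⊗ 𝒪_L`, whence a morphism from `G_{n+k}` to `P`; its
  -- composites with the coordinates of `P` are the desired retractions.
  have hβ (a : valRing G.E) (ha : a ∈ maxIdeal G.E ^ (n + k + 1)) : β a = 0 := by
    obtain ⟨c, rfl⟩ := hk a ha
    have hunif : F.act n (unif F.E ^ (n + 1)) = 0 := F.act_eq_zero n _ (by
      rw [maxIdeal_pow_eq_span]
      exact Ideal.mem_span_singleton_self _)
    refine Eq.trans (Category.id_comp _).symm ?_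
    rw [← h₅, Preadditive.sum_comp]
    refine Finset.sum_eq_zero fun i _ => ?_
    have : (β (b i) : P ⟶ P) ≫ (β (algebraMap _ _ (unif F.E ^ (n + 1)) * c) : P ⟶ P) =
        (β (algebraMap _ _ (unif F.E ^ (n + 1))) : P ⟶ P) ≫ (β (b i * c) : P ⟶ P) := by
      change β _ * β _ = β _ * β _
      rw [← map_mul, ← map_mul]
      congr 1
      ring
    rw [Category.assoc, Category.assoc, this, ← Category.assoc ι, ← h₁, hunif]
    change π i ≫ ((0 : F.obj n ⟶ F.obj n) ≫ ι) ≫ _ = 0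
    rw [zero_comp, zero_comp, comp_zero]
  obtain ⟨r, ⟨h₆, h₇⟩, -⟩ := hf (n + k) P β hβ (F.trIter n k ≫ ι) (fun a => by
    rw [← Category.assoc, trIter_act, Category.assoc, h₁, Category.assoc]
    rfl)
  have key (i j : Fin d) :
      f.app (n + k) ≫ (G.act (n + k) (b i) : G.obj (n + k) ⟶ G.obj (n + k)) ≫ r ≫ π j =
        F.trIter n k ≫ (ι ≫ (β (b i) : P ⟶ P)) ≫ π j := by
    rw [← Category.assoc (G.act (n + k) (b i) : G.obj (n + k) ⟶ G.obj (n + k)), h₆,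
      Category.assoc, ← Category.assoc, h₇]
    simp only [Category.assoc]
  refine ⟨k, fun j => r ≫ π j, fun i => ?_, fun i j h => ?_⟩
  · rw [key, h₃, Category.comp_id]
  · rw [key, h₄ i j h, comp_zero]

variable (ℓ 𝒜) in
/-- The morphisms which are composites of extensions of scalars and of multiplications by `ℓ`. -/
abbrev W' : MorphismProperty (PiSystem ℓ 𝒜) := MorphismProperty.multiplicativeClosure W

lemma finiteDimensional_sup (F G : PiSystem ℓ 𝒜) :
    FiniteDimensional ℚ_[ℓ] (F.E ⊔ G.E : IntermediateField ℚ_[ℓ] (PadicAlgCl ℓ)) := by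
  have := F.finite
  have := G.finite
  exact IntermediateField.finiteDimensional_sup _ _

instance : (W' ℓ 𝒜).HasLeftCalculusOfFractions :=
  hasLeftCalculusOfFractions_multiplicativeClosure
    (fun {X Y Z} s f hs => by
      cases hs with
      | baseChange _ hs =>
        obtain ⟨T, g, hT, hg⟩ := exists_isBaseChange Z (Y.E ⊔ Z.E) (finiteDimensional_sup Y Z)
          le_sup_right
        obtain ⟨f', hf'⟩ := hs.exists_desc (f ≫ g) (hT ▸ le_sup_left)
        exact ⟨T, g, f', .of _ (.baseChange g hg), hf'.symm⟩
      | mulEll => exact ⟨Z, Z.mulEll, f, .of _ (.mulEll Z), (mulEll_comp f).symm⟩)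
    (fun {X Y Z} s f g hs h => by
      cases hs with
      | baseChange _ hs => exact ⟨Z, 𝟙 Z, .id Z, by rw [hs.hom_ext h]⟩
      | mulEll => exact ⟨Z, Z.mulEll, .of _ (.mulEll Z), by rw [← mulEll_comp, h, mulEll_comp]⟩)

/-- Fractions whose numerator comes from a given category can be extended in that category. -/
lemma exists_dominating {ℬ : Type u'} [Category.{v'} ℬ] [Abelian ℬ] (T : ℬ ⥤ 𝒜) [T.Additive]
    [T.IsLeftAdjoint] {F G : PiSystem ℓ 𝒜} {s : F ⟶ G} (hs : W' ℓ 𝒜 s) :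
    ∀ (B : PiSystem ℓ ℬ) (a : F ⟶ (map T).obj B), ∃ (B' : PiSystem ℓ ℬ) (s' : B ⟶ B')
      (r : G ⟶ (map T).obj B'), W' ℓ ℬ s' ∧ s ≫ r = a ≫ (map T).map s' := by
  have key {F G : PiSystem ℓ 𝒜} {s : F ⟶ G} (hs : W s) (B : PiSystem ℓ ℬ)
      (a : F ⟶ (map T).obj B) : ∃ (B' : PiSystem ℓ ℬ) (s' : B ⟶ B') (r : G ⟶ (map T).obj B'),
        W' ℓ ℬ s' ∧ s ≫ r = a ≫ (map T).map s' := by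
    cases hs with
    | baseChange _ hs =>
      -- An extension of scalars is dominated by the extension of scalars of `B` to the compositum.
      have hfin : FiniteDimensional ℚ_[ℓ] (G.E ⊔ B.E :) := by
        have := G.finite
        have := B.finite
        exact IntermediateField.finiteDimensional_sup _ _
      obtain ⟨B', s', hB', hs'⟩ := exists_isBaseChange B (G.E ⊔ B.E) hfin le_sup_right
      obtain ⟨r, hr⟩ := hs.exists_desc (a ≫ (map T).map s')
        (show G.E ≤ B'.E from hB' ▸ le_sup_left)
      exact ⟨B', s', r, .of _ (.baseChange s' hs'), hr⟩
    | mulEll =>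
      refine ⟨B, B.mulEll, a, .of _ (.mulEll B), ?_⟩
      rw [mulEll_comp]
      congr 1
      refine PiSystem.hom_ext fun n => ?_
      change ℓ • 𝟙 _ = T.map (ℓ • 𝟙 _)
      rw [T.map_nsmul, T.map_id]
      rfl
  induction hs with
  | of s hs => exact key hs
  | id F => exact fun B a => ⟨B, 𝟙 B, a, .id B, by simp⟩
  | comp_of s t hs ht ih =>
    intro B a
    obtain ⟨B', s', r, hs', h⟩ := ih B a
    obtain ⟨B'', s'', r', hs'', h'⟩ := key ht B' r
    exact ⟨B'', s' ≫ s'', r', (W' ℓ ℬ).comp_mem _ _ hs' hs'', by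
      rw [Category.assoc, h', ← Category.assoc, h, Category.assoc, Functor.map_comp]⟩

lemma epi_trIter (hF : ∀ n, Epi (F.tr n)) (n k : ℕ) : Epi (F.trIter n k) := by
  induction k with
  | zero => exact inferInstanceAs (Epi (𝟙 (F.obj n)))
  | succ k ih => exact epi_comp (F.tr (n + k)) (F.trIter n k)

/-- The morphisms of `W'` are monomorphisms up to `ℓ`-torsion. -/
lemma exists_pow_smul_eq {s : G ⟶ H} (hs : W' ℓ 𝒜 s) : ∃ N : ℕ, ∀ (F : PiSystem ℓ 𝒜),
    (∀ n, Epi (F.tr n)) → ∀ a b : F ⟶ G, a ≫ s = b ≫ s → ∀ n, ℓ ^ N • a.app n = ℓ ^ N • b.app n := by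
  have key {G H : PiSystem ℓ 𝒜} {s : G ⟶ H} (hs : W s) (F : PiSystem ℓ 𝒜)
      (hF : ∀ n, Epi (F.tr n)) (a b : F ⟶ G) (h : a ≫ s = b ≫ s) (n : ℕ) :
      ℓ • a.app n = ℓ • b.app n := by
    cases hs with
    | baseChange _ hs =>
      have := G.finite
      have := H.finite
      let := (valRingIncl s.field_le).toAlgebra
      obtain ⟨d, ⟨c⟩⟩ := exists_basis_valRing s.field_le
      have hd : 0 < d := by
        rcases Nat.eq_zero_or_pos d with rfl | hd
        · have : Subsingleton (valRing H.E) := c.repr.toEquiv.subsingleton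
          exact absurd (Subsingleton.elim (1 : valRing H.E) 0) one_ne_zero
        · exact hd
      -- A coordinate retracts the extension of scalars up to transition morphisms, which are epimorphisms.
      obtain ⟨k, r, hr, -⟩ := hs.exists_retraction c n
      have := epi_trIter hF n k
      congr 1
      rw [← cancel_epi (F.trIter n k), ← app_trIter, ← app_trIter, ← hr ⟨0, hd⟩]
      have h' : a.app (n + k) ≫ s.app (n + k) = b.app (n + k) ≫ s.app (n + k) :=
        congrArg (fun z => Hom.app z (n + k)) h
      rw [reassoc_of% h']
    | mulEll =>
      rw [← comp_mulEll_app, ← comp_mulEll_app, h]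
  induction hs with
  | of s hs => exact ⟨1, fun F hF a b h n => by rw [pow_one]; exact key hs F hF a b h n⟩
  | id G => exact ⟨0, fun F hF a b h n => by rw [Category.comp_id, Category.comp_id] at h; rw [h]⟩
  | comp_of s t hs ht ih =>
    obtain ⟨N, hN⟩ := ih
    refine ⟨N + 1, fun F hF a b h n => ?_⟩
    have h₁ : (F.mulEll ≫ a) ≫ s = (F.mulEll ≫ b) ≫ s := PiSystem.hom_ext fun m => by
      have := key ht F hF (a ≫ s) (b ≫ s) (by simpa using h) m
      rw [← comp_mulEll_app, ← comp_mulEll_app, ← mulEll_comp, ← mulEll_comp] at this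
      simpa using this
    have h₂ := hN F hF _ _ h₁ n
    rw [mulEll_comp, mulEll_comp, comp_mulEll_app, comp_mulEll_app, smul_smul, smul_smul] at h₂
    rw [pow_succ]
    exact h₂

/-- Morphisms with `ℚ̄_ℓ`-coefficients are left fractions of morphisms of systems. -/
lemma exists_fraction (φ : (QlSystem.Q ℓ 𝒜).obj F ⟶ (QlSystem.Q ℓ 𝒜).obj G) :
    ∃ (H : PiSystem ℓ 𝒜) (a : F ⟶ H) (s : G ⟶ H), W' ℓ 𝒜 s ∧
      φ ≫ (QlSystem.Q ℓ 𝒜).map s = (QlSystem.Q ℓ 𝒜).map a := by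
  obtain ⟨z, hz⟩ := Localization.exists_leftFraction (QlSystem.Q ℓ 𝒜) (W' ℓ 𝒜) φ
  refine ⟨z.Y', z.f, z.s, z.hs, ?_⟩
  rw [hz]
  exact z.map_comp_map_s _ _

lemma isIso_Q_map {s : F ⟶ G} (hs : W' ℓ 𝒜 s) : IsIso ((QlSystem.Q ℓ 𝒜).map s) :=
  Localization.inverts (QlSystem.Q ℓ 𝒜) (W' ℓ 𝒜) s hs

lemma Q_map_eq_iff (a b : F ⟶ G) : (QlSystem.Q ℓ 𝒜).map a = (QlSystem.Q ℓ 𝒜).map b ↔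
    ∃ (H : PiSystem ℓ 𝒜) (s : G ⟶ H), W' ℓ 𝒜 s ∧ a ≫ s = b ≫ s := by
  rw [MorphismProperty.map_eq_iff_postcomp (QlSystem.Q ℓ 𝒜) (W' ℓ 𝒜)]
  exact ⟨fun ⟨H, s, hs, h⟩ => ⟨H, s, hs, h⟩, fun ⟨H, s, hs, h⟩ => ⟨H, s, hs, h⟩⟩

/-- Morphisms of systems which agree up to a power of `ℓ` agree with `ℚ̄_ℓ`-coefficients. -/
lemma Q_map_eq_of_smul_eq (N : ℕ) (a b : F ⟶ G) (h : ∀ n, ℓ ^ N • a.app n = ℓ ^ N • b.app n) :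
    (QlSystem.Q ℓ 𝒜).map a = (QlSystem.Q ℓ 𝒜).map b := by
  induction N generalizing a b with
  | zero => congr 1; exact PiSystem.hom_ext fun n => by simpa using h n
  | succ N ih =>
    have := ih (a ≫ G.mulEll) (b ≫ G.mulEll) fun n => by
      rw [comp_mulEll_app, comp_mulEll_app, smul_smul, smul_smul, ← pow_succ, h]
    rw [Functor.map_comp, Functor.map_comp] at this
    have h' := isIso_Q_map (ℓ := ℓ) (MorphismProperty.multiplicativeClosure.of G.mulEll (W.mulEll G))
    exact (cancel_mono _).1 this

lemma Q_map_eq_iff_of_epi (hF : ∀ n, Epi (F.tr n)) (a b : F ⟶ G) :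
    (QlSystem.Q ℓ 𝒜).map a = (QlSystem.Q ℓ 𝒜).map b ↔
      ∃ N : ℕ, ∀ n, ℓ ^ N • a.app n = ℓ ^ N • b.app n := by
  refine ⟨fun h => ?_, fun ⟨N, hN⟩ => Q_map_eq_of_smul_eq N a b hN⟩
  obtain ⟨H, s, hs, h⟩ := (Q_map_eq_iff a b).1 h
  obtain ⟨N, hN⟩ := exists_pow_smul_eq hs
  exact ⟨N, hN F hF a b h⟩

lemma act_unif_tr (F : PiSystem ℓ 𝒜) [FiniteDimensional ℚ_[ℓ] F.E] (n : ℕ) :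
    (F.act (n + 1) (unif F.E ^ (n + 1)) : F.obj (n + 1) ⟶ F.obj (n + 1)) ≫ F.tr n = 0 := by
  rw [F.tr_act, F.act_eq_zero n _ (by
    rw [maxIdeal_pow_eq_span]; exact Ideal.mem_span_singleton_self _)]
  exact comp_zero

/-- A system is adic if and only if `F_n` is the cokernel of `π_E ^ (n + 1)` on `F_{n + 1}`. -/
lemma isAdic_iff (F : PiSystem ℓ 𝒜) [FiniteDimensional ℚ_[ℓ] F.E] : F.IsAdic ↔
    ∀ n, IsIso (cokernel.desc _ (F.tr n) (F.act_unif_tr n)) := by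
  refine forall_congr' fun n => ?_
  obtain ⟨γ, h₁, h₂, h₃⟩ := exists_quotient (unif F.E ^ (n + 1)) (F.act (n + 1))
  rw [← maxIdeal_pow_eq_span] at h₂ h₃
  constructor
  · intro h
    obtain ⟨e, -, he⟩ := h₃.exists_iso h h₁ (F.tr_act n) h₂ (F.act_eq_zero n)
    have : cokernel.desc _ (F.tr n) (F.act_unif_tr n) = e.hom := by
      rw [← cancel_epi (cokernel.π _), cokernel.π_desc, he]
    rw [this]
    infer_instance
  · intro h H θ hθ φ hφ
    obtain ⟨ψ, ⟨h₄, h₅⟩, h₆⟩ := h₃ H θ hθ φ hφ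
    let c := cokernel.desc _ (F.tr n) (F.act_unif_tr n)
    have hc : cokernel.π _ ≫ c = F.tr n := cokernel.π_desc _ _ _
    have hlin (a : valRing F.E) : (γ a : _ ⟶ _) ≫ c = c ≫ (F.act n a : F.obj n ⟶ F.obj n) := by
      rw [← cancel_epi (cokernel.π _), ← Category.assoc]
      have := h₁ a
      rw [← this, Category.assoc, hc, F.tr_act, ← Category.assoc, hc]
    refine ⟨inv c ≫ ψ, ⟨fun a => ?_, ?_⟩, fun ψ' hψ' => ?_⟩
    · rw [← cancel_epi c, ← Category.assoc, ← hlin, Category.assoc, IsIso.hom_inv_id_assoc, h₄,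
        Category.assoc, IsIso.hom_inv_id_assoc]
    · rw [← hc, Category.assoc, IsIso.hom_inv_id_assoc, h₅]
    · rw [← cancel_epi c, IsIso.hom_inv_id_assoc]
      refine h₆ _ ⟨fun a => ?_, ?_⟩
      · rw [← Category.assoc, hlin, Category.assoc, hψ'.1, Category.assoc]
      · rw [← Category.assoc, hc, hψ'.2]

lemma IsAdic.epi_tr (hF : F.IsAdic) (n : ℕ) : Epi (F.tr n) := by
  have := F.finite
  have := (isAdic_iff F).1 hF n
  rw [← cokernel.π_desc _ (F.tr n) (F.act_unif_tr n)]
  exact epi_comp _ _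

end PiSystem

/-! ### Finitely generated modules over the valuation ring -/

section FiniteModules

lemma tmul_eq_zero_of_smul_eq_zero {R Q M : Type*} [CommRing R] [Field Q] [Algebra R Q]
    [FaithfulSMul R Q] [AddCommGroup M] [Module R M] {m : M} {a : R} (ha : a ≠ 0)
    (hm : a • m = 0) (c : Q) : c ⊗ₜ[R] m = 0 := by
  have ha' : algebraMap R Q a ≠ 0 := fun h =>
    ha (FaithfulSMul.algebraMap_injective R Q (by rw [h, map_zero]))
  have : c = a • ((algebraMap R Q a)⁻¹ * c) := by
    rw [Algebra.smul_def, ← mul_assoc, mul_inv_cancel₀ ha', one_mul]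
  rw [this, TensorProduct.smul_tmul, hm, TensorProduct.tmul_zero]

variable {R Q M : Type*} [CommRing R] [IsDomain R] [IsPrincipalIdealRing R] [Field Q] [Algebra R Q]
  [AddCommGroup M] [Module R M] [Module.Finite R M]

variable (R M) in
/-- A finitely generated module over a principal ideal domain is free up to torsion. -/
lemma exists_surjective_of_isPrincipalIdealRing : ∃ (r : ℕ) (q : M →ₗ[R] (Fin r → R)),
    Function.Surjective q ∧ ∀ m, q m = 0 ↔ ∃ a : R, a ≠ 0 ∧ a • m = 0 := by
  have : Module.Free R (M ⧸ Submodule.torsion R M) := Module.free_of_finite_type_torsion_free'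
  let b := Module.finBasis R (M ⧸ Submodule.torsion R M)
  refine ⟨_, b.equivFun.toLinearMap ∘ₗ (Submodule.torsion R M).mkQ,
    b.equivFun.surjective.comp (Submodule.mkQ_surjective _), fun m => ?_⟩
  rw [LinearMap.comp_apply, LinearEquiv.coe_coe, LinearEquiv.map_eq_zero_iff, Submodule.mkQ_apply,
    Submodule.Quotient.mk_eq_zero, Submodule.mem_torsion_iff]
  exact ⟨fun ⟨a, ha⟩ => ⟨a, nonZeroDivisors.ne_zero a.2, ha⟩,
    fun ⟨a, ha, h⟩ => ⟨⟨a, mem_nonZeroDivisors_of_ne_zero ha⟩, h⟩⟩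

variable (R M) in
lemma exists_torsion_bound : ∃ c : R, c ≠ 0 ∧ ∀ (m : M) (a : R), a ≠ 0 → a • m = 0 → c • m = 0 := by
  have : IsNoetherian R M := isNoetherian_of_isNoetherianRing_of_finite R M
  have h : Module.IsTorsion R (Submodule.torsion R M) := Submodule.torsion_isTorsion
  obtain ⟨c, hc, hc'⟩ := Submodule.annihilator_top_inter_nonZeroDivisors h
  refine ⟨c, nonZeroDivisors.ne_zero hc', fun m a ha hm => ?_⟩
  have := Submodule.mem_annihilator.1 hc ⟨m, (Submodule.mem_torsion_iff m).2
    ⟨⟨a, mem_nonZeroDivisors_of_ne_zero ha⟩, hm⟩⟩ trivial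
  exact congrArg Subtype.val this

variable [FaithfulSMul R Q]

/-- Up to torsion, the structure of `Q ⊗ M` is that of `M`. -/
lemma exists_linearEquiv_tensor : ∃ (q : M →ₗ[R] (Fin (Module.finrank Q (Q ⊗[R] M)) → R))
    (e : Q ⊗[R] M ≃ₗ[Q] (Fin (Module.finrank Q (Q ⊗[R] M)) → Q)), Function.Surjective q ∧
    (∀ m, q m = 0 → ∃ a : R, a ≠ 0 ∧ a • m = 0) ∧
    ∀ c m i, e (c ⊗ₜ[R] m) i = c * algebraMap R Q (q m i) := by
  obtain ⟨r, q, hq, hq'⟩ := exists_surjective_of_isPrincipalIdealRing R M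
  let q' (i : Fin r) : Q ⊗[R] M →ₗ[Q] Q :=
    (Algebra.linearMap R Q ∘ₗ LinearMap.proj i ∘ₗ q).liftBaseChange Q
  have hq'' (i : Fin r) (c : Q) (m : M) : q' i (c ⊗ₜ m) = c * algebraMap R Q (q m i) := by
    simp [q']
  choose t ht using fun i : Fin r => hq (Pi.single i 1)
  -- `σ` is induced by lifts of the basis; it is inverse to `Q ⊗ q` since the kernel of `q` is torsion.
  let σ : (Fin r → Q) →ₗ[Q] Q ⊗[R] M := Fintype.linearCombination Q fun i => 1 ⊗ₜ t i
  have h₁ (c : Fin r → Q) : LinearMap.pi q' (σ c) = c := by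
    funext i
    simp [σ, Fintype.linearCombination_apply, hq'', ht, TensorProduct.smul_tmul', Pi.single_apply]
  have h₂ (z : Q ⊗[R] M) : σ (LinearMap.pi q' z) = z := by
    induction z with
    | zero => simp
    | add z z' h h' => rw [map_add, map_add, h, h']
    | tmul c m =>
      have hm : q (m - ∑ i, q m i • t i) = 0 := by
        rw [map_sub, map_sum, sub_eq_zero]
        funext i
        simp [ht, Finset.sum_apply, Pi.single_apply]
      obtain ⟨a, ha, ha'⟩ := (hq' _).1 hm
      have := tmul_eq_zero_of_smul_eq_zero (Q := Q) ha ha' c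
      rw [TensorProduct.tmul_sub, sub_eq_zero] at this
      conv_rhs => rw [this]
      simp only [σ, Fintype.linearCombination_apply, LinearMap.pi_apply, hq'',
        TensorProduct.tmul_sum, TensorProduct.smul_tmul', smul_eq_mul, mul_one]
      refine Finset.sum_congr rfl fun i _ => ?_
      rw [← TensorProduct.smul_tmul, Algebra.smul_def, mul_comm]
  let e : Q ⊗[R] M ≃ₗ[Q] (Fin r → Q) :=
    LinearEquiv.ofLinearMap (LinearMap.pi q') σ (LinearMap.ext h₁) (LinearMap.ext h₂)
  have hr : Module.finrank Q (Q ⊗[R] M) = r := by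
    rw [e.finrank_eq, Module.finrank_fin_fun]
  rw [hr]
  exact ⟨q, e, hq, fun m hm => (hq' m).1 hm, fun c m i => hq'' i c m⟩

lemma one_tmul_eq_zero_iff (m : M) :
    (1 : Q) ⊗ₜ[R] m = 0 ↔ ∃ a : R, a ≠ 0 ∧ a • m = 0 := by
  refine ⟨fun h => ?_, fun ⟨a, ha, hm⟩ => tmul_eq_zero_of_smul_eq_zero ha hm 1⟩
  obtain ⟨q, e, -, hq, he⟩ := exists_linearEquiv_tensor (R := R) (Q := Q) (M := M)
  refine hq m (funext fun i => FaithfulSMul.algebraMap_injective R Q ?_)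
  have := he 1 m i
  rw [h, map_zero, one_mul] at this
  rw [← this]
  simp

end FiniteModules

section Coefficients

variable {ℓ : ℕ} [Fact ℓ.Prime] (E : IntermediateField ℚ_[ℓ] (PadicAlgCl ℓ))

lemma exists_dvd_ell_pow {a : valRing E} (ha : a ≠ 0) : ∃ N : ℕ, a ∣ (ℓ : valRing E) ^ N := by
  have ha' : 0 < ‖(a : PadicAlgCl ℓ)‖ := norm_pos_iff.2 fun h => ha (Subtype.ext h)
  obtain ⟨N, hN⟩ := exists_pow_lt_of_lt_one ha' (norm_ell_lt_one (ℓ := ℓ))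
  exact ⟨N, dvd_of_norm_le E ha (by simpa using hN.le)⟩

end Coefficients

/-! ### Stalks of smooth systems -/

lemma exists_compatible {S : ℕ → Type u} (p : ∀ n, S (n + 1) → S n) [∀ n, Finite (S n)]
    [∀ n, Nonempty (S n)] : ∃ s : ∀ n, S n, ∀ n, p n (s (n + 1)) = s n := by
  let F : ℕᵒᵖ ⥤ Type u := Functor.ofOpSequence (X := S) fun n => ↾(p n)
  have h₁ (j : ℕᵒᵖ) : Finite (F.obj j) := inferInstanceAs (Finite (S j.unop))
  have h₂ (j : ℕᵒᵖ) : Nonempty (F.obj j) := inferInstanceAs (Nonempty (S j.unop))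
  obtain ⟨s, hs⟩ := nonempty_sections_of_finite_inverse_system F
  refine ⟨fun n => s (op n), fun n => ?_⟩
  have h₃ : F.map (homOfLE (Nat.le_succ n)).op = ↾(p n) := Functor.ofOpSequence_map_homOfLE_succ _ n
  have := hs (homOfLE (Nat.le_succ n)).op
  rw [h₃] at this
  exact this

lemma exists_compatible_of_surjective (n : ℕ) : ∀ {S : ℕ → Type u} (p : ∀ n, S (n + 1) → S n)
    (_ : ∀ n, Function.Surjective (p n)) (y : S n),
    ∃ s : ∀ n, S n, (∀ n, p n (s (n + 1)) = s n) ∧ s n = y := by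
  induction n with
  | zero =>
    intro S p hp y
    choose l hl using hp
    exact ⟨fun n => Nat.rec (motive := S) y (fun k z => l k z) n, fun n => hl _ _, rfl⟩
  | succ n ih =>
    intro S p hp y
    obtain ⟨s, hs, hs'⟩ := ih (S := fun k => S (k + 1)) (fun k => p (k + 1)) (fun k => hp (k + 1)) y
    refine ⟨fun k => Nat.casesOn (motive := S) k (p 0 (s 0)) s, fun k => ?_, hs'⟩
    cases k with
    | zero => rfl
    | succ k => exact hs k

section Smooth

open PiSystem

variable {ℓ : ℕ} [Fact ℓ.Prime] {X : Scheme.{u}} {F G H : PiSystem ℓ (EtAb X)}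

lemma PiSystem.IsBaseChange.isLC {f : F ⟶ G} (hf : IsBaseChange f) (n : ℕ) (hF : IsLC (F.obj n)) :
    IsLC (G.obj n) := by
  obtain ⟨P, β, d, b, ι, π, h₁, h₂, h₃, ⟨e⟩, -⟩ := hf.exists_presentation n
  have hP := hF.directSum ι π h₁ h₂ h₃
  exact (hP.cokernel hP β).map_iso e.symm

lemma IsSmoothSystem.isLC (hF : IsSmoothSystem F) (n : ℕ) : IsLC (F.obj n) :=
  isFiniteLocallyConstant_iff.1 (hF.2 n)

lemma IsSmoothSystem.epi_tr (hF : IsSmoothSystem F) (n : ℕ) : Epi (F.tr n) := hF.1.epi_tr n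

lemma IsSmoothSystem.of_baseChange {f : F ⟶ G} (hf : IsBaseChange f) (hF : IsSmoothSystem F) :
    IsSmoothSystem G :=
  ⟨hf.isAdic hF.1, fun n => isFiniteLocallyConstant_iff.2 (hf.isLC n (hF.isLC n))⟩

lemma IsSmoothSystem.of_W {f : F ⟶ G} (hf : W f) (hF : IsSmoothSystem F) : IsSmoothSystem G := by
  cases hf with
  | baseChange _ hf => exact hF.of_baseChange hf
  | mulEll => exact hF

lemma IsSmoothSystem.of_W' {f : F ⟶ G} (hf : W' ℓ _ f) (hF : IsSmoothSystem F) :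
    IsSmoothSystem G := by
  induction hf with
  | of f hf => exact hF.of_W hf
  | id => exact hF
  | comp_of f g _ hg ih => exact (ih hF).of_W hg

variable {Ω : Type u} [Field Ω] [IsSepClosed Ω] {x : Spec (.of Ω) ⟶ X}

lemma IsLC.finite_stalk {A : EtAb X} (hA : IsLC A) (x : Spec (.of Ω) ⟶ X) :
    Finite ((stalk x).obj A) := by
  obtain ⟨U, ⟨q, hq⟩, M, _, _, φ, hφ⟩ := hA (x default)
  obtain ⟨u, -⟩ := exists_lift x hq
  exact Finite.of_surjective _ (hφ Ω _ _ x u).2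

lemma stalk_map_nsmul (x : Spec (.of Ω) ⟶ X) {A B : EtAb X} (k : ℕ) (φ : A ⟶ B)
    (y : (stalk x).obj A) : ((stalk x).map (k • φ)).hom y = k • ((stalk x).map φ).hom y := by
  rw [Functor.map_nsmul]
  rfl

lemma stalk_map_sub (x : Spec (.of Ω) ⟶ X) {A B : EtAb X} (φ ψ : A ⟶ B)
    (y : (stalk x).obj A) :
    ((stalk x).map (φ - ψ)).hom y = ((stalk x).map φ).hom y - ((stalk x).map ψ).hom y := by
  rw [Functor.map_sub]
  rfl

namespace Stalk

lemma val_add (t t' : Stalk x F) (n : ℕ) : (t + t').val n = t.val n + t'.val n := rfl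

lemma val_sub (t t' : Stalk x F) (n : ℕ) : (t - t').val n = t.val n - t'.val n := rfl

lemma val_zero (n : ℕ) : (0 : Stalk x F).val n = 0 := rfl

lemma val_smul (a : valRing F.E) (t : Stalk x F) (n : ℕ) :
    (a • t).val n = ((stalk x).map (F.act n a)).hom (t.val n) := rfl

lemma val_map (f : F ⟶ G) (t : Stalk x F) (n : ℕ) :
    (t.map f).val n = ((stalk x).map (f.app n)).hom (t.val n) := rfl

lemma map_add (f : F ⟶ G) (t t' : Stalk x F) : (t + t').map f = t.map f + t'.map f :=
  ext fun _ => _root_.map_add ((stalk x).map (f.app _)).hom _ _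

lemma map_smul (f : F ⟶ G) (a : valRing F.E) (t : Stalk x F) :
    (a • t).map f = valRingIncl f.field_le a • t.map f := ext fun n => by
  rw [val_map, val_smul, val_smul, val_map, ← stalk_comp_apply, ← stalk_comp_apply, f.act_app]

lemma map_comp (f : F ⟶ G) (g : G ⟶ H) (t : Stalk x F) : t.map (f ≫ g) = (t.map f).map g :=
  ext fun _ => stalk_comp_apply x _ _ _

lemma map_id (t : Stalk x F) : t.map (𝟙 F) = t :=
  ext fun n => congrArg (fun φ => φ.hom (t.val n)) ((stalk x).map_id (F.obj n))

lemma val_nsmul (k : ℕ) (t : Stalk x F) (n : ℕ) : (k • t).val n = k • t.val n := by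
  induction k with
  | zero => simp [val_zero]
  | succ k ih => rw [succ_nsmul, succ_nsmul, val_add, ih]

lemma map_mulEll (t : Stalk x F) : t.map F.mulEll = ℓ • t := ext fun n => by
  rw [val_map, val_nsmul]
  exact (stalk_map_nsmul x ℓ (𝟙 _) _).trans
    (congrArg (fun φ => ℓ • AddCommGrpCat.Hom.hom φ (t.val n)) ((stalk x).map_id (F.obj n)))

lemma trIter_val (t : Stalk x F) (n k : ℕ) :
    ((stalk x).map (F.trIter n k)).hom (t.val (n + k)) = t.val n := by
  induction k with
  | zero => exact congrArg (fun φ => φ.hom (t.val n)) ((stalk x).map_id (F.obj n))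
  | succ k ih =>
    rw [← ih, ← t.tr_val (n + k), ← stalk_comp_apply]
    rfl

lemma val_eq_zero_of_le (t : Stalk x F) {m n : ℕ} (h : m ≤ n) (ht : t.val n = 0) : t.val m = 0 := by
  obtain ⟨k, rfl⟩ := Nat.exists_eq_add_of_le h
  rw [← t.trIter_val m k, ht, map_zero]

end Stalk

namespace PiSystem.IsAdic

lemma stalk_tr_surjective (hF : F.IsAdic) (n : ℕ) :
    Function.Surjective ((stalk x).map (F.tr n)).hom := by
  have := hF.epi_tr n
  have hepi : Epi ((stalk x).map (F.tr n)) := inferInstance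
  exact (AddCommGrpCat.epi_iff_surjective _).1 hepi

lemma val_surjective (hF : F.IsAdic) (n : ℕ) (y : (stalk x).obj (F.obj n)) :
    ∃ t : Stalk x F, t.val n = y := by
  obtain ⟨s, hs, hs'⟩ := exists_compatible_of_surjective n
    (S := fun m => (stalk x).obj (F.obj m)) _ hF.stalk_tr_surjective y
  exact ⟨⟨s, hs⟩, hs'⟩

/-- The kernel of `F_{n+1} ⟶ F_n` is the image of `π_E^(n+1)`. -/
lemma exists_act_eq (hF : F.IsAdic) [FiniteDimensional ℚ_[ℓ] F.E] {n : ℕ}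
    {y : (stalk x).obj (F.obj (n + 1))} (hy : ((stalk x).map (F.tr n)).hom y = 0) :
    ∃ z, ((stalk x).map (F.act (n + 1) (unif F.E ^ (n + 1)))).hom z = y := by
  have := (isAdic_iff F).1 hF n
  have hex : ((ShortComplex.mk _ (F.tr n) (F.act_unif_tr n)).map (stalk x)).Exact := by
    refine (ShortComplex.exact_of_g_is_cokernel (ShortComplex.mk _ (F.tr n) (F.act_unif_tr n))
      ?_).map (stalk x)
    exact IsColimit.ofIsoColimit (cokernelIsCokernel _) (Cofork.ext (asIso (cokernel.desc _ (F.tr n) (F.act_unif_tr n))) (by simp))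
  rw [ShortComplex.ab_exact_iff] at hex
  exact hex _ hy

lemma exists_act_eq_of_trIter (hF : F.IsAdic) [FiniteDimensional ℚ_[ℓ] F.E] {n k : ℕ}
    {y : (stalk x).obj (F.obj (n + k))} (hy : ((stalk x).map (F.trIter n k)).hom y = 0) :
    ∃ z, ((stalk x).map (F.act (n + k) (unif F.E ^ (n + 1)))).hom z = y := by
  induction k with
  | zero =>
    refine ⟨0, ?_⟩
    rw [map_zero]
    exact hy.symm.trans (congrArg (fun φ => AddCommGrpCat.Hom.hom φ y) ((stalk x).map_id (F.obj n)))
  | succ k ih =>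
    obtain ⟨z, hz⟩ := ih (y := ((stalk x).map (F.tr (n + k))).hom y) (by
      rw [← stalk_comp_apply]
      exact hy)
    obtain ⟨z', rfl⟩ := hF.stalk_tr_surjective _ z
    rw [← stalk_comp_apply, ← F.tr_act, stalk_comp_apply, ← sub_eq_zero, ← map_sub] at hz
    obtain ⟨w, hw⟩ := hF.exists_act_eq hz
    refine ⟨z' - ((stalk x).map (F.act (n + k + 1) (unif F.E ^ k))).hom w, ?_⟩
    have : ((stalk x).map (F.act (n + k + 1) (unif F.E ^ (n + 1)))).hom
        (((stalk x).map (F.act (n + k + 1) (unif F.E ^ k))).hom w) =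
        ((stalk x).map (F.act (n + k + 1) (unif F.E ^ (n + k + 1)))).hom w := by
      have hpow : unif F.E ^ (n + k + 1) = unif F.E ^ (n + 1) * unif F.E ^ k := by ring
      rw [hpow, map_mul, ← stalk_comp_apply]
      rfl
    change ((stalk x).map (F.act (n + k + 1) (unif F.E ^ (n + 1)))).hom (z' - _) = y
    rw [map_sub, this, hw, sub_sub_cancel]

end PiSystem.IsAdic

/-- The kernel of `T → (F_n)_x` is `π_E ^ (n + 1) T`. -/
lemma IsSmoothSystem.exists_smul_eq (hF : IsSmoothSystem F) [FiniteDimensional ℚ_[ℓ] F.E] {n : ℕ}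
    (t : Stalk x F) (ht : t.val n = 0) : ∃ u : Stalk x F, unif F.E ^ (n + 1) • u = t := by
  let S (m : ℕ) : Type u :=
    {z : (stalk x).obj (F.obj m) // ((stalk x).map (F.act m (unif F.E ^ (n + 1)))).hom z = t.val m}
  let p (m : ℕ) (z : S (m + 1)) : S m := ⟨((stalk x).map (F.tr m)).hom z.1, by
    rw [← stalk_comp_apply, ← F.tr_act, stalk_comp_apply, z.2, t.tr_val]⟩
  have (m : ℕ) : Finite (S m) := by
    have := (hF.isLC m).finite_stalk x
    exact Subtype.finite
  have (m : ℕ) : Nonempty (S m) := by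
    rcases le_total m n with h | h
    · exact ⟨0, by rw [map_zero, t.val_eq_zero_of_le h ht]⟩
    · obtain ⟨k, rfl⟩ := Nat.exists_eq_add_of_le h
      obtain ⟨z, hz⟩ := hF.1.exists_act_eq_of_trIter (y := t.val (n + k)) (by rw [t.trIter_val, ht])
      exact ⟨z, hz⟩
  obtain ⟨s, hs⟩ := exists_compatible p
  exact ⟨⟨fun m => (s m).1, fun m => congrArg Subtype.val (hs m)⟩, Stalk.ext fun m => (s m).2⟩

lemma IsSmoothSystem.exists_smul_eq_of_mem (hF : IsSmoothSystem F) [FiniteDimensional ℚ_[ℓ] F.E]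
    {n : ℕ} (t : Stalk x F) :
    t.val n = 0 ↔ t ∈ (maxIdeal F.E ^ (n + 1) • ⊤ : Submodule (valRing F.E) (Stalk x F)) := by
  constructor
  · intro h
    obtain ⟨u, rfl⟩ := hF.exists_smul_eq t h
    refine Submodule.smul_mem_smul ?_ trivial
    rw [maxIdeal_pow_eq_span]
    exact Ideal.mem_span_singleton_self _
  · intro h
    induction h using Submodule.smul_induction_on' with
    | smul a ha t _ =>
      rw [Stalk.val_smul, F.act_eq_zero n a ha, Functor.map_zero]
      rfl
    | add t _ t' _ h h' => rw [Stalk.val_add, h, h', add_zero]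

lemma IsSmoothSystem.isHausdorff (hF : IsSmoothSystem F) :
    IsHausdorff (maxIdeal F.E) (Stalk x F) where
  haus' t ht := Stalk.ext fun n => by
    have := F.finite
    have h := ht (n + 1)
    rw [SModEq.zero] at h
    exact (hF.exists_smul_eq_of_mem t).2 h

/-- Lifts of elements generating `(F_0)_x` generate the stalk. -/
lemma IsSmoothSystem.span_eq_top (hF : IsSmoothSystem F) {r : ℕ} (t : Fin r → Stalk x F)
    (h : ∀ y : (stalk x).obj (F.obj 0), ∃ c : Fin r → valRing F.E, (∑ i, c i • t i).val 0 = y) :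
    Submodule.span (valRing F.E) (Set.range t) = ⊤ := by
  have := F.finite
  have := hF.isHausdorff (x := x)
  refine surjective_of_complete (I := maxIdeal F.E) t fun m => ?_
  obtain ⟨c, hc⟩ := h (m.val 0)
  refine ⟨c, ?_⟩
  have := (hF.exists_smul_eq_of_mem (n := 0) (m - ∑ i, c i • t i)).1 (by
    rw [Stalk.val_sub, hc, sub_self])
  rwa [zero_add, pow_one] at this

/-- The stalk of a smooth system is a finitely generated `𝒪_E`-module. -/
lemma IsSmoothSystem.finite_stalk (hF : IsSmoothSystem F) (x : Spec (.of Ω) ⟶ X) :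
    Module.Finite (valRing F.E) (Stalk x F) := by
  have := (hF.isLC 0).finite_stalk x
  obtain ⟨r, ⟨e⟩⟩ := Finite.exists_equiv_fin ((stalk x).obj (F.obj 0))
  choose t ht using fun y => hF.1.val_surjective (x := x) 0 y
  refine ⟨Submodule.fg_def.2 ⟨Set.range fun i => t (e.symm i), Set.finite_range _, ?_⟩⟩
  refine hF.span_eq_top _ fun y => ⟨Pi.single (e y) 1, ?_⟩
  rw [Finset.sum_eq_single (e y) (fun j _ hj => by rw [Pi.single_eq_of_ne hj, zero_smul]) (by simp)]
  simp [ht]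

end Smooth

/-! ### Rank and torsion -/

section Rank

open PiSystem

variable {ℓ : ℕ} [Fact ℓ.Prime] {X : Scheme.{u}} {F G H : PiSystem ℓ (EtAb X)}
variable {Ω : Type u} [Field Ω] [IsSepClosed Ω] {x : Spec (.of Ω) ⟶ X}

/-- The components of the elements of the stalk of a system, as a homomorphism. -/
def Stalk.valHom (n : ℕ) : Stalk x F →+ (stalk x).obj (F.obj n) :=
  AddMonoidHom.mk' (fun t => t.val n) fun _ _ => rfl

/-- Evaluation of morphisms at an element of a stalk, as a homomorphism. -/
def stalkMapHom (x : Spec (.of Ω) ⟶ X) {A B : EtAb X} (y : (stalk x).obj A) :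
    (A ⟶ B) →+ (stalk x).obj B :=
  AddMonoidHom.mk' (fun φ => ((stalk x).map φ).hom y) fun φ ψ => by
    rw [Functor.map_add]
    rfl

/-- The map on stalks with `ℚ̄_ℓ`-coefficients induced by a morphism of systems. -/
def qlMap (x : Spec (.of Ω) ⟶ X) (f : F ⟶ G) : QlStalk x F →ₗ[PadicAlgCl ℓ] QlStalk x G :=
  LinearMap.liftBaseChange (PadicAlgCl ℓ)
    { toFun := fun t : Stalk x F => (1 : PadicAlgCl ℓ) ⊗ₜ[valRing G.E] t.map f
      map_add' := fun t t' => by rw [Stalk.map_add, TensorProduct.tmul_add]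
      map_smul' := fun a t => by
        rw [Stalk.map_smul, ← TensorProduct.smul_tmul, RingHom.id_apply, TensorProduct.smul_tmul']
        rfl }

@[simp] lemma qlMap_tmul (f : F ⟶ G) (c : PadicAlgCl ℓ) (t : Stalk x F) :
    qlMap x f (c ⊗ₜ t) = c ⊗ₜ t.map f := by
  simp [qlMap, TensorProduct.smul_tmul']

lemma qlMap_comp (f : F ⟶ G) (g : G ⟶ H) (z : QlStalk x F) :
    qlMap x (f ≫ g) z = qlMap x g (qlMap x f z) := by
  induction z using TensorProduct.induction_on with
  | zero => simp
  | add z z' h h' => rw [map_add, map_add, map_add, h, h']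
  | tmul c t => simp [Stalk.map_comp]

lemma qlMap_id (z : QlStalk x F) : qlMap x (𝟙 F) z = z := by
  induction z using TensorProduct.induction_on with
  | zero => simp
  | add z z' h h' => rw [map_add, h, h']
  | tmul c t => simp [Stalk.map_id]

lemma bijective_qlMap_mulEll (F : PiSystem ℓ (EtAb X)) : Function.Bijective (qlMap x F.mulEll) := by
  have h (z : QlStalk x F) : qlMap x F.mulEll z = (ℓ : PadicAlgCl ℓ) • z := by
    induction z using TensorProduct.induction_on with
    | zero => simp
    | add z z' h h' => rw [map_add, h, h', smul_add]
    | tmul c t =>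
      rw [qlMap_tmul, Stalk.map_mulEll, TensorProduct.tmul_smul, Nat.cast_smul_eq_nsmul]
  refine ⟨fun z z' hz => ?_, fun z => ⟨(ℓ : PadicAlgCl ℓ)⁻¹ • z, ?_⟩⟩
  · rw [h, h] at hz
    exact smul_right_injective _ (ell_ne_zero (ℓ := ℓ)) hz
  · rw [h, smul_inv_smul₀ (ell_ne_zero (ℓ := ℓ))]

/-- An extension of scalars identifies the stalk of the target with `𝒪_L ⊗ T`. -/
lemma PiSystem.IsBaseChange.bijective_qlMap {f : F ⟶ G} (hf : IsBaseChange f)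
    (hF : IsSmoothSystem F) (x : Spec (.of Ω) ⟶ X) : Function.Bijective (qlMap x f) := by
  have := F.finite
  have := G.finite
  let := (valRingIncl f.field_le).toAlgebra
  let : Module (valRing F.E) (Stalk x G) := Module.compHom _ (valRingIncl f.field_le)
  have : IsScalarTower (valRing F.E) (valRing G.E) (Stalk x G) :=
    ⟨fun a b t => mul_smul (valRingIncl f.field_le a) b t⟩
  have : IsScalarTower (valRing F.E) (valRing G.E) (PadicAlgCl ℓ) :=
    ⟨fun a b t => mul_smul (valRingIncl f.field_le a) b t⟩
  have hG := hF.of_baseChange hf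
  obtain ⟨d, ⟨b⟩⟩ := exists_basis_valRing f.field_le
  let l : Stalk x F →ₗ[valRing F.E] Stalk x G :=
    { toFun := fun t => t.map f
      map_add' := fun t t' => Stalk.map_add f t t'
      map_smul' := fun a t => Stalk.map_smul f a t }
  let φ : valRing G.E ⊗[valRing F.E] Stalk x F →ₗ[valRing G.E] Stalk x G :=
    l.liftBaseChange (valRing G.E)
  have hφ (a : valRing G.E) (t : Stalk x F) : φ (a ⊗ₜ t) = a • t.map f := by
    simp [φ, l]
  have hinj : Function.Injective φ := by
    rw [injective_iff_map_eq_zero]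
    intro z hz
    obtain ⟨t, rfl⟩ : ∃ t : Fin d → Stalk x F, z = ∑ i, b i ⊗ₜ t i := by
      clear hz
      induction z using TensorProduct.induction_on with
      | zero => exact ⟨0, by simp⟩
      | add z z' h h' =>
        obtain ⟨t, rfl⟩ := h
        obtain ⟨t', rfl⟩ := h'
        exact ⟨t + t', by simp [TensorProduct.tmul_add, Finset.sum_add_distrib]⟩
      | tmul c t =>
        refine ⟨fun i => b.repr c i • t, ?_⟩
        conv_lhs => rw [← b.sum_repr c]
        rw [TensorProduct.sum_tmul]
        exact Finset.sum_congr rfl fun i _ => TensorProduct.smul_tmul _ _ _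
    -- The retractions recover the coordinates `t i` of an element of the kernel.
    have ht (i : Fin d) : t i = 0 := Stalk.ext fun n => by
      obtain ⟨k, r, h₁, h₂⟩ := hf.exists_retraction b n
      have hterm (j : Fin d) : ((stalk x).map (r i)).hom ((b j • (t j).map f).val (n + k)) =
          ((stalk x).map (f.app (n + k) ≫
            (G.act (n + k) (b j) : G.obj (n + k) ⟶ G.obj (n + k)) ≫ r i)).hom ((t j).val (n + k)) := by
        rw [Stalk.val_smul, Stalk.val_map, stalk_comp_apply, stalk_comp_apply]
      have h₃ := congrArg (fun s : Stalk x G => ((stalk x).map (r i)).hom (Stalk.valHom (n + k) s)) hz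
      simp only [map_sum, hφ, map_zero] at h₃
      rw [Finset.sum_eq_single i (fun j _ hj => ?_) (by simp)] at h₃
      · refine Eq.trans ?_ h₃
        change _ = ((stalk x).map (r i)).hom ((b i • (t i).map f).val (n + k))
        rw [hterm, h₁, Stalk.trIter_val]
      · change ((stalk x).map (r i)).hom ((b j • (t j).map f).val (n + k)) = 0
        rw [hterm, h₂ j i hj, Functor.map_zero]
        rfl
    simp [ht]
  -- Elements which generate the stalk of `G_0` generate the stalk of `G`.
  have hsurj : Function.Surjective φ := by
    rw [← LinearMap.range_eq_top, ← top_le_iff]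
    have := (hF.isLC 0).finite_stalk x
    obtain ⟨r, ⟨e⟩⟩ := Finite.exists_equiv_fin ((stalk x).obj (F.obj 0))
    choose t ht using fun y => hF.1.val_surjective (x := x) 0 y
    rw [← hG.span_eq_top (fun i => (t (e.symm i)).map f) fun y => ?_, Submodule.span_le]
    · rintro _ ⟨i, rfl⟩
      exact ⟨1 ⊗ₜ t (e.symm i), by rw [hφ, one_smul]⟩
    · obtain ⟨P, -, d', b', -, π, -, -, -, -, hepi⟩ := hf.exists_presentation 0
      have hepi' : Epi ((stalk x).map
        (∑ i, π i ≫ f.app 0 ≫ (G.act 0 (b' i) : G.obj 0 ⟶ G.obj 0))) := inferInstance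
      obtain ⟨p, rfl⟩ := (AddCommGrpCat.epi_iff_surjective _).1 hepi' y
      refine ⟨∑ i, Pi.single (e (((stalk x).map (π i)).hom p)) (b' i), ?_⟩
      have (i : Fin d') : ∑ j, (Pi.single (M := fun _ => valRing G.E)
          (e (((stalk x).map (π i)).hom p)) (b' i) j) • (t (e.symm j)).map f =
            b' i • (t (((stalk x).map (π i)).hom p)).map f := by
        rw [Finset.sum_eq_single (e (((stalk x).map (π i)).hom p))
          (fun j _ hj => by rw [Pi.single_eq_of_ne hj, zero_smul]) (by simp)]
        simp
      simp only [Finset.sum_apply, Finset.sum_smul]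
      rw [Finset.sum_comm]
      simp only [this]
      change Stalk.valHom 0 _ = stalkMapHom x p _
      rw [map_sum, map_sum]
      refine Finset.sum_congr rfl fun i _ => ?_
      change (b' i • (t (((stalk x).map (π i)).hom p)).map f).val 0 =
        ((stalk x).map (π i ≫ f.app 0 ≫ (G.act 0 (b' i) : G.obj 0 ⟶ G.obj 0))).hom p
      rw [Stalk.val_smul, Stalk.val_map, ht, stalk_comp_apply, stalk_comp_apply]
  let e : valRing G.E ⊗[valRing F.E] Stalk x F ≃ₗ[valRing G.E] Stalk x G :=
    LinearEquiv.ofBijective φ ⟨hinj, hsurj⟩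
  let e' : PadicAlgCl ℓ ⊗[valRing F.E] Stalk x F ≃ₗ[PadicAlgCl ℓ] PadicAlgCl ℓ ⊗[valRing G.E] Stalk x G :=
    (TensorProduct.AlgebraTensorModule.cancelBaseChange (valRing F.E) (valRing G.E) (PadicAlgCl ℓ)
      (PadicAlgCl ℓ) (Stalk x F)).symm ≪≫ₗ
    TensorProduct.AlgebraTensorModule.congr (LinearEquiv.refl _ _) e
  have he (z : QlStalk x F) : qlMap x f z = e' z := by
    induction z using TensorProduct.induction_on with
    | zero => simp
    | add z z' h h' => rw [map_add, map_add, h, h']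
    | tmul c t =>
      rw [qlMap_tmul]
      simp only [e', e, LinearEquiv.trans_apply,
        TensorProduct.AlgebraTensorModule.cancelBaseChange_symm_tmul,
        TensorProduct.AlgebraTensorModule.congr_tmul, LinearEquiv.refl_apply]
      exact congrArg (c ⊗ₜ[valRing G.E] ·) ((hφ 1 t).trans (one_smul _ _)).symm
  have : ⇑(qlMap x f) = e' := funext he
  rw [this]
  exact e'.bijective

/-- The morphisms of `W'` induce bijections on `ℚ̄_ℓ`-stalks. -/
lemma bijective_qlMap_of_W' {f : F ⟶ G} (hf : W' ℓ _ f) (hF : IsSmoothSystem F)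
    (x : Spec (.of Ω) ⟶ X) : Function.Bijective (qlMap x f) := by
  have key {F G : PiSystem ℓ (EtAb X)} {f : F ⟶ G} (hf : W f) (hF : IsSmoothSystem F) :
      Function.Bijective (qlMap x f) := by
    cases hf with
    | baseChange _ hf => exact hf.bijective_qlMap hF x
    | mulEll => exact bijective_qlMap_mulEll F
  induction hf with
  | of f hf => exact key hf hF
  | id F =>
    rw [show ⇑(qlMap x (𝟙 F)) = id from funext qlMap_id]
    exact Function.bijective_id
  | comp_of f g hf hg ih =>
    rw [show ⇑(qlMap x (f ≫ g)) = qlMap x g ∘ qlMap x f from funext (qlMap_comp f g)]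
    exact (key hg (hF.of_W' hf)).comp (ih hF)

lemma IsSmoothSystem.finite_qlStalk (hF : IsSmoothSystem F) (x : Spec (.of Ω) ⟶ X) :
    Module.Finite (PadicAlgCl ℓ) (QlStalk x F) := by
  have := hF.finite_stalk x
  infer_instance

/-- The dimension of the stalk is invariant: an isomorphism `φ` and its inverse are fractions, and the
denominators induce bijections on stalks. -/
lemma finrank_qlStalk_le (hF : IsSmoothSystem F) (hG : IsSmoothSystem G)
    (φ : (QlSystem.Q ℓ _).obj F ≅ (QlSystem.Q ℓ _).obj G) (x : Spec (.of Ω) ⟶ X) :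
    Module.finrank (PadicAlgCl ℓ) (QlStalk x F) ≤ Module.finrank (PadicAlgCl ℓ) (QlStalk x G) := by
  obtain ⟨H, a, s, hs, hφ⟩ := exists_fraction φ.hom
  have := isIso_Q_map hs
  have : IsIso ((QlSystem.Q ℓ (EtAb X)).map a) := hφ ▸ inferInstance
  obtain ⟨K, b, t, ht, hab⟩ := exists_fraction (inv ((QlSystem.Q ℓ (EtAb X)).map a))
  rw [IsIso.inv_comp_eq, ← Functor.map_comp, Q_map_eq_iff] at hab
  obtain ⟨K', u, hu, h⟩ := hab
  have h₁ := (bijective_qlMap_of_W' ((W' ℓ _).comp_mem _ _ ht hu) hF x).1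
  rw [h, Category.assoc, show ⇑(qlMap x (a ≫ b ≫ u)) = qlMap x (b ≫ u) ∘ qlMap x a from
    funext (qlMap_comp a (b ≫ u))] at h₁
  have h₂ := bijective_qlMap_of_W' hs hG x
  have := (hG.of_W' hs).finite_qlStalk x
  have := hG.finite_qlStalk x
  exact (LinearMap.finrank_le_finrank_of_injective h₁.of_comp).trans
    (LinearMap.finrank_le_finrank_of_surjective h₂.2)

/-- The rank depends only on the local system with `ℚ̄_ℓ`-coefficients. -/
lemma IsRankOne.of_iso (hF : IsSmoothSystem F) (hG : IsSmoothSystem G)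
    (φ : (QlSystem.Q ℓ _).obj F ≅ (QlSystem.Q ℓ _).obj G) (h : IsRankOne x F) : IsRankOne x G :=
  le_antisymm ((finrank_qlStalk_le hG hF φ.symm x).trans_eq h)
    (h.symm.trans_le (finrank_qlStalk_le hF hG φ x))

/-- The torsion of the stalk of a smooth system is annihilated by a fixed power of `ℓ`, because the stalk is
finitely generated. -/
lemma IsSmoothSystem.exists_torsion_bound (hF : IsSmoothSystem F) (x : Spec (.of Ω) ⟶ X) :
    ∃ N : ℕ, ∀ t : Stalk x F, (1 : PadicAlgCl ℓ) ⊗ₜ[valRing F.E] t = 0 → ℓ ^ N • t = 0 := by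
  have := F.finite
  have := hF.finite_stalk x
  obtain ⟨c, hc, h⟩ := LadicSheaf.exists_torsion_bound (valRing F.E) (Stalk x F)
  obtain ⟨N, d, hd⟩ := exists_dvd_ell_pow F.E hc
  refine ⟨N, fun t ht => ?_⟩
  obtain ⟨a, ha, hat⟩ := (one_tmul_eq_zero_iff t).1 ht
  rw [← Nat.cast_smul_eq_nsmul (valRing F.E), Nat.cast_pow, hd, mul_comm, mul_smul, h t a ha hat,
    smul_zero]

lemma one_tmul_eq_zero_of_smul {t : Stalk x F} {N : ℕ} (h : ℓ ^ N • t = 0) :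
    (1 : PadicAlgCl ℓ) ⊗ₜ[valRing F.E] t = 0 := by
  have h₀ : ((ℓ ^ N : ℕ) : valRing F.E) ≠ 0 := fun h => pow_ne_zero N (ell_ne_zero (ℓ := ℓ))
    (by simpa using congrArg (fun a : valRing F.E => (a : PadicAlgCl ℓ)) h)
  exact tmul_eq_zero_of_smul_eq_zero h₀ (by rw [Nat.cast_smul_eq_nsmul, h]) 1

/-- On a connected scheme, a morphism of smooth systems is determined up to torsion by its effect
on one stalk. -/
lemma smul_eq_of_one_tmul_eq [ConnectedSpace X] (hF : IsSmoothSystem F) (hG : IsSmoothSystem G)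
    (x : Spec (.of Ω) ⟶ X) {N : ℕ}
    (hN : ∀ t : Stalk x G, (1 : PadicAlgCl ℓ) ⊗ₜ[valRing G.E] t = 0 → ℓ ^ N • t = 0)
    {a b : F ⟶ G} (h : ∀ t : Stalk x F, (1 : PadicAlgCl ℓ) ⊗ₜ[valRing G.E] t.map a =
      (1 : PadicAlgCl ℓ) ⊗ₜ[valRing G.E] t.map b) (n : ℕ) :
    ℓ ^ N • a.app n = ℓ ^ N • b.app n := by
  rw [← sub_eq_zero, ← smul_sub]
  refine eq_zero_of_stalk_map (hF.isLC n) (hG.isLC n) _ x fun y => ?_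
  obtain ⟨t, rfl⟩ := hF.1.val_surjective n y
  rw [stalk_map_nsmul, stalk_map_sub]
  have := hN (t.map a - t.map b) (by rw [TensorProduct.tmul_sub, h, sub_self])
  have := congrArg (fun s : Stalk x G => s.val n) this
  rwa [Stalk.val_nsmul, Stalk.val_sub] at this

/-- On a connected scheme, the torsion of morphisms to a given smooth system is bounded. -/
lemma IsSmoothSystem.exists_bound [ConnectedSpace X] (hG : IsSmoothSystem G)
    (x : Spec (.of Ω) ⟶ X) : ∃ N : ℕ, ∀ (F : PiSystem ℓ (EtAb X)), IsSmoothSystem F →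
      ∀ a b : F ⟶ G, (QlSystem.Q ℓ _).map a = (QlSystem.Q ℓ _).map b →
        ∀ n, ℓ ^ N • a.app n = ℓ ^ N • b.app n := by
  obtain ⟨N, hN⟩ := hG.exists_torsion_bound x
  refine ⟨N, fun F hF a b h n => smul_eq_of_one_tmul_eq hF hG x hN (fun t => ?_) n⟩
  obtain ⟨M, hM⟩ := (Q_map_eq_iff_of_epi hF.epi_tr a b).1 h
  rw [← sub_eq_zero, ← TensorProduct.tmul_sub]
  refine one_tmul_eq_zero_of_smul (N := M) (Stalk.ext fun m => ?_)
  rw [Stalk.val_nsmul, Stalk.val_sub, Stalk.val_map, Stalk.val_map, smul_sub, ← stalk_map_nsmul,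
    ← stalk_map_nsmul, hM, sub_self]
  rfl

/-- On a connected scheme, a morphism of local systems is determined by its effect on one stalk. -/
lemma Q_map_eq_of_one_tmul_eq [ConnectedSpace X] (hF : IsSmoothSystem F) (hG : IsSmoothSystem G)
    (x : Spec (.of Ω) ⟶ X) {a b : F ⟶ G} (h : ∀ t : Stalk x F,
      (1 : PadicAlgCl ℓ) ⊗ₜ[valRing G.E] t.map a = (1 : PadicAlgCl ℓ) ⊗ₜ[valRing G.E] t.map b) :
    (QlSystem.Q ℓ _).map a = (QlSystem.Q ℓ _).map b := by
  obtain ⟨N, hN⟩ := hG.exists_torsion_bound x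
  exact Q_map_eq_of_smul_eq N a b (smul_eq_of_one_tmul_eq hF hG x hN h)

/-- The stalk of a smooth system of rank one is free of rank one up to torsion. -/
lemma IsRankOne.exists_coordinate (h : IsRankOne x F) (hF : IsSmoothSystem F) :
    ∃ q : Stalk x F →ₗ[valRing F.E] valRing F.E, Function.Surjective q ∧
      ∀ t t' : Stalk x F, ∀ c : PadicAlgCl ℓ,
        (1 : PadicAlgCl ℓ) ⊗ₜ[valRing F.E] t' = c ⊗ₜ[valRing F.E] t ↔ (q t' : PadicAlgCl ℓ) = c * q t := by
  have := F.finite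
  have := hF.finite_stalk x
  obtain ⟨q, e, hq, -, he⟩ := exists_linearEquiv_tensor (R := valRing F.E) (Q := PadicAlgCl ℓ)
    (M := Stalk x F)
  have h' : Module.finrank (PadicAlgCl ℓ) (PadicAlgCl ℓ ⊗[valRing F.E] Stalk x F) = 1 := h
  let i : Fin (Module.finrank (PadicAlgCl ℓ) (PadicAlgCl ℓ ⊗[valRing F.E] Stalk x F)) :=
    ⟨0, by rw [h']; exact one_pos⟩
  have hi (j) : j = i := Fin.ext (by have := j.2; change j.1 = 0; lia)
  refine ⟨LinearMap.proj i ∘ₗ q, fun a => ?_, fun t t' c => ?_⟩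
  · obtain ⟨t, ht⟩ := hq fun _ => a
    exact ⟨t, congrFun ht i⟩
  · rw [← e.injective.eq_iff, funext_iff]
    have (t : Stalk x F) : ((LinearMap.proj i ∘ₗ q) t : PadicAlgCl ℓ) =
        algebraMap (valRing F.E) (PadicAlgCl ℓ) (q t i) := rfl
    rw [this, this]
    refine ⟨fun h => ?_, fun h j => ?_⟩
    · have := h i
      rwa [he, he, one_mul] at this
    · rw [hi j, he, he, one_mul, h]

end Rank

/-! ### Geometry of the separable base change -/

section Geometry

variable {K Ks : Type u} [Field K] [Field Ks] [Algebra K Ks]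

instance : Surjective (specSep K Ks) := ⟨fun _ => ⟨default, Subsingleton.elim _ _⟩⟩

instance [Algebra.IsSeparable K Ks] : IsIntegralHom (specSep K Ks) := by
  rw [specSep, IsIntegralHom.SpecMap_iff]
  exact fun a => Algebra.IsIntegral.isIntegral (R := K) (A := Ks) a

variable {X : Scheme.{u}} (f : X ⟶ Spec (.of K))

instance : Surjective (sepProj Ks f) :=
  MorphismProperty.of_isPullback (sep_isPullback Ks f).flip inferInstance

instance : UniversallyOpen (sepProj Ks f) :=
  MorphismProperty.of_isPullback (sep_isPullback Ks f).flip inferInstance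

instance [Algebra.IsSeparable K Ks] : IsIntegralHom (sepProj Ks f) :=
  MorphismProperty.of_isPullback (sep_isPullback Ks f).flip inferInstance

variable [IsSepClosed Ks]

/-- The fibre of `X̄ ⟶ X` over a rational point is a point. -/
lemma eq_geomPtBar (x : Spec (.of K) ⟶ X) (hx : x ≫ f = 𝟙 _) (q : sepBaseChange Ks f)
    (hq : sepProj Ks f q = x default) : q = geomPtBar Ks f x hx default := by
  have h : IsPullback (geomPtBar Ks f x hx) (specSep K Ks) (sepProj Ks f) x := by
    refine IsPullback.of_right (h₁₂ := sepStr Ks f) (h₂₂ := f) (v₁₃ := specSep K Ks) ?_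
      (geomPtBar_proj f x hx) (sep_isPullback Ks f).flip
    have h₁ : geomPtBar Ks f x hx ≫ sepStr Ks f = 𝟙 _ := IsPullback.lift_snd _ _ _ _
    rw [h₁, hx]
    exact IsPullback.of_id_fst
  obtain ⟨t, ht, -⟩ := Scheme.exists_preimage_of_isPullback h q default hq
  rw [← ht, Subsingleton.elim t default]

/-- `X̄` is connected: the projection to `X` is open, closed and surjective, and one of its fibres
is a point. -/
lemma connectedSpace_sepBaseChange [Algebra.IsSeparable K Ks] [ConnectedSpace X]
    (x : Spec (.of K) ⟶ X) (hx : x ≫ f = 𝟙 _) : ConnectedSpace (sepBaseChange Ks f) := by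
  have hne : Nonempty (sepBaseChange Ks f) := ⟨geomPtBar Ks f x hx default⟩
  have hopen : IsOpenMap (sepProj Ks f) := (sepProj Ks f).isOpenMap
  have hclosed : IsClosedMap (sepProj Ks f) := (sepProj Ks f).isClosedMap
  have key (Z : Set (sepBaseChange Ks f)) (hZ : IsClopen Z) (hZ' : Z.Nonempty) :
      geomPtBar Ks f x hx default ∈ Z := by
    have h := IsClopen.eq_univ (s := sepProj Ks f '' Z) ⟨hclosed _ hZ.1, hopen _ hZ.2⟩
      (hZ'.image _)
    obtain ⟨q, hq, hq'⟩ := h.ge (Set.mem_univ (x default))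
    rwa [← eq_geomPtBar f x hx q hq']
  have : PreconnectedSpace (sepBaseChange Ks f) := by
    rw [preconnectedSpace_iff_clopen]
    intro Z hZ
    by_contra! h
    obtain ⟨h₁, h₂⟩ := h
    exact key Zᶜ hZ.compl (Set.nonempty_compl.2 h₂) (key Z hZ h₁)
  exact ⟨hne⟩

end Geometry

/-! ### The Galois action on sections -/

section SectionAction

variable {K Ks : Type u} [Field K] [Field Ks] [Algebra K Ks] {X : Scheme.{u}}
  {f : X ⟶ Spec (.of K)}

/-- The automorphism of the direct image of an equivariant sheaf given by a Galois automorphism. -/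
def galPush (F : Equivariant (galAction (Ks := Ks) f)) (γ : Ks ≃ₐ[K] Ks) :
    (push (sepProj Ks f)).obj F.obj ⟶ (push (sepProj Ks f)).obj F.obj :=
  (projIso f γ).inv.app F.obj ≫ (push (sepProj Ks f)).map (F.act γ).hom

instance (F : Equivariant (galAction (Ks := Ks) f)) (γ : Ks ≃ₐ[K] Ks) : IsIso (galPush F γ) := by
  rw [galPush]; infer_instance

lemma galPush_mul (F : Equivariant (galAction (Ks := Ks) f)) (γ δ : Ks ≃ₐ[K] Ks) :
    galPush F (γ * δ) = galPush F δ ≫ galPush F γ := by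
  have h₁ := projIso_mul f γ δ F.obj
  have h₂ := (projIso f γ).inv.naturality (F.act δ).hom
  simp only [Functor.comp_map] at h₂
  have h₃ : (projIso f (γ * δ)).inv.app F.obj = (projIso f δ).inv.app F.obj ≫
      (projIso f γ).inv.app (((galAction f).T δ).obj F.obj) ≫
        (push (sepProj Ks f)).map (((galAction f).comp γ δ).hom.app F.obj) := by
    rw [← cancel_mono ((projIso f (γ * δ)).hom.app F.obj), Iso.inv_hom_id_app, Category.assoc,
      Category.assoc, h₁]
    simp
  rw [galPush, galPush, galPush, h₃, Category.assoc, Category.assoc, ← Functor.map_comp,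
    F.act_mul, Functor.map_comp, Category.assoc, reassoc_of% h₂]

lemma galPush_one (F : Equivariant (galAction (Ks := Ks) f)) :
    galPush F (1 : Ks ≃ₐ[K] Ks) = 𝟙 _ := by
  have := galPush_mul F 1 1
  rw [mul_one] at this
  rw [← cancel_mono (galPush F (1 : Ks ≃ₐ[K] Ks)), Category.id_comp, ← this]

/-- The action of a Galois automorphism on the sections of an equivariant sheaf over
`Ū = U ×_X X̄`. -/
abbrev secAct (F : Equivariant (galAction (Ks := Ks) f)) (γ : Ks ≃ₐ[K] Ks) (U : X.Etale) :
    Sec F.obj ((etBaseChange (sepProj Ks f)).obj U) →+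
      Sec F.obj ((etBaseChange (sepProj Ks f)).obj U) :=
  mor (galPush F γ) U

lemma secAct_mul (F : Equivariant (galAction (Ks := Ks) f)) (γ δ : Ks ≃ₐ[K] Ks) {U : X.Etale}
    (s : Sec F.obj ((etBaseChange (sepProj Ks f)).obj U)) :
    secAct F (γ * δ) U s = secAct F γ U (secAct F δ U s) := by
  exact (congrArg (fun φ => mor φ U s) (galPush_mul F γ δ)).trans
    (mor_comp (galPush F δ) (galPush F γ) s)

lemma secAct_one (F : Equivariant (galAction (Ks := Ks) f)) {U : X.Etale}
    (s : Sec F.obj ((etBaseChange (sepProj Ks f)).obj U)) : secAct F 1 U s = s := by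
  exact (congrArg (fun φ => mor φ U s) (galPush_one F)).trans (mor_id s)

lemma res_secAct (F : Equivariant (galAction (Ks := Ks) f)) (γ : Ks ≃ₐ[K] Ks) {U V : X.Etale}
    (a : V ⟶ U) (s : Sec F.obj ((etBaseChange (sepProj Ks f)).obj U)) :
    res F.obj ((etBaseChange (sepProj Ks f)).map a) (secAct F γ U s) =
      secAct F γ V (res F.obj ((etBaseChange (sepProj Ks f)).map a) s) :=
  (mor_res (galPush F γ) a s).symm

variable (f) in
/-- The isomorphism `γ^* Ū ⟶ Ū` of étale `X̄`-schemes. -/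
def galComp (γ : Ks ≃ₐ[K] Ks) (U : X.Etale) :
    (etBaseChange (galX f γ)).obj ((etBaseChange (sepProj Ks f)).obj U) ⟶
      (etBaseChange (sepProj Ks f)).obj U :=
  (etBaseChangeComp (galX f γ) (sepProj Ks f) _ (galX_proj f γ).symm).hom.app U

@[simp] lemma galComp_fst (γ : Ks ≃ₐ[K] Ks) (U : X.Etale) :
    totMap (galComp f γ U) ≫ bcFst (sepProj Ks f) U =
      bcFst (galX f γ) _ ≫ bcFst (sepProj Ks f) U :=
  bcLift_fst _ _ _ _ _

lemma secAct_eq (F : Equivariant (galAction (Ks := Ks) f)) (γ : Ks ≃ₐ[K] Ks) {U : X.Etale}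
    (s : Sec F.obj ((etBaseChange (sepProj Ks f)).obj U)) :
    secAct F γ U s = mor (F.act γ).hom ((etBaseChange (sepProj Ks f)).obj U)
      (res F.obj (galComp f γ U) s) :=
  mor_comp ((projIso f γ).inv.app F.obj) ((push (sepProj Ks f)).map (F.act γ).hom) s

/-- The restriction of `γ s` to an étale `X̄`-scheme `W` over `Ū` is determined by the restriction
of `s` to `γ^* W`. -/
lemma res_secAct_eq (F : Equivariant (galAction (Ks := Ks) f)) (γ : Ks ≃ₐ[K] Ks) {U : X.Etale}
    {W : (sepBaseChange Ks f).Etale} (a : W ⟶ (etBaseChange (sepProj Ks f)).obj U)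
    (s : Sec F.obj ((etBaseChange (sepProj Ks f)).obj U)) :
    res F.obj a (secAct F γ U s) = mor (F.act γ).hom W
      (res F.obj ((etBaseChange (galX f γ)).map a ≫ galComp f γ U) s) := by
  rw [secAct_eq]
  refine (mor_res _ a _).symm.trans ?_
  exact congrArg (mor (F.act γ).hom W) (res_res _ _ s)

lemma mor_secAct {F F' : Equivariant (galAction (Ks := Ks) f)} (φ : F ⟶ F') (γ : Ks ≃ₐ[K] Ks)
    {U : X.Etale} (s : Sec F.obj ((etBaseChange (sepProj Ks f)).obj U)) :
    mor φ.hom _ (secAct F γ U s) = secAct F' γ U (mor φ.hom _ s) := by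
  have h : galPush F γ ≫ (push (sepProj Ks f)).map φ.hom =
      (push (sepProj Ks f)).map φ.hom ≫ galPush F' γ := by
    have h₂ := (projIso f γ).inv.naturality φ.hom
    simp only [Functor.comp_map] at h₂
    rw [galPush, galPush, Category.assoc, ← Functor.map_comp, φ.comm, Functor.map_comp,
      reassoc_of% h₂]
  have h₁ := mor_comp (galPush F γ) ((push (sepProj Ks f)).map φ.hom) (U := U) s
  have h₂ := mor_comp ((push (sepProj Ks f)).map φ.hom) (galPush F' γ) (U := U) s
  exact h₁.symm.trans ((congrArg (fun χ => mor χ U s) h).trans h₂)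

end SectionAction

/-! ### Continuity of the natural action -/

section GaloisOnSections

/-- The global sections of a fibre product of affine schemes are generated by those of the
factors. -/
lemma closure_appTop_of_isPullback {P X Y S : Scheme.{u}} {fst : P ⟶ X} {snd : P ⟶ Y} {f : X ⟶ S}
    {g : Y ⟶ S} [IsAffine X] [IsAffine Y] [IsAffine S] (h : IsPullback fst snd f g) :
    Subring.closure (Set.range fst.appTop.hom ∪ Set.range snd.appTop.hom) = ⊤ := by
  have hP := isPushout_appTop_of_isPullback h
  let R := Subring.closure (Set.range fst.appTop.hom ∪ Set.range snd.appTop.hom)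
  let i : CommRingCat.of R ⟶ Γ(P, ⊤) := CommRingCat.ofHom R.subtype
  let a : Γ(X, ⊤) ⟶ CommRingCat.of R := CommRingCat.ofHom
    (fst.appTop.hom.codRestrict R fun r => Subring.subset_closure (.inl ⟨r, rfl⟩))
  let b : Γ(Y, ⊤) ⟶ CommRingCat.of R := CommRingCat.ofHom
    (snd.appTop.hom.codRestrict R fun r => Subring.subset_closure (.inr ⟨r, rfl⟩))
  have hi : Mono i := ConcreteCategory.mono_of_injective _ Subtype.val_injective
  obtain ⟨d, h₁, h₂⟩ := hP.exists_desc a b (by rw [← cancel_mono i]; exact hP.w)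
  have hd : d ≫ i = 𝟙 _ := hP.hom_ext (by rw [reassoc_of% h₁, Category.comp_id]; rfl)
    (by rw [reassoc_of% h₂, Category.comp_id]; rfl)
  refine eq_top_iff.2 fun t _ => ?_
  have := congrArg (fun φ => φ.hom t) hd
  have h' : ((d.hom t : R) : Γ(P, ⊤)) = t := this
  rw [← h']
  exact (d.hom t).2

variable {K Ks : Type u} [Field K] [Field Ks] [Algebra K Ks] {X : Scheme.{u}}
  (f : X ⟶ Spec (.of K))

lemma eventually_gal_apply [Algebra.IsSeparable K Ks] (b : Ks) :
    ∀ᶠ γ in nhds (1 : Ks ≃ₐ[K] Ks), γ b = b :=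
  (stabilizer_isOpen_of_isIntegral (K := K) b).mem_nhds (one_mem (MulAction.stabilizer _ b))

/-- The action of a Galois automorphism on `Ū = U ×_X X̄`, covering the action on `X̄`. -/
def galTot (γ : Ks ≃ₐ[K] Ks) (U : X.Etale) :
    tot ((etBaseChange (sepProj Ks f)).obj U) ⟶ tot ((etBaseChange (sepProj Ks f)).obj U) :=
  (bc_isPullback (sepProj Ks f) U).lift (bcFst _ U) (str _ ≫ galX f γ) (by
    rw [Category.assoc, galX_proj, bc_w])

lemma galTot_fst (γ : Ks ≃ₐ[K] Ks) (U : X.Etale) :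
    galTot f γ U ≫ bcFst (sepProj Ks f) U = bcFst _ U := IsPullback.lift_fst _ _ _ _

lemma galTot_str (γ : Ks ≃ₐ[K] Ks) (U : X.Etale) :
    galTot f γ U ≫ str ((etBaseChange (sepProj Ks f)).obj U) = str _ ≫ galX f γ :=
  IsPullback.lift_snd _ _ _ _

lemma galComp_galTot (γ : Ks ≃ₐ[K] Ks) (U : X.Etale) :
    totMap (galComp f γ U) ≫ galTot f γ U = bcFst (galX f γ) _ :=
  bc_tot_hom_ext _ (by rw [Category.assoc, galTot_fst, galComp_fst])
    (by rw [Category.assoc, galTot_str, totMap_str_assoc, bc_w])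

/-- `Ū` is the base change of `U` from `K` to `K^s`. -/
lemma bc_isPullback_specSep (U : X.Etale) : IsPullback (bcFst (sepProj Ks f) U)
    (str ((etBaseChange (sepProj Ks f)).obj U) ≫ sepStr Ks f) (str U ≫ f) (specSep K Ks) :=
  (bc_isPullback (sepProj Ks f) U).paste_vert (sep_isPullback Ks f)

/-- A function on `Ū` is fixed by an open subgroup of the Galois group. -/
lemma eventually_appTop_galTot [Algebra.IsSeparable K Ks] (U : X.Etale) [IsAffine (tot U)]
    (a : Γ(tot ((etBaseChange (sepProj Ks f)).obj U), ⊤)) :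
    ∀ᶠ γ in nhds (1 : Ks ≃ₐ[K] Ks), (galTot f γ U).appTop.hom a = a := by
  have ha : a ∈ Subring.closure _ :=
    (closure_appTop_of_isPullback (bc_isPullback_specSep (Ks := Ks) f U)).ge (Subring.mem_top a)
  induction ha using Subring.closure_induction with
  | zero => exact .of_forall fun γ => map_zero _
  | one => exact .of_forall fun γ => map_one _
  | add a b _ _ ha hb => filter_upwards [ha, hb] with γ ha hb; rw [map_add, ha, hb]
  | neg a _ ha => filter_upwards [ha] with γ ha; rw [map_neg, ha]
  | mul a b _ _ ha hb => filter_upwards [ha, hb] with γ ha hb; rw [map_mul, ha, hb]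
  | mem a ha =>
    obtain (⟨r, rfl⟩ | ⟨b, rfl⟩) := ha
    · refine .of_forall fun γ => ?_
      rw [← CommRingCat.comp_apply, ← Scheme.Hom.comp_appTop, galTot_fst]
    · obtain ⟨b, rfl⟩ := (Scheme.ΓSpecIso (.of Ks)).commRingCatIsoToRingEquiv.symm.surjective b
      have hb : ∀ᶠ γ in nhds (1 : Ks ≃ₐ[K] Ks), γ⁻¹ b = b :=
        (eventually_gal_apply b).mono fun γ hγ => by
          rw [← hγ]; exact (γ.symm_apply_apply b).trans hγ.symm
      filter_upwards [hb] with γ hγ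
      rw [← CommRingCat.comp_apply, ← Scheme.Hom.comp_appTop, ← Category.assoc, galTot_str,
        Category.assoc, galX_str, ← Category.assoc, Scheme.Hom.comp_appTop, CommRingCat.comp_apply]
      congr 1
      have := congrArg (fun φ => φ.hom b) (Scheme.ΓSpecIso_inv_naturality
        (CommRingCat.ofHom ((γ⁻¹ : Ks ≃ₐ[K] Ks) : Ks →+* Ks)))
      refine this.symm.trans ?_
      exact congrArg (Scheme.ΓSpecIso (.of Ks)).inv.hom hγ

/-- An open and closed subset of `Ū` is stable under an open subgroup of the Galois group. -/
lemma eventually_preimage_galTot [Algebra.IsSeparable K Ks] (U : X.Etale) [IsAffine (tot U)]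
    {Z : Set (tot ((etBaseChange (sepProj Ks f)).obj U))} (hZ : IsClopen Z) :
    ∀ᶠ γ in nhds (1 : Ks ≃ₐ[K] Ks), galTot f γ U ⁻¹' Z = Z := by
  have : IsAffine (tot ((etBaseChange (sepProj Ks f)).obj U)) :=
    IsAffine.of_isPullback (bc_isPullback_specSep (Ks := Ks) f U)
  obtain ⟨S, hS, rfl⟩ := isCompact_and_isOpen_iff_finite_and_eq_biUnion_basicOpen.1
    ⟨hZ.1.isCompact, hZ.2⟩
  have := (hS.eventually_all (p := fun a γ => (galTot f γ U).appTop.hom a = a)).2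
    fun a _ => eventually_appTop_galTot f U a
  filter_upwards [this] with γ hγ
  rw [Set.preimage_iUnion₂]
  refine Set.iUnion₂_congr fun a ha => ?_
  have := Scheme.preimage_basicOpen_top (galTot f γ U) a
  rw [hγ a ha] at this
  exact congrArg (fun O : (tot ((etBaseChange (sepProj Ks f)).obj U)).Opens => O.carrier) this

variable (Ks) in
/-- The functor sending a sheaf `A` on `X` to `p^* A` with its natural Galois action. -/
def natEquivariant : EtAb X ⥤ Equivariant (galAction (Ks := Ks) f) :=
  Equivariant.ofNat (galAction f) (pull (sepProj Ks f)) (baseChangeAct f) (baseChangeAct_mul f)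

/-- Sections which come from `X` are invariant under the natural action. -/
lemma secAct_pb (A : EtAb X) (γ : Ks ≃ₐ[K] Ks) {U : X.Etale} (s : Sec A U) :
    secAct ((natEquivariant Ks f).obj A) γ U (pb (sepProj Ks f) A U s) = pb (sepProj Ks f) A U s := by
  have h : (pullPushAdj (sepProj Ks f)).unit.app A ≫ galPush ((natEquivariant Ks f).obj A) γ =
      (pullPushAdj (sepProj Ks f)).unit.app A := by
    have h₁ := unit_coact (galAction f) (pullPushAdj (sepProj Ks f)) (projIso f) γ A
    have h₂ : coact (galAction f) (pullPushAdj (sepProj Ks f)) (projIso f) γ A ≫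
        (baseChangeAct f γ).hom.app A = 𝟙 _ := (baseChangeAct f γ).inv_hom_id_app A
    change _ ≫ (projIso f γ).inv.app _ ≫ (push (sepProj Ks f)).map
      ((baseChangeAct f γ).hom.app A) = _
    refine (Category.assoc _ _ _).symm.trans ?_
    refine (congrArg (· ≫ _) h₁.symm).trans ?_
    refine (Category.assoc _ _ _).trans ?_
    rw [← Functor.map_comp, h₂, CategoryTheory.Functor.map_id]
    exact Category.comp_id _
  have h₁ := mor_comp ((pullPushAdj (sepProj Ks f)).unit.app A)
    (galPush ((natEquivariant Ks f).obj A) γ) (U := U) s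
  exact h₁.symm.trans (congrArg (fun φ => mor φ U s) h)

/-- If two sections agree on `γ^* W`, then their images under `γ` agree on `W`. -/
lemma res_secAct_eq_of_res_eq (F : Equivariant (galAction (Ks := Ks) f)) (γ : Ks ≃ₐ[K] Ks)
    {U : X.Etale} {W : (sepBaseChange Ks f).Etale}
    {a : W ⟶ (etBaseChange (sepProj Ks f)).obj U}
    {s s' : Sec F.obj ((etBaseChange (sepProj Ks f)).obj U)}
    (h : res F.obj ((etBaseChange (galX f γ)).map a ≫ galComp f γ U) s =
      res F.obj ((etBaseChange (galX f γ)).map a ≫ galComp f γ U) s') :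
    res F.obj a (secAct F γ U s) = res F.obj a (secAct F γ U s') := by
  rw [res_secAct_eq, res_secAct_eq, h]

/-- An open subset of an étale `X`-scheme. -/
def etOpen (U : X.Etale) (O : (tot U).Opens) : X.Etale := Scheme.Etale.mk (O.ι ≫ str U)

/-- The inclusion of an open subset. -/
def etOpenι (U : X.Etale) (O : (tot U).Opens) : etOpen U O ⟶ U :=
  etHomMk (U := etOpen U O) (V := U) O.ι rfl

lemma range_totMap_etOpenι (U : X.Etale) (O : (tot U).Opens) :
    Set.range (totMap (etOpenι U O)) = O := Scheme.Opens.range_ι O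

lemma eventually_secAct_eq_of_isTriv [Algebra.IsSeparable K Ks] {A : EtAb X} (hA : IsLC A)
    {U : X.Etale} [IsAffine (tot U)] {M : Type u} [AddCommGroup M] [Finite M] {φ : M →+ Sec A U}
    (hφ : IsTriv A U φ)
    (s : Sec ((pull (sepProj Ks f)).obj A) ((etBaseChange (sepProj Ks f)).obj U)) :
    ∀ᶠ γ in nhds (1 : Ks ≃ₐ[K] Ks), secAct ((natEquivariant Ks f).obj A) γ U s = s := by
  let p := sepProj Ks f
  choose Z hZ hZ' using fun m => exists_isClopen_vanishing (hA.pull p) (s - pb p A U (φ m))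
  filter_upwards [Filter.eventually_all.2 fun m => eventually_preimage_galTot f U (hZ m)] with γ hγ
  refine sec_ext fun z => ?_
  obtain ⟨Ω, _, _, y, u, rfl⟩ := exists_geomPoint z
  obtain ⟨m, hm⟩ := (hφ.pullback p).exists_germ_eq u (germ y _ _ u s)
  have hu : Lift.pt y u default ∈ Z m :=
    (hZ' m Ω _ _ y u).2 (by rw [germ_sub, sub_eq_zero]; exact hm.symm)
  have key {W : (sepBaseChange Ks f).Etale} (a : W ⟶ (etBaseChange p).obj U)
      (ha : ∀ w, totMap a w ∈ Z m) : res _ a s = res _ a (pb p A U (φ m)) := by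
    refine sec_ext_germ fun Ω _ _ y w => ?_
    have := (hZ' m Ω _ _ y (Lift.map y a w)).1 (ha _)
    rwa [germ_sub, sub_eq_zero, ← germ_res, ← germ_res] at this
  let a := etOpenι ((etBaseChange p).obj U) ⟨Z m, (hZ m).2⟩
  have ha (w) : totMap a w ∈ Z m := by
    have := (range_totMap_etOpenι ((etBaseChange p).obj U) ⟨Z m, (hZ m).2⟩).le ⟨w, rfl⟩
    exact this
  refine ⟨_, a, ?_, ?_⟩
  · rw [range_totMap_etOpenι]
    exact hu
  · have h₁ (w) : totMap ((etBaseChange (galX f γ)).map a ≫ galComp f γ U) w ∈ Z m := ?_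
    · refine (res_secAct_eq_of_res_eq f ((natEquivariant Ks f).obj A) γ (key _ h₁)).trans ?_
      exact (congrArg (res _ a) (secAct_pb f A γ (φ m))).trans (key a ha).symm
    refine (hγ m).le ?_
    have h : totMap ((etBaseChange (galX f γ)).map a ≫ galComp f γ U) ≫ galTot f γ U =
        bcFst _ _ ≫ totMap a := by
      rw [totMap_comp, Category.assoc, galComp_galTot, etBaseChange_map_fst]
    change galTot f γ U (totMap _ w) ∈ Z m
    rw [← Scheme.Hom.comp_apply, h]
    exact ha _

/-- The natural action on the inverse image of a locally constant sheaf is continuous. -/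
lemma eventually_secAct_eq [Algebra.IsSeparable K Ks] {A : EtAb X} (hA : IsLC A) {U : X.Etale}
    [CompactSpace (tot U)]
    (s : Sec ((pull (sepProj Ks f)).obj A) ((etBaseChange (sepProj Ks f)).obj U)) :
    ∀ᶠ γ in nhds (1 : Ks ≃ₐ[K] Ks), secAct ((natEquivariant Ks f).obj A) γ U s = s := by
  have h₁ (z : tot U) : ∃ (V : X.Etale) (a : V ⟶ U), z ∈ Set.range (totMap a) ∧
      ∀ᶠ γ in nhds (1 : Ks ≃ₐ[K] Ks), secAct ((natEquivariant Ks f).obj A) γ V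
        (res _ ((etBaseChange (sepProj Ks f)).map a) s) =
          res _ ((etBaseChange (sepProj Ks f)).map a) s := by
    obtain ⟨T, ⟨t, ht⟩, M, _, _, φ, hφ⟩ := hA (str U z)
    obtain ⟨Ω, _, _, x, u, rfl⟩ := exists_geomPoint z
    obtain ⟨v, hv⟩ := exists_lift x (U := T) (q := t)
      (ht.trans (congrArg (fun y => y default) (Lift.pt_str x u)))
    obtain ⟨W, w, a, b, rfl, -⟩ := exists_common_nbhd x u v
    obtain ⟨O, hO, hw⟩ := exists_isAffineOpen_mem_and_subset (U := ⊤)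
      (x := Lift.pt x w default) trivial
    have : IsAffine (tot (etOpen W O)) := hO
    refine ⟨etOpen W O, etOpenι W O ≫ a, ?_, eventually_secAct_eq_of_isTriv f hA
      (hφ.restrict (etOpenι W O ≫ b)) _⟩
    obtain ⟨q, hq⟩ := (range_totMap_etOpenι W O).ge hw.1
    exact ⟨q, by rw [totMap_comp, Scheme.Hom.comp_apply, hq]; rfl⟩
  choose V a hz h using h₁
  obtain ⟨S, hS⟩ := isCompact_univ.elim_finite_subcover (fun z => Set.range (totMap (a z)))
    (fun z => isOpen_range_totMap _) fun z _ => Set.mem_iUnion.2 ⟨z, hz z⟩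
  filter_upwards [S.eventually_all.2 fun z _ => h z] with γ hγ
  refine sec_ext fun y => ?_
  obtain ⟨z, hz, hy⟩ := Set.mem_iUnion₂.1 (hS (Set.mem_univ (bcFst (sepProj Ks f) U y)))
  refine ⟨_, (etBaseChange (sepProj Ks f)).map (a z), ?_, ?_⟩
  · have hp : IsPullback (bcFst (sepProj Ks f) (V z))
        (totMap ((etBaseChange (sepProj Ks f)).map (a z))) (totMap (a z))
        (bcFst (sepProj Ks f) U) := by
      refine IsPullback.of_bot ?_ (etBaseChange_map_fst _ (a z)).symm (bc_isPullback _ U)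
      simpa using bc_isPullback (sepProj Ks f) (V z)
    obtain ⟨q, hq⟩ := hy
    obtain ⟨t, -, ht⟩ := Scheme.exists_preimage_of_isPullback hp q y hq
    exact ⟨t, ht⟩
  · exact (res_secAct ((natEquivariant Ks f).obj A) γ (a z) s).trans (hγ z hz)

/-- A section which is fixed near `1` has locally constant orbit map. -/
lemma isLocallyConstant_secAct (F : Equivariant (galAction (Ks := Ks) f)) {U : X.Etale}
    {s : Sec F.obj ((etBaseChange (sepProj Ks f)).obj U)}
    (hs : ∀ᶠ γ in nhds (1 : Ks ≃ₐ[K] Ks), secAct F γ U s = s) :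
    IsLocallyConstant fun γ => secAct F γ U s := by
  rw [IsLocallyConstant.iff_eventually_eq]
  intro γ
  have : Filter.Tendsto (fun δ => γ⁻¹ * δ) (nhds γ) (nhds (1 : Ks ≃ₐ[K] Ks)) := by
    have h := (continuous_const_mul γ⁻¹).tendsto γ
    rwa [inv_mul_cancel] at h
  filter_upwards [this.eventually hs] with δ hδ
  rw [← mul_inv_cancel_left γ δ, secAct_mul, hδ]

end GaloisOnSections

/-! ### Étale algebras over a separable closure are defined over a finite extension -/

section FiniteLevel

variable (K : Type u) {Ks : Type u} [Field K] [Field Ks] [Algebra K Ks] (A : Type u) [CommRing A]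
  [Algebra K A]

/-- The image of `A ⊗ L` in `A ⊗ K^s`. -/
def tensorField (L : IntermediateField K Ks) : Subalgebra A (A ⊗[K] Ks) :=
  (Algebra.TensorProduct.map (AlgHom.id A A) L.val).range

variable {K A}

lemma tensorField_mono {L L' : IntermediateField K Ks} (h : L ≤ L') :
    tensorField K A L ≤ tensorField K A L' := by
  rintro _ ⟨t, rfl⟩
  refine ⟨Algebra.TensorProduct.map (AlgHom.id A A) (IntermediateField.inclusion h) t, ?_⟩
  change (Algebra.TensorProduct.map (AlgHom.id A A) L'.val)
    (Algebra.TensorProduct.map (AlgHom.id A A) (IntermediateField.inclusion h) t) = _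
  rw [← AlgHom.comp_apply, ← Algebra.TensorProduct.map_comp]
  rfl

lemma exists_mem_tensorField [Algebra.IsAlgebraic K Ks] (t : A ⊗[K] Ks) :
    ∃ L : IntermediateField K Ks, FiniteDimensional K L ∧ t ∈ tensorField K A L := by
  induction t with
  | zero => exact ⟨⊥, inferInstance, zero_mem _⟩
  | tmul a b =>
    refine ⟨IntermediateField.adjoin K {b}, IntermediateField.adjoin.finiteDimensional
      (Algebra.IsIntegral.isIntegral b),
      ⟨a ⊗ₜ ⟨b, IntermediateField.mem_adjoin_simple_self K b⟩, rfl⟩⟩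
  | add s t hs ht =>
    obtain ⟨L, _, hs⟩ := hs
    obtain ⟨L', _, ht⟩ := ht
    exact ⟨L ⊔ L', inferInstance,
      add_mem (tensorField_mono le_sup_left hs) (tensorField_mono le_sup_right ht)⟩

instance [Algebra.IsSeparable K Ks] (L : IntermediateField K Ks) [FiniteDimensional K L] :
    Algebra.Etale K L where
  formallyEtale := Algebra.FormallyEtale.of_isSeparable K L
  finitePresentation := Algebra.FinitePresentation.of_finiteType.1 inferInstance

instance [Algebra.IsSeparable K Ks] (L : IntermediateField K Ks) [FiniteDimensional K L] :
    Algebra.Etale A (tensorField K A L) := by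
  have h : Function.Injective (Algebra.TensorProduct.map (AlgHom.id A A) L.val) :=
    Module.Flat.lTensor_preserves_injective_linearMap (M := A) L.val.toLinearMap
      L.val.toRingHom.injective
  exact Algebra.Etale.of_equiv (AlgEquiv.ofInjective _ h)

/-- An étale algebra `B` over `A ⊗ K^s` is generated by `K^s` and an étale `A`-algebra: it is
defined over `A ⊗ L` for a finite extension `L` of `K`, which is étale over `A`. -/
lemma exists_etale_generating [Algebra.IsSeparable K Ks] (B : Type u) [CommRing B]
    [Algebra (A ⊗[K] Ks) B] [Algebra.Etale (A ⊗[K] Ks) B] :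
    ∃ (D : Type u) (_ : CommRing D) (_ : Algebra A D) (_ : Algebra.Etale A D) (ι : D →+* B),
      (∀ a, ι (algebraMap A D a) = algebraMap (A ⊗[K] Ks) B (a ⊗ₜ 1)) ∧
      Subring.closure (Set.range ι ∪ Set.range fun b : Ks => algebraMap (A ⊗[K] Ks) B (1 ⊗ₜ b)) =
        ⊤ := by
  obtain ⟨A₀, B₀, _, _, ⟨S, hS⟩, hE, ⟨e⟩⟩ := Algebra.Etale.exists_subalgebra_fg A (A ⊗[K] Ks) B
  -- `B` is defined over a finitely generated subalgebra of `A ⊗ K^s`, hence over `A ⊗ L` with `L` finite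
  -- over `K`.
  have h₁ : ∃ L : IntermediateField K Ks, FiniteDimensional K L ∧
      (S : Set (A ⊗[K] Ks)) ⊆ tensorField K A L := by
    choose L hL hL' using exists_mem_tensorField (K := K) (Ks := Ks) (A := A)
    exact ⟨⨆ t : S, L t, IntermediateField.finiteDimensional_iSup_of_finite,
      fun t ht => tensorField_mono (le_iSup (fun t : S => L t) ⟨t, ht⟩) (hL' t)⟩
  obtain ⟨L, _, hL⟩ := h₁
  have hle : A₀ ≤ tensorField K A L := by rw [← hS]; exact Algebra.adjoin_le hL
  let E := tensorField K A L
  let _ : Algebra A₀ E := (Subalgebra.inclusion hle).toRingHom.toAlgebra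
  have : IsScalarTower A₀ E (A ⊗[K] Ks) := .of_algebraMap_eq fun _ => rfl
  have : IsScalarTower A A₀ E := .of_algebraMap_eq fun _ => rfl
  let D := E ⊗[A₀] B₀
  have : SMulCommClass A₀ A E := ⟨fun a b c => by simp only [Algebra.smul_def]; ring⟩
  have : IsScalarTower A E D := TensorProduct.isScalarTower_left
  let j : D →ₐ[A₀] (A ⊗[K] Ks) ⊗[A₀] B₀ := Algebra.TensorProduct.map
    (IsScalarTower.toAlgHom A₀ E (A ⊗[K] Ks)) (AlgHom.id A₀ B₀)
  let ι : D →+* B := (e.symm : (A ⊗[K] Ks) ⊗[A₀] B₀ →+* B).comp j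
  have hι (c : E) (b : B₀) : ι (c ⊗ₜ b) = e.symm ((c : A ⊗[K] Ks) ⊗ₜ b) := rfl
  have he (c : A ⊗[K] Ks) : e.symm (c ⊗ₜ 1) = algebraMap _ B c := by
    rw [← e.symm.commutes]; rfl
  have hA (a : A) : ι (algebraMap A D a) = algebraMap (A ⊗[K] Ks) B (a ⊗ₜ 1) := by
    rw [← he]; exact hι (algebraMap A E a) 1
  refine ⟨D, inferInstance, inferInstance, Algebra.Etale.comp A E D, ι, hA, ?_⟩
  refine eq_top_iff.2 fun b _ => ?_
  set R : Subring B := Subring.closure _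
  have hR₁ (d : D) : ι d ∈ R := Subring.subset_closure (.inl ⟨d, rfl⟩)
  have hR₂ (c : A ⊗[K] Ks) : algebraMap (A ⊗[K] Ks) B c ∈ R := by
    induction c with
    | zero => rw [map_zero]; exact zero_mem _
    | add c c' h h' => rw [map_add]; exact add_mem h h'
    | tmul a b =>
      rw [← mul_one a, ← one_mul b, ← Algebra.TensorProduct.tmul_mul_tmul, map_mul, ← hA]
      exact mul_mem (hR₁ _) (Subring.subset_closure (.inr ⟨b, rfl⟩))
  obtain ⟨t, rfl⟩ := e.symm.surjective b
  induction t with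
  | zero => rw [map_zero]; exact zero_mem _
  | add c c' h h' => rw [map_add]; exact add_mem (h trivial) (h' trivial)
  | tmul c b =>
    rw [← mul_one c, ← one_mul b, ← Algebra.TensorProduct.tmul_mul_tmul, map_mul, he]
    exact mul_mem (hR₂ _) (hR₁ (1 ⊗ₜ b))

end FiniteLevel

section Model

lemma isoSpec_hom_comp_appTop {W : Scheme.{u}} [IsAffine W] {R : CommRingCat.{u}}
    (ρ : R ⟶ Γ(W, ⊤)) (r : R) :
    (W.isoSpec.hom ≫ Spec.map ρ).appTop.hom ((Scheme.ΓSpecIso R).inv.hom r) = ρ.hom r := by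
  have h : (Scheme.ΓSpecIso R).inv ≫ (W.isoSpec.hom ≫ Spec.map ρ).appTop = ρ := by
    rw [Scheme.Hom.comp_appTop, ← Scheme.ΓSpecIso_inv_naturality_assoc]
    simp [Scheme.isoSpec]
  exact congrArg (fun φ => φ.hom r) h

variable {K Ks : Type u} [Field K] [Field Ks] [Algebra K Ks] [Algebra.IsSeparable K Ks]

/-- An étale scheme `W` over the base change of an affine `K`-scheme `T` to `K^s` has a model `U`
which is étale over `T`; then `W` is a closed subscheme of the base change of `U`. -/
lemma exists_etale_model {T P W : Scheme.{u}} [IsAffine T] [IsAffine W] {h : T ⟶ Spec (.of K)}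
    {fst : P ⟶ T} {snd : P ⟶ Spec (.of Ks)} (hP : IsPullback fst snd h (specSep K Ks))
    (g : W ⟶ P) [Etale g] :
    ∃ (U : Scheme.{u}) (e : U ⟶ T) (c : W ⟶ U), IsAffine U ∧ Etale e ∧ c ≫ e = g ≫ fst ∧
      ∀ (Q : Scheme.{u}) (b : W ⟶ Q) (q₁ : Q ⟶ U) (q₂ : Q ⟶ Spec (.of Ks)), IsAffine Q →
        b ≫ q₁ = c → b ≫ q₂ = g ≫ snd → IsClosedImmersion b := by
  let φ : CommRingCat.of K ⟶ Γ(T, ⊤) := Spec.preimage (T.isoSpec.inv ≫ h)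
  have hφ : T.isoSpec.hom ≫ Spec.map φ = h := by simp [φ]
  let _ : Algebra K Γ(T, ⊤) := φ.hom.toAlgebra
  let A : Type u := Γ(T, ⊤)
  -- `P` is identified with the spectrum of `A ⊗ K^s`, where `A = Γ(T)`.
  have hS : IsPullback (Spec.map (CommRingCat.ofHom
        (Algebra.TensorProduct.includeLeftRingHom : A →+* A ⊗[K] Ks)) ≫ T.isoSpec.inv)
      (Spec.map (CommRingCat.ofHom
        (Algebra.TensorProduct.includeRight : Ks →ₐ[K] A ⊗[K] Ks).toRingHom)) h (specSep K Ks) := by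
    refine IsPullback.of_iso (IsPullback.of_hasPullback (Spec.map (CommRingCat.ofHom (algebraMap K A)))
      (Spec.map (CommRingCat.ofHom (algebraMap K Ks)))) (pullbackSpecIso K A Ks) T.isoSpec.symm
      (Iso.refl _) (Iso.refl _) ?_ ?_ ?_ ?_
    · rw [← pullbackSpecIso_hom_fst, Category.assoc]; rfl
    · rw [← pullbackSpecIso_hom_snd]; exact Category.comp_id _
    · rw [← hφ]; simp; rfl
    · simp
  let θ : P ≅ Spec (.of (A ⊗[K] Ks)) := hP.isoIsPullback _ _ hS
  have hθ₁ : θ.hom ≫ Spec.map (CommRingCat.ofHom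
        (Algebra.TensorProduct.includeLeftRingHom : A →+* A ⊗[K] Ks)) = fst ≫ T.isoSpec.hom := by
    rw [← hP.isoIsPullback_hom_fst _ _ hS, Category.assoc, Category.assoc, Iso.inv_hom_id,
      Category.comp_id]
  have hθ₂ : θ.hom ≫ Spec.map (CommRingCat.ofHom
      (Algebra.TensorProduct.includeRight : Ks →ₐ[K] A ⊗[K] Ks).toRingHom) = snd :=
    hP.isoIsPullback_hom_snd _ _ hS
  let β : CommRingCat.of (A ⊗[K] Ks) ⟶ Γ(W, ⊤) := Spec.preimage (W.isoSpec.inv ≫ g ≫ θ.hom)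
  have hβ : W.isoSpec.hom ≫ Spec.map β = g ≫ θ.hom := by simp [β]
  have hβE : Etale (Spec.map β) := by
    rw [Spec.map_preimage]; infer_instance
  let B : Type u := Γ(W, ⊤)
  let _ : Algebra (A ⊗[K] Ks) B := β.hom.toAlgebra
  have : Algebra.Etale (A ⊗[K] Ks) B := HasRingHomProperty.Spec_iff.1 hβE
  obtain ⟨D, _, _, hD, ι, hι, hgen⟩ := exists_etale_generating (K := K) (Ks := Ks) (A := A) B
  let j : CommRingCat.of D ⟶ Γ(W, ⊤) := CommRingCat.ofHom ι
  have hj : CommRingCat.ofHom (algebraMap A D) ≫ j = CommRingCat.ofHom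
      (Algebra.TensorProduct.includeLeftRingHom : A →+* A ⊗[K] Ks) ≫ β := by
    ext a; exact hι a
  have he : Etale (Spec.map (CommRingCat.ofHom (algebraMap A D))) :=
    HasRingHomProperty.Spec_iff.2 (RingHom.etale_algebraMap.2 hD)
  refine ⟨Spec (.of D), Spec.map (CommRingCat.ofHom (algebraMap A D)) ≫ T.isoSpec.inv,
    W.isoSpec.hom ≫ Spec.map j, inferInstance, inferInstance, ?_, ?_⟩
  · rw [Category.assoc, ← Spec.map_comp_assoc, hj, Spec.map_comp_assoc, reassoc_of% hβ,
      reassoc_of% hθ₁, Iso.hom_inv_id, Category.comp_id]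
  · intro Q b q₁ q₂ _ h₁ h₂
    refine IsClosedImmersion.of_surjective_of_isAffine b fun t => ?_
    -- The functions on `Q` restrict to the generators of `B = Γ(W)`.
    have hR : b.appTop.hom.range = ⊤ := by
      rw [eq_top_iff, ← hgen, Subring.closure_le]
      rintro _ (⟨d, rfl⟩ | ⟨c, rfl⟩)
      · refine ⟨q₁.appTop.hom ((Scheme.ΓSpecIso (.of D)).inv.hom d), ?_⟩
        rw [← CommRingCat.comp_apply, ← Scheme.Hom.comp_appTop, h₁]
        exact isoSpec_hom_comp_appTop j d
      · refine ⟨q₂.appTop.hom ((Scheme.ΓSpecIso (.of Ks)).inv.hom c), ?_⟩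
        rw [← CommRingCat.comp_apply, ← Scheme.Hom.comp_appTop, h₂, ← hθ₂, ← Category.assoc, ← hβ,
          Category.assoc, ← Spec.map_comp]
        exact isoSpec_hom_comp_appTop (R := .of Ks) _ c
    exact hR.ge (Subring.mem_top t)

variable {X : Scheme.{u}} (f : X ⟶ Spec (.of K))

/-- Every point of an étale `X̄`-scheme has an étale neighbourhood which is a closed and open
subscheme of `Ū` for an affine étale `X`-scheme `U`. -/
lemma exists_closed_nbhd {V : (sepBaseChange Ks f).Etale} (v : tot V) :
    ∃ (U : X.Etale) (W : (sepBaseChange Ks f).Etale) (a : W ⟶ V)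
      (b : W ⟶ (etBaseChange (sepProj Ks f)).obj U), IsAffine (tot U) ∧
        v ∈ Set.range (totMap a) ∧ IsClosedImmersion (totMap b) := by
  let p := sepProj Ks f
  obtain ⟨O, hO, hv, -⟩ := exists_isAffineOpen_mem_and_subset (U := ⊤) (x := p (str V v)) trivial
  let T : X.Etale := Scheme.Etale.mk O.ι
  have : IsAffine (tot T) := hO
  obtain ⟨N, hN, hvN, hNO⟩ := exists_isAffineOpen_mem_and_subset (U := (str V ≫ p) ⁻¹ᵁ O)
    (x := v) (by simpa using hv)
  let W := etOpen V N
  have : IsAffine (tot W) := hN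
  have hW : Set.range (str W ≫ p) ⊆ Set.range O.ι := by
    rw [Scheme.Opens.range_ι]
    rintro _ ⟨w, rfl⟩
    exact hNO (show _ ∈ N from (Scheme.Opens.range_ι N).le ⟨w, rfl⟩)
  let l : tot W ⟶ O := IsOpenImmersion.lift O.ι (str W ≫ p) hW
  have hl : l ≫ O.ι = str W ≫ p := IsOpenImmersion.lift_fac _ _ _
  let g := bcLift p T W l hl
  obtain ⟨U, e, c, _, _, h₁, h₂⟩ := exists_etale_model (bc_isPullback_specSep (Ks := Ks) f T) (totMap g)
  let U' : X.Etale := Scheme.Etale.mk (e ≫ str T)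
  have hU' : IsAffine (tot U') := ‹IsAffine U›
  have hc : c ≫ str U' = str W ≫ p := by
    change c ≫ e ≫ str T = _
    rw [reassoc_of% h₁]
    exact (bcLift_fst_assoc p T W l hl (str T)).trans hl
  refine ⟨U', W, etOpenι V N, bcLift p U' W c hc, hU', ?_, ?_⟩
  · rw [range_totMap_etOpenι]; exact hvN
  · refine h₂ _ _ (bcFst p U') (str _ ≫ sepStr Ks f) ?_ (bcLift_fst _ _ _ _ _) ?_
    · exact IsAffine.of_isPullback (bc_isPullback_specSep (Ks := Ks) f U')
    · rw [totMap_str_assoc, totMap_str_assoc]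

end Model

/-! ### Invariant sections -/

section ExtensionByZero

variable {X : Scheme.{u}} {A : EtAb X}

lemma Lift.map_map {Ω : Type u} [Field Ω] [IsSepClosed Ω] {x : Spec (.of Ω) ⟶ X} {U V W : X.Etale}
    (a : W ⟶ V) (b : V ⟶ U) (w : Lift x W) :
    Lift.map x b (Lift.map x a w) = Lift.map x (a ≫ b) w :=
  Lift.ext _ (by simp)

lemma Lift.map_injective {Ω : Type u} [Field Ω] [IsSepClosed Ω] {x : Spec (.of Ω) ⟶ X}
    {V W : X.Etale} (b : W ⟶ V) [Mono (totMap b)] {w w' : Lift x W}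
    (h : Lift.map x b w = Lift.map x b w') : w = w' :=
  Lift.ext _ ((cancel_mono (totMap b)).1 (by rw [← Lift.pt_map, ← Lift.pt_map, h]))

/-- A section over a closed and open subscheme extends by zero. -/
lemma exists_res_eq_of_isClosedImmersion {V W : X.Etale} (b : W ⟶ V) [IsClosedImmersion (totMap b)]
    (t : Sec A W) : ∃ s : Sec A V, res A b s = t := by
  let P (V' : X.Etale) (a : V' ⟶ V) (t' : Sec A V') : Prop :=
    ∀ (Ω : Type u) (_ : Field Ω) (_ : IsSepClosed Ω) (x : Spec (.of Ω) ⟶ X) (v : Lift x V'),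
      (∀ w : Lift x W, Lift.map x a v = Lift.map x b w → germ x A V' v t' = germ x A W w t) ∧
      (Lift.pt x (Lift.map x a v) default ∉ Set.range (totMap b) → germ x A V' v t' = 0)
  have hres {V' W' : X.Etale} (a : V' ⟶ V) (c : W' ⟶ V') (s : Sec A V') (hs : P V' a s) :
      P W' (c ≫ a) (res A c s) := fun Ω _ _ x v => by
    rw [germ_res, ← Lift.map_map]
    exact hs Ω _ _ x (Lift.map x c v)
  have huniq (V' : X.Etale) (a : V' ⟶ V) (s s' : Sec A V') (hs : P V' a s) (hs' : P V' a s') :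
      s = s' := by
    refine sec_ext_germ fun Ω _ _ x v => ?_
    by_cases h : Lift.pt x (Lift.map x a v) default ∈ Set.range (totMap b)
    · obtain ⟨q, hq⟩ := h
      obtain ⟨w, hw, -⟩ := exists_lift_map x b (Lift.map x a v) hq
      rw [(hs Ω _ _ x v).1 w hw.symm, (hs' Ω _ _ x v).1 w hw.symm]
    · rw [(hs Ω _ _ x v).2 h, (hs' Ω _ _ x v).2 h]
  have ht : P W b t := fun Ω _ _ x v =>
    ⟨fun w h => by rw [Lift.map_injective b h], fun h => absurd ⟨_, rfl⟩ h⟩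
  have hex (z : tot V) : ∃ (V' : X.Etale) (a : V' ⟶ V), z ∈ Set.range (totMap a) ∧
      ∃ s, P V' a s := by
    by_cases hz : z ∈ Set.range (totMap b)
    · exact ⟨W, b, hz, t, ht⟩
    · let O : (tot V).Opens :=
        ⟨(Set.range (totMap b))ᶜ, (totMap b).isClosedEmbedding.isClosed_range.isOpen_compl⟩
      refine ⟨etOpen V O, etOpenι V O, ?_, 0, fun Ω _ _ x v => ⟨fun w h => ?_, fun _ => germ_zero _ _⟩⟩
      · rw [range_totMap_etOpenι]; exact hz
      · have h₁ : Lift.pt x (Lift.map x (etOpenι V O) v) default ∈ (O : Set (tot V)) := by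
          rw [← range_totMap_etOpenι]; exact ⟨_, rfl⟩
        rw [h] at h₁
        exact absurd ⟨_, rfl⟩ h₁
  obtain ⟨s, hs⟩ := sec_glue P hres huniq hex
  exact ⟨s, hs W b t ht⟩

end ExtensionByZero

section FieldExtension

variable {K Ks : Type u} [Field K] [Field Ks] [Algebra K Ks] [IsSepClosed Ks]
  [Algebra.IsSeparable K Ks]

instance isGalois_of_isSepClosed : IsGalois K Ks where
  to_normal := normal_iff.2 fun b => ⟨Algebra.IsIntegral.isIntegral b,
    IsSepClosed.splits_codomain _ (Algebra.IsSeparable.isSeparable K b)⟩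

/-- Two embeddings over `K` of `K^s` and of an intermediate field differ by a Galois
automorphism. -/
lemma exists_gal_eq {Ω : Type u} [Field Ω] [IsSepClosed Ω] (L : IntermediateField K Ks)
    (α : L →+* Ω) (β : Ks →+* Ω) (h : ∀ c : K, α (algebraMap K L c) = β (algebraMap K Ks c)) :
    ∃ τ : Ks ≃ₐ[K] Ks, ∀ a : L, α a = β (τ a) := by
  obtain ⟨α', hα'⟩ : ∃ α' : Ks →+* Ω, ∀ a : L, α' a = α a := by
    let _ : Algebra L Ω := α.toAlgebra
    let α' : Ks →ₐ[L] Ω := IsSepClosed.lift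
    exact ⟨α', α'.commutes⟩
  let _ : Algebra Ks Ω := β.toAlgebra
  let _ : Algebra K Ω := (β.comp (algebraMap K Ks)).toAlgebra
  have : IsScalarTower K Ks Ω := .of_algebraMap_eq fun _ => rfl
  let α'' : Ks →ₐ[K] Ω := ⟨α', fun c => (hα' (algebraMap K L c)).trans (h c)⟩
  refine ⟨Normal.algHomEquivAut K Ω Ks α'', fun a => ?_⟩
  have h₁ := (Normal.algHomEquivAut K Ω Ks).symm_apply_apply α''
  exact (hα' a).symm.trans (congrArg (fun χ => χ (a : Ks)) h₁).symm

end FieldExtension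

section GaloisCover

variable {K Ks : Type u} [Field K] [Field Ks] [Algebra K Ks] {X : Scheme.{u}}
  (f : X ⟶ Spec (.of K))

/-- `Spec L ⟶ Spec K` for an intermediate field `L`. -/
abbrev specField (L : IntermediateField K Ks) : Spec (.of L) ⟶ Spec (.of K) :=
  Spec.map (CommRingCat.ofHom (algebraMap K L))

instance [Algebra.IsSeparable K Ks] (L : IntermediateField K Ks) [FiniteDimensional K L] :
    Etale (specField L) :=
  HasRingHomProperty.Spec_iff.2 (RingHom.etale_algebraMap.2 (inferInstanceAs (Algebra.Etale K L)))

/-- `Spec` of the embedding `τ|L : L ⟶ K^s`. -/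
def specEmb (L : IntermediateField K Ks) (τ : Ks ≃ₐ[K] Ks) : Spec (.of Ks) ⟶ Spec (.of L) :=
  Spec.map (CommRingCat.ofHom ((τ : Ks →+* Ks).comp (algebraMap L Ks)))

lemma specEmb_specField (L : IntermediateField K Ks) (τ : Ks ≃ₐ[K] Ks) :
    specEmb L τ ≫ specField L = specSep K Ks := by
  rw [specEmb, ← Spec.map_comp, ← CommRingCat.ofHom_comp]
  congr 2
  ext a
  exact τ.commutes a

lemma galSpec_specEmb (L : IntermediateField K Ks) (γ τ : Ks ≃ₐ[K] Ks) : galSpec γ ≫ specEmb L τ = specEmb L (γ⁻¹ * τ) := by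
  rw [specEmb, galSpec, ← Spec.map_comp, ← CommRingCat.ofHom_comp]
  rfl

variable [Algebra.IsSeparable K Ks]

/-- The étale `X`-scheme `U ×_K L`. -/
def etExt (U : X.Etale) (L : IntermediateField K Ks) [FiniteDimensional K L] : X.Etale :=
  Scheme.Etale.mk (pullback.fst (str U ≫ f) (specField L) ≫ str U)

variable {U : X.Etale} {L : IntermediateField K Ks} [FiniteDimensional K L]

variable (U L) in
/-- The projection `U ×_K L ⟶ U`. -/
def etExtFst : tot (etExt f U L) ⟶ tot U := pullback.fst (str U ≫ f) (specField L)

variable (U L) in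
/-- The projection `U ×_K L ⟶ Spec L`. -/
def etExtSnd : tot (etExt f U L) ⟶ Spec (.of L) := pullback.snd (str U ≫ f) (specField L)

variable (U L) in
lemma etExt_isPullback :
    IsPullback (etExtFst f U L) (etExtSnd f U L) (str U ≫ f) (specField L) :=
  IsPullback.of_hasPullback _ _

variable (U L) in
lemma etExtFst_str : etExtFst f U L ≫ str U = str (etExt f U L) := rfl

variable (U L) in
/-- The embedding of `Ū` as a component of the base change of `U ×_K L` to `K^s` which is given by
the restriction of `τ` to `L`. -/
def etEmb (τ : Ks ≃ₐ[K] Ks) : (etBaseChange (sepProj Ks f)).obj U ⟶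
    (etBaseChange (sepProj Ks f)).obj (etExt f U L) :=
  bcLift _ _ _ ((etExt_isPullback f U L).lift (bcFst _ U) (str _ ≫ sepStr Ks f ≫ specEmb L τ) (by
      rw [Category.assoc, Category.assoc, specEmb_specField, bc_w_assoc, (sep_isPullback Ks f).w])) (by
    rw [← etExtFst_str, IsPullback.lift_fst_assoc, bc_w])

lemma etEmb_fst (τ : Ks ≃ₐ[K] Ks) :
    totMap (etEmb f U L τ) ≫ bcFst (sepProj Ks f) _ ≫ etExtFst f U L = bcFst _ U :=
  (bcLift_fst_assoc _ _ _ _ _ _).trans (IsPullback.lift_fst _ _ _ _)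

lemma etEmb_snd (τ : Ks ≃ₐ[K] Ks) :
    totMap (etEmb f U L τ) ≫ bcFst (sepProj Ks f) _ ≫ etExtSnd f U L =
      str _ ≫ sepStr Ks f ≫ specEmb L τ :=
  (bcLift_fst_assoc _ _ _ _ _ _).trans (IsPullback.lift_snd _ _ _ _)

lemma tot_etExt_hom_ext {T : Scheme.{u}}
    {a b : T ⟶ tot ((etBaseChange (sepProj Ks f)).obj (etExt f U L))}
    (h₁ : a ≫ bcFst _ _ ≫ etExtFst f U L = b ≫ bcFst _ _ ≫ etExtFst f U L)
    (h₂ : a ≫ bcFst _ _ ≫ etExtSnd f U L = b ≫ bcFst _ _ ≫ etExtSnd f U L)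
    (h₃ : a ≫ str _ = b ≫ str _) : a = b :=
  bc_tot_hom_ext _ ((etExt_isPullback f U L).hom_ext (by simpa using h₁) (by simpa using h₂)) h₃

lemma galComp_etEmb (γ τ : Ks ≃ₐ[K] Ks) :
    (etBaseChange (galX f γ)).map (etEmb f U L τ) ≫ galComp f γ (etExt f U L) =
      galComp f γ U ≫ etEmb f U L (γ⁻¹ * τ) := by
  refine et_hom_ext (tot_etExt_hom_ext f ?_ ?_ (by simp))
  · rw [totMap_comp, totMap_comp, Category.assoc, Category.assoc, etEmb_fst, galComp_fst,
      ← Category.assoc (totMap (galComp f γ (etExt f U L))), galComp_fst]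
    simp only [Category.assoc]
    rw [etBaseChange_map_fst_assoc, etEmb_fst]
  · rw [totMap_comp, totMap_comp, Category.assoc, Category.assoc, etEmb_snd,
      ← Category.assoc (totMap (galComp f γ (etExt f U L))), galComp_fst, totMap_str_assoc]
    simp only [Category.assoc]
    rw [etBaseChange_map_fst_assoc, etEmb_snd, bc_w_assoc, ← Category.assoc (galX f γ), galX_str,
      Category.assoc, galSpec_specEmb]

lemma etEmb_eq_etEmb {Ω : Type u} [Field Ω] [IsSepClosed Ω] {y : Spec (.of Ω) ⟶ sepBaseChange Ks f}
    {c c' : Lift y ((etBaseChange (sepProj Ks f)).obj U)} {τ τ' : Ks ≃ₐ[K] Ks}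
    (h : Lift.map y (etEmb f U L τ) c = Lift.map y (etEmb f U L τ') c') :
    c = c' ∧ τ⁻¹ * τ' ∈ L.fixingSubgroup := by
  have h' := congrArg (Lift.pt y) h
  rw [Lift.pt_map, Lift.pt_map] at h'
  have h₁ := congrArg (· ≫ bcFst (sepProj Ks f) _ ≫ etExtFst f U L) h'
  have h₂ := congrArg (· ≫ bcFst (sepProj Ks f) _ ≫ etExtSnd f U L) h'
  simp only [Category.assoc, etEmb_fst, etEmb_snd] at h₁ h₂
  refine ⟨Lift.ext _ (bc_tot_hom_ext _ h₁ (by rw [Lift.pt_str, Lift.pt_str])), ?_⟩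
  rw [← Category.assoc, ← Category.assoc (Lift.pt y c'), Lift.pt_str, Lift.pt_str,
    ← Category.assoc, ← Category.assoc, ← Spec.map_preimage (y ≫ sepStr Ks f), specEmb, specEmb,
    ← Spec.map_comp, ← Spec.map_comp] at h₂
  have h₃ := Spec.map_injective h₂
  rw [IntermediateField.mem_fixingSubgroup_iff]
  intro a ha
  have h₄ := congrArg (fun φ => φ.hom (⟨a, ha⟩ : L)) h₃
  have h₅ : τ a = τ' a := (Spec.preimage (y ≫ sepStr Ks f)).hom.injective h₄
  change τ.symm (τ' a) = a
  rw [← h₅, AlgEquiv.symm_apply_apply]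

variable [IsSepClosed Ks]

/-- The components of the base change of `U ×_K L` are indexed by the embeddings of `L`. -/
lemma exists_etEmb_eq {Ω : Type u} [Field Ω] [IsSepClosed Ω] {y : Spec (.of Ω) ⟶ sepBaseChange Ks f}
    (u : Lift y ((etBaseChange (sepProj Ks f)).obj (etExt f U L))) :
    ∃ (τ : Ks ≃ₐ[K] Ks) (c : Lift y ((etBaseChange (sepProj Ks f)).obj U)),
      Lift.map y (etEmb f U L τ) c = u := by
  let α := Spec.preimage (Lift.pt y u ≫ bcFst _ _ ≫ etExtSnd f U L)
  let β := Spec.preimage (y ≫ sepStr Ks f)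
  have hα : Spec.map α = Lift.pt y u ≫ bcFst _ _ ≫ etExtSnd f U L := Spec.map_preimage _
  have hβ : Spec.map β = y ≫ sepStr Ks f := Spec.map_preimage _
  have hαβ : CommRingCat.ofHom (algebraMap K L) ≫ α = CommRingCat.ofHom (algebraMap K Ks) ≫ β := by
    apply Spec.map_injective
    rw [Spec.map_comp, Spec.map_comp, hα, hβ, Category.assoc, Category.assoc, Category.assoc,
      ← (etExt_isPullback f U L).w, ← (sep_isPullback Ks f).w, ← Category.assoc (etExtFst f U L),
      etExtFst_str, bc_w_assoc, ← Category.assoc, Lift.pt_str]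
  obtain ⟨τ, hτ⟩ := exists_gal_eq L α.hom β.hom fun c => congrArg (fun φ => φ.hom c) hαβ
  have hτ' : α = CommRingCat.ofHom ((τ : Ks →+* Ks).comp (algebraMap L Ks)) ≫ β := by
    ext a; exact hτ a
  refine ⟨τ, Lift.mk y ((bc_isPullback (sepProj Ks f) U).lift
    (Lift.pt y u ≫ bcFst _ _ ≫ etExtFst f U L) y (by
      rw [Category.assoc, Category.assoc, etExtFst_str, bc_w, ← Category.assoc, Lift.pt_str]))
      (IsPullback.lift_snd _ _ _ _), Lift.ext _ (tot_etExt_hom_ext f ?_ ?_ (by simp))⟩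
  · rw [Lift.pt_map, Category.assoc, etEmb_fst, Lift.pt_mk, IsPullback.lift_fst]
  · rw [Lift.pt_map, Category.assoc, etEmb_snd, Lift.pt_mk, IsPullback.lift_snd_assoc,
      ← Category.assoc, ← hβ, ← hα, hτ', Spec.map_comp]
    rfl

/-- A section over `Ū` which is fixed by an open subgroup extends to an invariant section over the
base change of `U ×_K L` for some finite extension `L` of `K`. -/
lemma exists_invariant_section (F : Equivariant (galAction (Ks := Ks) f))
    (s : Sec F.obj ((etBaseChange (sepProj Ks f)).obj U))
    (hs : ∀ᶠ γ in nhds (1 : Ks ≃ₐ[K] Ks), secAct F γ U s = s) :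
    ∃ (U' : X.Etale) (j : (etBaseChange (sepProj Ks f)).obj U ⟶ (etBaseChange (sepProj Ks f)).obj U')
      (s' : Sec F.obj ((etBaseChange (sepProj Ks f)).obj U')),
      (∀ γ, secAct F γ U' s' = s') ∧ res F.obj j s' = s := by
  obtain ⟨L, hL, hL'⟩ := (krullTopology_mem_nhds_one_iff K Ks _).1 hs
  have hτ {τ τ' : Ks ≃ₐ[K] Ks} (h : τ⁻¹ * τ' ∈ L.fixingSubgroup) :
      secAct F τ' U s = secAct F τ U s := by
    have : τ' = τ * (τ⁻¹ * τ') := by group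
    rw [this, secAct_mul]
    exact congrArg _ (hL' h)
  -- The base change of `U ×_K L` to `K^s` is a union of copies of `Ū` indexed by the embeddings of `L`
  -- into `K^s`; the invariant section is `τ s` on the copy given by `τ`, which depends only on `τ` on `L`.
  let P (V : (sepBaseChange Ks f).Etale) (a : V ⟶ (etBaseChange (sepProj Ks f)).obj (etExt f U L))
      (t : Sec F.obj V) : Prop :=
    ∀ (Ω : Type u) (_ : Field Ω) (_ : IsSepClosed Ω) (y : Spec (.of Ω) ⟶ sepBaseChange Ks f)
      (v : Lift y V) (c : Lift y ((etBaseChange (sepProj Ks f)).obj U)) (τ : Ks ≃ₐ[K] Ks),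
      Lift.map y a v = Lift.map y (etEmb f U L τ) c →
        germ y F.obj V v t = germ y F.obj _ c (secAct F τ U s)
  have hP (τ : Ks ≃ₐ[K] Ks) : P _ (etEmb f U L τ) (secAct F τ U s) := by
    intro Ω _ _ y v c τ' h
    obtain ⟨rfl, h'⟩ := etEmb_eq_etEmb f h
    rw [hτ h']
  have hres {V W : (sepBaseChange Ks f).Etale}
      (a : V ⟶ (etBaseChange (sepProj Ks f)).obj (etExt f U L)) (b : W ⟶ V) (t : Sec F.obj V)
      (ht : P V a t) : P W (b ≫ a) (res F.obj b t) := fun Ω _ _ y v c τ h => by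
    rw [germ_res]
    exact ht Ω _ _ y _ c τ (by rw [Lift.map_map, h])
  have huniq (V : (sepBaseChange Ks f).Etale)
      (a : V ⟶ (etBaseChange (sepProj Ks f)).obj (etExt f U L)) (t t' : Sec F.obj V)
      (ht : P V a t) (ht' : P V a t') : t = t' := by
    refine sec_ext_germ fun Ω _ _ y v => ?_
    obtain ⟨τ, c, h⟩ := exists_etEmb_eq f (Lift.map y a v)
    rw [ht Ω _ _ y v c τ h.symm, ht' Ω _ _ y v c τ h.symm]
  have hcov (z) : ∃ τ, z ∈ Set.range (totMap (etEmb f U L τ)) := by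
    obtain ⟨Ω, _, _, y, u, rfl⟩ := exists_geomPoint z
    obtain ⟨τ, c, rfl⟩ := exists_etEmb_eq f u
    exact ⟨τ, _, rfl⟩
  obtain ⟨s', hs'⟩ := sec_glue P hres huniq fun z => (hcov z).elim fun τ h =>
    ⟨_, etEmb f U L τ, h, _, hP τ⟩
  have h₁ (τ : Ks ≃ₐ[K] Ks) : res F.obj (etEmb f U L τ) s' = secAct F τ U s := hs' _ _ _ (hP τ)
  refine ⟨etExt f U L, etEmb f U L 1, s', fun γ => sec_ext fun z => ?_, by rw [h₁, secAct_one]⟩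
  obtain ⟨τ, h⟩ := hcov z
  refine ⟨_, etEmb f U L τ, h, ?_⟩
  have h₂ := secAct_eq F γ (secAct F (γ⁻¹ * τ) U s)
  rw [← secAct_mul, mul_inv_cancel_left] at h₂
  rw [res_secAct_eq, galComp_etEmb, ← res_res, h₁, h₁]
  exact h₂.symm

end GaloisCover

/-! ### Galois descent -/

section Invariants

variable {K Ks : Type u} [Field K] [Field Ks] [Algebra K Ks] {X : Scheme.{u}}
  {f : X ⟶ Spec (.of K)}

/-- The invariant sections of an equivariant sheaf over `Ū`. -/
def invSubgroup (F : Equivariant (galAction (Ks := Ks) f)) (U : X.Etale) :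
    AddSubgroup (Sec F.obj ((etBaseChange (sepProj Ks f)).obj U)) where
  carrier := {s | ∀ γ, secAct F γ U s = s}
  add_mem' ha hb γ := by rw [map_add, ha, hb]
  zero_mem' γ := map_zero _
  neg_mem' ha γ := by rw [map_neg, ha]

lemma res_mem_invSubgroup {F : Equivariant (galAction (Ks := Ks) f)} {U V : X.Etale} (a : V ⟶ U)
    {s : Sec F.obj ((etBaseChange (sepProj Ks f)).obj U)} (hs : s ∈ invSubgroup F U) :
    res F.obj ((etBaseChange (sepProj Ks f)).map a) s ∈ invSubgroup F V := fun γ => by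
  rw [← res_secAct, hs]

/-- The presheaf of invariant sections. -/
def invPresheaf (F : Equivariant (galAction (Ks := Ks) f)) : X.Etaleᵒᵖ ⥤ AddCommGrpCat.{u} where
  obj U := .of (invSubgroup F U.unop)
  map a := AddCommGrpCat.ofHom
    (((res F.obj ((etBaseChange (sepProj Ks f)).map a.unop)).comp (AddSubgroup.subtype _)).codRestrict
      _ fun s => res_mem_invSubgroup a.unop s.2)
  map_id U := by
    ext s
    refine (congrArg (fun b => res F.obj b s.1) ((etBaseChange (sepProj Ks f)).map_id U.unop)).trans ?_
    exact res_id s.1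
  map_comp a b := by
    ext s
    refine (congrArg (fun c => res F.obj c s.1)
      ((etBaseChange (sepProj Ks f)).map_comp b.unop a.unop)).trans ?_
    exact (res_res _ _ s.1).symm

/-- The inclusion of the presheaf of invariant sections. -/
def invPresheafι (F : Equivariant (galAction (Ks := Ks) f)) :
    invPresheaf F ⟶ ((push (sepProj Ks f)).obj F.obj).obj where
  app U := AddCommGrpCat.ofHom (AddSubgroup.subtype (invSubgroup F U.unop))
  naturality _ _ _ := rfl

lemma isSheaf_invPresheaf (F : Equivariant (galAction (Ks := Ks) f)) :
    Presheaf.IsSheaf X.smallEtaleTopology (invPresheaf F) := by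
  intro E U S hS x hx
  have hι (V) : Mono ((invPresheafι F).app V) :=
    ConcreteCategory.mono_of_injective _ Subtype.val_injective
  let x' : Presieve.FamilyOfElements (((push (sepProj Ks f)).obj F.obj).obj ⋙ coyoneda.obj (op E))
    S.arrows := fun V a ha => x a ha ≫ (invPresheafι F).app (op V)
  have hx' : x'.Compatible := fun V₁ V₂ W a₁ a₂ b₁ b₂ h₁ h₂ e =>
    congrArg (· ≫ (invPresheafι F).app (op W)) (hx a₁ a₂ h₁ h₂ e)
  obtain ⟨t, ht, huniq⟩ := ((push (sepProj Ks f)).obj F.obj).property E S hS x' hx'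
  have ht' (e : E) : t.hom e ∈ invSubgroup F U := fun γ => by
    have := huniq ((show E ⟶ ((push (sepProj Ks f)).obj F.obj).obj.obj (op U) from t) ≫
      (galPush F γ).hom.app (op U)) fun V a ha => ?_
    · exact congrArg (fun φ : E ⟶ ((push (sepProj Ks f)).obj F.obj).obj.obj (op U) => φ.hom e) this
    · have h₁ : t ≫ ((push (sepProj Ks f)).obj F.obj).obj.map a.op = x' a ha := ht a ha
      refine ConcreteCategory.hom_ext (C := AddCommGrpCat.{u}) (X := E)
        (Y := ((push (sepProj Ks f)).obj F.obj).obj.obj (op V)) _ _ fun e => ?_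
      have h₂ : res F.obj ((etBaseChange (sepProj Ks f)).map a) (t.hom e) = ((x a ha).hom e).1 :=
        congrArg (fun φ : E ⟶ ((push (sepProj Ks f)).obj F.obj).obj.obj (op V) => φ.hom e) h₁
      exact ((res_secAct F γ a (t.hom e)).trans (congrArg _ h₂)).trans (((x a ha).hom e).2 γ)
  refine ⟨AddCommGrpCat.ofHom (t.hom.codRestrict _ ht'), fun V a ha => ?_, fun t₁ h₁ => ?_⟩
  · exact (cancel_mono ((invPresheafι F).app (op V))).1 (ht a ha)
  · refine (cancel_mono ((invPresheafι F).app (op U))).1 (huniq _ fun V a ha => ?_)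
    exact congrArg (· ≫ (invPresheafι F).app (op V)) (h₁ a ha)

/-- The sheaf of invariant sections of an equivariant sheaf: the sheaf on `X` obtained by Galois
descent. -/
def descend (F : Equivariant (galAction (Ks := Ks) f)) : EtAb X := ⟨invPresheaf F, isSheaf_invPresheaf F⟩

/-- The inclusion of the invariant sections. -/
def descendι (F : Equivariant (galAction (Ks := Ks) f)) :
    descend F ⟶ (push (sepProj Ks f)).obj F.obj :=
  ⟨invPresheafι F⟩

/-- The morphism `p^* F^G ⟶ F`. -/
def descendCounit (F : Equivariant (galAction (Ks := Ks) f)) :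
    (pull (sepProj Ks f)).obj (descend F) ⟶ F.obj :=
  ((pullPushAdj (sepProj Ks f)).homEquiv _ _).symm (descendι F)

lemma descendCounit_pb (F : Equivariant (galAction (Ks := Ks) f)) {U : X.Etale}
    (s : Sec (descend F) U) : mor (descendCounit F) _ (pb (sepProj Ks f) _ U s) =
      (show invSubgroup F U from s).1 :=
  pb_homEquiv _ (descendι F) U s

/-- A morphism from an inverse image to an equivariant sheaf is equivariant if it sends the sections
which come from `X` to invariant sections. -/
lemma natEquivariant_comm {A : EtAb X} {F : Equivariant (galAction (Ks := Ks) f)}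
    (φ : ((natEquivariant Ks f).obj A).obj ⟶ F.obj)
    (h : ∀ γ U (s : Sec A U), secAct F γ U (mor φ _ (pb (sepProj Ks f) A U s)) =
      mor φ _ (pb (sepProj Ks f) A U s)) (γ : Ks ≃ₐ[K] Ks) :
    (((natEquivariant Ks f).obj A).act γ).hom ≫ φ =
      ((galAction f).T γ).map φ ≫ (F.act γ).hom := by
  refine (cancel_epi (((natEquivariant Ks f).obj A).act γ).inv).1 ?_
  refine (Iso.inv_hom_id_assoc _ _).trans ?_
  refine adj_hom_ext (pullPushAdj (sepProj Ks f)) (F := A) ?_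
  have h₁ := unit_coact (galAction f) (pullPushAdj (sepProj Ks f)) (projIso f) γ A
  refine mor_hom_ext fun U s => ?_
  have e₁ : mor (coact (galAction f) (pullPushAdj (sepProj Ks f)) (projIso f) γ A) _
      (pb (sepProj Ks f) A U s) = res _ (galComp f γ U) (pb (sepProj Ks f) A U s) :=
    congrArg (fun ψ => mor ψ U s) h₁
  have e₂ := (secAct_eq F γ _).symm.trans (h γ U s)
  refine e₂.symm.trans (congrArg (mor (F.act γ).hom _) ?_)
  exact (mor_res φ (galComp f γ U) _).symm.trans
    (congrArg (mor φ ((etBaseChange (galX f γ)).obj ((etBaseChange (sepProj Ks f)).obj U))) e₁.symm)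

lemma secAct_mor_pb {A : EtAb X} {F : Equivariant (galAction (Ks := Ks) f)}
    (φ : (natEquivariant Ks f).obj A ⟶ F) (γ : Ks ≃ₐ[K] Ks) {U : X.Etale} (s : Sec A U) :
    secAct F γ U (mor φ.hom _ (pb (sepProj Ks f) A U s)) =
      mor φ.hom _ (pb (sepProj Ks f) A U s) :=
  (mor_secAct φ γ _).symm.trans (congrArg (mor φ.hom _) (secAct_pb f A γ s))

/-- The morphism `A ⟶ F^G` adjoint to an equivariant morphism `p^* A ⟶ F`. -/
def toDescend {A : EtAb X} {F : Equivariant (galAction (Ks := Ks) f)}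
    (φ : (natEquivariant Ks f).obj A ⟶ F) : A ⟶ descend F :=
  ⟨{ app := fun U => AddCommGrpCat.ofHom (AddMonoidHom.codRestrict
        ((mor φ.hom _).comp (pb (sepProj Ks f) A U.unop)) (invSubgroup F U.unop)
        fun s γ => secAct_mor_pb φ γ s)
     naturality := fun U V a => by
      ext s
      refine Subtype.ext ?_
      change mor φ.hom _ (pb _ A _ (res A a.unop s)) =
        res F.obj ((etBaseChange (sepProj Ks f)).map a.unop) (mor φ.hom _ (pb _ A _ s))
      rw [pb_res]
      exact mor_res φ.hom _ _ }⟩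

/-- The adjunction between inverse images and invariants. -/
lemma pull_toDescend_comp {A : EtAb X} {F : Equivariant (galAction (Ks := Ks) f)}
    (φ : (natEquivariant Ks f).obj A ⟶ F) :
    (pull (sepProj Ks f)).map (toDescend φ) ≫ descendCounit F = φ.hom := by
  refine pull_hom_ext _ fun U s => ?_
  rw [mor_comp, ← pb_mor, descendCounit_pb]
  rfl

end Invariants

section LocalTriviality

variable {X : Scheme.{u}} {A : EtAb X} {Ω : Type u} [Field Ω] [IsSepClosed Ω]
  {x : Spec (.of Ω) ⟶ X}

/-- Finitely many equalities of germs hold on a common neighbourhood. -/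
lemma exists_res_eq_of_finite {ι : Type*} [Finite ι] {W : X.Etale} (w : Lift x W)
    (s s' : ι → Sec A W) (h : ∀ i, germ x A W w (s i) = germ x A W w (s' i)) :
    ∃ (T : X.Etale) (d : T ⟶ W) (t : Lift x T), Lift.map x d t = w ∧
      ∀ i, res A d (s i) = res A d (s' i) := by
  have := Fintype.ofFinite ι
  classical
  have key (S : Finset ι) : ∃ (T : X.Etale) (d : T ⟶ W) (t : Lift x T), Lift.map x d t = w ∧
      ∀ i ∈ S, res A d (s i) = res A d (s' i) := by
    induction S using Finset.induction_on with
    | empty => exact ⟨W, 𝟙 _, w, Lift.ext _ (by simp), fun _ h => absurd h (Finset.notMem_empty _)⟩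
    | insert i S _ ih =>
      obtain ⟨T, d, t, rfl, hT⟩ := ih
      have h' := h i
      rw [← germ_res, ← germ_res, germ_eq_iff] at h'
      obtain ⟨T', d', t', rfl, e⟩ := h'
      refine ⟨T', d' ≫ d, t', (Lift.map_map _ _ _).symm, fun j hj => ?_⟩
      rw [← res_res, ← res_res]
      rcases Finset.mem_insert.1 hj with rfl | hj
      · exact e
      · rw [hT j hj]
  obtain ⟨T, d, t, h, hT⟩ := key Finset.univ
  exact ⟨T, d, t, h, fun i => hT i (Finset.mem_univ i)⟩

/-- A homomorphism to the sections of a locally constant sheaf which is bijective on the germs at one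
geometric point trivializes the sheaf near this point. -/
lemma IsLC.exists_isTriv (hA : IsLC A) {V : X.Etale} {M : Type u} [AddCommGroup M] [Finite M]
    (φ : M →+ Sec A V) (v : Lift x V) (h : Function.Bijective fun m => germ x A V v (φ m)) :
    ∃ (W : X.Etale) (a : W ⟶ V), Lift.pt x v default ∈ Set.range (totMap a) ∧
      IsTriv A W ((res A a).comp φ) := by
  obtain ⟨T, ⟨t, ht⟩, N, _, _, ψ, hψ⟩ := hA (x default)
  obtain ⟨t, rfl⟩ := exists_lift x ht
  obtain ⟨W, w, a, b, rfl, rfl⟩ := exists_common_nbhd x v t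
  let eM := Equiv.ofBijective _ h
  let eN := Equiv.ofBijective _ (hψ Ω _ _ x (Lift.map x b w))
  let ρ : M ≃ N := eM.trans eN.symm
  obtain ⟨T, d, t, rfl, hd⟩ := exists_res_eq_of_finite w (fun m => res A a (φ m))
    (fun m => res A b (ψ (ρ m))) fun m => by
      rw [germ_res, germ_res]
      exact (eN.apply_symm_apply (eM m)).symm
  refine ⟨T, d ≫ a, ⟨Lift.pt x t default, ?_⟩, fun Ω _ _ y z => ?_⟩
  · rw [← Scheme.Hom.comp_apply, Lift.map_map, Lift.pt_map]
  · convert! (hψ Ω _ _ y (Lift.map y b (Lift.map y d z))).comp ρ.bijective using 2 with m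
    change germ y A T z (res A (d ≫ a) (φ m)) = germ y A _ _ (ψ (ρ m))
    rw [← res_res, hd, germ_res, germ_res]

end LocalTriviality

section Descent

/-- Two points with the same image lift to geometric points with the same image. -/
lemma exists_geomPoints {T S : Scheme.{u}} (g : T ⟶ S) {y z : T} (h : g y = g z) :
    ∃ (Ω : Type u) (_ : Field Ω) (_ : IsSepClosed Ω) (qy qz : Spec (.of Ω) ⟶ T),
      qy default = y ∧ qz default = z ∧ qy ≫ g = qz ≫ g := by
  obtain ⟨p, hy, hz⟩ := Scheme.exists_preimage_of_isPullback (IsPullback.of_hasPullback g g) y z h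
  let k := Scheme.residueField _ p
  let Ω := SeparableClosure k
  let q : Spec (.of Ω) ⟶ _ := Spec.map (CommRingCat.ofHom (algebraMap k Ω)) ≫
    Scheme.fromSpecResidueField _ p
  have hq : q default = p := exists_geomPoint_aux _ _ _ _
  refine ⟨Ω, inferInstance, inferInstance, q ≫ pullback.fst _ _, q ≫ pullback.snd _ _, ?_, ?_, ?_⟩
  · rw [Scheme.Hom.comp_apply, hq, hy]
  · rw [Scheme.Hom.comp_apply, hq, hz]
  · exact (Category.assoc _ _ _).trans ((congrArg (q ≫ ·) pullback.condition).trans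
      (Category.assoc _ _ _).symm)

variable {K Ks : Type u} [Field K] [Field Ks] [Algebra K Ks] {X : Scheme.{u}}
  {f : X ⟶ Spec (.of K)}

lemma galTot_mul (γ δ : Ks ≃ₐ[K] Ks) (U : X.Etale) :
    galTot f (γ * δ) U = galTot f δ U ≫ galTot f γ U :=
  bc_tot_hom_ext _ (by rw [Category.assoc, galTot_fst, galTot_fst, galTot_fst])
    (by rw [Category.assoc, galTot_str, galTot_str, ← Category.assoc, galTot_str, Category.assoc,
      galX_mul])

lemma galTot_one (U : X.Etale) : galTot f (1 : Ks ≃ₐ[K] Ks) U = 𝟙 _ :=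
  bc_tot_hom_ext _ (by rw [galTot_fst, Category.id_comp])
    (by rw [galTot_str, galX_one, Category.id_comp, Category.comp_id])

/-- An invariant section vanishes on a Galois stable set. -/
lemma exists_res_eq_zero_galTot {F : Equivariant (galAction (Ks := Ks) f)} {U : X.Etale}
    {s : Sec F.obj ((etBaseChange (sepProj Ks f)).obj U)} (hs : s ∈ invSubgroup F U)
    (γ : Ks ≃ₐ[K] Ks) {W : (sepBaseChange Ks f).Etale} (a : W ⟶ (etBaseChange (sepProj Ks f)).obj U)
    (h : res F.obj a s = 0) (w : tot W) :
    ∃ (W' : (sepBaseChange Ks f).Etale) (a' : W' ⟶ (etBaseChange (sepProj Ks f)).obj U),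
      galTot f γ U (totMap a w) ∈ Set.range (totMap a') ∧ res F.obj a' s = 0 := by
  have h' : res F.obj ((etBaseChange (galX f γ⁻¹)).map a ≫ galComp f γ⁻¹ U) s = 0 := by
    refine (mor_bijective (F.act γ⁻¹).hom W).1 ?_
    refine Eq.trans ?_ (map_zero _).symm
    exact (res_secAct_eq F γ⁻¹ a s).symm.trans ((congrArg _ (hs γ⁻¹)).trans h)
  have : Surjective (bcFst (galX f γ⁻¹) W) :=
    MorphismProperty.of_isPullback (bc_isPullback (galX f γ⁻¹) W).flip inferInstance
  obtain ⟨w', rfl⟩ := (bcFst (galX f γ⁻¹) W).surjective w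
  refine ⟨_, (etBaseChange (galX f γ⁻¹)).map a ≫ galComp f γ⁻¹ U, ⟨w', ?_⟩, h'⟩
  have h₁ : totMap ((etBaseChange (galX f γ⁻¹)).map a ≫ galComp f γ⁻¹ U) ≫ galTot f γ⁻¹ U =
      bcFst (galX f γ⁻¹) W ≫ totMap a := by
    rw [totMap_comp, Category.assoc, galComp_galTot, etBaseChange_map_fst]
  have h₂ : bcFst (galX f γ⁻¹) W ≫ totMap a ≫ galTot f γ U =
      totMap ((etBaseChange (galX f γ⁻¹)).map a ≫ galComp f γ⁻¹ U) := by
    rw [← reassoc_of% h₁, ← galTot_mul, mul_inv_cancel, galTot_one, Category.comp_id]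
  rw [← h₂]
  rfl

variable [Algebra.IsSeparable K Ks]

lemma isClosedMap_bcFst (U : X.Etale) : IsClosedMap (bcFst (sepProj Ks f) U) := by
  have : IsIntegralHom (bcFst (sepProj Ks f) U) :=
    MorphismProperty.of_isPullback (bc_isPullback (sepProj Ks f) U).flip inferInstance
  exact (bcFst (sepProj Ks f) U).isClosedMap

/-- Every geometric point of `X` lifts to `X̄`. -/
lemma exists_lift_sepProj {Ω : Type u} [Field Ω] [IsSepClosed Ω] (x : Spec (.of Ω) ⟶ X) :
    ∃ y : Spec (.of Ω) ⟶ sepBaseChange Ks f, y ≫ sepProj Ks f = x := by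
  let α := Spec.preimage (x ≫ f)
  have hα : Spec.map α = x ≫ f := Spec.map_preimage _
  let _ : Algebra K Ω := α.hom.toAlgebra
  let β : Ks →ₐ[K] Ω := IsSepClosed.lift
  refine ⟨(sep_isPullback Ks f).lift x (Spec.map (CommRingCat.ofHom (β : Ks →+* Ω))) ?_,
    IsPullback.lift_fst _ _ _ _⟩
  rw [specSep, ← Spec.map_comp, ← hα]
  congr 1
  exact CommRingCat.hom_ext (RingHom.ext fun c => (β.commutes c).symm)

variable [IsSepClosed Ks]

/-- The Galois group acts transitively on the fibres of `Ū ⟶ U`. -/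
lemma exists_galTot_eq {U : X.Etale} {y z : tot ((etBaseChange (sepProj Ks f)).obj U)}
    (h : bcFst (sepProj Ks f) U y = bcFst (sepProj Ks f) U z) :
    ∃ γ : Ks ≃ₐ[K] Ks, galTot f γ U y = z := by
  obtain ⟨Ω, _, _, qy, qz, rfl, rfl, hqq⟩ := exists_geomPoints _ h
  let α := Spec.preimage (qy ≫ str _ ≫ sepStr Ks f)
  let β := Spec.preimage (qz ≫ str _ ≫ sepStr Ks f)
  have hα : Spec.map α = qy ≫ str _ ≫ sepStr Ks f := Spec.map_preimage _
  have hβ : Spec.map β = qz ≫ str _ ≫ sepStr Ks f := Spec.map_preimage _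
  have hw := (bc_isPullback_specSep (Ks := Ks) f U).w
  have hK : CommRingCat.ofHom (algebraMap K Ks) ≫ α = CommRingCat.ofHom (algebraMap K Ks) ≫ β := by
    apply Spec.map_injective
    rw [Spec.map_comp, Spec.map_comp, hα, hβ]
    change _ ≫ specSep K Ks = _ ≫ specSep K Ks
    rw [Category.assoc] at hw
    rw [Category.assoc, Category.assoc, Category.assoc, Category.assoc, ← hw, reassoc_of% hqq]
  obtain ⟨τ, hτ⟩ := exists_gal_eq (K := K) (Ks := Ks) (Ω := Ω) ⊤
    (β.hom.comp (algebraMap (⊤ : IntermediateField K Ks) Ks)) α.hom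
    fun c => (congrArg (fun ψ => ψ.hom c) hK).symm
  have hτ' : β = CommRingCat.ofHom (τ : Ks →+* Ks) ≫ α := by
    exact CommRingCat.hom_ext (RingHom.ext fun a => hτ ⟨a, trivial⟩)
  refine ⟨τ⁻¹, ?_⟩
  rw [← Scheme.Hom.comp_apply]
  refine congrArg (fun q : Spec (.of Ω) ⟶ _ => q default)
    ((bc_isPullback_specSep f U).hom_ext ?_ ?_)
  · rw [Category.assoc, galTot_fst, hqq]
  · rw [Category.assoc, ← Category.assoc (galTot f _ U), galTot_str, Category.assoc, galX_str,
      ← hβ, hτ', Spec.map_comp, hα, Category.assoc, Category.assoc]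
    rfl

/-- Galois descent: an equivariant sheaf on which the action is continuous is the inverse image of
the sheaf of its invariant sections. -/
lemma isIso_descendCounit (F : Equivariant (galAction (Ks := Ks) f))
    (hc : ∀ (U : X.Etale) [CompactSpace (tot U)]
      (s : Sec F.obj ((etBaseChange (sepProj Ks f)).obj U)),
      ∀ᶠ γ in nhds (1 : Ks ≃ₐ[K] Ks), secAct F γ U s = s) : IsIso (descendCounit F) := by
  refine isIso_of_stalk _ fun Ω _ _ y => ⟨?_, fun t => ?_⟩
  · rw [injective_iff_map_eq_zero]
    intro t ht
    obtain ⟨U, v, s, rfl⟩ := exists_germ_pb (sepProj Ks f) y t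
    have hs : (show invSubgroup F U from s).1 ∈ invSubgroup F U := (show invSubgroup F U from s).2
    replace ht : germ y F.obj _ v (show invSubgroup F U from s).1 = 0 :=
      ((congrArg _ (descendCounit_pb F s)).symm.trans (germ_mor y _ _ _ _).symm).trans ht
    generalize hs' : (show invSubgroup F U from s).1 = s' at hs ht
    -- The locus `Z` where the invariant section vanishes is stable under Galois, hence contains the fibre
    -- of `Ū ⟶ U` through the given point; as this map is closed, the section vanishes over an open `O`.
    let Z : Set (tot ((etBaseChange (sepProj Ks f)).obj U)) := {z | ∃ (W : (sepBaseChange Ks f).Etale)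
      (a : W ⟶ (etBaseChange (sepProj Ks f)).obj U), z ∈ Set.range (totMap a) ∧ res F.obj a s' = 0}
    have hZ : IsOpen Z := by
      rw [isOpen_iff_forall_mem_open]
      rintro z ⟨W, a, hz, ha⟩
      exact ⟨_, fun z' hz' => ⟨W, a, hz', ha⟩, isOpen_range_totMap a, hz⟩
    let O : (tot U).Opens := ⟨(bcFst (sepProj Ks f) U '' Zᶜ)ᶜ,
      (isClosedMap_bcFst U _ hZ.isClosed_compl).isOpen_compl⟩
    have hv : bcFst (sepProj Ks f) U (Lift.pt y v default) ∈ O := by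
      rintro ⟨n, hn, e⟩
      obtain ⟨W, a, ⟨w, hw⟩, ha⟩ := (germ_eq_zero_iff v s').1 ht
      obtain ⟨γ, rfl⟩ := exists_galTot_eq e.symm
      rw [← hw] at hn
      exact hn (exists_res_eq_zero_galTot hs γ a ha w)
    have hsO : res (descend F) (etOpenι U O) s = 0 := by
      refine Subtype.ext ?_
      change res F.obj ((etBaseChange (sepProj Ks f)).map (etOpenι U O))
        (show invSubgroup F U from s).1 = 0
      rw [hs']
      refine sec_ext_germ fun Ω _ _ y w => ?_
      rw [germ_res, germ_zero, germ_eq_zero_iff]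
      by_contra hn
      have h₁ : bcFst (sepProj Ks f) U (Lift.pt y (Lift.map y
          ((etBaseChange (sepProj Ks f)).map (etOpenι U O)) w) default) ∈ O := by
        rw [Lift.pt_map, ← Scheme.Hom.comp_apply, Category.assoc, etBaseChange_map_fst]
        rw [← SetLike.mem_coe, ← range_totMap_etOpenι, ← Category.assoc]
        exact ⟨_, rfl⟩
      exact h₁ ⟨_, hn, rfl⟩
    have h0 : germ (y ≫ sepProj Ks f) (descend F) U (liftEquiv _ y rfl U v) s = 0 := by
      refine (germ_eq_zero_iff _ _).2 ⟨_, etOpenι U O, ?_, hsO⟩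
      rw [range_totMap_etOpenι]
      exact hv
    refine (germ_pb_eq_of_germ_eq (sepProj Ks f) y rfl (v := v) (v' := v) (s' := 0)
      (h0.trans (germ_zero _ _).symm)).trans ?_
    rw [map_zero, germ_zero]
  · obtain ⟨V, v, s, rfl⟩ := exists_germ y t
    -- Locally every étale `X̄`-scheme is closed in some `Ū`, and a section of an étale sheaf over a closed
    -- subscheme which is étale over `Ū` is a restriction.
    obtain ⟨U, W, a, b, hU, ⟨w, hw⟩, hb⟩ := exists_closed_nbhd f (Lift.pt y v default)
    obtain ⟨w, rfl, -⟩ := exists_lift_map y a v hw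
    obtain ⟨s₁, hs₁⟩ := exists_res_eq_of_isClosedImmersion b (res F.obj a s)
    obtain ⟨U', j, s', hs', e⟩ := exists_invariant_section f F s₁ (hc U s₁)
    refine ⟨germ y _ _ (Lift.map y (b ≫ j) w) (pb (sepProj Ks f) (descend F) U' ⟨s', hs'⟩), ?_⟩
    refine (germ_mor y _ _ _ _).trans ((congrArg _ (descendCounit_pb F _)).trans ?_)
    change germ y F.obj _ _ s' = _
    rw [← germ_res, ← res_res, e, hs₁, germ_res]

/-- A sheaf whose inverse image on `X̄` is locally constant is locally constant. -/
lemma IsLC.of_pull_sepProj {A : EtAb X} (hA : IsLC ((LadicSheaf.pull (sepProj Ks f)).obj A)) : IsLC A := by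
  intro p
  let P := sepProj Ks f
  obtain ⟨q, rfl⟩ := P.surjective p
  obtain ⟨Ω, _, _, y, t, ht⟩ := exists_geomPoint (U := etTop (sepBaseChange Ks f)) q
  let x := y ≫ P
  have hx : x default = P q := by
    have h : y default = q := by
      rw [← ht]; exact congrArg (fun g : Spec (.of Ω) ⟶ _ => g default) (Lift.pt_str y t).symm
    rw [← h]; rfl
  have := (hA.finite_stalk y)
  have hM : Finite ((stalk x).obj A) := Finite.of_equiv _ (stalkPull P y rfl A).toEquiv
  let M : Type u := (stalk x).obj A
  -- The finitely many elements of the stalk of `A` spread out to a homomorphism `φ` over some `U`.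
  choose U' u' s' hs' using fun m : M => exists_germ x m
  obtain ⟨W, w, a, ha⟩ := exists_common_nbhd_of_finite x U' u'
  let σ (m : M) : Sec A W := res A (a m) (s' m)
  have hσ (m : M) : germ x A W w (σ m) = m := by rw [germ_res, ha, hs']
  obtain ⟨U, d, u, rfl, hd⟩ := exists_res_eq_of_finite w (fun m : M × M => σ (m.1 + m.2))
    (fun m => σ m.1 + σ m.2) fun m => by rw [germ_add, hσ, hσ, hσ]
  let φ : M →+ Sec A U := AddMonoidHom.mk' (fun m => res A d (σ m)) fun m m' => by
    rw [← map_add]; exact hd (m, m')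
  have hφ (m : M) : germ x A U u (φ m) = m := (germ_res x d u _).trans (hσ m)
  -- `φ` trivializes the inverse image over an open `Z` which contains the fibre of `Ū ⟶ U` through the
  -- given point, since Galois acts transitively on this fibre; as `Ū ⟶ U` is closed, `φ` trivializes `A`
  -- over an open `O`.
  let Z : Set (tot ((etBaseChange P).obj U)) := {z | ∃ (W : (sepBaseChange Ks f).Etale)
      (a : W ⟶ (etBaseChange P).obj U), z ∈ Set.range (totMap a) ∧
        IsTriv ((LadicSheaf.pull P).obj A) W ((res _ a).comp ((pb P A U).comp φ))}
  have hZ : IsOpen Z := by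
    rw [isOpen_iff_forall_mem_open]
    rintro z ⟨W, a, hz, ha⟩
    exact ⟨_, fun z' hz' => ⟨W, a, hz', ha⟩, isOpen_range_totMap a, hz⟩
  let O : (tot U).Opens := ⟨(bcFst P U '' Zᶜ)ᶜ,
    (isClosedMap_bcFst U _ hZ.isClosed_compl).isOpen_compl⟩
  let v₀ := (liftEquiv P y (x := x) rfl U).symm u
  have hv₀ : Lift.pt y v₀ ≫ bcFst P U = Lift.pt x u := IsPullback.lift_fst _ _ _ _
  have hu : Lift.pt x u default ∈ O := by
    rintro ⟨n, hn, e⟩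
    rw [← hv₀, Scheme.Hom.comp_apply] at e
    obtain ⟨γ, rfl⟩ := exists_galTot_eq e.symm
    have e' : (y ≫ galX f γ) ≫ P = x := by rw [Category.assoc, galX_proj]
    let v := (liftEquiv P (y ≫ galX f γ) e' U).symm u
    have hv : Lift.pt _ v = Lift.pt y v₀ ≫ galTot f γ U := by
      refine bc_tot_hom_ext _ ?_ ?_
      · rw [Category.assoc, galTot_fst, hv₀]
        exact IsPullback.lift_fst _ _ _ _
      · rw [Category.assoc, galTot_str, Lift.pt_str, ← Category.assoc, Lift.pt_str]
    have h₁ := hA.exists_isTriv ((pb P A U).comp φ) v <| by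
      refine (congrArg Function.Bijective (funext fun m => ?_)).mp (stalkPull P _ e' A).symm.bijective
      refine (AddEquiv.symm_apply_eq _).2 ?_
      refine Eq.trans ?_ (stalkPull_germ P _ e' A v (φ m)).symm
      rw [Equiv.apply_symm_apply]
      exact (hφ m).symm
    rw [hv, Scheme.Hom.comp_apply] at h₁
    exact hn h₁
  refine ⟨etOpen U O, ?_, M, inferInstance, hM, (res A (etOpenι U O)).comp φ, ?_⟩
  · have : Lift.pt x u default ∈ Set.range (totMap (etOpenι U O)) := by
      rw [range_totMap_etOpenι]; exact hu
    obtain ⟨z, hz⟩ := this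
    refine ⟨z, ?_⟩
    rw [← totMap_str (etOpenι U O), Scheme.Hom.comp_apply, hz, ← Scheme.Hom.comp_apply, Lift.pt_str, hx]
  · intro Ω' _ _ x' u'
    obtain ⟨y', rfl⟩ := exists_lift_sepProj (Ks := Ks) (f := f) x'
    let z := Lift.map _ (etOpenι U O) u'
    let v := (liftEquiv P y' rfl U).symm z
    have hv : Lift.pt _ v ≫ bcFst P U = Lift.pt _ z := IsPullback.lift_fst _ _ _ _
    have h₁ : Lift.pt _ v default ∈ Z := by
      by_contra hn
      have h₂ : Lift.pt _ z default ∈ O := by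
        rw [← SetLike.mem_coe, ← range_totMap_etOpenι, Lift.pt_map]
        exact ⟨_, rfl⟩
      rw [← hv] at h₂
      exact h₂ ⟨_, hn, rfl⟩
    obtain ⟨W, a, ⟨w, hw⟩, ha⟩ := h₁
    obtain ⟨w, hw, -⟩ := exists_lift_map y' a v hw
    refine (congrArg Function.Bijective (funext fun m => ?_)).mp
      ((stalkPull P y' rfl A).bijective.comp (ha Ω' _ _ y' w))
    change stalkPull P y' rfl A (germ y' _ W w (res _ a (pb P A U (φ m)))) =
      germ _ A _ u' (res A (etOpenι U O) (φ m))
    rw [germ_res, hw, germ_res, stalkPull_germ, Equiv.apply_symm_apply]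

end Descent

/-! ### Morphisms of étale schemes and geometric points -/

section GeometricPoints

variable {X : Scheme.{u}} {V W : X.Etale}

/-- Morphisms of étale schemes which agree on geometric points are equal. -/
lemma et_hom_ext_lift {a a' : V ⟶ W} (h : ∀ (Ω : Type u) (_ : Field Ω) (_ : IsSepClosed Ω)
    (x : Spec (.of Ω) ⟶ X) (v : Lift x V), Lift.map x a v = Lift.map x a' v) : a = a' := by
  let d : tot V ⟶ pullback (str W) (str W) := pullback.lift (totMap a) (totMap a') (by simp)
  have hd : Set.range d ⊆ Set.range (pullback.diagonal (str W)) := by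
    rintro _ ⟨v, rfl⟩
    obtain ⟨Ω, _, _, x, v, rfl⟩ := exists_geomPoint v
    refine ⟨totMap a (Lift.pt x v default), ?_⟩
    have e : Lift.pt x v ≫ d = (Lift.pt x v ≫ totMap a) ≫ pullback.diagonal (str W) := by
      refine pullback.hom_ext ?_ ?_
      · rw [Category.assoc, pullback.lift_fst, Category.assoc, pullback.diagonal_fst,
          Category.comp_id]
      · rw [Category.assoc, pullback.lift_snd, Category.assoc, pullback.diagonal_snd,
          Category.comp_id]
        exact (congrArg (Lift.pt x) (h Ω _ _ x v)).symm
    exact congrArg (fun g : Spec (.of Ω) ⟶ _ => g default) e.symm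
  have e := IsOpenImmersion.lift_fac (pullback.diagonal (str W)) d hd
  refine et_hom_ext ?_
  have h₁ := congrArg (· ≫ pullback.fst _ _) e
  have h₂ := congrArg (· ≫ pullback.snd _ _) e
  simp only [Category.assoc, pullback.diagonal_fst, pullback.diagonal_snd, Category.comp_id] at h₁ h₂
  exact (pullback.lift_fst _ _ _).symm.trans (h₁.symm.trans (h₂.trans (pullback.lift_snd _ _ _)))

/-- A morphism of étale schemes which is injective on geometric points is an open immersion. -/
lemma isOpenImmersion_of_lift_injective (a : V ⟶ W) (h : ∀ (Ω : Type u) (_ : Field Ω)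
    (_ : IsSepClosed Ω) (x : Spec (.of Ω) ⟶ X), Function.Injective (Lift.map x a)) :
    IsOpenImmersion (totMap a) := by
  let T : X.Etale := Scheme.Etale.mk (pullback.fst (totMap a) (totMap a) ≫ str V)
  let p₁ : T ⟶ V := etHomMk (U := T) (pullback.fst _ _) rfl
  let p₂ : T ⟶ V := etHomMk (U := T) (pullback.snd _ _) (by
    change _ = pullback.fst (totMap a) (totMap a) ≫ str V
    rw [← totMap_str a]
    exact (pullback.condition_assoc (f := totMap a) (g := totMap a) (str W)).symm)
  have hΔ : IsIso (pullback.diagonal (totMap a)) := by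
    refine isIso_of_isOpenImmersion_of_opensRange_eq_top _ (top_unique ?_)
    intro z _
    obtain ⟨Ω, _, _, x, t, rfl⟩ := exists_geomPoint (U := T) z
    have e : Lift.map x p₁ t = Lift.map x p₂ t := by
      apply h Ω _ _ x
      rw [Lift.map_map, Lift.map_map]
      congr 1
      exact et_hom_ext pullback.condition
    have e' : (Lift.pt x t ≫ pullback.fst (totMap a) (totMap a)) ≫ pullback.diagonal (totMap a) =
        Lift.pt x t := by
      refine pullback.hom_ext ?_ ?_
      · exact (Category.assoc _ _ _).trans
          (congrArg (_ ≫ ·) (pullback.diagonal_fst _) |>.trans (Category.comp_id _))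
      · exact (Category.assoc _ _ _).trans
          ((congrArg (_ ≫ ·) (pullback.diagonal_snd _) |>.trans (Category.comp_id _)).trans
            (congrArg (Lift.pt x) e))
    exact ⟨_, congrArg (fun g : Spec (.of Ω) ⟶ tot T => g default) e'⟩
  have : Mono (totMap a) := pullback.isIso_diagonal_iff _ |>.1 hΔ
  exact IsOpenImmersion.of_flat_of_mono _

lemma isIso_of_lift_bijective (a : V ⟶ W) (h : ∀ (Ω : Type u) (_ : Field Ω)
    (_ : IsSepClosed Ω) (x : Spec (.of Ω) ⟶ X), Function.Bijective (Lift.map x a)) :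
    IsIso a := by
  have := isOpenImmersion_of_lift_injective a fun Ω _ _ x => (h Ω _ _ x).1
  have hi : IsIso (totMap a) := by
    refine isIso_of_isOpenImmersion_of_opensRange_eq_top _ (top_unique ?_)
    intro z _
    obtain ⟨Ω, _, _, x, t, rfl⟩ := exists_geomPoint z
    obtain ⟨v, rfl⟩ := (h Ω _ _ x).2 t
    exact ⟨_, rfl⟩
  exact ⟨etHomMk (inv (totMap a)) (by rw [IsIso.inv_comp_eq, totMap_str]),
    et_hom_ext (by simp), et_hom_ext (by simp)⟩

end GeometricPoints

/-! ### Étale spaces of locally constant sheaves -/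

section Espace

variable {X : Scheme.{u}}

/-- A finite étale scheme over the open subset `U` representing the restriction of `A` to `U`: a
section of `A` over it, the universal one, induces bijections from the geometric points to the
stalks. -/
structure Espace (A : EtAb X) (U : X.Opens) where
  /-- the representing object, as an étale `X`-scheme -/
  obj : X.Etale
  /-- the structure morphism -/
  toOpen : tot obj ⟶ U
  w : toOpen ≫ U.ι = str obj
  finite : IsFinite toOpen
  /-- the universal section -/
  sec : Sec A obj
  bij : ∀ (Ω : Type u) (_ : Field Ω) (_ : IsSepClosed Ω) (x : Spec (.of Ω) ⟶ X), x default ∈ U →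
    Function.Bijective fun u : Lift x obj => germ x A obj u sec

namespace Espace

variable {A : EtAb X} {U : X.Opens}

lemma mem_of_lift (E : Espace A U) {Ω : Type u} [Field Ω] [IsSepClosed Ω] {x : Spec (.of Ω) ⟶ X}
    (u : Lift x E.obj) : x default ∈ U := by
  have h : (Lift.pt x u ≫ E.toOpen) ≫ U.ι = x := by rw [Category.assoc, E.w, Lift.pt_str]
  have h' : x default = U.ι ((Lift.pt x u ≫ E.toOpen) default) :=
    congrArg (fun g : Spec (.of Ω) ⟶ X => g default) h.symm
  rw [h']
  exact ((Lift.pt x u ≫ E.toOpen) default).2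

lemma mem_of_hom {V : X.Etale} (hV : Set.range (str V) ⊆ U) {Ω : Type u} [Field Ω] [IsSepClosed Ω]
    {x : Spec (.of Ω) ⟶ X} (v : Lift x V) : x default ∈ U :=
  hV ⟨Lift.pt x v default, congrArg (fun g : Spec (.of Ω) ⟶ X => g default) (Lift.pt_str x v)⟩

lemma hom_unique (E : Espace A U) {V : X.Etale} {a b : V ⟶ E.obj}
    (h : res A a E.sec = res A b E.sec) : a = b :=
  et_hom_ext_lift fun Ω _ _ x v => by
    refine (E.bij Ω _ _ x (E.mem_of_lift (Lift.map x a v))).1 ?_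
    change germ _ _ _ _ _ = germ _ _ _ _ _
    rw [← germ_res, h, germ_res]

/-- The universal property: a section over `V` comes from a morphism `V ⟶ E`, whose graph is the
locus in `V × E` where the section agrees with the universal one. -/
lemma exists_hom (E : Espace A U) {V : X.Etale} (hV : Set.range (str V) ⊆ U) (s : Sec A V) :
    ∃ a : V ⟶ E.obj, res A a E.sec = s := by
  -- `P = V ×_X E`, and `O` is the open locus where the two sections agree; `O ⟶ V` is an isomorphism.
  let P : X.Etale := Scheme.Etale.mk (pullback.fst (str V) (str E.obj) ≫ str V)
  let p₁ : P ⟶ V := etHomMk (U := P) (pullback.fst _ _) rfl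
  let p₂ : P ⟶ E.obj := etHomMk (U := P) (pullback.snd _ _) pullback.condition.symm
  let O : (tot P).Opens := ⟨{z | ∃ (T : X.Etale) (a : T ⟶ P), z ∈ Set.range (totMap a) ∧
      res A a (res A p₁ s - res A p₂ E.sec) = 0}, by
    rw [isOpen_iff_forall_mem_open]
    rintro z ⟨T, a, hz, ha⟩
    exact ⟨_, fun z' hz' => ⟨T, a, hz', ha⟩, isOpen_range_totMap a, hz⟩⟩
  have hO {Ω : Type u} [Field Ω] [IsSepClosed Ω] {x : Spec (.of Ω) ⟶ X} (z : Lift x P) :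
      Lift.pt x z default ∈ O ↔
        germ x A V (Lift.map x p₁ z) s = germ x A _ (Lift.map x p₂ z) E.sec := by
    rw [← germ_res, ← germ_res, ← sub_eq_zero, ← germ_sub, germ_eq_zero_iff]
    rfl
  let q : etOpen P O ⟶ V := etOpenι P O ≫ p₁
  have hq : IsIso q := by
    refine isIso_of_lift_bijective q fun Ω _ _ x => ⟨fun z z' h => ?_, fun v => ?_⟩
    · have hm : Mono (totMap (etOpenι P O)) := inferInstanceAs (Mono O.ι)
      refine Lift.map_injective (etOpenι P O) (Lift.ext _ (pullback.hom_ext ?_ ?_))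
      · exact congrArg (Lift.pt x) h
      · have key (z : Lift x (etOpen P O)) : germ x A V (Lift.map x q z) s =
            germ x A _ (Lift.map x p₂ (Lift.map x (etOpenι P O) z)) E.sec := by
          refine Eq.trans ?_ ((hO (Lift.map x (etOpenι P O) z)).1 ?_)
          · rw [Lift.map_map]
          · rw [← SetLike.mem_coe, ← range_totMap_etOpenι, Lift.pt_map]
            exact ⟨_, rfl⟩
        have h₁ : Lift.map x p₂ (Lift.map x (etOpenι P O) z) =
            Lift.map x p₂ (Lift.map x (etOpenι P O) z') := by
          refine (E.bij Ω _ _ x (mem_of_hom hV (Lift.map x q z))).1 ?_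
          exact (key z).symm.trans ((congrArg (fun v => germ x A V v s) h).trans (key z'))
        exact congrArg (Lift.pt x) h₁
    · obtain ⟨u, hu⟩ := (E.bij Ω _ _ x (mem_of_hom hV v)).2 (germ x A V v s)
      let z : Lift x P := Lift.mk x (pullback.lift (Lift.pt x v) (Lift.pt x u) (by simp)) (by
        refine (pullback.lift_fst_assoc _ _ _ _).trans (Lift.pt_str x v))
      have h₁ : Lift.map x p₁ z = v := Lift.ext _ (pullback.lift_fst _ _ _)
      have h₂ : Lift.map x p₂ z = u := Lift.ext _ (pullback.lift_snd _ _ _)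
      have hz : Lift.pt x z default ∈ Set.range (totMap (etOpenι P O)) := by
        rw [range_totMap_etOpenι]
        refine (hO z).2 ?_
        rw [h₁, h₂]
        exact hu.symm
      obtain ⟨w, hw⟩ := hz
      obtain ⟨w, hw', -⟩ := exists_lift_map _ _ z hw
      exact ⟨w, by rw [← Lift.map_map, hw', h₁]⟩
  have hs : res A (etOpenι P O ≫ p₂) E.sec = res A q s := by
    refine sec_ext_germ fun Ω _ _ x z => ?_
    rw [germ_res, germ_res, ← Lift.map_map, ← Lift.map_map]
    refine ((hO _).1 ?_).symm
    rw [← SetLike.mem_coe, ← range_totMap_etOpenι, Lift.pt_map]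
    exact ⟨_, rfl⟩
  refine ⟨inv q ≫ etOpenι P O ≫ p₂, ?_⟩
  rw [← res_res, hs, res_res, IsIso.inv_hom_id, res_id]

/-- The restriction to a smaller open subset. -/
def restrict (E : Espace A U) {U' : X.Opens} (h : U' ≤ U) : Espace A U' where
  obj := Scheme.Etale.mk (pullback.fst E.toOpen (X.homOfLE h) ≫ str E.obj)
  toOpen := pullback.snd E.toOpen (X.homOfLE h)
  w := by
    change _ = pullback.fst E.toOpen (X.homOfLE h) ≫ str E.obj
    refine Eq.trans ?_ (congrArg (pullback.fst E.toOpen (X.homOfLE h) ≫ ·) E.w)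
    refine Eq.trans ?_ (pullback.condition_assoc U.ι).symm
    exact congrArg (_ ≫ ·) (Scheme.homOfLE_ι X h).symm
  finite := MorphismProperty.of_isPullback (P := @IsFinite) (IsPullback.of_hasPullback _ _) E.finite
  sec := res A (etHomMk (U := Scheme.Etale.mk (pullback.fst E.toOpen (X.homOfLE h) ≫ str E.obj))
    (V := E.obj) (pullback.fst _ _) rfl) E.sec
  bij Ω _ _ x hx := by
    let T : X.Etale := Scheme.Etale.mk (pullback.fst E.toOpen (X.homOfLE h) ≫ str E.obj)
    let a : T ⟶ E.obj := etHomMk (U := T) (V := E.obj) (pullback.fst _ _) rfl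
    have hm : Mono (totMap a) := inferInstanceAs (Mono (pullback.fst E.toOpen (X.homOfLE h)))
    have ha : Function.Bijective (Lift.map x a) := by
      refine ⟨fun _ _ => Lift.map_injective a, fun u => ?_⟩
      have hx' : Set.range x ⊆ Set.range U'.ι := by
        rintro _ ⟨z, rfl⟩
        rw [Subsingleton.elim z default, Scheme.Opens.range_ι]
        exact hx
      refine ⟨Lift.mk x (pullback.lift (Lift.pt x u) (IsOpenImmersion.lift U'.ι x hx') ?_) ?_, ?_⟩
      · rw [← cancel_mono U.ι, Category.assoc, E.w, Lift.pt_str, Category.assoc, Scheme.homOfLE_ι,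
          IsOpenImmersion.lift_fac]
      · exact (pullback.lift_fst_assoc _ _ _ _).trans (Lift.pt_str x u)
      · exact Lift.ext _ (pullback.lift_fst _ _ _)
    refine (congrArg Function.Bijective (funext fun u => ?_)).mp ((E.bij Ω _ _ x (h hx)).comp ha)
    exact (germ_res x a u E.sec).symm

end Espace

end Espace

/-! ### Descent of split étale algebras -/

section Descent

variable {R S : Type u} [CommRing R] [CommRing S] [Algebra R S]
  {M : Type u} [Fintype M] [DecidableEq M]

/-- A descent datum along `R → S` for the split algebra `S ^ M` which permutes the factors: `e m k` is
the idempotent of the locus where the factor `m` of the first pullback corresponds to the factor `k`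
of the second one. -/
structure IsPermDatum (e : M → M → S ⊗[R] S) : Prop where
  mul_eq : ∀ m k k', e m k * e m k' = if k = k' then e m k else 0
  sum_row : ∀ m, ∑ k, e m k = 1
  sum_col : ∀ k, ∑ m, e m k = 1
  diag : ∀ m k, Algebra.TensorProduct.lmul' R (S := S) (e m k) = if m = k then 1 else 0
  cocycle : ∀ k m m',
    (Algebra.TensorProduct.includeRight (e m m') : S ⊗[R] (S ⊗[R] S)) *
        Algebra.TensorProduct.map (AlgHom.id R S) Algebra.TensorProduct.includeRight (e k m') =
      Algebra.TensorProduct.includeRight (e m m') *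
        Algebra.TensorProduct.map (AlgHom.id R S) Algebra.TensorProduct.includeLeft (e k m)

namespace IsPermDatum

variable {e : M → M → S ⊗[R] S} (h : IsPermDatum e)

variable (R S M) in
/-- The first pullback. -/
def fstHom : (M → S) →ₐ[R] (M → S ⊗[R] S) :=
  AlgHom.pi fun m => Algebra.TensorProduct.includeLeft.comp (Pi.evalAlgHom R (fun _ => S) m)

/-- The second pullback, identified with the first one by the descent datum. -/
def sndHom : (M → S) →ₐ[R] (M → S ⊗[R] S) where
  toFun b m := ∑ k, e m k * (1 : S) ⊗ₜ[R] b k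
  map_one' := by
    ext m
    simp only [Pi.one_apply]
    rw [← h.sum_row m]
    exact Finset.sum_congr rfl fun k _ => mul_one _
  map_mul' b c := by
    ext m
    simp only [Pi.mul_apply]
    rw [Finset.sum_mul_sum]
    refine Finset.sum_congr rfl fun k _ => ?_
    rw [Finset.sum_eq_single k]
    · rw [mul_mul_mul_comm, h.mul_eq, if_pos rfl, Algebra.TensorProduct.tmul_mul_tmul, one_mul]
    · intro k' _ hk
      rw [mul_mul_mul_comm, h.mul_eq, if_neg hk.symm, zero_mul]
    · exact fun hk => absurd (Finset.mem_univ k) hk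
  map_zero' := by ext m; simp
  map_add' b c := by
    ext m
    simp only [Pi.add_apply, tmul_add, mul_add, Finset.sum_add_distrib]
  commutes' r := by
    ext m
    have : (1 : S) ⊗ₜ[R] algebraMap R S r = algebraMap R (S ⊗[R] S) r := by
      rw [Algebra.TensorProduct.algebraMap_apply', ]
    simp only [Pi.algebraMap_apply, this]
    rw [← Finset.sum_mul, h.sum_row, one_mul]

/-- The descended algebra. -/
abbrev descended : Subalgebra R (M → S) := AlgHom.equalizer (fstHom R S M) h.sndHom

lemma mem_descended {b : M → S} : b ∈ h.descended ↔ ∀ m, b m ⊗ₜ[R] (1 : S) =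
    ∑ k, e m k * (1 : S) ⊗ₜ[R] b k := by
  rw [AlgHom.mem_equalizer, funext_iff]
  rfl

/-- The map `S ⊗ B → S ^ M`. -/
def split : S ⊗[R] h.descended →ₐ[S] (M → S) :=
  Algebra.TensorProduct.lift (Algebra.ofId S (M → S)) h.descended.val fun _ _ => Commute.all _ _

lemma split_tmul (s : S) (b : h.descended) (m : M) : h.split (s ⊗ₜ b) m = s * b.1 m := rfl

variable (R S M) in
/-- The components of an element of `S ⊗ S ^ M`. -/
def comp (m : M) : S ⊗[R] (M → S) →ₐ[R] S ⊗[R] S :=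
  Algebra.TensorProduct.map (AlgHom.id R S) (Pi.evalAlgHom R (fun _ => S) m)

lemma comp_bijective : Function.Bijective fun (c : S ⊗[R] (M → S)) m => comp R S M m c := by
  refine (congrArg Function.Bijective (funext fun c => ?_)).mp
    (TensorProduct.piRight R S S (fun _ : M => S)).bijective
  induction c using TensorProduct.induction_on with
  | zero => rw [map_zero]; exact funext fun m => (map_zero _).symm
  | tmul s b => exact funext fun m => rfl
  | add a b ha hb =>
    rw [map_add, ha, hb]
    exact funext fun m => (map_add _ _ _).symm

lemma comp_tripleBijective : Function.Bijective fun (c : S ⊗[R] (M → S ⊗[R] S)) m =>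
    Algebra.TensorProduct.map (AlgHom.id R S) (Pi.evalAlgHom R (fun _ => S ⊗[R] S) m) c := by
  refine (congrArg Function.Bijective (funext fun c => ?_)).mp
    (TensorProduct.piRight R S S (fun _ : M => S ⊗[R] S)).bijective
  induction c using TensorProduct.induction_on with
  | zero => rw [map_zero]; exact funext fun m => (map_zero _).symm
  | tmul s b => exact funext fun m => rfl
  | add a b ha hb =>
    rw [map_add, ha, hb]
    exact funext fun m => (map_add _ _ _).symm

/-- Membership in the base change of the descended algebra, in coordinates. -/
lemma mem_equalizer_iff (c : S ⊗[R] (M → S)) :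
    c ∈ AlgHom.equalizer (Algebra.TensorProduct.map (AlgHom.id S S) (fstHom R S M))
        (Algebra.TensorProduct.map (AlgHom.id S S) h.sndHom) ↔
      ∀ m, Algebra.TensorProduct.map (AlgHom.id R S) Algebra.TensorProduct.includeLeft (comp R S M m c) =
        ∑ k, (Algebra.TensorProduct.includeRight (e m k) : S ⊗[R] (S ⊗[R] S)) *
          Algebra.TensorProduct.map (AlgHom.id R S) Algebra.TensorProduct.includeRight
            (comp R S M k c) := by
  rw [AlgHom.mem_equalizer, ← comp_tripleBijective.1.eq_iff, funext_iff]
  refine forall_congr' fun m => ?_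
  refine Eq.congr ?_ ?_
  · induction c using TensorProduct.induction_on with
    | zero => simp
    | tmul s b => rfl
    | add a b ha hb => simp only [map_add, ha, hb]
  · induction c using TensorProduct.induction_on with
    | zero => simp
    | tmul s b =>
      change s ⊗ₜ[R] (∑ k, e m k * (1 : S) ⊗ₜ[R] b k) = ∑ k, (1 : S) ⊗ₜ[R] e m k * s ⊗ₜ[R] ((1 : S) ⊗ₜ[R] b k)
      rw [tmul_sum]
      exact Finset.sum_congr rfl fun k _ => by rw [Algebra.TensorProduct.tmul_mul_tmul, one_mul]
    | add a b ha hb => simp only [map_add, ha, hb, mul_add, Finset.sum_add_distrib]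

lemma split_eq [Module.Flat R S] (z : S ⊗[R] h.descended) (m : M) :
    h.split z m = Algebra.TensorProduct.lmul' R (comp R S M m
      (AlgHom.tensorEqualizerEquiv S S (fstHom R S M) h.sndHom z).1) := by
  induction z using TensorProduct.induction_on with
  | zero => rw [map_zero, map_zero]; exact ((congrArg _ (map_zero _)).trans (map_zero _)).symm
  | tmul s b => rfl
  | add a b ha hb =>
    rw [map_add, map_add, Pi.add_apply, ha, hb]
    exact ((congrArg _ (map_add _ _ _)).trans (map_add _ _ _)).symm

/-- The comparison of the base change of the descended algebra with the split algebra is injective: the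
elements of the equalizer are determined by their restrictions to the diagonal. -/
lemma split_injective [Module.Flat R S] : Function.Injective h.split := by
  rw [injective_iff_map_eq_zero]
  intro z hz
  set c := AlgHom.tensorEqualizerEquiv S S (fstHom R S M) h.sndHom z with hc
  have h₀ (k) : Algebra.TensorProduct.lmul' R (comp R S M k c.1) = 0 := by
    rw [← h.split_eq, hz]; rfl
  -- restriction to the locus where the first two coordinates agree
  let δ : S ⊗[R] (S ⊗[R] S) →ₐ[R] S ⊗[R] S :=
    Algebra.TensorProduct.lift Algebra.TensorProduct.includeLeft (AlgHom.id R _) fun _ _ => Commute.all _ _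
  have hδ₁ (t : S ⊗[R] S) : δ (Algebra.TensorProduct.map (AlgHom.id R S)
      Algebra.TensorProduct.includeLeft t) = Algebra.TensorProduct.lmul' R t ⊗ₜ 1 := by
    induction t using TensorProduct.induction_on with
    | zero => simp
    | tmul a b => simp [δ]
    | add a b ha hb => simp only [map_add, ha, hb, add_tmul]
  have hδ₂ (t : S ⊗[R] S) : δ (Algebra.TensorProduct.map (AlgHom.id R S)
      Algebra.TensorProduct.includeRight t) = t := by
    induction t using TensorProduct.induction_on with
    | zero => simp
    | tmul a b => simp [δ]
    | add a b ha hb => simp only [map_add, ha, hb]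
  have hδ₃ (t : S ⊗[R] S) : δ (Algebra.TensorProduct.includeRight t) = t := by
    simp [δ, ← Algebra.TensorProduct.one_def]
  have h₁ (k m) : e k m * comp R S M m c.1 = 0 := by
    have := congrArg (e k m * ·) (congrArg δ ((h.mem_equalizer_iff c.1).1 c.2 k))
    simp only [hδ₁, h₀, zero_tmul, mul_zero, map_sum, map_mul, hδ₂, hδ₃, Finset.mul_sum] at this
    rw [Finset.sum_eq_single m] at this
    · rw [this, ← mul_assoc, h.mul_eq, if_pos rfl]
    · intro k' _ hk
      rw [← mul_assoc, h.mul_eq, if_neg hk.symm, zero_mul]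
    · exact fun hk => absurd (Finset.mem_univ m) hk
  have h₂ : c.1 = 0 := by
    refine comp_bijective.1 (funext fun m => ?_)
    change comp R S M m c.1 = comp R S M m 0
    rw [map_zero, ← one_mul (comp R S M m c.1), ← h.sum_col m, Finset.sum_mul]
    exact Finset.sum_eq_zero fun k _ => h₁ k m
  refine (AlgHom.tensorEqualizerEquiv S S (fstHom R S M) h.sndHom).injective ?_
  rw [map_zero]
  exact Subtype.ext h₂

/-- The comparison is surjective: the columns of the descent datum are elements of the equalizer with
prescribed restrictions to the diagonal. -/
lemma split_surjective [Module.Flat R S] : Function.Surjective h.split := by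
  intro r
  obtain ⟨c, hc⟩ := comp_bijective.2 fun m => ∑ k, e k m * r k ⊗ₜ[R] (1 : S)
  replace hc (m) : comp R S M m c = ∑ k, e k m * r k ⊗ₜ[R] (1 : S) := congrFun hc m
  have hc' : c ∈ AlgHom.equalizer (Algebra.TensorProduct.map (AlgHom.id S S) (fstHom R S M))
        (Algebra.TensorProduct.map (AlgHom.id S S) h.sndHom) := by
    rw [mem_equalizer_iff]
    intro m
    simp only [hc, map_sum, map_mul, Finset.mul_sum]
    rw [Finset.sum_comm]
    refine Finset.sum_congr rfl fun k _ => ?_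
    have key (m' : M) : (Algebra.TensorProduct.includeRight (e m m') : S ⊗[R] (S ⊗[R] S)) *
        (Algebra.TensorProduct.map (AlgHom.id R S) Algebra.TensorProduct.includeRight (e k m') *
          Algebra.TensorProduct.map (AlgHom.id R S) Algebra.TensorProduct.includeRight (r k ⊗ₜ[R] (1 : S))) =
        Algebra.TensorProduct.includeRight (e m m') *
        (Algebra.TensorProduct.map (AlgHom.id R S) Algebra.TensorProduct.includeLeft (e k m) *
          Algebra.TensorProduct.map (AlgHom.id R S) Algebra.TensorProduct.includeLeft (r k ⊗ₜ[R] (1 : S))) := by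
      rw [← mul_assoc, h.cocycle, mul_assoc]
      rfl
    simp only [key]
    rw [← Finset.sum_mul, ← map_sum, h.sum_row, map_one, one_mul]
  refine ⟨(AlgHom.tensorEqualizerEquiv S S (fstHom R S M) h.sndHom).symm ⟨c, hc'⟩, funext fun m => ?_⟩
  rw [split_eq, AlgEquiv.apply_symm_apply, hc]
  simp [h.diag]

/-- `S ⊗ B = S ^ M`. -/
def splitEquiv [Module.Flat R S] : S ⊗[R] h.descended ≃ₐ[S] (M → S) :=
  AlgEquiv.ofBijective h.split ⟨h.split_injective, h.split_surjective⟩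

lemma etale_descended [Module.FaithfullyFlat R S] : Algebra.Etale R h.descended :=
  have : Algebra.Etale S (S ⊗[R] h.descended) := Algebra.Etale.of_equiv h.splitEquiv.symm
  Algebra.Etale.of_etale_tensorProduct_of_faithfullyFlat (T := S)

lemma finite_descended [Module.FaithfullyFlat R S] : Module.Finite R h.descended :=
  have : Module.Finite S (S ⊗[R] h.descended) := Module.Finite.equiv h.splitEquiv.symm.toLinearEquiv
  Module.Finite.of_finite_tensorProduct_of_faithfullyFlat S

/-- The points of the descended algebra: every homomorphism to a field which extends `χ|R` is a
coordinate, evaluated by `χ`. -/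
lemma exists_eq_coordinate [Module.Flat R S] {Ω : Type u} [Field Ω] (χ : S →+* Ω)
    (ψ : h.descended →+* Ω) (hψ : ∀ r : R, ψ (algebraMap R _ r) = χ (algebraMap R S r)) :
    ∃ m, ∀ b, ψ b = χ (b.1 m) := by
  let _ : Algebra R Ω := (χ.comp (algebraMap R S)).toAlgebra
  let χ' : S →ₐ[R] Ω := ⟨χ, fun _ => rfl⟩
  let ψ' : h.descended →ₐ[R] Ω := ⟨ψ, hψ⟩
  let Ψ : S ⊗[R] h.descended →ₐ[R] Ω := Algebra.TensorProduct.lift χ' ψ' fun _ _ => Commute.all _ _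
  let Ψ' : (M → S) →+* Ω := (Ψ : _ →+* Ω).comp h.splitEquiv.symm.toRingEquiv.toRingHom
  have hΨ' (z) : Ψ' (h.split z) = Ψ z := congrArg Ψ (h.splitEquiv.symm_apply_apply z)
  have h₁ : ∑ m, Ψ' (Pi.single m 1) = 1 := by
    rw [← map_sum, Finset.univ_sum_single (fun _ : M => (1 : S))]
    exact map_one Ψ'
  obtain ⟨m, -, hm⟩ := Finset.exists_ne_zero_of_sum_ne_zero (by rw [h₁]; exact one_ne_zero)
  have hmm : Ψ' (Pi.single m 1) * Ψ' (Pi.single m 1) = Ψ' (Pi.single m 1) := by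
    rw [← map_mul, ← Pi.single_mul, one_mul]
  have hm1 : Ψ' (Pi.single m 1) = 1 := mul_left_cancel₀ hm (by rw [hmm, mul_one])
  have hχ (s : S) : Ψ' (algebraMap S (M → S) s) = χ s := by
    have : algebraMap S (M → S) s = h.split (s ⊗ₜ 1) :=
      funext fun k => ((h.split_tmul s 1 k).trans (mul_one s)).symm
    rw [this, hΨ']
    change χ s * ψ 1 = _
    rw [map_one, mul_one]
  refine ⟨m, fun b => ?_⟩
  have hb : ψ b = Ψ' b.1 := by
    have : b.1 = h.split (1 ⊗ₜ b) := funext fun k => by rw [split_tmul, one_mul]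
    rw [this, hΨ']
    change _ = χ 1 * ψ b
    rw [map_one, one_mul]
  rw [hb, ← mul_one (Ψ' b.1), ← hm1, ← map_mul]
  have : b.1 * Pi.single m 1 = algebraMap S (M → S) (b.1 m) * Pi.single m 1 := by
    funext k
    by_cases hk : k = m
    · subst hk; simp
    · simp [Pi.single_eq_of_ne hk]
  rw [this, map_mul, hm1, mul_one, hχ]

lemma eq_of_coordinate_eq [Module.Flat R S] {Ω : Type u} [Field Ω] (χ : S →+* Ω) {m m' : M}
    (hm : ∀ b : h.descended, χ (b.1 m) = χ (b.1 m')) : m = m' := by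
  have key (z : S ⊗[R] h.descended) : χ (h.split z m) = χ (h.split z m') := by
    induction z using TensorProduct.induction_on with
    | zero => simp
    | tmul s b => rw [split_tmul, split_tmul, map_mul, map_mul, hm]
    | add a b ha hb => simp only [map_add, Pi.add_apply, ha, hb]
  obtain ⟨z, hz⟩ := h.split_surjective (Pi.single m 1)
  by_contra hne
  have := key z
  rw [hz, Pi.single_eq_same, Pi.single_eq_of_ne (Ne.symm hne), map_one, map_zero] at this
  exact one_ne_zero this

end IsPermDatum

end Descent

/-! ### Étale spaces, locally -/

section LocalEspace

/-- Idempotents are separated by geometric points. -/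
lemma idem_ext {R C : Type u} [CommRing R] [CommRing C] [Algebra R C] {a b : C}
    (ha : IsIdempotentElem a) (hb : IsIdempotentElem b)
    (h : ∀ (Ω : Type u) (_ : Field Ω) (_ : IsSepClosed Ω) (_ : Algebra R Ω) (χ : C →ₐ[R] Ω),
      χ a = χ b) : a = b := by
  refine PrimeSpectrum.basicOpen_injOn_isIdempotentElem ha hb ?_
  ext p
  let Ω := SeparableClosure p.asIdeal.ResidueField
  let χ : C →+* Ω := algebraMap C Ω
  let _ : Algebra R Ω := (χ.comp (algebraMap R C)).toAlgebra
  have := h Ω inferInstance inferInstance inferInstance ⟨χ, fun _ => rfl⟩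
  have key (c : C) : c ∈ p.asIdeal ↔ χ c = 0 := by
    rw [← p.asIdeal.algebraMap_residueField_eq_zero]
    change _ ↔ algebraMap C Ω c = 0
    rw [IsScalarTower.algebraMap_apply C p.asIdeal.ResidueField Ω]
    exact (map_eq_zero_iff _ (algebraMap p.asIdeal.ResidueField Ω).injective).symm
  change a ∉ p.asIdeal ↔ b ∉ p.asIdeal
  rw [key, key]
  exact not_congr (by change χ a = χ b at this; rw [this])

variable {X : Scheme.{u}} {R : Type u} [CommRing R] (j : Spec (.of R) ⟶ X) [IsOpenImmersion j]

instance etale_spec_algebraMap (C : Type u) [CommRing C] [Algebra R C] [Algebra.Etale R C] :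
    Etale (Spec.map (CommRingCat.ofHom (algebraMap R C))) :=
  (HasRingHomProperty.Spec_iff (P := @Etale)).2 (RingHom.etale_algebraMap.2 inferInstance)

/-- The spectrum of an étale algebra over an affine open subset. -/
def spE (C : Type u) [CommRing C] [Algebra R C] [Algebra.Etale R C] : X.Etale :=
  Scheme.Etale.mk (Spec.map (CommRingCat.ofHom (algebraMap R C)) ≫ j)

variable {C D : Type u} [CommRing C] [Algebra R C] [Algebra.Etale R C]
  [CommRing D] [Algebra R D] [Algebra.Etale R D]

/-- The morphism of étale schemes attached to a homomorphism of étale algebras. -/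
def spMap (a : C →ₐ[R] D) : spE j D ⟶ spE j C :=
  etHomMk (U := spE j D) (V := spE j C) (Spec.map (CommRingCat.ofHom a.toRingHom)) (by
    change Spec.map _ ≫ Spec.map _ ≫ j = Spec.map _ ≫ j
    rw [← Category.assoc, ← Spec.map_comp, ← CommRingCat.ofHom_comp]
    congr 3
    exact a.comp_algebraMap)

variable (Ω : Type u) [Field Ω] [IsSepClosed Ω] [Algebra R Ω]

/-- The geometric point of `X` attached to a separably closed `R`-algebra. -/
def spPt : Spec (.of Ω) ⟶ X := Spec.map (CommRingCat.ofHom (algebraMap R Ω)) ≫ j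

variable {Ω}

/-- The lifting of the geometric point attached to a homomorphism of algebras. -/
def spLift (χ : C →ₐ[R] Ω) : Lift (spPt j Ω) (spE j C) :=
  Lift.mk _ (Spec.map (CommRingCat.ofHom χ.toRingHom)) (by
    change Spec.map _ ≫ Spec.map _ ≫ j = Spec.map _ ≫ j
    rw [← Category.assoc, ← Spec.map_comp, ← CommRingCat.ofHom_comp]
    congr 3
    exact χ.comp_algebraMap)

lemma spLift_map (a : C →ₐ[R] D) (χ : D →ₐ[R] Ω) :
    Lift.map _ (spMap j a) (spLift j χ) = spLift j (χ.comp a) :=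
  Lift.ext _ (by
    change Spec.map _ ≫ Spec.map _ = Spec.map _
    rw [← Spec.map_comp, ← CommRingCat.ofHom_comp]
    rfl)

lemma exists_eq_spLift (u : Lift (spPt j Ω) (spE j C)) : ∃ χ : C →ₐ[R] Ω, u = spLift j χ := by
  obtain ⟨χ, hχ⟩ := Spec.map_surjective (show Spec (.of Ω) ⟶ Spec (.of C) from Lift.pt _ u)
  have hw := Lift.pt_str _ u
  have hw' : Spec.map (CommRingCat.ofHom (algebraMap R C) ≫ χ) =
      Spec.map (CommRingCat.ofHom (algebraMap R Ω)) := by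
    rw [← cancel_mono j, Spec.map_comp, hχ, Category.assoc]
    exact hw
  have hw'' := Spec.map_injective hw'
  refine ⟨⟨χ.hom, fun r => congrArg (fun f => f.hom r) hw''⟩, Lift.ext _ hχ.symm⟩

lemma exists_eq_spPt {Ω : Type u} [Field Ω] (x : Spec (.of Ω) ⟶ X) (hx : x default ∈ j.opensRange) :
    ∃ _ : Algebra R Ω, x = spPt j Ω := by
  have hx' : Set.range x ⊆ Set.range j := by
    rintro _ ⟨z, rfl⟩
    rw [Subsingleton.elim z default]
    exact hx
  obtain ⟨ψ, hψ⟩ := Spec.map_surjective (IsOpenImmersion.lift j x hx')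
  exact ⟨ψ.hom.toAlgebra, ((congrArg (· ≫ j) hψ).trans (IsOpenImmersion.lift_fac _ _ _)).symm⟩

variable {A : EtAb X}

/-- The idempotent of the locus where a section vanishes. -/
lemma exists_idem_vanishing (hA : IsLC A) (s : Sec A (spE j C)) : ∃ e : C, IsIdempotentElem e ∧
    ∀ (Ω : Type u) (_ : Field Ω) (_ : IsSepClosed Ω) (_ : Algebra R Ω) (χ : C →ₐ[R] Ω),
      (germ _ A _ (spLift j χ) s = 0 → χ e = 1) ∧ (germ _ A _ (spLift j χ) s ≠ 0 → χ e = 0) := by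
  obtain ⟨Z, hZ, h⟩ := exists_isClopen_vanishing hA s
  obtain ⟨e, he, hZe⟩ := PrimeSpectrum.isClopen_iff.1 (show IsClopen (X := PrimeSpectrum C) Z from hZ)
  refine ⟨e, he, fun Ω _ _ _ χ => ?_⟩
  have hχ : χ e * χ e = χ e := by rw [← map_mul, he.eq]
  let q : PrimeSpectrum Ω := (default : Spec (.of Ω))
  have key : Lift.pt _ (spLift j χ) default ∈ Z ↔ χ e ≠ 0 := by
    have : Lift.pt _ (spLift j χ) default ∈ Z ↔
        PrimeSpectrum.comap χ.toRingHom q ∈ PrimeSpectrum.basicOpen e := by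
      rw [← SetLike.mem_coe, ← hZe]
      rfl
    rw [this, PrimeSpectrum.mem_basicOpen]
    refine not_congr ((Ideal.mem_comap).trans ?_)
    rw [q.asIdeal.eq_bot_or_top.resolve_right q.2.ne_top]
    exact Ideal.mem_bot
  rw [ne_eq, ← h]
  exact ⟨fun hz => mul_left_cancel₀ (key.1 hz) (by rw [hχ, mul_one]),
    fun hz => not_not.1 fun hn => hz (key.2 hn)⟩

variable {S : Type u} [CommRing S] [Algebra R S] [Algebra.Etale R S]
  {M : Type u} [AddCommGroup M] {φ : M →+ Sec A (spE j S)}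

/-- The permutation of `M` relating the trivializations of `A` at two geometric points of `S` over
the same geometric point of `R`. -/
def rel (φ : M →+ Sec A (spE j S)) (χ χ' : S →ₐ[R] Ω) (m m' : M) : Prop :=
  germ _ A _ (spLift j χ) (φ m) = germ _ A _ (spLift j χ') (φ m')

/-- A trivialization over an étale cover `Spec S ⟶ Spec R` gives a permutation-valued descent datum. -/
lemma exists_permDatum [Fintype M] [DecidableEq M] (hA : IsLC A) (hφ : IsTriv A (spE j S) φ) :
    ∃ e : M → M → S ⊗[R] S, IsPermDatum e ∧
      ∀ (Ω : Type u) (_ : Field Ω) (_ : IsSepClosed Ω) (_ : Algebra R Ω) (χ χ' : S →ₐ[R] Ω) m m',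
        (rel j φ χ χ' m m' → Algebra.TensorProduct.lift χ χ' (fun _ _ => Commute.all _ _) (e m m') = 1) ∧
        (¬ rel j φ χ χ' m m' →
          Algebra.TensorProduct.lift χ χ' (fun _ _ => Commute.all _ _) (e m m') = 0) := by
  let i₁ : S →ₐ[R] S ⊗[R] S := Algebra.TensorProduct.includeLeft
  let i₂ : S →ₐ[R] S ⊗[R] S := Algebra.TensorProduct.includeRight
  have hE : Algebra.Etale R (S ⊗[R] S) := Algebra.Etale.comp R S _
  -- `e m m'` is the idempotent of the open and closed locus where the first pullback of `φ m` agrees with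
  -- the second pullback of `φ m'`; all identities are checked at geometric points.
  choose e he hev using fun m m' => exists_idem_vanishing j hA
    (res A (spMap j i₁) (φ m) - res A (spMap j i₂) (φ m'))
  have key {Ω : Type u} [Field Ω] [IsSepClosed Ω] [Algebra R Ω] (χ : S ⊗[R] S →ₐ[R] Ω) (m m' : M) :
      (rel j φ (χ.comp i₁) (χ.comp i₂) m m' → χ (e m m') = 1) ∧
        (¬ rel j φ (χ.comp i₁) (χ.comp i₂) m m' → χ (e m m') = 0) := by
    have h := hev m m' Ω inferInstance inferInstance inferInstance χ
    rw [germ_sub, germ_res, germ_res, spLift_map, spLift_map, sub_ne_zero, sub_eq_zero] at h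
    exact h
  have hinj {Ω : Type u} [Field Ω] [IsSepClosed Ω] [Algebra R Ω] (χ : S →ₐ[R] Ω) {m m' : M}
      (h : germ _ A _ (spLift j χ) (φ m) = germ _ A _ (spLift j χ) (φ m')) : m = m' :=
    (hφ Ω _ _ _ _).1 h
  have hmul m k k' : e m k * e m k' = if k = k' then e m k else 0 := by
    split_ifs with hk
    · rw [← hk, (he m k).eq]
    · refine idem_ext (R := R) ((he _ _).mul (he _ _)) .zero fun Ω _ _ _ χ => ?_
      rw [map_mul, map_zero, mul_eq_zero]
      by_contra! h
      exact hk (hinj _ ((not_not.1 (mt (key χ m k).2 h.1)).symm.trans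
        (not_not.1 (mt (key χ m k').2 h.2))))
  have hmul' m m' k : e m k * e m' k = if m = m' then e m k else 0 := by
    split_ifs with hk
    · rw [← hk, (he m k).eq]
    · refine idem_ext (R := R) ((he _ _).mul (he _ _)) .zero fun Ω _ _ _ χ => ?_
      rw [map_mul, map_zero, mul_eq_zero]
      by_contra! h
      exact hk (hinj _ ((not_not.1 (mt (key χ m k).2 h.1)).trans
        (not_not.1 (mt (key χ m' k).2 h.2)).symm))
  have hsum m : ∑ k, e m k = 1 := by
    refine idem_ext (R := R) (OrthogonalIdempotents.isIdempotentElem_sum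
      ⟨he m, fun k k' hk => (hmul _ _ _).trans (if_neg hk)⟩) .one fun Ω _ _ _ χ => ?_
    obtain ⟨k, hk⟩ := hφ.exists_germ_eq (spLift j (χ.comp i₂)) (germ _ A _ (spLift j (χ.comp i₁)) (φ m))
    rw [map_sum, map_one, Finset.sum_eq_single k, (key χ m k).1 hk.symm]
    · exact fun k' _ hk' => (key χ m k').2 fun h => hk' (hinj _ (h.symm.trans hk.symm))
    · simp
  have hsum' k : ∑ m, e m k = 1 := by
    refine idem_ext (R := R) (OrthogonalIdempotents.isIdempotentElem_sum
      ⟨fun m => he m k, fun m m' hk => (hmul' _ _ _).trans (if_neg hk)⟩) .one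
      fun Ω _ _ _ χ => ?_
    obtain ⟨m, hm⟩ := hφ.exists_germ_eq (spLift j (χ.comp i₁)) (germ _ A _ (spLift j (χ.comp i₂)) (φ k))
    rw [map_sum, map_one, Finset.sum_eq_single m, (key χ m k).1 hm]
    · exact fun m' _ hm' => (key χ m' k).2 fun h => hm' (hinj _ (h.trans hm.symm))
    · simp
  refine ⟨e, ⟨hmul, hsum, hsum', fun m k => ?_, fun k m m' => ?_⟩, fun Ω _ _ _ χ χ' m m' => ?_⟩
  · refine idem_ext (R := R) ((he m k).map _) (by split_ifs; exacts [.one, .zero])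
      fun Ω _ _ _ χ => ?_
    have h := key (χ.comp (Algebra.TensorProduct.lmul' R)) m k
    have e₁ : (χ.comp (Algebra.TensorProduct.lmul' R)).comp i₁ = χ := by ext; simp [i₁]
    have e₂ : (χ.comp (Algebra.TensorProduct.lmul' R)).comp i₂ = χ := by ext; simp [i₂]
    rw [e₁, e₂] at h
    split_ifs with hk
    · rw [map_one]; exact h.1 (by rw [rel, hk])
    · rw [map_zero]; exact h.2 fun hr => hk (hinj _ hr)
  · refine idem_ext (R := R) (((he m m').map _).mul ((he k m').map _))
      (((he m m').map _).mul ((he k m).map _)) fun Ω _ _ _ χ => ?_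
    rw [map_mul, map_mul]
    have h₁ := key (χ.comp (Algebra.TensorProduct.includeRight (R := R) (A := S) (B := S ⊗[R] S))) m m'
    have h₂ := key (χ.comp (Algebra.TensorProduct.map (AlgHom.id R S) i₂)) k m'
    have h₃ := key (χ.comp (Algebra.TensorProduct.map (AlgHom.id R S) i₁)) k m
    have e₁ : (χ.comp (Algebra.TensorProduct.map (AlgHom.id R S) i₂)).comp i₁ =
        (χ.comp (Algebra.TensorProduct.map (AlgHom.id R S) i₁)).comp i₁ := by
      ext s; simp [i₁, i₂]
    have e₂ : (χ.comp (Algebra.TensorProduct.map (AlgHom.id R S) i₂)).comp i₂ =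
        (χ.comp (Algebra.TensorProduct.includeRight (R := R) (A := S) (B := S ⊗[R] S))).comp i₂ := by
      ext s; simp [i₂]
    have e₃ : (χ.comp (Algebra.TensorProduct.map (AlgHom.id R S) i₁)).comp i₂ =
        (χ.comp (Algebra.TensorProduct.includeRight (R := R) (A := S) (B := S ⊗[R] S))).comp i₁ := by
      ext s; simp [i₁, i₂]
    rw [e₁, e₂] at h₂
    rw [e₃] at h₃
    by_cases hr : rel j φ ((χ.comp (Algebra.TensorProduct.includeRight (R := R) (A := S)
        (B := S ⊗[R] S))).comp i₁) ((χ.comp (Algebra.TensorProduct.includeRight (R := R) (A := S)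
        (B := S ⊗[R] S))).comp i₂) m m'
    · congr 1
      by_cases hr' : rel j φ ((χ.comp (Algebra.TensorProduct.map (AlgHom.id R S) i₁)).comp i₁)
          ((χ.comp (Algebra.TensorProduct.includeRight (R := R) (A := S) (B := S ⊗[R] S))).comp i₁) k m
      · exact (h₂.1 (hr'.trans hr)).trans (h₃.1 hr').symm
      · exact (h₂.2 fun h => hr' (h.trans hr.symm)).trans (h₃.2 hr').symm
    · have := h₁.2 hr
      change χ (Algebra.TensorProduct.includeRight (e m m')) = 0 at this
      rw [this, zero_mul, zero_mul]
  · have hc (s s' : S) : Commute (χ s) (χ' s') := Commute.all _ _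
    have h := key (Algebra.TensorProduct.lift χ χ' hc) m m'
    have e₁ : (Algebra.TensorProduct.lift χ χ' hc).comp i₁ = χ := by ext; simp [i₁]
    have e₂ : (Algebra.TensorProduct.lift χ χ' hc).comp i₂ = χ' := by ext; simp [i₂]
    rwa [e₁, e₂] at h

lemma rel.unique_right (hφ : IsTriv A (spE j S) φ) {χ χ' : S →ₐ[R] Ω} {m m' m'' : M}
    (h : rel j φ χ χ' m m') (h' : rel j φ χ χ' m m'') : m' = m'' :=
  (hφ Ω _ _ _ _).1 (h.symm.trans h')

/-- A locally constant sheaf on an affine scheme trivialized by a faithfully flat étale algebra has a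
finite étale étale space: a trivialization gives a descent datum permuting the factors of a split
algebra. -/
lemma nonempty_espace_of_faithfullyFlat [Module.FaithfullyFlat R S] [Finite M]
    (hA : IsLC A) (hφ : IsTriv A (spE j S) φ) : Nonempty (Espace A j.opensRange) := by
  classical
  let _ : Fintype M := Fintype.ofFinite M
  obtain ⟨e, he, her⟩ := exists_permDatum j hA hφ
  have := he.etale_descended
  have := he.finite_descended
  let Y : X.Etale := spE j he.descended
  let ev (m : M) : he.descended →ₐ[R] S := (Pi.evalAlgHom R (fun _ : M => S) m).comp he.descended.val
  let β (m : M) : spE j S ⟶ Y := spMap j (ev m)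
  have hrange (V : X.Etale) (a : V ⟶ Y) {Ω : Type u} [Field Ω] [IsSepClosed Ω]
      {x : Spec (.of Ω) ⟶ X} (v : Lift x V) : x default ∈ j.opensRange := by
    have h := Lift.pt_str x (Lift.map x a v)
    exact ⟨_, congrArg (fun g : Spec (.of Ω) ⟶ _ => g default) ((Category.assoc _ _ _).trans h)⟩
  have hT {Ω : Type u} [Field Ω] [IsSepClosed Ω] {x : Spec (.of Ω) ⟶ X}
      (hx : x default ∈ j.opensRange) : Nonempty (Lift x (spE j S)) := by
    obtain ⟨r, hr⟩ := hx
    obtain ⟨q, hq⟩ := PrimeSpectrum.comap_surjective_of_faithfullyFlat (A := R) (B := S) r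
    obtain ⟨t, -⟩ := exists_lift (U := spE j S) x (q := q)
      ((congrArg j hq).trans hr)
    exact ⟨t⟩
  have hsurj {Ω : Type u} [Field Ω] [IsSepClosed Ω] {x : Spec (.of Ω) ⟶ X} (y : Lift x Y)
      (t : Lift x (spE j S)) : ∃ m, Lift.map x (β m) t = y := by
    obtain ⟨_, rfl⟩ := exists_eq_spPt j x (hrange Y (𝟙 _) y)
    obtain ⟨ψ, rfl⟩ := exists_eq_spLift j y
    obtain ⟨χ, rfl⟩ := exists_eq_spLift j t
    obtain ⟨m, hm⟩ := he.exists_eq_coordinate χ.toRingHom ψ.toRingHom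
      fun r => (ψ.commutes r).trans (χ.commutes r).symm
    refine ⟨m, (spLift_map j _ _).trans (congrArg _ ?_)⟩
    ext b
    exact (hm b).symm
  have hrel {Ω : Type u} [Field Ω] [IsSepClosed Ω] {x : Spec (.of Ω) ⟶ X}
      (t t' : Lift x (spE j S)) (m m' : M) : Lift.map x (β m) t = Lift.map x (β m') t' ↔
        germ x A _ t (φ m) = germ x A _ t' (φ m') := by
    obtain ⟨_, rfl⟩ := exists_eq_spPt j x (hrange _ (β 0) t)
    obtain ⟨χ, rfl⟩ := exists_eq_spLift j t
    obtain ⟨χ', rfl⟩ := exists_eq_spLift j t'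
    have hback (k : M) (hk : rel j φ χ χ' m k) (b : he.descended) : χ (b.1 m) = χ' (b.1 k) := by
      have hc (s s' : S) : Commute (χ s) (χ' s') := Commute.all _ _
      have hb := congrArg (Algebra.TensorProduct.lift χ χ' hc) (he.mem_descended.1 b.2 m)
      rw [map_sum, Finset.sum_eq_single k, map_mul, ((her Ω _ _ _ χ χ' m k).1 hk)] at hb
      · simpa using hb
      · intro k' _ hk'
        rw [map_mul, ((her Ω _ _ _ χ χ' m k').2 fun h => hk' (h.unique_right j hφ hk)), zero_mul]
      · simp
    constructor
    · intro h
      have h' : spLift j (χ.comp (ev m)) = spLift j (χ'.comp (ev m')) :=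
        (spLift_map j _ _).symm.trans (h.trans (spLift_map j _ _))
      have h'' : χ.comp (ev m) = χ'.comp (ev m') :=
        AlgHom.coe_ringHom_injective (congrArg (fun f => f.hom)
          (Spec.map_injective (congrArg (Lift.pt _) h')))
      obtain ⟨k, hk⟩ := hφ.exists_germ_eq (spLift j χ') (germ _ A _ (spLift j χ) (φ m))
      have hkm : k = m' := he.eq_of_coordinate_eq χ'.toRingHom fun b =>
        (hback k hk.symm b).symm.trans (congrArg (fun f => f b) h'')
      rw [← hkm]
      exact hk.symm
    · intro h
      refine (spLift_map j _ _).trans (Eq.trans (congrArg _ ?_) (spLift_map j _ _).symm)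
      ext b
      exact hback m' h b
  have hres {V W : X.Etale} (a : V ⟶ Y) (b : W ⟶ V) (s : Sec A V)
      (h : ∀ (Ω : Type u) (_ : Field Ω) (_ : IsSepClosed Ω) (x : Spec (.of Ω) ⟶ X) (v : Lift x V)
        (t : Lift x (spE j S)) (m : M), Lift.map x a v = Lift.map x (β m) t →
          germ x A V v s = germ x A _ t (φ m))
      (Ω : Type u) (_ : Field Ω) (_ : IsSepClosed Ω) (x : Spec (.of Ω) ⟶ X) (v : Lift x W)
        (t : Lift x (spE j S)) (m : M) (e : Lift.map x (b ≫ a) v = Lift.map x (β m) t) :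
          germ x A W v (res A b s) = germ x A _ t (φ m) := by
    rw [germ_res]
    exact h Ω _ _ x _ t m (by rw [Lift.map_map, e])
  have huniq (V : X.Etale) (a : V ⟶ Y) (s s' : Sec A V)
      (h : ∀ (Ω : Type u) (_ : Field Ω) (_ : IsSepClosed Ω) (x : Spec (.of Ω) ⟶ X) (v : Lift x V)
        (t : Lift x (spE j S)) (m : M), Lift.map x a v = Lift.map x (β m) t →
          germ x A V v s = germ x A _ t (φ m))
      (h' : ∀ (Ω : Type u) (_ : Field Ω) (_ : IsSepClosed Ω) (x : Spec (.of Ω) ⟶ X) (v : Lift x V)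
        (t : Lift x (spE j S)) (m : M), Lift.map x a v = Lift.map x (β m) t →
          germ x A V v s' = germ x A _ t (φ m)) : s = s' := by
    refine sec_ext_germ fun Ω _ _ x v => ?_
    obtain ⟨t⟩ := hT (hrange V a v)
    obtain ⟨m, hm⟩ := hsurj (Lift.map x a v) t
    rw [h Ω _ _ x v t m hm.symm, h' Ω _ _ x v t m hm.symm]
  have hex (y : tot Y) : ∃ (V : X.Etale) (a : V ⟶ Y), y ∈ Set.range (totMap a) ∧ ∃ s : Sec A V,
      ∀ (Ω : Type u) (_ : Field Ω) (_ : IsSepClosed Ω) (x : Spec (.of Ω) ⟶ X) (v : Lift x V)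
        (t : Lift x (spE j S)) (m : M), Lift.map x a v = Lift.map x (β m) t →
          germ x A V v s = germ x A _ t (φ m) := by
    obtain ⟨Ω, _, _, x, y, rfl⟩ := exists_geomPoint y
    obtain ⟨t⟩ := hT (hrange Y (𝟙 _) y)
    obtain ⟨m, rfl⟩ := hsurj y t
    exact ⟨spE j S, β m, ⟨_, rfl⟩, φ m, fun Ω _ _ x v t' m' h => (hrel v t' m m').1 h⟩
  obtain ⟨σ, hσ⟩ := sec_glue (fun V a s => ∀ (Ω : Type u) (_ : Field Ω) (_ : IsSepClosed Ω)
    (x : Spec (.of Ω) ⟶ X) (v : Lift x V) (t : Lift x (spE j S)) (m : M),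
    Lift.map x a v = Lift.map x (β m) t → germ x A V v s = germ x A _ t (φ m)) hres huniq hex
  have hσβ {Ω : Type u} [Field Ω] [IsSepClosed Ω] {x : Spec (.of Ω) ⟶ X} (t : Lift x (spE j S))
      (m : M) : germ x A Y (Lift.map x (β m) t) σ = germ x A _ t (φ m) := by
    rw [← germ_res, hσ (spE j S) (β m) (φ m) fun Ω _ _ x v t' m' h => (hrel v t' m m').1 h]
  have hji : j.isoOpensRange.hom ≫ j.opensRange.ι = j := j.isoOpensRange_hom_ι
  have hfin : IsFinite (Spec.map (CommRingCat.ofHom (algebraMap R he.descended))) :=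
    (IsFinite.SpecMap_iff _).2 (RingHom.finite_algebraMap.2 inferInstance)
  refine ⟨⟨Y, Spec.map (CommRingCat.ofHom (algebraMap R he.descended)) ≫ j.isoOpensRange.hom,
    ?_, ?_, σ, fun Ω _ _ x hx => ⟨fun y y' h => ?_, fun z => ?_⟩⟩⟩
  · exact (Category.assoc _ _ _).trans (congrArg (_ ≫ ·) hji)
  · exact MorphismProperty.comp_mem @IsFinite _ _ hfin inferInstance
  · obtain ⟨t⟩ := hT hx
    obtain ⟨m, rfl⟩ := hsurj y t
    obtain ⟨m', rfl⟩ := hsurj y' t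
    exact (hrel t t m m').2 ((hσβ t m).symm.trans (h.trans (hσβ t m')))
  · obtain ⟨t⟩ := hT hx
    obtain ⟨m, hm⟩ := hφ.exists_germ_eq t z
    exact ⟨Lift.map x (β m) t, (hσβ t m).trans hm⟩

/-- Locally on `X`, a locally constant sheaf has a finite étale étale space. -/
lemma IsLC.exists_espace (hA : IsLC A) (p : X) : ∃ U : X.Opens, p ∈ U ∧ Nonempty (Espace A U) := by
  obtain ⟨T, ⟨q, rfl⟩, M, _, _, φ, hφ⟩ := hA p
  obtain ⟨U₀, hU₀, hpU₀, -⟩ := exists_isAffineOpen_mem_and_subset (X := X) (x := str T q) (U := ⊤) trivial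
  obtain ⟨W, hW, hqW, hWU₀⟩ := exists_isAffineOpen_mem_and_subset (X := tot T) (x := q)
    (U := str T ⁻¹ᵁ U₀) hpU₀
  -- Over an affine open `U₁` of `X`, the trivializing étale scheme is refined by a faithfully flat étale
  -- affine scheme `P`.
  let im : X.Opens := ⟨Set.range (W.ι ≫ str T), (W.ι ≫ str T).isOpenMap.isOpen_range⟩
  obtain ⟨U₁, hU₁, hpU₁, hU₁'⟩ := exists_isAffineOpen_mem_and_subset (X := X) (x := str T q)
    (U := im ⊓ U₀) ⟨⟨⟨q, hqW⟩, rfl⟩, hpU₀⟩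
  let g : W.toScheme ⟶ U₀ := IsOpenImmersion.lift U₀.ι (W.ι ≫ str T) (by
    rintro _ ⟨w, rfl⟩
    rw [Scheme.Opens.range_ι]
    exact hWU₀ w.2)
  have hg : g ≫ U₀.ι = W.ι ≫ str T := IsOpenImmersion.lift_fac _ _ _
  let k : U₁.toScheme ⟶ U₀ := X.homOfLE (hU₁'.trans inf_le_right)
  have hge : Etale (g ≫ U₀.ι) := by rw [hg]; infer_instance
  have hge' : Etale g := Etale.of_comp g U₀.ι
  have : IsAffine W.toScheme := hW
  have : IsAffine U₀.toScheme := hU₀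
  have : IsAffine U₁.toScheme := hU₁
  let P := pullback g k
  let π : P ⟶ U₁ := pullback.snd g k
  have hπ : π ≫ U₁.ι = (pullback.fst g k ≫ W.ι) ≫ str T := by
    rw [Category.assoc, ← hg, pullback.condition_assoc]
    exact congrArg (_ ≫ ·) (Scheme.homOfLE_ι X _).symm
  have hπs : Function.Surjective π := by
    intro z
    obtain ⟨w, hw⟩ := (hU₁' z.2).1
    have hw' : g w = k z := by
      apply U₀.ι.isOpenEmbedding.injective
      refine (congrArg (fun f : W.toScheme ⟶ X => f w) hg).trans (hw.trans ?_)
      exact (congrArg (fun f : U₁.toScheme ⟶ X => f z) (Scheme.homOfLE_ι X _)).symm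
    obtain ⟨t, -, ht⟩ := Scheme.Pullback.exists_preimage_pullback w z hw'
    exact ⟨t, ht⟩
  let _ : Algebra Γ(U₁, ⊤) Γ(P, ⊤) := π.appTop.hom.toAlgebra
  have hSpec : Spec.map π.appTop = P.isoSpec.inv ≫ π ≫ U₁.toScheme.isoSpec.hom := by
    rw [← Category.assoc, ← Scheme.isoSpec_inv_naturality, Category.assoc, Iso.inv_hom_id,
      Category.comp_id]
  have het : Algebra.Etale Γ(U₁, ⊤) Γ(P, ⊤) :=
    RingHom.etale_algebraMap.1 (HasRingHomProperty.appTop (P := @Etale) π inferInstance)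
  have hff : Module.FaithfullyFlat Γ(U₁, ⊤) Γ(P, ⊤) := by
    have hs : Surjective (Spec.map π.appTop) := by
      have : Surjective π := ⟨hπs⟩
      rw [hSpec]
      infer_instance
    have hf : Flat (Spec.map π.appTop) := by
      rw [hSpec]
      infer_instance
    exact (flat_and_surjective_SpecMap_iff _).1 ⟨hf, hs⟩
  let j : Spec (.of Γ(U₁, ⊤)) ⟶ X := U₁.toScheme.isoSpec.inv ≫ U₁.ι
  let a : spE j Γ(P, ⊤) ⟶ T := etHomMk (U := spE j Γ(P, ⊤))
    (P.isoSpec.inv ≫ pullback.fst g k ≫ W.ι) (by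
      refine (Category.assoc _ _ _).trans ((congrArg (P.isoSpec.inv ≫ ·) hπ.symm).trans ?_)
      exact (Scheme.isoSpec_inv_naturality_assoc π U₁.ι).symm)
  obtain ⟨E⟩ := nonempty_espace_of_faithfullyFlat j hA (hφ.restrict a)
  refine ⟨_, ?_, ⟨E⟩⟩
  refine ⟨U₁.toScheme.isoSpec.hom ⟨_, hpU₁⟩, ?_⟩
  have : U₁.toScheme.isoSpec.hom ≫ j = U₁.ι := Iso.hom_inv_id_assoc _ _
  exact congrArg (fun f : U₁.toScheme ⟶ X => f ⟨_, hpU₁⟩) this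

end LocalEspace

/-! ### Étale spaces, globally -/

section GlobalEspace

variable {X : Scheme.{u}} {A : EtAb X}

namespace IsLC

variable (hA : IsLC A)

/-- The open subsets over which `A` has an étale space. -/
abbrev Idx (A : EtAb X) : Type u := {U : X.Opens // Nonempty (Espace A U)}

/-- The étale space over such an open subset. -/
def esp (U : Idx A) : Espace A U.1 := U.2.some

/-- The cover of `X` by the open subsets over which `A` has an étale space. -/
def espCover (hA : IsLC A) : X.OpenCover where
  I₀ := Idx A
  X U := U.1
  f U := U.1.ι
  mem₀ := by
    rw [Scheme.presieve₀_mem_precoverage_iff]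
    refine ⟨fun x => ?_, inferInstance⟩
    obtain ⟨U, hxU, hU⟩ := hA.exists_espace x
    exact ⟨⟨U, hU⟩, by simpa using hxU⟩

instance : Preorder (espCover hA).I₀ := inferInstanceAs (Preorder (Idx A))

instance : Small.{u} (espCover hA).I₀ := inferInstanceAs (Small.{u} (Idx A))

instance : Scheme.Cover.LocallyDirected (espCover hA) :=
  .ofIsBasisOpensRange (by
    intro i j
    change i.1 ≤ j.1 ↔ (i.1.ι).opensRange ≤ (j.1.ι).opensRange
    simp) <| by
    rw [TopologicalSpace.Opens.isBasis_iff_nbhd]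
    intro U x hx
    obtain ⟨V, hxV, ⟨E⟩⟩ := hA.exists_espace x
    exact ⟨U ⊓ V, ⟨⟨U ⊓ V, ⟨E.restrict inf_le_right⟩⟩, Scheme.Opens.opensRange_ι _⟩, ⟨hx, hxV⟩,
      inf_le_left⟩

lemma range_str_esp (i : Idx A) : Set.range (str (esp i).obj) ⊆ i.1 := by
  rw [← (esp i).w]
  rintro _ ⟨z, rfl⟩
  exact ((esp i).toOpen z).2

lemma exists_esp_trans {i j : Idx A} (h : i.1 ≤ j.1) : ∃ a : (esp i).obj ⟶ (esp j).obj,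
    res A a (esp j).sec = (esp i).sec :=
  (esp j).exists_hom ((range_str_esp i).trans h) _

/-- The transition morphism of étale spaces. -/
def espTrans {i j : Idx A} (h : i.1 ≤ j.1) : (esp i).obj ⟶ (esp j).obj := (exists_esp_trans h).choose

lemma res_espTrans {i j : Idx A} (h : i.1 ≤ j.1) : res A (espTrans h) (esp j).sec = (esp i).sec :=
  (exists_esp_trans h).choose_spec

lemma espTrans_comp {i j k : Idx A} (h : i.1 ≤ j.1) (h' : j.1 ≤ k.1) :
    espTrans (h.trans h') = espTrans h ≫ espTrans h' := by
  refine (esp k).hom_unique ?_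
  rw [← res_res, res_espTrans, res_espTrans, res_espTrans]

lemma espTrans_map_eq_iff {i j : Idx A} (h : i.1 ≤ j.1) {Ω : Type u} [Field Ω] [IsSepClosed Ω]
    {x : Spec (.of Ω) ⟶ X} (e : Lift x (esp i).obj) (e' : Lift x (esp j).obj) :
    Lift.map x (espTrans h) e = e' ↔ germ x A _ e (esp i).sec = germ x A _ e' (esp j).sec := by
  rw [← res_espTrans h, germ_res]
  exact ⟨fun he => by rw [he], fun he => ((esp j).bij Ω _ _ x ((esp j).mem_of_lift e')).1 he⟩

lemma espTrans_toOpen {i j : Idx A} (h : i.1 ≤ j.1) :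
    totMap (espTrans h) ≫ (esp j).toOpen = (esp i).toOpen ≫ X.homOfLE h := by
  rw [← cancel_mono j.1.ι, Category.assoc, (esp j).w, totMap_str, Category.assoc, Scheme.homOfLE_ι,
    (esp i).w]

lemma isPullback_espTrans {i j : Idx A} (h : i.1 ≤ j.1) :
    IsPullback (totMap (espTrans h)) (esp i).toOpen (esp j).toOpen (X.homOfLE h) := by
  have : IsOpenImmersion (totMap (espTrans h)) := isOpenImmersion_of_lift_injective _
    fun Ω _ _ x e e' he => ((esp i).bij Ω _ _ x ((esp i).mem_of_lift e)).1
      (((espTrans_map_eq_iff h e _).1 he).trans ((espTrans_map_eq_iff h e' _).1 rfl).symm)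
  refine (IsOpenImmersion.isPullback _ _ _ _ (espTrans_toOpen h) ?_).flip
  refine le_antisymm (fun y hy => ?_) ?_
  · obtain ⟨Ω, _, _, x, y, rfl⟩ := exists_geomPoint y
    obtain ⟨z, hz⟩ := hy
    have hx : x default ∈ i.1 := by
      have e₁ : x default = j.1.ι ((esp j).toOpen (Lift.pt x y default)) := by
        have := (congrArg (Lift.pt x y ≫ ·) (esp j).w).trans (Lift.pt_str x y)
        exact congrArg (fun g : Spec (.of Ω) ⟶ X => g default) this.symm
      have e₂ : j.1.ι (X.homOfLE h z) = i.1.ι z :=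
        congrArg (fun g : i.1.toScheme ⟶ X => g z) (Scheme.homOfLE_ι X h)
      rw [e₁, ← hz, e₂]
      exact z.2
    obtain ⟨e, he⟩ := ((esp i).bij Ω _ _ x hx).2 (germ x A _ y (esp j).sec)
    rw [← (espTrans_map_eq_iff h e y).2 he]
    exact ⟨_, rfl⟩
  · rintro _ ⟨z, rfl⟩
    exact ⟨(esp i).toOpen z,
      (congrArg (fun g : tot (esp i).obj ⟶ j.1 => g z) (espTrans_toOpen h)).symm⟩

/-- The étale spaces over the open subsets of the cover form a gluing datum. -/
def gluingData : Scheme.Cover.RelativeGluingData (espCover hA) where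
  functor :=
    { obj i := tot (esp (A := A) i).obj
      map {i j} h := totMap (espTrans (A := A) (i := i) (j := j) (leOfHom h))
      map_id i := by
        rw [← totMap_id]
        exact congrArg totMap ((esp (A := A) i).hom_unique
          ((res_espTrans (A := A) (i := i) (j := i) le_rfl).trans (res_id _).symm))
      map_comp {i j k} h h' := by
        rw [← totMap_comp]
        exact congrArg totMap (espTrans_comp (A := A) (i := i) (j := j) (k := k) (leOfHom h)
          (leOfHom h')) }
  natTrans :=
    { app i := (esp (A := A) i).toOpen
      naturality i j h := espTrans_toOpen (A := A) (i := i) (j := j) (leOfHom h) }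
  equifibered i j h := isPullback_espTrans (A := A) (i := i) (j := j) (leOfHom h)

lemma isZariskiLocalAtTarget_etale : IsZariskiLocalAtTarget (@Etale.{u}) :=
  have h : HasRingHomProperty (@Etale.{u}) RingHom.Etale := inferInstance
  h.instIsZariskiLocalAtTarget

lemma isZariskiLocalAtTarget_isFinite : IsZariskiLocalAtTarget (@IsFinite.{u}) :=
  have h : HasAffineProperty (@IsFinite.{u}) (affineAnd RingHom.Finite) :=
    (HasAffineProperty.affineAnd_iff _ RingHom.finite_respectsIso
      RingHom.finite_localizationPreserves.away RingHom.finite_ofLocalizationSpan).2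
      fun f => by simp [isFinite_iff]
  h.instIsZariskiLocalAtTarget

lemma toBase_property (P : MorphismProperty Scheme.{u}) (hP : IsZariskiLocalAtTarget P)
    (h : ∀ i : Idx A, P (esp i).toOpen) : P (gluingData hA).toBase := by
  refine IsZariskiLocalAtTarget.of_openCover (𝒰 := espCover hA) fun i => ?_
  have hp := ((gluingData hA).isPullback_natTrans_ι_toBase i).flip
  have : (espCover hA).pullbackHom (gluingData hA).toBase i =
      hp.isoPullback.inv ≫ (esp (A := A) i).toOpen := hp.isoPullback_inv_snd.symm
  exact this ▸ (P.cancel_left_of_respectsIso hp.isoPullback.inv _).2 (h i)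

/-- A locally constant sheaf is represented by a finite étale scheme. -/
lemma exists_representing (hA : IsLC A) : ∃ (Y : X.Etale) (_ : IsFinite (str Y)) (σ : Sec A Y),
    ∀ (Ω : Type u) (_ : Field Ω) (_ : IsSepClosed Ω) (x : Spec (.of Ω) ⟶ X),
      Function.Bijective fun u : Lift x Y => germ x A Y u σ := by
  let d := gluingData hA
  have het : Etale d.toBase := toBase_property hA _ isZariskiLocalAtTarget_etale fun i => by
    have : Etale ((esp i).toOpen ≫ i.1.ι) := by rw [(esp i).w]; infer_instance
    exact Etale.of_comp _ i.1.ι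
  have hfin : IsFinite d.toBase := toBase_property hA _ isZariskiLocalAtTarget_isFinite fun i => (esp i).finite
  let Y : X.Etale := Scheme.Etale.mk d.toBase
  let a (i : Idx A) : (esp i).obj ⟶ Y := etHomMk (V := Y) (colimit.ι d.functor i)
    ((d.ι_toBase i).trans (esp i).w)
  have ha (i : Idx A) : IsOpenImmersion (totMap (a i)) :=
    d.cover.map_prop i
  have htr {i j : Idx A} (h : i.1 ≤ j.1) : espTrans h ≫ a j = a i :=
    et_hom_ext (colimit.w d.functor (show (show (espCover hA).I₀ from i) ⟶ j from homOfLE h))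
  have hsurj {Ω : Type u} [Field Ω] [IsSepClosed Ω] {x : Spec (.of Ω) ⟶ X} (u : Lift x Y)
      (i : Idx A) (hi : x default ∈ i.1) : ∃ e, Lift.map x (a i) e = u := by
    have : Lift.pt x u default ∈ Set.range (totMap (a i)) := by
      refine (d.preimage_toBase_eq_range_ι i).subset ?_
      refine ⟨⟨_, hi⟩, ?_⟩
      exact congrArg (fun g : Spec (.of Ω) ⟶ X => g default) (Lift.pt_str x u).symm
    obtain ⟨q, hq⟩ := this
    obtain ⟨e, he, -⟩ := exists_lift_map x (a i) u hq
    exact ⟨e, he⟩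
  -- Points of two of the glued étale spaces are identified only if their germs agree.
  have hrel {Ω : Type u} [Field Ω] [IsSepClosed Ω] {x : Spec (.of Ω) ⟶ X} {i j : Idx A}
      (e : Lift x (esp i).obj) (e' : Lift x (esp j).obj)
      (h : Lift.map x (a i) e = Lift.map x (a j) e') :
      germ x A _ e (esp i).sec = germ x A _ e' (esp j).sec := by
    let k : Idx A := ⟨i.1 ⊓ j.1, ⟨(esp i).restrict inf_le_left⟩⟩
    have hk : x default ∈ k.1 := ⟨(esp i).mem_of_lift e, (esp j).mem_of_lift e'⟩
    have hki : k.1 ≤ i.1 := inf_le_left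
    have hkj : k.1 ≤ j.1 := inf_le_right
    obtain ⟨f, hf⟩ := ((esp k).bij Ω _ _ x hk).2 (germ x A _ e (esp i).sec)
    obtain ⟨f', hf'⟩ := ((esp k).bij Ω _ _ x hk).2 (germ x A _ e' (esp j).sec)
    have hff : f = f' := by
      refine Lift.map_injective (a k) ?_
      rw [← htr hki, ← Lift.map_map, (espTrans_map_eq_iff hki f e).2 hf, h, htr hki, ← htr hkj,
        ← Lift.map_map, (espTrans_map_eq_iff hkj f' e').2 hf']
    exact hf.symm.trans ((congrArg (fun f => germ x A _ f (esp k).sec) hff).trans hf')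
  have hcov {Ω : Type u} [Field Ω] [IsSepClosed Ω] (x : Spec (.of Ω) ⟶ X) :
      ∃ i : Idx A, x default ∈ i.1 := by
    obtain ⟨U, hxU, hU⟩ := hA.exists_espace (x default)
    exact ⟨⟨U, hU⟩, hxU⟩
  -- The universal section is glued from the universal sections of the pieces.
  let P (V : X.Etale) (b : V ⟶ Y) (s : Sec A V) : Prop :=
    ∀ (Ω : Type u) (_ : Field Ω) (_ : IsSepClosed Ω) (x : Spec (.of Ω) ⟶ X) (v : Lift x V)
      (i : Idx A) (e : Lift x (esp i).obj), Lift.map x b v = Lift.map x (a i) e →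
        germ x A V v s = germ x A _ e (esp i).sec
  have hPa (i : Idx A) : P _ (a i) (esp i).sec := fun Ω _ _ x v j e h => hrel v e h
  have hres {V W : X.Etale} (b : V ⟶ Y) (c : W ⟶ V) (s : Sec A V) (h : P V b s) :
      P W (c ≫ b) (res A c s) := fun Ω _ _ x v i e hv => by
    rw [germ_res]
    exact h Ω _ _ x _ i e (by rw [Lift.map_map, hv])
  have huniq (V : X.Etale) (b : V ⟶ Y) (s s' : Sec A V) (h : P V b s) (h' : P V b s') : s = s' := by
    refine sec_ext_germ fun Ω _ _ x v => ?_
    obtain ⟨i, hi⟩ := hcov x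
    obtain ⟨e, he⟩ := hsurj (Lift.map x b v) i hi
    rw [h Ω _ _ x v i e he.symm, h' Ω _ _ x v i e he.symm]
  have hex (y : tot Y) : ∃ (V : X.Etale) (b : V ⟶ Y), y ∈ Set.range (totMap b) ∧
      ∃ s : Sec A V, P V b s := by
    obtain ⟨Ω, _, _, x, y, rfl⟩ := exists_geomPoint y
    obtain ⟨i, hi⟩ := hcov x
    obtain ⟨e, rfl⟩ := hsurj y i hi
    exact ⟨_, a i, ⟨_, rfl⟩, _, hPa i⟩
  obtain ⟨σ, hσ⟩ := sec_glue P hres huniq hex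
  have hσa {Ω : Type u} [Field Ω] [IsSepClosed Ω] {x : Spec (.of Ω) ⟶ X} (i : Idx A)
      (e : Lift x (esp i).obj) : germ x A Y (Lift.map x (a i) e) σ = germ x A _ e (esp i).sec := by
    rw [← germ_res, hσ _ (a i) _ (hPa i)]
  refine ⟨Y, hfin, σ, fun Ω _ _ x => ?_⟩
  obtain ⟨i, hi⟩ := hcov x
  refine ⟨fun u u' h => ?_, fun z => ?_⟩
  · obtain ⟨e, rfl⟩ := hsurj u i hi
    obtain ⟨e', rfl⟩ := hsurj u' i hi
    rw [((esp i).bij Ω _ _ x hi).1 ((hσa i e).symm.trans (h.trans (hσa i e')))]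
  · obtain ⟨e, he⟩ := ((esp i).bij Ω _ _ x hi).2 z
    exact ⟨_, (hσa i e).trans he⟩

end IsLC

end GlobalEspace

/-! ### The action of the fundamental group on stalks -/

section Monodromy

variable {X : Scheme.{u}} {A B : EtAb X}

namespace IsLC

variable (hA : IsLC A)

/-- The finite étale scheme representing a locally constant sheaf. -/
def rep : FEt X := ⟨hA.exists_representing.choose, hA.exists_representing.choose_spec.choose⟩

/-- The universal section. -/
def repSec : Sec A hA.rep.obj := hA.exists_representing.choose_spec.choose_spec.choose

lemma rep_bijective {Ω : Type u} [Field Ω] [IsSepClosed Ω] (x : Spec (.of Ω) ⟶ X) :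
    Function.Bijective fun u : Lift x hA.rep.obj => germ x A _ u hA.repSec :=
  hA.exists_representing.choose_spec.choose_spec.choose_spec Ω _ _ x

/-- The representing scheme as an étale space over the whole of `X`. -/
def repEspace : Espace A ⊤ where
  obj := hA.rep.obj
  toOpen := str hA.rep.obj ≫ X.topIso.inv
  w := by rw [Category.assoc, ← Scheme.topIso_hom, Iso.inv_hom_id, Category.comp_id]
  finite := MorphismProperty.comp_mem @IsFinite _ _ hA.rep.property inferInstance
  sec := hA.repSec
  bij _ _ _ x _ := hA.rep_bijective x

lemma exists_rep_hom {V : X.Etale} (s : Sec A V) : ∃ a : V ⟶ hA.rep.obj, res A a hA.repSec = s :=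
  hA.repEspace.exists_hom (V := V) (fun _ _ => trivial) s

variable {Ω : Type u} [Field Ω] [IsSepClosed Ω] {x : Spec (.of Ω) ⟶ X}

/-- The lifting to the representing scheme with a given germ. -/
def repLift (t : (stalk x).obj A) : Lift x hA.rep.obj := ((hA.rep_bijective x).2 t).choose

lemma germ_repLift (t : (stalk x).obj A) : germ x A _ (hA.repLift t) hA.repSec = t :=
  ((hA.rep_bijective x).2 t).choose_spec

/-- The action of the fundamental group on the stalk of a locally constant sheaf, through its action
on the fibre of the representing scheme. -/
def pi (g : Pi1 x) (t : (stalk x).obj A) : (stalk x).obj A :=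
  germ x A _ (g • hA.repLift t) hA.repSec

lemma pi_germ (g : Pi1 x) (Y : FEt X) (u : Lift x Y.obj) (s : Sec A Y.obj) :
    hA.pi g (germ x A Y.obj u s) = germ x A Y.obj (g • u) s := by
  obtain ⟨a, rfl⟩ := hA.exists_rep_hom s
  let a' : Y ⟶ hA.rep := ⟨a⟩
  have h : hA.repLift (germ x A Y.obj u (res A a hA.repSec)) = Lift.map x a u :=
    (hA.rep_bijective x).1 ((hA.germ_repLift _).trans (germ_res x a u _))
  rw [pi, h, germ_res]
  exact congrArg (fun v => germ x A _ v hA.repSec) (Pi1.smul_map g a' u)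

lemma pi_mor (hB : IsLC B) (φ : A ⟶ B) (g : Pi1 x) (t : (stalk x).obj A) :
    ((stalk x).map φ).hom (hA.pi g t) = hB.pi g (((stalk x).map φ).hom t) := by
  rw [pi, germ_mor, ← hB.pi_germ, ← germ_mor, germ_repLift]

lemma pi_mul (g h : Pi1 x) (t : (stalk x).obj A) : hA.pi (g * h) t = hA.pi g (hA.pi h t) := by
  change germ x A _ ((g * h) • hA.repLift t) hA.repSec =
    hA.pi g (germ x A hA.rep.obj (h • hA.repLift t) hA.repSec)
  rw [mul_smul, pi_germ]

lemma pi_one (t : (stalk x).obj A) : hA.pi 1 t = t := by rw [pi, one_smul, germ_repLift]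

/-- Addition is a morphism of étale spaces. -/
lemma pi_add (g : Pi1 x) (t t' : (stalk x).obj A) : hA.pi g (t + t') = hA.pi g t + hA.pi g t' := by
  let Y := hA.rep
  have hY : IsFinite (str Y.obj) := Y.property
  let P : X.Etale := Scheme.Etale.mk (pullback.fst (str Y.obj) (str Y.obj) ≫ str Y.obj)
  let P' : FEt X := ⟨P, inferInstanceAs (IsFinite (pullback.fst (str Y.obj) (str Y.obj) ≫ str Y.obj))⟩
  let p₁ : P ⟶ Y.obj := etHomMk (U := P) (pullback.fst _ _) rfl
  let p₂ : P ⟶ Y.obj := etHomMk (U := P) (pullback.snd _ _) pullback.condition.symm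
  let q₁ : P' ⟶ Y := ⟨p₁⟩
  let q₂ : P' ⟶ Y := ⟨p₂⟩
  let w : Lift x P'.obj := Lift.mk x (pullback.lift (Lift.pt x (hA.repLift t)) (Lift.pt x (hA.repLift t'))
    (by simp)) ((pullback.lift_fst_assoc _ _ _ _).trans (Lift.pt_str x _))
  have h₁ : Lift.map x p₁ w = hA.repLift t := Lift.ext _ (pullback.lift_fst _ _ _)
  have h₂ : Lift.map x p₂ w = hA.repLift t' := Lift.ext _ (pullback.lift_snd _ _ _)
  have e₁ : t = germ x A P'.obj w (res A p₁ hA.repSec) := by rw [germ_res, h₁, germ_repLift]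
  have e₂ : t' = germ x A P'.obj w (res A p₂ hA.repSec) := by rw [germ_res, h₂, germ_repLift]
  rw [e₁, e₂, ← germ_add, pi_germ, germ_add, ← pi_germ, ← pi_germ]

lemma isLocallyConstant_pi (t : (stalk x).obj A) : IsLocallyConstant fun g : Pi1 x => hA.pi g t :=
  (Pi1.isLocallyConstant_smul hA.rep (hA.repLift t)).comp fun u => germ x A _ u hA.repSec

end IsLC

variable {ℓ : ℕ} [Fact ℓ.Prime] {F G : PiSystem ℓ (EtAb X)}
  {Ω : Type u} [Field Ω] [IsSepClosed Ω] {x : Spec (.of Ω) ⟶ X}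

namespace IsSmoothSystem

variable (hF : IsSmoothSystem F)

/-- The action of the fundamental group on the stalk of a smooth system. -/
def pi (g : Pi1 x) : Stalk x F →ₗ[valRing F.E] Stalk x F where
  toFun t := ⟨fun n => (hF.isLC n).pi g (t.val n), fun n => by
    beta_reduce
    rw [(hF.isLC (n + 1)).pi_mor (hF.isLC n), t.tr_val]⟩
  map_add' t t' := Stalk.ext fun n => (hF.isLC n).pi_add g _ _
  map_smul' a t := Stalk.ext fun n => ((hF.isLC n).pi_mor (hF.isLC n) (F.act n a) g (t.val n)).symm

lemma pi_val (g : Pi1 x) (t : Stalk x F) (n : ℕ) : (hF.pi g t).val n = (hF.isLC n).pi g (t.val n) := rfl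

lemma pi_mul (g h : Pi1 x) (t : Stalk x F) : hF.pi (g * h) t = hF.pi g (hF.pi h t) :=
  Stalk.ext fun n => (hF.isLC n).pi_mul g h _

lemma pi_one (t : Stalk x F) : hF.pi 1 t = t := Stalk.ext fun n => (hF.isLC n).pi_one _

/-- Being equivalent to a character, in terms of the action on the stalk. -/
lemma isEquivalentTo_iff (ρ : Pi1 x →* (PadicAlgCl ℓ)ˣ) : IsEquivalentTo F ρ ↔ IsRankOne x F ∧
    ∀ (g : Pi1 x) (t : Stalk x F),
      (1 : PadicAlgCl ℓ) ⊗ₜ[valRing F.E] hF.pi g t = (ρ g : PadicAlgCl ℓ) ⊗ₜ[valRing F.E] t := by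
  refine and_congr_right fun _ => ⟨fun h g t => h g t _ fun n => ?_, fun h g t t' ht => ?_⟩
  · exact ⟨(hF.isLC n).rep, (hF.isLC n).repSec, (hF.isLC n).repLift (t.val n),
      (hF.isLC n).germ_repLift _, rfl⟩
  · rw [← h g t]
    congr 1
    refine Stalk.ext fun n => ?_
    obtain ⟨Y, s, u, h₁, h₂⟩ := ht n
    rw [pi_val, ← h₁, ← h₂]
    exact ((hF.isLC n).pi_germ g Y u s).symm

/-- A smooth system of rank one is equivalent to a continuous character. -/
lemma exists_character (hF : IsSmoothSystem F) (h : IsRankOne x F) :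
    ∃ ρ : Pi1 x →* (PadicAlgCl ℓ)ˣ, Continuous ρ ∧ IsEquivalentTo F ρ := by
  have := F.finite
  obtain ⟨q, hq, hqc⟩ := h.exists_coordinate hF
  obtain ⟨t₁, ht₁⟩ := hq 1
  have hker (t : Stalk x F) (ht : q t = 0) (g : Pi1 x) : q (hF.pi g t) = 0 := by
    have e₁ : (1 : PadicAlgCl ℓ) ⊗ₜ[valRing F.E] t = (0 : PadicAlgCl ℓ) ⊗ₜ[valRing F.E] t :=
      (hqc t t 0).2 (by rw [ht, zero_mul]; rfl)
    have e₂ := congrArg (LinearMap.lTensor (PadicAlgCl ℓ) (hF.pi g)) e₁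
    rw [LinearMap.lTensor_tmul, LinearMap.lTensor_tmul] at e₂
    have := (hqc _ _ 0).1 e₂
    rw [zero_mul] at this
    exact Subtype.ext this
  have hlin (g : Pi1 x) (t : Stalk x F) : q (hF.pi g t) = q (hF.pi g t₁) * q t := by
    have := hker (t - q t • t₁) (by rw [map_sub, map_smul, ht₁, smul_eq_mul, mul_one, sub_self]) g
    rw [map_sub, map_sub, map_smul, map_smul, sub_eq_zero, smul_eq_mul] at this
    rw [this, mul_comm]
  -- The kernel of `q` is the torsion of the stalk, so `g` acts on the quotient `𝒪_E` by the scalar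
  -- `q (g t₁)`, where `q t₁ = 1`.
  let ρ₀ : Pi1 x →* PadicAlgCl ℓ :=
    { toFun g := (q (hF.pi g t₁) : PadicAlgCl ℓ)
      map_one' := by rw [pi_one, ht₁]; rfl
      map_mul' g h := by rw [pi_mul, hlin]; rfl }
  have hcont : Continuous ρ₀ := by
    rw [continuous_iff_continuousAt]
    intro g₀
    rw [ContinuousAt, Metric.tendsto_nhds]
    intro ε hε
    -- If `g` and `g₀` act alike on the image of `t₁` in `F_n`, then `g t₁ - g₀ t₁` is divisible by
    -- `π_E^(n+1)`.
    obtain ⟨n, hn⟩ := exists_pow_lt_of_lt_one hε (norm_unif_lt_one F.E)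
    filter_upwards [(IsLocallyConstant.iff_eventually_eq _).1
      ((hF.isLC n).isLocallyConstant_pi (t₁.val n)) g₀] with g hg
    obtain ⟨w, hw⟩ := hF.exists_smul_eq (hF.pi g t₁ - hF.pi g₀ t₁)
      (by rw [Stalk.val_sub, pi_val, pi_val, hg, sub_self])
    have e : ρ₀ g - ρ₀ g₀ = ((unif F.E ^ (n + 1) * q w : valRing F.E) : PadicAlgCl ℓ) := by
      rw [← smul_eq_mul, ← map_smul, hw, map_sub]
      rfl
    rw [dist_eq_norm, e, Subring.coe_mul, norm_mul, SubmonoidClass.coe_pow, norm_pow, pow_succ]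
    have h₁ := (norm_unif_lt_one F.E).le
    have h₂ : ‖(q w : PadicAlgCl ℓ)‖ ≤ 1 := (q w).2.2
    calc _ ≤ ‖(unif F.E : PadicAlgCl ℓ)‖ ^ n * 1 * 1 := by gcongr
      _ < ε := by simpa using hn
  refine ⟨ρ₀.toHomUnits, ?_, (hF.isEquivalentTo_iff _).2 ⟨h, fun g t => ?_⟩⟩
  · rw [Units.isEmbedding_val₀.continuous_iff]
    exact hcont
  · rw [hqc, hlin]
    rfl

end IsSmoothSystem

end Monodromy

/-! ### Inverse images and monodromy -/

section PullMonodromy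

variable {X Y : Scheme.{u}} {ℓ : ℕ} [Fact ℓ.Prime] {F : PiSystem ℓ (EtAb X)}
  {Ω : Type u} [Field Ω] [IsSepClosed Ω] (f : Y ⟶ X) (y : Spec (.of Ω) ⟶ Y) {x : Spec (.of Ω) ⟶ X}
  (e : y ≫ f = x)

lemma IsSmoothSystem.pull (hF : IsSmoothSystem F) :
    IsSmoothSystem ((PiSystem.map (LadicSheaf.pull f)).obj F) :=
  ⟨fun n => PiSystem.isExtensionOfScalars_map (hF.1 n) (LadicSheaf.pull f),
    fun n => isFiniteLocallyConstant_iff.2 ((hF.isLC n).pull f)⟩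

instance modulePull : Module (valRing F.E) (Stalk y ((PiSystem.map (pull f)).obj F)) :=
  inferInstanceAs (Module (valRing ((PiSystem.map (pull f)).obj F).E) _)

variable (F) in
/-- The stalk of the inverse image of a system. -/
def stalkPullEquiv : Stalk y ((PiSystem.map (pull f)).obj F) ≃ₗ[valRing F.E] Stalk x F where
  toFun t := ⟨fun n => stalkPull f y e (F.obj n) (t.val n), fun n => by
    exact (stalkPull_map f y e (F.tr n) (t.val (n + 1))).symm.trans (congrArg _ (t.tr_val n))⟩
  map_add' t t' := Stalk.ext fun n => map_add (stalkPull f y e (F.obj n)) _ _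
  map_smul' a t := Stalk.ext fun n => stalkPull_map f y e (F.act n a) (t.val n)
  invFun t := ⟨fun n => (stalkPull f y e (F.obj n)).symm (t.val n), fun n => by
    refine (AddEquiv.eq_symm_apply _).2 ((stalkPull_map f y e (F.tr n) _).trans ?_)
    rw [AddEquiv.apply_symm_apply, t.tr_val]⟩
  left_inv t := Stalk.ext fun n => (stalkPull f y e (F.obj n)).symm_apply_apply _
  right_inv t := Stalk.ext fun n => (stalkPull f y e (F.obj n)).apply_symm_apply _

variable (F) in
/-- The stalk of the inverse image of a system, with `ℚ̄_ℓ`-coefficients. -/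
def qlStalkPullEquiv : QlStalk y ((PiSystem.map (pull f)).obj F) ≃ₗ[PadicAlgCl ℓ] QlStalk x F :=
  show PadicAlgCl ℓ ⊗[valRing F.E] Stalk y ((PiSystem.map (pull f)).obj F) ≃ₗ[PadicAlgCl ℓ] _ from
    TensorProduct.AlgebraTensorModule.congr (LinearEquiv.refl (PadicAlgCl ℓ) (PadicAlgCl ℓ))
      (stalkPullEquiv F f y e)

lemma qlStalkPullEquiv_tmul (c : PadicAlgCl ℓ) (t : Stalk y ((PiSystem.map (pull f)).obj F)) :
    qlStalkPullEquiv F f y e (c ⊗ₜ t) = c ⊗ₜ[valRing F.E] stalkPullEquiv F f y e t := rfl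

lemma isRankOne_pull_iff (e : y ≫ f = x) : IsRankOne y ((PiSystem.map (pull f)).obj F) ↔ IsRankOne x F := by
  rw [IsRankOne, IsRankOne, (qlStalkPullEquiv F f y e).finrank_eq]

/-- The identification of stalks is compatible with the actions of the fundamental groups. -/
lemma IsLC.stalkPull_pi {A : EtAb X} (hA : IsLC A) (g : Pi1 y) (t : (stalk y).obj ((LadicSheaf.pull f).obj A)) :
    stalkPull f y e A ((hA.pull f).pi g t) = hA.pi (pi1Map f y e g) (stalkPull f y e A t) := by
  obtain ⟨t, rfl⟩ := (stalkPull f y e A).symm.surjective t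
  let U := hA.rep
  let v : Lift y ((fetBaseChange f).obj U).obj := (fetLiftEquiv f y e U).symm (hA.repLift t)
  have ht : (stalkPull f y e A).symm t = germ y _ ((fetBaseChange f).obj U).obj v
      (pb f A U.obj hA.repSec) := by
    rw [AddEquiv.symm_apply_eq]
    refine Eq.trans ?_ (stalkPull_germ f y e A v _).symm
    have h : liftEquiv f y e U.obj v = hA.repLift t := (fetLiftEquiv f y e U).apply_symm_apply _
    exact (hA.germ_repLift t).symm.trans (congrArg (fun u => germ x A U.obj u hA.repSec) h.symm)
  rw [ht]
  refine (congrArg (stalkPull f y e A)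
    ((hA.pull f).pi_germ g ((fetBaseChange f).obj U) v (pb f A U.obj hA.repSec))).trans ?_
  refine (stalkPull_germ f y e A (g • v) _).trans ?_
  refine Eq.trans ?_ (congrArg (hA.pi (pi1Map f y e g)) (stalkPull_germ f y e A v _).symm)
  refine Eq.trans ?_ (hA.pi_germ (pi1Map f y e g) U (liftEquiv f y e U.obj v) hA.repSec).symm
  have h : liftEquiv f y e U.obj (g • v) = pi1Map f y e g • (liftEquiv f y e U.obj v) := by
    change _ = fetLiftEquiv f y e U (g • (fetLiftEquiv f y e U).symm (fetLiftEquiv f y e U v))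
    rw [Equiv.symm_apply_apply]
    rfl
  exact congrArg (fun u => germ x A U.obj u hA.repSec) h

/-- The inverse image is equivalent to the restriction of the character. -/
lemma IsEquivalentTo.pull (hF : IsSmoothSystem F) {ρ : Pi1 x →* (PadicAlgCl ℓ)ˣ}
    (h : IsEquivalentTo F ρ) :
    IsEquivalentTo ((PiSystem.map (LadicSheaf.pull f)).obj F) (ρ.comp (pi1Map f y e)) := by
  refine ((hF.pull f).isEquivalentTo_iff _).2 ⟨(isRankOne_pull_iff f y e).2 h.1, fun g t => ?_⟩
  apply (qlStalkPullEquiv F f y e).injective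
  refine Eq.trans (qlStalkPullEquiv_tmul f y e 1 _) (Eq.trans ?_ (qlStalkPullEquiv_tmul f y e _ t).symm)
  refine Eq.trans ?_ (((hF.isEquivalentTo_iff ρ).1 h).2 (pi1Map f y e g) (stalkPullEquiv F f y e t))
  exact congrArg (fun z => (1 : PadicAlgCl ℓ) ⊗ₜ[valRing F.E] z)
    (Stalk.ext fun n => (hF.isLC n).stalkPull_pi f y e g (t.val n))

lemma continuous_pi1Map : Continuous (pi1Map f y e) := by
  rw [Pi1.continuous_iff]
  intro U u
  exact (Pi1.isLocallyConstant_smul ((fetBaseChange f).obj U) ((fetLiftEquiv f y e U).symm u)).comp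
    (fetLiftEquiv f y e U)

end PullMonodromy

section Coinv

variable {K Ks : Type u} [Field K] [Field Ks] [Algebra K Ks] [IsSepClosed Ks]
  {X : Scheme.{u}} (f : X ⟶ Spec (.of K)) (x : Spec (.of K) ⟶ X) (hx : x ≫ f = 𝟙 _)

/-- A continuous homomorphism to a commutative Hausdorff group, restricted to the geometric
fundamental group, factors through the coinvariants. -/
lemma exists_coinvariants_factor {H : Type*} [CommGroup H] [TopologicalSpace H] [T1Space H]
    (ρ : Pi1 (geomPt Ks x) →* H) (hρ : Continuous ρ) :
    ∃ χ : Coinvariants Ks f x hx →* H, Continuous χ ∧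
      χ.comp (QuotientGroup.mk' _) = ρ.comp (pi1Map (sepProj Ks f) _ (geomPtBar_proj f x hx)) := by
  let σ : Pi1 (geomPtBar Ks f x hx) →* H := ρ.comp (pi1Map (sepProj Ks f) _ (geomPtBar_proj f x hx))
  have hσ : Continuous σ := hρ.comp (continuous_pi1Map _ _ _)
  have hker : coinvSubgroup Ks f x hx ≤ σ.ker := by
    refine Subgroup.topologicalClosure_minimal _ (Subgroup.normalClosure_le_normal ?_) ?_
    · rintro a (⟨g, h, rfl⟩ | ⟨γ, g, h, hgh, rfl⟩)
      · change σ _ = 1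
        simp only [map_mul, map_inv]
        rw [mul_comm (σ g), mul_inv_cancel_right, mul_inv_cancel]
      · change σ _ = 1
        have : σ h = σ g := by
          change ρ _ = ρ _
          rw [hgh, map_mul, map_mul, map_inv, mul_comm (ρ (galSection Ks x γ)), mul_inv_cancel_right]
        rw [map_mul, map_inv, this, mul_inv_cancel]
    · exact isClosed_singleton.preimage hσ
  exact ⟨QuotientGroup.lift _ σ hker, continuous_quot_lift _ hσ, rfl⟩

end Coinv

/-! ### Galois descent of systems -/

section Adic

open PiSystem

variable {ℓ : ℕ} [Fact ℓ.Prime] {𝒜 : Type u} [Category.{v} 𝒜] [Preadditive 𝒜]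

/-- A levelwise isomorphism of systems with the same coefficient field is an extension of scalars. -/
lemma PiSystem.isBaseChange_of_isIso {F G : PiSystem ℓ 𝒜} (f : F ⟶ G) (h : G.E ≤ F.E)
    (hf : ∀ n, IsIso (f.app n)) : IsBaseChange f := by
  intro n H θ hθ φ hφ
  have := hf n
  refine ⟨inv (f.app n) ≫ φ, ⟨fun a => ?_, IsIso.hom_inv_id_assoc _ _⟩, fun ψ hψ => ?_⟩
  · rw [← cancel_epi (f.app n)]
    have e := f.act_app n (valRingIncl h a)
    have e' : valRingIncl f.field_le (valRingIncl h a) = a := rfl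
    rw [e'] at e
    have e₂ := hφ (valRingIncl h a)
    rw [e'] at e₂
    rw [← Category.assoc, ← e, Category.assoc, IsIso.hom_inv_id_assoc, e₂, ← Category.assoc,
      IsIso.hom_inv_id_assoc]
  · rw [← hψ.2, IsIso.inv_hom_id_assoc]

end Adic

section Reflect

variable {X Y : Scheme.{u}} (f : Y ⟶ X) [Surjective f] {ℓ : ℕ} [Fact ℓ.Prime]

/-- Being adic is reflected by inverse images under surjective morphisms. -/
lemma PiSystem.IsAdic.of_pull {F : PiSystem ℓ (EtAb X)}
    (h : ((PiSystem.map (pull f)).obj F).IsAdic) : F.IsAdic := by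
  have := F.finite
  have : FiniteDimensional ℚ_[ℓ] ((PiSystem.map (pull f)).obj F).E := F.finite
  rw [isAdic_iff] at h ⊢
  intro n
  have hn := h n
  let a : F.obj (n + 1) ⟶ F.obj (n + 1) := F.act (n + 1) (unif F.E ^ (n + 1))
  have e : (pull f).map (cokernel.desc a (F.tr n) (F.act_unif_tr n)) =
      (PreservesCokernel.iso (pull f) a).hom ≫ cokernel.desc ((pull f).map a) ((pull f).map (F.tr n))
        (((PiSystem.map (pull f)).obj F).act_unif_tr n) := by
    rw [← cancel_epi ((pull f).map (cokernel.π a)), ← Functor.map_comp, cokernel.π_desc,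
      PreservesCokernel.π_iso_hom_assoc]
    exact (cokernel.π_desc _ _ _).symm
  have : IsIso (cokernel.desc ((pull f).map a) ((pull f).map (F.tr n))
        (((PiSystem.map (pull f)).obj F).act_unif_tr n)) := hn
  have : IsIso ((pull f).map (cokernel.desc a (F.tr n) (F.act_unif_tr n))) := by
    rw [e]
    infer_instance
  exact isIso_of_isIso_pull_map (f := f) _

end Reflect

section DescendSystem

variable {K Ks : Type u} [Field K] [Field Ks] [Algebra K Ks] {X : Scheme.{u}}
  {f : X ⟶ Spec (.of K)}

lemma mor_mem_invSubgroup {F F' : Equivariant (galAction (Ks := Ks) f)} (φ : F ⟶ F') {U : X.Etale}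
    {s : Sec F.obj ((etBaseChange (sepProj Ks f)).obj U)} (hs : s ∈ invSubgroup F U) :
    mor φ.hom _ s ∈ invSubgroup F' U := fun γ => by rw [← mor_secAct, hs]

/-- The functoriality of Galois descent. -/
def descendMap {F F' : Equivariant (galAction (Ks := Ks) f)} (φ : F ⟶ F') : descend F ⟶ descend F' :=
  ⟨{ app U := AddCommGrpCat.ofHom (((mor φ.hom _).comp (AddSubgroup.subtype _)).codRestrict
        (invSubgroup F' U.unop) fun s => mor_mem_invSubgroup φ s.2)
     naturality U V a := by
      ext s
      exact Subtype.ext (mor_res φ.hom _ s.1) }⟩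

lemma descend_hom_ext {A : EtAb X} {F : Equivariant (galAction (Ks := Ks) f)} {a b : A ⟶ descend F}
    (h : ∀ U s, (show invSubgroup F U from mor a U s).1 = (show invSubgroup F U from mor b U s).1) :
    a = b :=
  mor_hom_ext fun U s => Subtype.ext (h U s)

lemma pull_descendMap {F F' : Equivariant (galAction (Ks := Ks) f)} (φ : F ⟶ F') :
    (pull (sepProj Ks f)).map (descendMap φ) ≫ descendCounit F' = descendCounit F ≫ φ.hom := by
  refine pull_hom_ext _ fun U s => ?_
  rw [mor_comp, ← pb_mor, descendCounit_pb, mor_comp, descendCounit_pb]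
  rfl

/-- The counit `p^* F^G ⟶ F` is equivariant. -/
def descendCounitHom (F : Equivariant (galAction (Ks := Ks) f)) :
    (natEquivariant Ks f).obj (descend F) ⟶ F where
  hom := descendCounit F
  comm := natEquivariant_comm (descendCounit F) fun γ U s => by
    refine (congrArg (secAct F γ U) (descendCounit_pb F s)).trans ?_
    exact ((show invSubgroup F U from s).2 γ).trans (descendCounit_pb F s).symm

variable {ℓ : ℕ} [Fact ℓ.Prime]

/-- The levels of an equivariant system. -/
def level (F : Equivariant ((galAction (Ks := Ks) f).pi ℓ)) (n : ℕ) :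
    Equivariant (galAction (Ks := Ks) f) where
  obj := F.obj.obj n
  act γ :=
    { hom := (F.act γ).hom.app n
      inv := (F.act γ).inv.app n
      hom_inv_id := congrArg (fun φ => PiSystem.Hom.app φ n) (F.act γ).hom_inv_id
      inv_hom_id := congrArg (fun φ => PiSystem.Hom.app φ n) (F.act γ).inv_hom_id }
  act_mul γ δ := congrArg (fun φ => PiSystem.Hom.app φ n) (F.act_mul γ δ)

/-- The transition morphisms of an equivariant system. -/
def levelTr (F : Equivariant ((galAction (Ks := Ks) f).pi ℓ)) (n : ℕ) :
    level F (n + 1) ⟶ level F n where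
  hom := F.obj.tr n
  comm γ := (F.act γ).hom.app_tr n

/-- The module structure on the levels of an equivariant system. -/
def levelAct (F : Equivariant ((galAction (Ks := Ks) f).pi ℓ)) (n : ℕ) (a : valRing F.obj.E) :
    level F n ⟶ level F n where
  hom := F.obj.act n a
  comm γ := ((F.act γ).hom.act_app n a).symm

/-- The system on `X` obtained from an equivariant system by Galois descent. -/
def descendSystem (F : Equivariant ((galAction (Ks := Ks) f).pi ℓ)) : PiSystem ℓ (EtAb X) where
  E := F.obj.E
  finite := F.obj.finite
  obj n := descend (level F n)
  tr n := descendMap (levelTr F n)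
  act n :=
    { toFun a := descendMap (levelAct F n a)
      map_one' := descend_hom_ext fun U s =>
        (congrArg (fun φ : F.obj.obj n ⟶ F.obj.obj n => mor φ _ (show invSubgroup (level F n) U from s).1)
          (map_one (F.obj.act n))).trans (mor_id _)
      map_mul' a b := descend_hom_ext fun U s =>
        (congrArg (fun φ : F.obj.obj n ⟶ F.obj.obj n => mor φ _ (show invSubgroup (level F n) U from s).1)
          (map_mul (F.obj.act n) a b)).trans (mor_comp _ _ _)
      map_zero' := descend_hom_ext fun U s =>
        (congrArg (fun φ : F.obj.obj n ⟶ F.obj.obj n => mor φ _ (show invSubgroup (level F n) U from s).1)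
          (map_zero (F.obj.act n))).trans (mor_zero _)
      map_add' a b := descend_hom_ext fun U s =>
        (congrArg (fun φ : F.obj.obj n ⟶ F.obj.obj n => mor φ _ (show invSubgroup (level F n) U from s).1)
          (map_add (F.obj.act n) a b)).trans (mor_add _ _ _) }
  tr_act n a := descend_hom_ext fun U s =>
    (mor_comp _ _ _).symm.trans ((congrArg (fun φ : F.obj.obj (n + 1) ⟶ F.obj.obj n =>
      mor φ _ (show invSubgroup (level F (n + 1)) U from s).1) (F.obj.tr_act n a)).trans (mor_comp _ _ _))
  act_eq_zero n a ha := descend_hom_ext fun U s =>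
    (congrArg (fun φ : F.obj.obj n ⟶ F.obj.obj n => mor φ _ (show invSubgroup (level F n) U from s).1)
      (F.obj.act_eq_zero n a ha)).trans (mor_zero _)

/-- The equivariant morphism `p^* F^G ⟶ F` of systems. -/
def descendSystemCounit (F : Equivariant ((galAction (Ks := Ks) f).pi ℓ)) :
    (naturalAction Ks f ℓ).obj (descendSystem F) ⟶ F where
  hom :=
    { field_le := le_rfl
      app n := descendCounit (level F n)
      app_tr n := (pull_descendMap (levelTr F n)).symm
      act_app n a := pull_descendMap (levelAct F n a) }
  comm γ := PiSystem.hom_ext fun n => (descendCounitHom (level F n)).comm γ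

variable [IsSepClosed Ks] [Algebra.IsSeparable K Ks]

lemma isIso_descendSystemCounit_app {F : Equivariant ((galAction (Ks := Ks) f).pi ℓ)}
    (hc : IsContinuousAction f F) (n : ℕ) : IsIso ((descendSystemCounit F).hom.app n) := by
  refine isIso_descendCounit (level F n) fun U _ s => ?_
  have h := (IsLocallyConstant.iff_eventually_eq _).1 (hc n U inferInstance s) 1
  filter_upwards [h] with γ hγ
  exact Eq.trans hγ (secAct_one (level F n) s)

lemma isIso_descendSystemCounit {F : Equivariant ((galAction (Ks := Ks) f).pi ℓ)}
    (hc : IsContinuousAction f F) : IsIso (descendSystemCounit F).hom := by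
  have := isIso_descendSystemCounit_app hc
  exact ⟨{ field_le := le_rfl
           app n := inv ((descendSystemCounit F).hom.app n)
           app_tr n := by
            rw [IsIso.inv_comp_eq, ← Category.assoc, IsIso.eq_comp_inv]
            exact ((descendSystemCounit F).hom.app_tr n).symm
           act_app n a := by
            rw [IsIso.comp_inv_eq, Category.assoc, IsIso.eq_inv_comp]
            exact ((descendSystemCounit F).hom.act_app n a).symm },
    PiSystem.hom_ext fun n => IsIso.hom_inv_id _, PiSystem.hom_ext fun n => IsIso.inv_hom_id _⟩

/-- The descended system is smooth: being adic and being locally constant are reflected by the inverse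
image along `X̄ ⟶ X`. -/
lemma isSmoothSystem_descendSystem {F : Equivariant ((galAction (Ks := Ks) f).pi ℓ)}
    (hF : IsSmoothSystem F.obj) (hc : IsContinuousAction f F) : IsSmoothSystem (descendSystem F) := by
  have := isIso_descendSystemCounit hc
  have h : IsSmoothSystem ((PiSystem.map (pull (sepProj Ks f))).obj (descendSystem F)) :=
    hF.of_baseChange (PiSystem.isBaseChange_of_isIso (inv (descendSystemCounit F).hom) le_rfl fun n =>
      ⟨(descendSystemCounit F).hom.app n,
        congrArg (fun φ => PiSystem.Hom.app φ n) (IsIso.inv_hom_id (descendSystemCounit F).hom),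
        congrArg (fun φ => PiSystem.Hom.app φ n) (IsIso.hom_inv_id (descendSystemCounit F).hom)⟩)
  exact ⟨.of_pull _ h.1, fun n => isFiniteLocallyConstant_iff.2 (.of_pull_sepProj (h.isLC n))⟩

end DescendSystem

/-! ### Equivariant morphisms between inverse images -/

section Continuity

variable {K Ks : Type u} [Field K] [Field Ks] [Algebra K Ks] [Algebra.IsSeparable K Ks]
  {X : Scheme.{u}} {f : X ⟶ Spec (.of K)} {ℓ : ℕ} [Fact ℓ.Prime]

/-- The natural action on the inverse image of a smooth system is continuous. -/
lemma isContinuousAction_naturalAction {F : PiSystem ℓ (EtAb X)} (hF : IsSmoothSystem F) :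
    IsContinuousAction f ((naturalAction Ks f ℓ).obj F) := fun n _ _ s =>
  isLocallyConstant_secAct f ((natEquivariant Ks f).obj (F.obj n))
    (eventually_secAct_eq f (hF.isLC n) s)

end Continuity

section Unit

variable {K Ks : Type u} [Field K] [Field Ks] [Algebra K Ks] [IsSepClosed Ks]
  [Algebra.IsSeparable K Ks] {X : Scheme.{u}} {f : X ⟶ Spec (.of K)}

/-- A locally constant sheaf is the sheaf of invariants of its inverse image. -/
lemma isIso_toDescend_id {A : EtAb X} (hA : IsLC A) :
    IsIso (toDescend (𝟙 ((natEquivariant Ks f).obj A))) := by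
  have := isIso_descendCounit ((natEquivariant Ks f).obj A) fun U _ s => eventually_secAct_eq f hA s
  have h := pull_toDescend_comp (𝟙 ((natEquivariant Ks f).obj A))
  have h' : IsIso ((pull (sepProj Ks f)).map (toDescend (𝟙 ((natEquivariant Ks f).obj A))) ≫
      descendCounit ((natEquivariant Ks f).obj A)) := by
    rw [h]
    exact inferInstanceAs (IsIso (𝟙 _))
  have := IsIso.of_isIso_comp_right ((pull (sepProj Ks f)).map
    (toDescend (𝟙 ((natEquivariant Ks f).obj A)))) (descendCounit ((natEquivariant Ks f).obj A))
  exact isIso_of_isIso_pull_map (f := sepProj Ks f) _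

/-- Equivariant morphisms between inverse images of locally constant sheaves descend. -/
lemma exists_pull_map_eq {A B : EtAb X} (hB : IsLC B)
    (φ : (natEquivariant Ks f).obj A ⟶ (natEquivariant Ks f).obj B) :
    ∃ a : A ⟶ B, (pull (sepProj Ks f)).map a = φ.hom := by
  have := isIso_toDescend_id (Ks := Ks) (f := f) hB
  refine ⟨toDescend φ ≫ inv (toDescend (𝟙 ((natEquivariant Ks f).obj B))), ?_⟩
  have h := pull_toDescend_comp (𝟙 ((natEquivariant Ks f).obj B))
  let a : A ⟶ B := toDescend φ ≫ inv (toDescend (𝟙 ((natEquivariant Ks f).obj B)))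
  have ha : a ≫ toDescend (𝟙 ((natEquivariant Ks f).obj B)) = toDescend φ := by simp [a]
  refine (Category.comp_id ((pull (sepProj Ks f)).map a)).symm.trans
    ((congrArg ((pull (sepProj Ks f)).map a ≫ ·) h.symm).trans ?_)
  refine (Category.assoc _ _ _).symm.trans ((congrArg (· ≫ _)
    (Functor.map_comp (pull (sepProj Ks f)) a _).symm).trans ?_)
  rw [ha]
  exact pull_toDescend_comp φ

variable {ℓ : ℕ} [Fact ℓ.Prime]

/-- Equivariant morphisms between inverse images of smooth systems descend. -/
lemma exists_map_pull_eq {F G : PiSystem ℓ (EtAb X)} (hG : IsSmoothSystem G)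
    (φ : (naturalAction Ks f ℓ).obj F ⟶ (naturalAction Ks f ℓ).obj G) :
    ∃ a : F ⟶ G, (PiSystem.map (pull (sepProj Ks f))).map a = φ.hom := by
  choose a ha using fun n => exists_pull_map_eq (hG.isLC n)
    (⟨φ.hom.app n, fun γ => congrArg (fun ψ => PiSystem.Hom.app ψ n) (φ.comm γ)⟩ :
      (natEquivariant Ks f).obj (F.obj n) ⟶ (natEquivariant Ks f).obj (G.obj n))
  refine ⟨⟨φ.hom.field_le, a, fun n => ?_, fun n b => ?_⟩, PiSystem.hom_ext ha⟩
  · apply pull_map_injective (sepProj Ks f)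
    rw [Functor.map_comp, Functor.map_comp, ha, ha]
    exact φ.hom.app_tr n
  · apply pull_map_injective (sepProj Ks f)
    refine (Functor.map_comp _ _ _).trans (Eq.trans ?_ (Functor.map_comp _ _ _).symm)
    rw [ha]
    exact φ.hom.act_app n b

end Unit

section StalkAction

variable {K Ks : Type u} [Field K] [Field Ks] [Algebra K Ks] {X : Scheme.{u}}
  (f : X ⟶ Spec (.of K)) (x : Spec (.of K) ⟶ X) (hx : x ≫ f = 𝟙 _)

/-- The sections of `γ_* p^* A` over `Ū` given by the sections of `A` over `U`. -/
def twistSec (A : EtAb X) (γ : Ks ≃ₐ[K] Ks) {U : X.Etale} (s : Sec A U) :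
    Sec ((push (galX f γ)).obj ((pull (sepProj Ks f)).obj A)) ((etBaseChange (sepProj Ks f)).obj U) :=
  res ((pull (sepProj Ks f)).obj A) (galComp f γ U) (pb (sepProj Ks f) A U s)

lemma mor_twistSec (A : EtAb X) (γ : Ks ≃ₐ[K] Ks) {U : X.Etale} (s : Sec A U) :
    mor ((baseChangeAct f γ).hom.app A) _ (twistSec f A γ s) = pb (sepProj Ks f) A U s :=
  (secAct_eq ((natEquivariant Ks f).obj A) γ _).symm.trans (secAct_pb f A γ s)

variable [IsSepClosed Ks]

/-- `s(γ)` acts on the liftings of the geometric point by composition with `Spec γ`. -/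
lemma pt_galSection_smul (γ : Ks ≃ₐ[K] Ks) (U : FEt X) (u : Lift (geomPt Ks x) U.obj) :
    Lift.pt (geomPt Ks x) (galSection Ks x γ • u) = galSpec γ⁻¹ ≫ Lift.pt (geomPt Ks x) u := by
  refine (Category.assoc (galSpec γ⁻¹) (Lift.pt (specSep K Ks)
    ((fetLiftEquiv x (specSep K Ks) rfl U).symm u)) (bcFst x U.obj)).trans ?_
  refine congrArg (galSpec γ⁻¹ ≫ ·) ?_
  exact congrArg (Lift.pt (geomPt Ks x)) ((fetLiftEquiv x (specSep K Ks) rfl U).apply_symm_apply u)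

/-- The twist by `γ` of a lifting corresponds to the action of `s(γ)⁻¹` on the liftings to `U`. -/
lemma liftEquiv_twist (γ : Ks ≃ₐ[K] Ks) (U : FEt X)
    (v : Lift (geomPtBar Ks f x hx) ((etBaseChange (sepProj Ks f)).obj U.obj)) :
    galSection Ks x γ • (show Lift (geomPt Ks x) U.obj from
      liftEquiv _ _ (geomPtBar_proj f x hx) U.obj (Lift.map _ (galComp f γ U.obj)
        (Lift.twist (galX f γ) _ _ (galSpec γ) (geomPtBar_galX f x hx γ) v))) =
      liftEquiv _ _ (geomPtBar_proj f x hx) U.obj v := by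
  refine Lift.ext _ ((pt_galSection_smul x γ U _).trans ?_)
  have h₁ : Lift.pt (geomPt Ks x) (liftEquiv _ _ (geomPtBar_proj f x hx) U.obj
      (Lift.map _ (galComp f γ U.obj)
        (Lift.twist (galX f γ) _ _ (galSpec γ) (geomPtBar_galX f x hx γ) v))) =
      galSpec γ ≫ Lift.pt (geomPtBar Ks f x hx) v ≫ bcFst (sepProj Ks f) U.obj := by
    simp [liftEquiv, Lift.twist]
  have h₂ : Lift.pt (geomPt Ks x) (liftEquiv _ _ (geomPtBar_proj f x hx) U.obj v) =
      Lift.pt (geomPtBar Ks f x hx) v ≫ bcFst (sepProj Ks f) U.obj := by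
    simp [liftEquiv]
  refine (congrArg (galSpec γ⁻¹ ≫ ·) h₁).trans (Eq.trans ?_ h₂.symm)
  rw [← Category.assoc, ← galSpec_mul, mul_inv_cancel, galSpec_one, Category.id_comp]

lemma pushStalk_twistSec (A : EtAb X) (γ : Ks ≃ₐ[K] Ks) {U : X.Etale} (s : Sec A U)
    (v : Lift (geomPtBar Ks f x hx) ((etBaseChange (sepProj Ks f)).obj U)) :
    stalkPull _ _ (geomPtBar_proj f x hx) A
      ((pushStalk (galX f γ) _ _ _ (geomPtBar_galX f x hx γ) _).hom (germ (geomPtBar Ks f x hx)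
        ((push (galX f γ)).obj ((pull (sepProj Ks f)).obj A)) _ v (twistSec f A γ s))) =
      germ (geomPt Ks x) A U (liftEquiv _ _ (geomPtBar_proj f x hx) U (Lift.map _ (galComp f γ U)
        (Lift.twist (galX f γ) _ _ (galSpec γ) (geomPtBar_galX f x hx γ) v))) s := by
  refine (congrArg (stalkPull _ _ (geomPtBar_proj f x hx) A)
    (pushStalk_germ _ _ _ _ (geomPtBar_galX f x hx γ) _ _ v _)).trans ?_
  refine (congrArg (stalkPull _ _ (geomPtBar_proj f x hx) A)
    (germ_res (geomPtBar Ks f x hx) (galComp f γ U) _ (pb (sepProj Ks f) A U s))).trans ?_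
  exact stalkPull_germ _ _ (geomPtBar_proj f x hx) A _ s

/-- The germs of `γ_* p^* A` at the rational point come from sections of `A`. -/
lemma exists_germ_twistSec {A : EtAb X} (hA : IsLC A) (γ : Ks ≃ₐ[K] Ks)
    (t : (stalk (geomPtBar Ks f x hx)).obj ((push (galX f γ)).obj ((pull (sepProj Ks f)).obj A))) :
    ∃ (v : Lift (geomPtBar Ks f x hx) ((etBaseChange (sepProj Ks f)).obj hA.rep.obj)),
      t = germ (geomPtBar Ks f x hx) ((push (galX f γ)).obj ((pull (sepProj Ks f)).obj A)) _ v
        (twistSec f A γ hA.repSec) := by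
  let μ := (baseChangeAct f γ).hom.app A
  let t₀ := stalkPull _ _ (geomPtBar_proj f x hx) A (((stalk _).map μ).hom t)
  refine ⟨(liftEquiv _ _ (geomPtBar_proj f x hx) hA.rep.obj).symm (hA.repLift t₀), ?_⟩
  apply (stalk_map_bijective μ (geomPtBar Ks f x hx)).1
  apply (stalkPull _ _ (geomPtBar_proj f x hx) A).injective
  refine Eq.trans ?_ (congrArg (stalkPull _ _ (geomPtBar_proj f x hx) A)
    (germ_mor (geomPtBar Ks f x hx) μ _ _ _).symm)
  rw [mor_twistSec, stalkPull_germ, Equiv.apply_symm_apply, IsLC.germ_repLift]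

/-- On the stalk of `p^* A` at the rational point, `γ` acts through the image of `γ` in the
fundamental group of `X`. -/
lemma stalkPull_baseChangeAct {A : EtAb X} (hA : IsLC A) (γ : Ks ≃ₐ[K] Ks)
    (t : (stalk (geomPtBar Ks f x hx)).obj ((push (galX f γ)).obj ((pull (sepProj Ks f)).obj A))) :
    stalkPull _ _ (geomPtBar_proj f x hx) A
        (((stalk (geomPtBar Ks f x hx)).map ((baseChangeAct f γ).hom.app A)).hom t) =
      hA.pi (galSection Ks x γ) (stalkPull _ _ (geomPtBar_proj f x hx) A
        ((pushStalk (galX f γ) _ _ _ (geomPtBar_galX f x hx γ) _).hom t)) := by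
  obtain ⟨v, rfl⟩ := exists_germ_twistSec f x hx hA γ t
  rw [pushStalk_twistSec]
  refine Eq.trans ?_ (hA.pi_germ (galSection Ks x γ) hA.rep _ hA.repSec).symm
  rw [liftEquiv_twist]
  refine (congrArg (stalkPull _ _ (geomPtBar_proj f x hx) A)
    (germ_mor (geomPtBar Ks f x hx) ((baseChangeAct f γ).hom.app A) _ v _)).trans ?_
  rw [mor_twistSec, stalkPull_germ]

end StalkAction

/-! ### The natural action and the character -/

section NaturalAction

variable {ℓ : ℕ} [Fact ℓ.Prime]

lemma IsSmoothSystem.of_iso {X : Scheme.{u}} {F G : PiSystem ℓ (EtAb X)} (hF : IsSmoothSystem F)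
    (e : F ≅ G) : IsSmoothSystem G :=
  hF.of_baseChange (PiSystem.isBaseChange_of_isIso e.hom e.inv.field_le fun n =>
    ⟨e.inv.app n, congrArg (fun φ => PiSystem.Hom.app φ n) e.hom_inv_id,
      congrArg (fun φ => PiSystem.Hom.app φ n) e.inv_hom_id⟩)

variable {K Ks : Type u} [Field K] [Field Ks] [Algebra K Ks] {X : Scheme.{u}}
  (f : X ⟶ Spec (.of K)) (x : Spec (.of K) ⟶ X) (hx : x ≫ f = 𝟙 _) {F : PiSystem ℓ (EtAb X)}

lemma IsSmoothSystem.map_galAction {F : Equivariant ((galAction (Ks := Ks) f).pi ℓ)}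
    (hF : IsSmoothSystem F.obj) (γ : Ks ≃ₐ[K] Ks) :
    IsSmoothSystem ((PiSystem.map ((galAction f).T γ)).obj F.obj) :=
  hF.of_iso (F.act γ).symm

variable [IsSepClosed Ks]

/-- The natural action is the one given by the restriction of the character along the rational point. -/
lemma actsOnStalkBy_naturalAction (hF : IsSmoothSystem F) {ρ : Pi1 (geomPt Ks x) →* (PadicAlgCl ℓ)ˣ}
    (h : IsEquivalentTo F ρ) (γ : Ks ≃ₐ[K] Ks) :
    ActsOnStalkBy f x hx γ (((naturalAction Ks f ℓ).obj F).act γ).hom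
      (ρ (galSection Ks x γ) : (PadicAlgCl ℓ)ˣ) := by
  intro t t' ht
  apply (qlStalkPullEquiv F _ _ (geomPtBar_proj f x hx)).injective
  refine (qlStalkPullEquiv_tmul _ _ (geomPtBar_proj f x hx) _ _).trans (Eq.trans ?_
    (qlStalkPullEquiv_tmul _ _ (geomPtBar_proj f x hx) _ t').symm)
  refine Eq.trans ?_ (((hF.isEquivalentTo_iff ρ).1 h).2 (galSection Ks x γ)
    (stalkPullEquiv F _ _ (geomPtBar_proj f x hx) t'))
  refine congrArg (fun z => (1 : PadicAlgCl ℓ) ⊗ₜ[valRing F.E] z) (Stalk.ext fun n => ?_)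
  refine (stalkPull_baseChangeAct f x hx (hF.isLC n) γ (t.val n)).trans ?_
  exact congrArg (fun z => (hF.isLC n).pi (galSection Ks x γ)
    (stalkPull _ _ (geomPtBar_proj f x hx) (F.obj n) z)) (ht n)

/-- Every element of the stalk of `γ_* p^* F` has an image under the identification of the stalks. -/
lemma exists_pushStalk_eq (hF : IsSmoothSystem F) (γ : Ks ≃ₐ[K] Ks)
    (t : Stalk (geomPtBar Ks f x hx) ((PiSystem.map ((galAction f).T γ)).obj
      ((naturalAction Ks f ℓ).obj F).obj)) :
    ∃ t' : Stalk (geomPtBar Ks f x hx) ((naturalAction Ks f ℓ).obj F).obj, ∀ n,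
      (pushStalk (galX f γ) _ _ _ (geomPtBar_galX f x hx γ)
        (((naturalAction Ks f ℓ).obj F).obj.obj n)).hom (t.val n) = t'.val n := by
  let E := stalkPullEquiv F _ _ (geomPtBar_proj (Ks := Ks) f x hx)
  refine ⟨E.symm (hF.pi (galSection Ks x γ)⁻¹
    (E (t.map (((naturalAction Ks f ℓ).obj F).act γ).hom))), fun n => ?_⟩
  refine ((AddEquiv.symm_apply_eq _).2 ?_).symm
  refine (congrArg ((hF.isLC n).pi (galSection Ks x γ)⁻¹)
    (stalkPull_baseChangeAct f x hx (hF.isLC n) γ (t.val n))).trans ?_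
  rw [← IsLC.pi_mul, inv_mul_cancel, IsLC.pi_one]
  rfl

/-- A morphism `γ_* p^* F ⟶ p^* F` is determined by its effect on the stalk. -/
lemma Q_map_eq_of_actsOnStalkBy [Algebra.IsSeparable K Ks] [ConnectedSpace X] (hF : IsSmoothSystem F)
    (γ : Ks ≃ₐ[K] Ks) {c : PadicAlgCl ℓ}
    {a b : (PiSystem.map ((galAction f).T γ)).obj ((naturalAction Ks f ℓ).obj F).obj ⟶
      ((naturalAction Ks f ℓ).obj F).obj}
    (ha : ActsOnStalkBy f x hx γ a c) (hb : ActsOnStalkBy f x hx γ b c) :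
    (QlSystem.Q ℓ _).map a = (QlSystem.Q ℓ _).map b := by
  have := connectedSpace_sepBaseChange (Ks := Ks) f x hx
  have hF' : IsSmoothSystem ((naturalAction Ks f ℓ).obj F).obj := hF.pull _
  refine Q_map_eq_of_one_tmul_eq (hF'.map_galAction f γ) hF' (geomPtBar Ks f x hx) fun t => ?_
  obtain ⟨t', ht'⟩ := exists_pushStalk_eq f x hx hF γ t
  exact (ha t t' ht').trans (hb t t' ht').symm

end NaturalAction

open PiSystem

/-! ### Full faithfulness of the inverse image -/

section Power

variable {ℓ : ℕ} [Fact ℓ.Prime] {𝒜 : Type u} [Category.{v} 𝒜] [Abelian 𝒜]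

/-- Multiplication by `ℓ ^ N` on a system. -/
def PiSystem.mulEllPow (N : ℕ) (F : PiSystem ℓ 𝒜) : F ⟶ F where
  field_le := le_rfl
  app n := ℓ ^ N • 𝟙 (F.obj n)
  app_tr n := by simp
  act_app n a := by
    rw [Preadditive.comp_nsmul, Preadditive.nsmul_comp, Category.comp_id, Category.id_comp]; rfl

lemma isIso_Q_map_mulEllPow (N : ℕ) (F : PiSystem ℓ 𝒜) :
    IsIso ((QlSystem.Q ℓ 𝒜).map (PiSystem.mulEllPow N F)) := by
  induction N with
  | zero =>
    have : PiSystem.mulEllPow 0 F = 𝟙 F := PiSystem.hom_ext fun n => by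
      simp [PiSystem.mulEllPow]
    rw [this]
    infer_instance
  | succ N ih =>
    have : PiSystem.mulEllPow (N + 1) F = PiSystem.mulEllPow N F ≫ F.mulEll :=
      PiSystem.hom_ext fun n => by
        rw [PiSystem.comp_app]
        simp [PiSystem.mulEllPow, PiSystem.mulEll, smul_smul, pow_succ, mul_comm]
    have h := isIso_Q_map (ℓ := ℓ)
      (MorphismProperty.multiplicativeClosure.of F.mulEll (PiSystem.W.mulEll F))
    rw [this, Functor.map_comp]
    infer_instance

end Power

section Faithful

variable {ℓ : ℕ} [Fact ℓ.Prime] {X Y : Scheme.{u}} (f : Y ⟶ X) [Surjective f]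
  {F G : PiSystem ℓ (EtAb X)}

/-- The inverse image along a surjective morphism is faithful on smooth systems. -/
lemma QlSystem.map_pull_injective (hF : IsSmoothSystem F)
    {φ ψ : (QlSystem.Q ℓ _).obj F ⟶ (QlSystem.Q ℓ _).obj G}
    (h : (QlSystem.map ℓ (pull f)).map φ = (QlSystem.map ℓ (pull f)).map ψ) : φ = ψ := by
  obtain ⟨H, a, s, hs, ha⟩ := exists_fraction φ
  obtain ⟨H', b, t, ht, hb⟩ := exists_fraction (ψ ≫ (QlSystem.Q ℓ _).map s)
  have := isIso_Q_map hs
  have := isIso_Q_map ht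
  have ha' : φ ≫ (QlSystem.Q ℓ _).map s ≫ (QlSystem.Q ℓ _).map t = (QlSystem.Q ℓ _).map (a ≫ t) := by
    rw [← Category.assoc, ha, Functor.map_comp]
  have hb' : ψ ≫ (QlSystem.Q ℓ _).map s ≫ (QlSystem.Q ℓ _).map t = (QlSystem.Q ℓ _).map b := by
    rw [← hb, Category.assoc]
  rw [← cancel_mono ((QlSystem.Q ℓ _).map s ≫ (QlSystem.Q ℓ _).map t), ha', hb']
  have h₁ : (QlSystem.map ℓ (pull f)).map ((QlSystem.Q ℓ _).map (a ≫ t)) =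
      (QlSystem.map ℓ (pull f)).map ((QlSystem.Q ℓ _).map b) := by
    rw [← ha', ← hb', Functor.map_comp, h, ← Functor.map_comp]
  have h₂ : (QlSystem.Q ℓ _).map ((PiSystem.map (pull f)).map (a ≫ t)) =
      (QlSystem.Q ℓ _).map ((PiSystem.map (pull f)).map b) := by
    rw [← cancel_epi ((QlSystem.fac ℓ (pull f)).hom.app F)]
    refine ((QlSystem.fac ℓ (pull f)).hom.naturality (a ≫ t)).symm.trans (Eq.trans ?_
      ((QlSystem.fac ℓ (pull f)).hom.naturality b))
    exact congrArg (· ≫ _) h₁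
  obtain ⟨N, hN⟩ := (Q_map_eq_iff_of_epi (hF.pull f).epi_tr _ _).1 h₂
  refine Q_map_eq_of_smul_eq N _ _ fun n => ?_
  apply pull_map_injective f
  rw [Functor.map_nsmul, Functor.map_nsmul]
  exact hN n

end Faithful

section Actions

variable {ℓ : ℕ} [Fact ℓ.Prime] {K Ks : Type u} [Field K] [Field Ks] [Algebra K Ks]
  {X : Scheme.{u}} {f : X ⟶ Spec (.of K)}

/-- The action of `γ` on `F ⊗ ℚ̄_ℓ`, where `F` is an equivariant system. -/
def qlAct (F : Equivariant ((galAction (Ks := Ks) f).pi ℓ)) (γ : Ks ≃ₐ[K] Ks) :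
    (QlSystem.map ℓ ((galAction f).T γ)).obj ((QlSystem.Q ℓ _).obj F.obj) ⟶
      (QlSystem.Q ℓ _).obj F.obj :=
  (QlSystem.fac ℓ ((galAction f).T γ)).hom.app F.obj ≫ (QlSystem.Q ℓ _).map (F.act γ).hom

/-- Equivariance with `ℚ̄_ℓ`-coefficients, in terms of systems. -/
lemma qlAct_comp (F F' : Equivariant ((galAction (Ks := Ks) f).pi ℓ)) (γ : Ks ≃ₐ[K] Ks)
    (φ : F.obj ⟶ F'.obj) :
    qlAct F γ ≫ (QlSystem.Q ℓ _).map φ =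
        (QlSystem.map ℓ ((galAction f).T γ)).map ((QlSystem.Q ℓ _).map φ) ≫ qlAct F' γ ↔
      (QlSystem.Q ℓ _).map ((F.act γ).hom ≫ φ) =
        (QlSystem.Q ℓ _).map ((PiSystem.map ((galAction f).T γ)).map φ ≫ (F'.act γ).hom) := by
  have h : (QlSystem.map ℓ ((galAction f).T γ)).map ((QlSystem.Q ℓ _).map φ) ≫
      (QlSystem.fac ℓ ((galAction f).T γ)).hom.app F'.obj =
      (QlSystem.fac ℓ ((galAction f).T γ)).hom.app F.obj ≫
        (QlSystem.Q ℓ _).map ((PiSystem.map ((galAction f).T γ)).map φ) :=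
    (QlSystem.fac ℓ ((galAction f).T γ)).hom.naturality φ
  rw [qlAct, qlAct, reassoc_of% h, Category.assoc, cancel_epi]
  exact ⟨fun h => (Functor.map_comp _ _ _).trans (h.trans (Functor.map_comp _ _ _).symm),
    fun h => (Functor.map_comp _ _ _).symm.trans (h.trans (Functor.map_comp _ _ _))⟩

lemma qlAct_naturality {F F' : Equivariant ((galAction (Ks := Ks) f).pi ℓ)} (φ : F ⟶ F')
    (γ : Ks ≃ₐ[K] Ks) : qlAct F γ ≫ (QlSystem.Q ℓ _).map φ.hom =
      (QlSystem.map ℓ ((galAction f).T γ)).map ((QlSystem.Q ℓ _).map φ.hom) ≫ qlAct F' γ :=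
  (qlAct_comp F F' γ φ.hom).2 (congrArg (QlSystem.Q ℓ _).map (φ.comm γ))

/-- The comparison `p^* (F ⊗ ℚ̄_ℓ) ≅ p^* F ⊗ ℚ̄_ℓ` is equivariant. -/
lemma naturalActionQl_act_comp_fac (F : PiSystem ℓ (EtAb X)) (γ : Ks ≃ₐ[K] Ks) :
    (((naturalActionQl Ks f ℓ).obj ((QlSystem.Q ℓ _).obj F)).act γ).hom ≫
        (QlSystem.fac ℓ (pull (sepProj Ks f))).hom.app F =
      (QlSystem.map ℓ ((galAction f).T γ)).map ((QlSystem.fac ℓ (pull (sepProj Ks f))).hom.app F) ≫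
        qlAct ((naturalAction Ks f ℓ).obj F) γ := by
  have h := QlSystem.mapComp_app ℓ (baseChangeAct f γ) F
  refine (congrArg (· ≫ _) h).trans ?_
  simp only [Category.assoc, Iso.inv_hom_id_app]
  rfl

end Actions

section Fraction

variable {ℓ : ℕ} [Fact ℓ.Prime] {𝒜 : Type u} [Category.{v} 𝒜] [Abelian 𝒜] {ℬ : Type u'}
  [Category.{v'} ℬ] [Abelian ℬ] (T : ℬ ⥤ 𝒜) [T.Additive] [T.IsLeftAdjoint]

/-- A morphism to `T(B) ⊗ ℚ̄_ℓ` is a fraction whose denominator is the image of a morphism under `T`. -/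
lemma PiSystem.exists_fraction_map {A : PiSystem ℓ 𝒜} {B : PiSystem ℓ ℬ}
    (φ : (QlSystem.Q ℓ 𝒜).obj A ⟶ (QlSystem.Q ℓ 𝒜).obj ((PiSystem.map T).obj B)) :
    ∃ (B' : PiSystem ℓ ℬ) (s : B ⟶ B') (b : A ⟶ (PiSystem.map T).obj B'), W' ℓ ℬ s ∧
      φ ≫ (QlSystem.Q ℓ 𝒜).map ((PiSystem.map T).map s) = (QlSystem.Q ℓ 𝒜).map b := by
  obtain ⟨H, a, s, hs, ha⟩ := exists_fraction φ
  obtain ⟨B', s', r, hs', hr⟩ := exists_dominating T hs B (𝟙 _)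
  rw [Category.id_comp] at hr
  refine ⟨B', s', a ≫ r, hs', ?_⟩
  rw [Functor.map_comp, ← ha, Category.assoc, ← Functor.map_comp, hr]

end Fraction

section Full

variable {ℓ : ℕ} [Fact ℓ.Prime] {K Ks : Type u} [Field K] [Field Ks] [Algebra K Ks]
  {X : Scheme.{u}} {f : X ⟶ Spec (.of K)} {F G : PiSystem ℓ (EtAb X)}

/-- Equivariance is invariant under conjugation by equivariant isomorphisms. -/
lemma comp_eq_of_conjugate {𝒞 : Type u'} [Category.{v'} 𝒞] (T : 𝒞 ⥤ 𝒞) {A A' B B' : 𝒞}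
    (i : A ⟶ A') [IsIso i] {j : B ⟶ B'} {a : T.obj A ⟶ A} {a' : T.obj A' ⟶ A'} {b : T.obj B ⟶ B}
    {b' : T.obj B' ⟶ B'} (ha : a ≫ i = T.map i ≫ a') (hb : b ≫ j = T.map j ≫ b') {θ : A ⟶ B}
    {θ' : A' ⟶ B'} (hθ : a ≫ θ = T.map θ ≫ b) (h : i ≫ θ' = θ ≫ j) :
    a' ≫ θ' = T.map θ' ≫ b' := by
  rw [← cancel_epi (T.map i), ← reassoc_of% ha, h, reassoc_of% hθ, hb, ← Functor.map_comp_assoc,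
    ← Functor.map_comp_assoc, h]

/-- The morphism `p^* F ⊗ ℚ̄_ℓ ⟶ p^* G ⊗ ℚ̄_ℓ` which corresponds to an equivariant morphism. -/
def bareHom (θ : (naturalActionQl Ks f ℓ).obj ((QlSystem.Q ℓ _).obj F) ⟶
    (naturalActionQl Ks f ℓ).obj ((QlSystem.Q ℓ _).obj G)) :
    (QlSystem.Q ℓ _).obj ((PiSystem.map (pull (sepProj Ks f))).obj F) ⟶
      (QlSystem.Q ℓ _).obj ((PiSystem.map (pull (sepProj Ks f))).obj G) :=
  (QlSystem.fac ℓ (pull (sepProj Ks f))).inv.app F ≫ θ.hom ≫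
    (QlSystem.fac ℓ (pull (sepProj Ks f))).hom.app G

lemma fac_comp_bareHom (θ : (naturalActionQl Ks f ℓ).obj ((QlSystem.Q ℓ _).obj F) ⟶
    (naturalActionQl Ks f ℓ).obj ((QlSystem.Q ℓ _).obj G)) :
    (QlSystem.fac ℓ (pull (sepProj Ks f))).hom.app F ≫ bareHom θ =
      θ.hom ≫ (QlSystem.fac ℓ (pull (sepProj Ks f))).hom.app G := by
  refine (Category.assoc _ _ _).symm.trans ?_
  rw [Iso.hom_inv_id_app]
  exact Category.id_comp _

/-- In terms of systems, the morphism `bareHom θ` is equivariant. -/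
lemma qlAct_bareHom (θ : (naturalActionQl Ks f ℓ).obj ((QlSystem.Q ℓ _).obj F) ⟶
    (naturalActionQl Ks f ℓ).obj ((QlSystem.Q ℓ _).obj G)) (γ : Ks ≃ₐ[K] Ks) :
    qlAct ((naturalAction Ks f ℓ).obj F) γ ≫ bareHom θ =
      (QlSystem.map ℓ ((galAction f).T γ)).map (bareHom θ) ≫
        qlAct ((naturalAction Ks f ℓ).obj G) γ := by
  have := ((QlSystem.fac ℓ (pull (sepProj Ks f))).app F).isIso_hom
  exact comp_eq_of_conjugate (QlSystem.map ℓ ((galAction (Ks := Ks) f).T γ))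
    ((QlSystem.fac ℓ (pull (sepProj Ks f))).hom.app F)
    (naturalActionQl_act_comp_fac (Ks := Ks) (f := f) F γ)
    (naturalActionQl_act_comp_fac (Ks := Ks) (f := f) G γ) (θ.comm γ) (fac_comp_bareHom θ)

variable [IsSepClosed Ks] [Algebra.IsSeparable K Ks] [ConnectedSpace X]

/-- An equivariant morphism `p^* F ⊗ ℚ̄_ℓ ⟶ p^* G ⊗ ℚ̄_ℓ` comes from `X`: it is a fraction whose
denominator comes from `X`, and the numerator becomes equivariant after multiplication by a power of
`ℓ` which annihilates the torsion of the target, uniformly in the Galois group. -/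
lemma exists_naturalActionQl_map_eq (x : Spec (.of K) ⟶ X) (hx : x ≫ f = 𝟙 _) (hF : IsSmoothSystem F)
    (hG : IsSmoothSystem G) (θ : (naturalActionQl Ks f ℓ).obj ((QlSystem.Q ℓ _).obj F) ⟶
      (naturalActionQl Ks f ℓ).obj ((QlSystem.Q ℓ _).obj G)) :
    ∃ φ, (naturalActionQl Ks f ℓ).map φ = θ := by
  have := connectedSpace_sepBaseChange (Ks := Ks) f x hx
  let P : PiSystem ℓ (EtAb X) ⥤ PiSystem ℓ (EtAb (sepBaseChange Ks f)) :=
    PiSystem.map (pull (sepProj Ks f))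
  obtain ⟨G', s', b, hs', hb⟩ := PiSystem.exists_fraction_map (pull (sepProj Ks f)) (bareHom θ)
  have hG' := hG.of_W' hs'
  -- `N` does not depend on the source of the morphisms, hence serves for all `γ`.
  obtain ⟨N, hN⟩ := IsSmoothSystem.exists_bound (hG'.pull (sepProj Ks f)) (geomPtBar Ks f x hx)
  have hF' : IsSmoothSystem ((naturalAction Ks f ℓ).obj F).obj := hF.pull _
  have hb' (γ : Ks ≃ₐ[K] Ks) := (qlAct_comp ((naturalAction Ks f ℓ).obj F)
      ((naturalAction Ks f ℓ).obj G') γ b).1 (by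
    have h₁ := qlAct_naturality ((naturalAction Ks f ℓ).map s') γ
    have h₂ := qlAct_bareHom θ γ
    refine (congrArg (_ ≫ ·) hb.symm).trans ?_
    refine (Category.assoc _ _ _).symm.trans ((congrArg (· ≫ _) h₂).trans ?_)
    refine (Category.assoc _ _ _).trans ((congrArg (_ ≫ ·) h₁).trans ?_)
    refine (Category.assoc _ _ _).symm.trans (congrArg (· ≫ _) ?_)
    exact (Functor.map_comp _ _ _).symm.trans (congrArg _ hb))
  have hb'' (γ : Ks ≃ₐ[K] Ks) := hN _ (hF'.map_galAction f γ) _ _ (hb' γ)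
  have he (n : ℕ) : (b ≫ P.map (PiSystem.mulEllPow N G')).app n = ℓ ^ N • b.app n := by
    refine (congrArg (b.app n ≫ ·) ((Functor.map_nsmul _).trans
      (congrArg (ℓ ^ N • ·) (CategoryTheory.Functor.map_id _ _)))).trans ?_
    exact (Preadditive.comp_nsmul _ _ _).trans (congrArg (ℓ ^ N • ·) (Category.comp_id _))
  let c : (naturalAction Ks f ℓ).obj F ⟶ (naturalAction Ks f ℓ).obj G' :=
    { hom := b ≫ P.map (PiSystem.mulEllPow N G')
      comm γ := PiSystem.hom_ext fun n => by
        refine (congrArg ((((naturalAction Ks f ℓ).obj F).act γ).hom.app n ≫ ·) (he n)).trans ?_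
        refine (Preadditive.comp_nsmul _ _ _).trans ((hb'' γ n).trans ?_)
        refine (Preadditive.nsmul_comp _ _ _).symm.trans (congrArg (· ≫ _) ?_)
        refine Eq.trans ?_ (congrArg ((galAction f).T γ).map (he n)).symm
        exact (((galAction f).T γ).map_nsmul (f := b.app n) (n := ℓ ^ N)).symm }
  obtain ⟨a₀, ha₀⟩ := exists_map_pull_eq hG' c
  have := PiSystem.isIso_Q_map hs'
  have := isIso_Q_map_mulEllPow N G'
  let t : G ⟶ G' := s' ≫ PiSystem.mulEllPow N G'
  have ht : IsIso ((QlSystem.Q ℓ _).map t) := by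
    rw [Functor.map_comp]
    infer_instance
  refine ⟨(QlSystem.Q ℓ _).map a₀ ≫ inv ((QlSystem.Q ℓ _).map t), Equivariant.Hom.ext ?_⟩
  let L := QlSystem.map ℓ (pull (sepProj Ks f))
  have htL : IsIso (L.map ((QlSystem.Q ℓ _).map t)) := inferInstance
  refine (cancel_mono (L.map ((QlSystem.Q ℓ _).map t))).1 ?_
  have h₁ : L.map ((QlSystem.Q ℓ _).map a₀ ≫ inv ((QlSystem.Q ℓ _).map t)) ≫
      L.map ((QlSystem.Q ℓ _).map t) = L.map ((QlSystem.Q ℓ _).map a₀) := by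
    rw [← Functor.map_comp, Category.assoc, IsIso.inv_hom_id, Category.comp_id]
  refine h₁.trans ?_
  refine (cancel_mono ((QlSystem.fac ℓ (pull (sepProj Ks f))).hom.app G')).1 ?_
  have n₁ : L.map ((QlSystem.Q ℓ _).map a₀) ≫ (QlSystem.fac ℓ (pull (sepProj Ks f))).hom.app G' =
      (QlSystem.fac ℓ (pull (sepProj Ks f))).hom.app F ≫ (QlSystem.Q ℓ _).map (P.map a₀) :=
    (QlSystem.fac ℓ (pull (sepProj Ks f))).hom.naturality a₀
  have n₂ : L.map ((QlSystem.Q ℓ _).map t) ≫ (QlSystem.fac ℓ (pull (sepProj Ks f))).hom.app G' =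
      (QlSystem.fac ℓ (pull (sepProj Ks f))).hom.app G ≫ (QlSystem.Q ℓ _).map (P.map t) :=
    (QlSystem.fac ℓ (pull (sepProj Ks f))).hom.naturality t
  have h₂ : bareHom θ ≫ (QlSystem.Q ℓ _).map (P.map t) = (QlSystem.Q ℓ _).map (P.map a₀) := by
    have e₁ : P.map t = P.map s' ≫ P.map (PiSystem.mulEllPow N G') := P.map_comp _ _
    have e₂ : P.map a₀ = b ≫ P.map (PiSystem.mulEllPow N G') := ha₀
    rw [e₁, e₂, Functor.map_comp, Functor.map_comp, ← hb, Category.assoc]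
  refine n₁.trans ((congrArg (_ ≫ ·) h₂.symm).trans ?_)
  refine (Category.assoc _ _ _).symm.trans ((congrArg (· ≫ _) (fac_comp_bareHom θ)).trans ?_)
  refine (Category.assoc _ _ _).trans ((congrArg (_ ≫ ·) n₂.symm).trans ?_)
  exact (Category.assoc _ _ _).symm

end Full

/-! ### Local systems of rank one -/

section EquivariantIso

variable {G : Type w} [Group G] {𝒞 : Type u} [Category.{v} 𝒞] {A : CatAction G 𝒞}

/-- A morphism of equivariant objects is an isomorphism if the underlying morphism is. -/
def Equivariant.isoOfIsIso {F F' : Equivariant A} (φ : F ⟶ F') [IsIso φ.hom] : F ≅ F' where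
  hom := φ
  inv := ⟨inv φ.hom, fun g => by
    rw [← cancel_epi ((A.T g).map φ.hom), ← Category.assoc, ← φ.comm, Category.assoc,
      IsIso.hom_inv_id, Category.comp_id, ← Functor.map_comp_assoc, IsIso.hom_inv_id,
      CategoryTheory.Functor.map_id, Category.id_comp]⟩
  hom_inv_id := Equivariant.Hom.ext (IsIso.hom_inv_id φ.hom)
  inv_hom_id := Equivariant.Hom.ext (IsIso.inv_hom_id φ.hom)

end EquivariantIso

section LocalSystem

variable {ℓ : ℕ} [Fact ℓ.Prime] {K Ks : Type u} [Field K] [Field Ks] [Algebra K Ks]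
  {X : Scheme.{u}} {f : X ⟶ Spec (.of K)}

/-- The natural action on `p^* (F ⊗ ℚ̄_ℓ)` comes from the natural action on `p^* F`, compatibly with
equivariant morphisms. -/
lemma act_comp_fac_comp {F : PiSystem ℓ (EtAb X)} {F' : Equivariant ((galAction (Ks := Ks) f).pi ℓ)}
    (φ : (naturalAction Ks f ℓ).obj F ⟶ F') (γ : Ks ≃ₐ[K] Ks) :
    (((naturalActionQl Ks f ℓ).obj ((QlSystem.Q ℓ _).obj F)).act γ).hom ≫
        (QlSystem.fac ℓ (pull (sepProj Ks f))).hom.app F ≫ (QlSystem.Q ℓ _).map φ.hom =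
      (QlSystem.map ℓ ((galAction f).T γ)).map ((QlSystem.fac ℓ (pull (sepProj Ks f))).hom.app F ≫
        (QlSystem.Q ℓ _).map φ.hom) ≫ qlAct F' γ := by
  refine (Category.assoc _ _ _).symm.trans ((congrArg (· ≫ _)
    (naturalActionQl_act_comp_fac F γ)).trans ?_)
  refine (Category.assoc _ _ _).trans ((congrArg (_ ≫ ·) (qlAct_naturality φ γ)).trans ?_)
  refine (Category.assoc _ _ _).symm.trans (congrArg (· ≫ _) ?_)
  exact (Functor.map_comp _ _ _).symm

/-- The inverse image of a smooth system, with its natural action, gives rise to a continuous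
action on the inverse image of the local system. -/
lemma isContinuousActionQl_naturalActionQl [Algebra.IsSeparable K Ks] {F : PiSystem ℓ (EtAb X)}
    (hF : IsSmoothSystem F) {𝓕 : QlSystem ℓ (EtAb X)} (e : (QlSystem.Q ℓ _).obj F ≅ 𝓕) :
    IsContinuousActionQl f ((naturalActionQl Ks f ℓ).obj 𝓕) := by
  let i := (QlSystem.fac ℓ (pull (sepProj Ks f))).app F
  let e' := (QlSystem.map ℓ (pull (sepProj Ks f))).mapIso e
  refine ⟨(naturalAction Ks f ℓ).obj F, hF.pull _, isContinuousAction_naturalAction hF,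
    i.symm ≪≫ e', fun γ => ?_⟩
  have h := naturalActionQl_act_comp_fac (Ks := Ks) (f := f) F γ
  have h' := ((naturalActionQl Ks f ℓ).map e.hom).comm γ
  let T := QlSystem.map ℓ ((galAction (Ks := Ks) f).T γ)
  have h₁ : qlAct ((naturalAction Ks f ℓ).obj F) γ ≫ i.inv =
      T.map i.inv ≫ (((naturalActionQl Ks f ℓ).obj ((QlSystem.Q ℓ _).obj F)).act γ).hom := by
    refine (cancel_epi (T.map i.hom)).1 ?_
    refine (Category.assoc _ _ _).symm.trans ((congrArg (· ≫ i.inv) h.symm).trans ?_)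
    refine (Category.assoc _ _ _).trans ((congrArg (_ ≫ ·) i.hom_inv_id).trans ?_)
    refine (Category.comp_id _).trans (Eq.trans ?_ (Category.assoc _ _ _))
    refine Eq.trans ?_ (congrArg (· ≫ _) (T.mapIso i).hom_inv_id.symm)
    exact (Category.id_comp _).symm
  refine (Category.assoc _ _ _).symm.trans ((Category.assoc _ _ _).symm.trans
    ((congrArg (· ≫ e'.hom) h₁).trans ?_))
  refine (Category.assoc _ _ _).trans ((congrArg (T.map i.inv ≫ ·) h').trans ?_)
  refine (Category.assoc _ _ _).symm.trans (congrArg (· ≫ _) ?_)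
  exact (T.map_comp _ _).symm

variable [IsSepClosed Ks] [Algebra.IsSeparable K Ks]

lemma isRankOne_of_isQlEquivalentTo {Y : Scheme.{u}} {Ω : Type u} [Field Ω] [IsSepClosed Ω]
    {y : Spec (.of Ω) ⟶ Y} {𝓕 : QlSystem ℓ (EtAb Y)}
    {ρ : Pi1 y →* (PadicAlgCl ℓ)ˣ} (h : IsQlEquivalentTo 𝓕 ρ) {F : PiSystem ℓ (EtAb Y)}
    (hF : IsSmoothSystem F) (e : (QlSystem.Q ℓ _).obj F ≅ 𝓕) : IsRankOne y F := by
  obtain ⟨F', hF', h', ⟨e'⟩⟩ := h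
  exact IsRankOne.of_iso hF' hF (e' ≪≫ e.symm) h'.1

/-- The inverse image of a local system of rank one is equivalent to a character which factors
through the coinvariants. -/
lemma coinvLocalSystem_naturalActionQl (x : Spec (.of K) ⟶ X) (hx : x ≫ f = 𝟙 _)
    {𝓕 : QlSystem ℓ (EtAb X)} (h : rankOneLocalSystem ℓ (geomPt Ks x) 𝓕) :
    coinvLocalSystem f x hx ℓ ((naturalActionQl Ks f ℓ).obj 𝓕) := by
  obtain ⟨F, hF, h, ⟨e⟩⟩ := h
  refine ⟨isContinuousActionQl_naturalActionQl hF e, ?_⟩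
  obtain ⟨ρ, hρ, hFρ⟩ := hF.exists_character h
  obtain ⟨χ, hχ, hχρ⟩ := exists_coinvariants_factor f x hx ρ hρ
  refine ⟨χ, hχ, (PiSystem.map (pull (sepProj Ks f))).obj F, hF.pull _, ?_,
    ⟨((QlSystem.fac ℓ (pull (sepProj Ks f))).app F).symm ≪≫
      (QlSystem.map ℓ (pull (sepProj Ks f))).mapIso e⟩⟩
  rw [hχρ]
  exact hFρ.pull _ _ _ hF

/-- Every local system with a continuous action comes from `X`, by Galois descent of a smooth system
which gives rise to it. -/
lemma exists_naturalActionQl_iso [ConnectedSpace X] (x : Spec (.of K) ⟶ X) (hx : x ≫ f = 𝟙 _)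
    {𝓕 : Equivariant ((galAction (Ks := Ks) f).ql ℓ)} (h : coinvLocalSystem f x hx ℓ 𝓕) :
    ∃ 𝓖 : QlSystem ℓ (EtAb X), rankOneLocalSystem ℓ (geomPt Ks x) 𝓖 ∧
      Nonempty ((naturalActionQl Ks f ℓ).obj 𝓖 ≅ 𝓕) := by
  have := connectedSpace_sepBaseChange (Ks := Ks) f x hx
  obtain ⟨⟨F, hF, hc, e, he⟩, χ, -, hχ⟩ := h
  have hF₀ := isSmoothSystem_descendSystem hF hc
  have := isIso_descendSystemCounit hc
  let φ := descendSystemCounit F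
  have h₁ : IsRankOne (geomPtBar Ks f x hx) F.obj := isRankOne_of_isQlEquivalentTo hχ hF e
  have h₂ : IsRankOne (geomPtBar Ks f x hx) ((PiSystem.map (pull (sepProj Ks f))).obj (descendSystem F)) :=
    h₁.of_iso hF (hF₀.pull _) ((QlSystem.Q ℓ _).mapIso (asIso φ.hom).symm)
  refine ⟨(QlSystem.Q ℓ _).obj (descendSystem F), ⟨descendSystem F, hF₀,
    (isRankOne_pull_iff _ _ (geomPtBar_proj f x hx)).1 h₂, ⟨Iso.refl _⟩⟩, ?_⟩
  let i := (QlSystem.fac ℓ (pull (sepProj Ks f))).app (descendSystem F)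
  let j : (QlSystem.Q ℓ _).obj _ ≅ (QlSystem.Q ℓ _).obj F.obj := (QlSystem.Q ℓ _).mapIso (asIso φ.hom)
  let ψ : (naturalActionQl Ks f ℓ).obj ((QlSystem.Q ℓ _).obj (descendSystem F)) ⟶ 𝓕 :=
    { hom := (i ≪≫ j ≪≫ e).hom
      comm γ := by
        let T := QlSystem.map ℓ ((galAction (Ks := Ks) f).T γ)
        have h₃ := act_comp_fac_comp φ γ
        have h₄ : qlAct F γ ≫ e.hom = T.map e.hom ≫ (𝓕.act γ).hom :=
          (Category.assoc _ _ _).trans (he γ)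
        refine (congrArg (_ ≫ ·) (Category.assoc i.hom j.hom e.hom).symm).trans ?_
        refine (Category.assoc _ _ _).symm.trans ((congrArg (· ≫ e.hom) h₃).trans ?_)
        refine (Category.assoc _ _ _).trans ((congrArg (_ ≫ ·) h₄).trans ?_)
        refine (Category.assoc _ _ _).symm.trans (congrArg (· ≫ _) ?_)
        refine (T.map_comp _ _).symm.trans (congrArg T.map ?_)
        exact Category.assoc _ _ _ }
  have : IsIso ψ.hom := (i ≪≫ j ≪≫ e).isIso_hom
  exact ⟨Equivariant.isoOfIsIso ψ⟩

end LocalSystem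

end LadicSheaf

end

theorem mainTheorem5 {K Ks : Type u} [Field K] [Field Ks] [Algebra K Ks] [IsSepClosed Ks]
    [Algebra.IsSeparable K Ks] (ℓ : ℕ) [Fact ℓ.Prime] (hℓ : (ℓ : K) ≠ 0)
    {X : Scheme.{u}} [IsNoetherian X] [ConnectedSpace X]
    (f : X ⟶ Spec (.of K)) (x : Spec (.of K) ⟶ X) (hx : x ≫ f = 𝟙 _) :
    (∀ (F : PiSystem ℓ (EtAb X)) (ρ : Pi1 (geomPt Ks x) →* (PadicAlgCl ℓ)ˣ), IsSmoothSystem F →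
      Continuous ρ → IsEquivalentTo F ρ →
        IsContinuousAction f ((naturalAction Ks f ℓ).obj F) ∧
        ∀ γ : Ks ≃ₐ[K] Ks,
          ActsOnStalkBy f x hx γ (((naturalAction Ks f ℓ).obj F).act γ).hom
            (ρ (galSection Ks x γ) : (PadicAlgCl ℓ)ˣ) ∧
          ∀ a, ActsOnStalkBy f x hx γ a (ρ (galSection Ks x γ) : (PadicAlgCl ℓ)ˣ) →
            (QlSystem.Q ℓ _).map a =
              (QlSystem.Q ℓ _).map (((naturalAction Ks f ℓ).obj F).act γ).hom) ∧
    ∃ h : ∀ 𝓕 : (rankOneLocalSystem ℓ (geomPt Ks x)).FullSubcategory,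
        coinvLocalSystem f x hx ℓ
          (((rankOneLocalSystem ℓ (geomPt Ks x)).ι ⋙ naturalActionQl Ks f ℓ).obj 𝓕),
      ((coinvLocalSystem f x hx ℓ).lift
        ((rankOneLocalSystem ℓ (geomPt Ks x)).ι ⋙ naturalActionQl Ks f ℓ) h).IsEquivalence := by
  refine ⟨fun F ρ hF _ hFρ => ⟨isContinuousAction_naturalAction hF, fun γ =>
    ⟨actsOnStalkBy_naturalAction f x hx hF hFρ γ, fun a ha => Q_map_eq_of_actsOnStalkBy f x hx hF γ ha
      (actsOnStalkBy_naturalAction f x hx hF hFρ γ)⟩⟩,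
    fun 𝓕 => coinvLocalSystem_naturalActionQl x hx 𝓕.2, ?_⟩
  have hfaithful : ((rankOneLocalSystem ℓ (geomPt Ks x)).ι ⋙ naturalActionQl Ks f ℓ).Faithful :=
    { map_injective {𝓕 𝓖 φ ψ} h := by
        obtain ⟨F, hF, -, ⟨e⟩⟩ := 𝓕.2
        obtain ⟨G, hG, -, ⟨e'⟩⟩ := 𝓖.2
        have h' : (QlSystem.map ℓ (pull (sepProj Ks f))).map φ.hom =
            (QlSystem.map ℓ (pull (sepProj Ks f))).map ψ.hom := congrArg Equivariant.Hom.hom h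
        have := QlSystem.map_pull_injective (sepProj Ks f) hF
          (φ := e.hom ≫ φ.hom ≫ e'.inv) (ψ := e.hom ≫ ψ.hom ≫ e'.inv) (by simp [h'])
        exact ObjectProperty.hom_ext _ (by simpa using this) }
  have hfull : ((rankOneLocalSystem ℓ (geomPt Ks x)).ι ⋙ naturalActionQl Ks f ℓ).Full :=
    { map_surjective {𝓕 𝓖} θ := by
        obtain ⟨F, hF, -, ⟨e⟩⟩ := 𝓕.2
        obtain ⟨G, hG, -, ⟨e'⟩⟩ := 𝓖.2
        obtain ⟨φ, hφ⟩ := exists_naturalActionQl_map_eq x hx hF hG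
          ((naturalActionQl Ks f ℓ).map e.hom ≫ θ ≫ (naturalActionQl Ks f ℓ).map e'.inv)
        refine ⟨ObjectProperty.homMk (e.inv ≫ φ ≫ e'.hom), ?_⟩
        change (naturalActionQl Ks f ℓ).map (e.inv ≫ φ ≫ e'.hom) = θ
        rw [Functor.map_comp, Functor.map_comp, hφ]
        let i := (naturalActionQl Ks f ℓ).mapIso e
        let i' := (naturalActionQl Ks f ℓ).mapIso e'
        have h (t : (naturalActionQl Ks f ℓ).obj 𝓕.obj ⟶ (naturalActionQl Ks f ℓ).obj 𝓖.obj) :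
            i.inv ≫ (i.hom ≫ t ≫ i'.inv) ≫ i'.hom = t := by simp
        exact h θ }
  have hess : ((coinvLocalSystem f x hx ℓ).lift
      ((rankOneLocalSystem ℓ (geomPt Ks x)).ι ⋙ naturalActionQl Ks f ℓ)
      fun 𝓕 => coinvLocalSystem_naturalActionQl x hx 𝓕.2).EssSurj :=
    ⟨fun 𝓕 => by
      obtain ⟨𝓖, h𝓖, ⟨i⟩⟩ := exists_naturalActionQl_iso x hx 𝓕.2
      exact ⟨⟨𝓖, h𝓖⟩, ⟨(coinvLocalSystem f x hx ℓ).isoMk i⟩⟩⟩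
  exact { }
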